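/- \textbf{Setting.} A \emph{road graph with ban intervals and costs} consists of a set $V$ of $n$ vertices and a set $E\subseteq V\times V$ of directed edges; for every $e\in E$ a driving time $\delta(e)\in\mathbb N$, $\delta(e)\ge 1$, and a finite sequence $\Phi(e)$ of pairwise disjoint nonempty ban intervals $[t^{closed},t^{open})$ with integer end points, during which $e$ is closed; a rating $\rho:V\to\{0,\dots,r\}$; and costs $d\in\mathbb Q_{\ge0}$ per unit of driving time and $c_0>c_1>\dots>c_r\ge 0$ in $\mathbb Q$, where $c_i$ is the cost per unit of waiting time at vertices of rating $i$ and waiting on edges costs $c_0$. All points in time are integers. A query consists of a source $s$, a destination $z$ and a planning horizon $H=[t^{min},t^{max}]$, $t^{min}\le t^{max}$. A feasible $s$-$z$-route consists of three sequences of the same length $\ell\ge1$: vertices $R$ with $R[1]=s$, $R[\ell]=z$ and $e_i=(R[i],R[i+1])\in E$, arrival times $A$ and departure times $D$ with $A[1]=t^{min}$, $D[\ell]\le t^{max}$, $A[i]\le D[i]$, $A[i+1]-D[i]\ge\delta(e_i)$ and $\sum_{I\in\Phi(e_i)}|T_i\cap I|\le|T_i|-\delta(e_i)$, where $T_i=[D[i],A[i+1])$.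 Its costs are $$\sum_{i=1}^{\ell}c_{\rho(R[i])}(D[i]-A[i])+\sum_{i=1}^{\ell-1}\bigl(c_0(A[i+1]-D[i]-\delta(e_i))+d\,\delta(e_i)\bigr).$$ It is Pareto-optimal if, compared to any other feasible $s$-$z$-route, it has smaller costs, or an earlier arrival time $A[\ell]$, or both are equal. \textbf{Algorithm.} For $e\in E$ let $\mathcal T_e(t)$ be the least period $p\in\mathbb N$ with $p-\sum_{I\in\Phi(e)}|[t-p,t)\cap I|\ge\delta(e)$. For every vertex $v$ the algorithm stores a cost profile $\mathcal C_v:H\to\mathbb Q_{\ge0}\cup\{\infty\}$, initially $\mathcal C_s(t)=c_{\rho(s)}(t-t^{min})$ and $\mathcal C_v=\infty$ for $v\ne s$, and it keeps a priority queue that initially contains $s$ with key $t^{min}$. While the queue is not empty, an entry $u$ with the earliest key $t^{visit}$ is removed, and for every edge $e=(u,v)$: (1) $\mathcal C'_v(t):=\mathcal C_u(t-\mathcal T_e(t))+d\,\delta(e)+c_0(\mathcal T_e(t)-\delta(e))$ if $t^{visit}+\mathcal T_e(t)\le t\le t^{max}$, and $\mathcal C'_v(t):=\infty$ otherwise; (2)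 $\mathcal C'_v(t)$ is replaced by $\min\{\mathcal C'_v(t')+c_{\rho(v)}(t-t')\mid t^{min}\le t'\le t\}$ for all $t\in H$; (3) if there is an earliest $t^*$ with $\mathcal C'_v(t^*)<\mathcal C_v(t^*)$, then $\mathcal C_v$ is replaced by $\min(\mathcal C_v,\mathcal C'_v)$ on $[t^*,t^{max}]$, and $v$ is inserted into the queue with key $t^*$, or its key is decreased to $t^*$ if it is contained with a later key. Finally, for every $t\in H$ with $\mathcal C_z(t)<\infty$ and $\mathcal C_z(t')>\mathcal C_z(t)$ for all $t'\in H$ with $t'<t$, a route arriving at $z$ at time $t$ is constructed backwards: for the first stop $(v,A)$ of the partial route, an edge $e=(u,v)$ with $\mathcal C_u(D)+d\,\delta(e)+c_0(\mathcal T_e(A)-\delta(e))=\mathcal C_v(A)$, where $D=A-\mathcal T_e(A)$, is chosen, and $u$ is put in front with departure time $D$ and as arrival time the earliest $t\le D$ with $\mathcal C_u(t)+c_{\rho(u)}(D-t)=\mathcal C_u(D)$, until $s$ with arrival time $t^{min}$ is the first stop. The profiles are stored as lists of the breakpoints of piecewise linear functions on the integers of $H$. Running time is the number of steps, where an arithmetic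 operation or comparison on integers or rationals is charged the square of the total binary length of its operands. \textbf{Theorem.} There is a polynomial $P$ such that for every road graph with $d=c_0$ and every query the algorithm terminates after at most $P(N)$ steps, where $N$ is the encoding length of the input (the number of vertices, edges and ban intervals, plus the binary lengths of all numbers in the input), and outputs a maximal set of Pareto-optimal $s$-$z$-routes no two of which have both the same arrival time at $z$ and the same costs. Moreover, the step-counted implementation carries out the main loop as described: every state that it reaches between two iterations represents the profiles and the queue after some sequence of iterations (1)--(3) from the initial state. -/

import Mathlib

namespace TempBans

/-! ### Road graphs with ban intervals, queries, routes -/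

/-- A road graph with ban intervals and costs. The vertices are `Fin n`; `Φ`, `δ` matter on `E` only.
A pair `(a, o)` in `Φ e` is the half-open ban interval `[a, o)`. All points in time are integers. -/
structure RoadGraph where
  n : ℕ
  E : List (Fin n × Fin n)
  E_nodup : E.Nodup
  Φ : Fin n × Fin n → List (ℤ × ℤ)
  Φ_pos : ∀ e ∈ E, ∀ I ∈ Φ e, I.1 < I.2
  Φ_disjoint : ∀ e ∈ E, (Φ e).Pairwise fun I J => Disjoint (Set.Ico I.1 I.2) (Set.Ico J.1 J.2)
  δ : Fin n × Fin n → ℕ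
  δ_pos : ∀ e ∈ E, 0 < δ e
  r : ℕ
  ρ : Fin n → Fin (r + 1)
  d : ℚ
  d_nonneg : 0 ≤ d
  c : Fin (r + 1) → ℚ
  c_nonneg : ∀ i, 0 ≤ c i
  c_strictAnti : StrictAnti c

/-- Source, destination and planning horizon `[tmin, tmax]`. -/
structure Query (G : RoadGraph) where
  s : Fin G.n
  z : Fin G.n
  tmin : ℤ
  tmax : ℤ
  tmin_le_tmax : tmin ≤ tmax

/-- The length of `[x, y) ∩ [I.1, I.2)`. -/
def overlap (x y : ℤ) (I : ℤ × ℤ) : ℤ := max 0 (min y I.2 - max x I.1)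

/-- The time during which the edge `e` is closed within `[x, y)`. -/
def RoadGraph.closedTime (G : RoadGraph) (e : Fin G.n × Fin G.n) (x y : ℤ) : ℤ :=
  ((G.Φ e).map (overlap x y)).sum

/-- One entry `(R[i], A[i], D[i])` of a route: vertex, arrival time, departure time. -/
structure Stop (n : ℕ) where
  vertex : Fin n
  arr : ℤ
  dep : ℤ

/-- The three sequences `R`, `A`, `D` of equal length, as one sequence of triples. -/
abbrev Route (n : ℕ) := List (Stop n)

section Routes

variable (G : RoadGraph)

/-- Driving from the stop `p` to the stop `q` along the edge between them: the edge exists, and it is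
open for at least the driving time while it is being traversed. -/
def Leg (p q : Stop G.n) : Prop :=
  (p.vertex, q.vertex) ∈ G.E ∧
  (G.δ (p.vertex, q.vertex) : ℤ) ≤ q.arr - p.dep ∧
  G.closedTime (p.vertex, q.vertex) p.dep q.arr ≤ (q.arr - p.dep) - G.δ (p.vertex, q.vertex)

/-- Feasible `s`-`z`-routes of a query. -/
def Feasible (q : Query G) (R : Route G.n) : Prop :=
  (∃ p ∈ R.head?, p.vertex = q.s ∧ p.arr = q.tmin) ∧
  (∃ p ∈ R.getLast?, p.vertex = q.z ∧ p.dep ≤ q.tmax) ∧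
  (∀ p ∈ R, p.arr ≤ p.dep) ∧
  R.IsChain (Leg G)

/-- Travel time costs. -/
def travelCost : Route G.n → ℚ
  | [] => 0
  | [p] => G.c (G.ρ p.vertex) * (p.dep - p.arr)
  | p :: p' :: R =>
      G.c (G.ρ p.vertex) * (p.dep - p.arr)
      + (G.c 0 * (p'.arr - p.dep - G.δ (p.vertex, p'.vertex)) + G.d * G.δ (p.vertex, p'.vertex))
      + travelCost (p' :: R)

/-- Arrival time at the last vertex of a (nonempty) route. -/
def arrivalTime (R : Route G.n) : ℤ := (R.getLast?.map Stop.arr).getD 0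

def ParetoOptimal (q : Query G) (R : Route G.n) : Prop :=
  Feasible G q R ∧ ∀ R', Feasible G q R' →
    travelCost G R < travelCost G R' ∨ arrivalTime G R < arrivalTime G R' ∨
    (travelCost G R = travelCost G R' ∧ arrivalTime G R = arrivalTime G R')

/-- A repetition-free list of routes that is, as a set, a maximal set of Pareto-optimal routes no two
of which have both the same arrival time and the same travel time costs. -/
def IsSolution (q : Query G) (out : List (Route G.n)) : Prop :=
  out.Nodup ∧
  Maximal (fun S : Set (Route G.n) => (∀ R ∈ S, ParetoOptimal G q R) ∧
    ∀ R ∈ S, ∀ R' ∈ S, arrivalTime G R = arrivalTime G R' → travelCost G R = travelCost G R' → R = R')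
    {R | R ∈ out}

end Routes

/-! ### The main loop of the label-correcting algorithm, on cost profiles as functions

A cost profile is a function of time that is `⊤` outside of the planning horizon. -/

section Abstract

variable (G : RoadGraph) (q : Query G)

/-- `𝒯_e(t)`: the least period `p` such that an edge can be traversed during `[t - p, t)`. -/
noncomputable def travelTime (e : Fin G.n × Fin G.n) (t : ℤ) : ℕ∞ :=
  sInf ((fun p : ℕ => (p : ℕ∞)) '' {p : ℕ | (G.δ e : ℤ) ≤ p - G.closedTime e (t - p) t})

/-- Cost profiles of all vertices, and the priority queue (the key of every contained vertex). -/
structure AbsState where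
  C : Fin G.n → ℤ → WithTop ℚ
  queue : Fin G.n → Option ℤ

def absInit : AbsState G where
  C v t := if v = q.s ∧ q.tmin ≤ t ∧ t ≤ q.tmax
    then ((G.c (G.ρ q.s) * (t - q.tmin) : ℚ) : WithTop ℚ) else ⊤
  queue v := if v = q.s then some q.tmin else none

/-- First step: travelling along `e`, starting from a vertex with profile `f` visited at `tvisit`. -/
noncomputable def absLink (e : Fin G.n × Fin G.n) (tvisit : ℤ) (f : ℤ → WithTop ℚ) (t : ℤ) :
    WithTop ℚ :=
  match travelTime G e t with
  | ⊤ => ⊤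
  | (p : ℕ) =>
      if tvisit + p ≤ t ∧ t ≤ q.tmax
      then f (t - p) + ((G.d * G.δ e + G.c 0 * (p - G.δ e) : ℚ) : WithTop ℚ) else ⊤

/-- Second step: waiting at cost `w` per time unit. -/
noncomputable def absWait (w : ℚ) (f : ℤ → WithTop ℚ) (t : ℤ) : WithTop ℚ :=
  if t ≤ q.tmax
  then (Finset.Icc q.tmin t).inf fun t' => f t' + ((w * (t - t') : ℚ) : WithTop ℚ) else ⊤

open Classical in
/-- The three steps for an edge `e` whose tail is visited at `tvisit`. -/
noncomputable def absRelax (tvisit : ℤ) (σ : AbsState G) (e : Fin G.n × Fin G.n) : AbsState G :=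
  let g := absWait G q (G.c (G.ρ e.2)) (absLink G q e tvisit (σ.C e.1))
  if h : ∃ t, IsLeast {t | g t < σ.C e.2 t} t then
    { C := Function.update σ.C e.2 fun t =>
        if h.choose ≤ t ∧ t ≤ q.tmax then min (σ.C e.2 t) (g t) else σ.C e.2 t
      queue := Function.update σ.queue e.2 <| some <|
        match σ.queue e.2 with
        | none => h.choose
        | some k => min k h.choose }
  else σ

/-- One iteration of the main loop: some queue entry with earliest key is removed and visited. -/
def AbsIteration (σ σ' : AbsState G) : Prop :=
  ∃ u t, σ.queue u = some t ∧ (∀ v k, σ.queue v = some k → t ≤ k) ∧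
    σ' = (G.E.filter fun e => e.1 = u).foldl (absRelax G q t)
      { σ with queue := Function.update σ.queue u none }

end Abstract

/-! ### Counting bit operations -/

/-- A result together with the number of steps spent on computing it. -/
structure Timed (α : Type) where
  val : α
  time : ℕ

instance : Monad Timed where
  pure a := ⟨a, 0⟩
  bind x f := ⟨(f x.val).val, x.time + (f x.val).time⟩

/-- Encoding length of an integer. -/
def bitsZ (x : ℤ) : ℕ := x.natAbs.size + 1

/-- Encoding length of a rational number in lowest terms. -/
def bitsQ (x : ℚ) : ℕ := x.num.natAbs.size + x.den.size + 1

/-- `k` further steps. -/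
def tick (k : ℕ) : Timed Unit := ⟨(), k⟩

/-- Reading one entry of a table with `k` entries; charged like a scan of the table. -/
def load {α : Type} (k : ℕ) (a : α) : Timed α := ⟨a, k + 1⟩

/-! The arithmetic operations and comparisons are charged the square of the total length of their
operands (the cost of the schoolbook methods and of Euclid's algorithm). -/

def addZ (x y : ℤ) : Timed ℤ := ⟨x + y, (bitsZ x + bitsZ y) ^ 2⟩
def subZ (x y : ℤ) : Timed ℤ := ⟨x - y, (bitsZ x + bitsZ y) ^ 2⟩
def negZ (x : ℤ) : Timed ℤ := ⟨-x, bitsZ x ^ 2⟩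
def ltZ (x y : ℤ) : Timed Bool := ⟨decide (x < y), (bitsZ x + bitsZ y) ^ 2⟩
def leZ (x y : ℤ) : Timed Bool := ⟨decide (x ≤ y), (bitsZ x + bitsZ y) ^ 2⟩
def eqZ (x y : ℤ) : Timed Bool := ⟨decide (x = y), (bitsZ x + bitsZ y) ^ 2⟩
def toQ (x : ℤ) : Timed ℚ := ⟨x, bitsZ x ^ 2⟩
def addQ (x y : ℚ) : Timed ℚ := ⟨x + y, (bitsQ x + bitsQ y) ^ 2⟩
def subQ (x y : ℚ) : Timed ℚ := ⟨x - y, (bitsQ x + bitsQ y) ^ 2⟩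
def mulQ (x y : ℚ) : Timed ℚ := ⟨x * y, (bitsQ x + bitsQ y) ^ 2⟩
def divQ (x y : ℚ) : Timed ℚ := ⟨x / y, (bitsQ x + bitsQ y) ^ 2⟩
def floorQ (x : ℚ) : Timed ℤ := ⟨⌊x⌋, bitsQ x ^ 2⟩
def ltQ (x y : ℚ) : Timed Bool := ⟨decide (x < y), (bitsQ x + bitsQ y) ^ 2⟩
def eqQ (x y : ℚ) : Timed Bool := ⟨decide (x = y), (bitsQ x + bitsQ y) ^ 2⟩

/-! ### Piecewise linear profiles -/

/-- A profile, stored as the list of its breakpoints `(t, cost)` in the order of time. It is `⊤` before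
the first and after the last breakpoint, and affine on the integers from a breakpoint to the next one
(a jump is an affine piece of length one). -/
abbrev Profile := List (ℤ × ℚ)

/-- The value at time `t` on the line through `p` and `p'`. -/
def interpolate (p p' : ℤ × ℚ) (t : ℤ) : Timed ℚ := do
  let dy ← subQ p'.2 p.2
  let dx ← toQ (← subZ p'.1 p.1)
  let x ← toQ (← subZ t p.1)
  addQ p.2 (← divQ (← mulQ dy x) dx)

def evalAt : Profile → ℤ → Timed (WithTop ℚ)
  | [], _ => do
      tick 1
      return ⊤
  | [p], t => do
      tick 1
      if ← eqZ t p.1 then return (p.2 : WithTop ℚ) else return ⊤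
  | p :: p' :: f, t => do
      tick 1
      if ← ltZ t p.1 then return ⊤
      else if ← ltZ t p'.1 then
        let y ← interpolate p p' t
        return (y : WithTop ℚ)
      else evalAt (p' :: f) t

/-- The function that a stored profile stands for. -/
def Profile.toFun (f : Profile) (t : ℤ) : WithTop ℚ := (evalAt f t).val

/-- Remove breakpoints that lie on the line between their neighbours. -/
def prune : Profile → Timed Profile
  | [] => do
      tick 1
      return []
  | p :: f => do
      tick 1
      match ← prune f with
      | p' :: p'' :: g =>
          let y ← interpolate p p'' p'.1
          if ← eqQ y p'.2 then return p :: p'' :: g else return p :: p' :: p'' :: g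
      | g => return p :: g

/-- Insert a time into an increasing list, unless it is there already. -/
def insertTime (t : ℤ) : List ℤ → Timed (List ℤ)
  | [] => do
      tick 1
      return [t]
  | k :: l => do
      tick 1
      if ← ltZ t k then return t :: k :: l
      else if ← eqZ t k then return k :: l
      else
        let l' ← insertTime t l
        return k :: l'

/-- Sort a list of times, without repetitions, and keep those in `[lo, hi]` only. -/
def sortTimes (lo hi : ℤ) : List ℤ → Timed (List ℤ)
  | [] => do
      tick 1
      return []
  | t :: l => do
      tick 1
      let l' ← sortTimes lo hi l
      if ← ltZ t lo then return l'
      else if ← ltZ hi t then return l'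
      else insertTime t l'

/-- Concatenation. -/
def append {α : Type} : List α → List α → Timed (List α)
  | [], l => do
      tick 1
      return l
  | a :: k, l => do
      tick 1
      let l' ← append k l
      return a :: l'

/-- The breakpoint times of a profile. -/
def times : Profile → Timed (List ℤ)
  | [] => do
      tick 1
      return []
  | p :: f => do
      tick 1
      let l ← times f
      return p.1 :: l

/-! ### Traversing an edge -/

def insertBan (I : ℤ × ℤ) : List (ℤ × ℤ) → Timed (List (ℤ × ℤ))
  | [] => do
      tick 1
      return [I]
  | J :: l => do
      tick 1
      if ← leZ I.1 J.1 then return I :: J :: l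
      else
        let l' ← insertBan I l
        return J :: l'

/-- Sort ban intervals chronologically. -/
def sortBans : List (ℤ × ℤ) → Timed (List (ℤ × ℤ))
  | [] => do
      tick 1
      return []
  | I :: l => do
      tick 1
      let l' ← sortBans l
      insertBan I l'

/-- Ban intervals with time running backwards. -/
def mirror : List (ℤ × ℤ) → Timed (List (ℤ × ℤ))
  | [] => do
      tick 1
      return []
  | I :: l => do
      tick 1
      let a ← negZ I.2
      let o ← negZ I.1
      let l' ← mirror l
      return (a, o) :: l'

/-- The earliest time at which one has been driving for `rem` time units if one starts at `t` and is
held up by the (chronologically sorted) ban intervals. -/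
def earliestArrival : List (ℤ × ℤ) → ℤ → ℤ → Timed ℤ
  | [], rem, t => do
      tick 1
      addZ t rem
  | I :: l, rem, t => do
      tick 1
      if ← leZ I.2 t then earliestArrival l rem t
      else
        let gap ← subZ I.1 t
        if ← leZ rem gap then addZ t rem
        else if ← ltZ 0 gap then
          let rem' ← subZ rem gap
          earliestArrival l rem' I.2
        else earliestArrival l rem I.2

/-- The latest departure for being at the head at time `t`, from the sorted mirrored ban intervals. -/
def latestDeparture (mirrored : List (ℤ × ℤ)) (drive t : ℤ) : Timed ℤ := do
  let t' ← negZ t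
  let x ← earliestArrival mirrored drive t'
  negZ x

/-- The arrival times for the departure times in a list that are not before `tvisit`. -/
def arrivals (bans : List (ℤ × ℤ)) (drive tvisit : ℤ) : List ℤ → Timed (List ℤ)
  | [] => do
      tick 1
      return []
  | k :: l => do
      tick 1
      let l' ← arrivals bans drive tvisit l
      if ← ltZ k tvisit then return l'
      else
        let a ← earliestArrival bans drive k
        return a :: l'

/-- The breakpoints of the travel time function. -/
def banTimes (bans : List (ℤ × ℤ)) (drive : ℤ) : List (ℤ × ℤ) → Timed (List ℤ)
  | [] => do
      tick 1
      return []
  | I :: l => do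
      tick 1
      let a ← earliestArrival bans drive I.2
      let a' ← subZ a 1
      let l' ← banTimes bans drive l
      return I.1 :: I.2 :: a' :: a :: l'

/-- The linked profile at the given times: `f (t - 𝒯) + d * δ + c₀ * (𝒯 - δ)`. -/
def linkAt (mirrored : List (ℤ × ℤ)) (drive : ℤ) (d c₀ : ℚ) (f : Profile) :
    List ℤ → Timed Profile
  | [] => do
      tick 1
      return []
  | t :: l => do
      tick 1
      let x ← latestDeparture mirrored drive t
      let y ← evalAt f x
      let wait ← subZ (← subZ t x) drive
      let driveCost ← mulQ d (← toQ drive)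
      let waitCost ← mulQ c₀ (← toQ wait)
      let cost ← addQ driveCost waitCost
      let g ← linkAt mirrored drive d c₀ f l
      match y with
      | ⊤ => return g
      | (y : ℚ) =>
          let y' ← addQ y cost
          return (t, y') :: g

/-- First step: the profile `f` of the tail, visited at `tvisit`, is linked with an edge. -/
def link (Φ : List (ℤ × ℤ)) (drive : ℤ) (d c₀ : ℚ) (tvisit tmax : ℤ) (f : Profile) :
    Timed Profile := do
  let bans ← sortBans Φ
  let mirrored ← sortBans (← mirror Φ)
  let a ← earliestArrival bans drive tvisit
  let l₁ ← arrivals bans drive tvisit (← times f)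
  let l₂ ← banTimes bans drive bans
  let l ← append l₁ l₂
  let ts ← sortTimes a tmax (a :: tmax :: l)
  prune (← linkAt mirrored drive d c₀ f ts)

/-! ### Minima -/

/-- The breakpoints strictly between `p.1` and `p'.1` of the minimum of the line from `p` to `p'`
and the line from `(p.1, y)` to `(p'.1, y')`. -/
def crossing (p p' : ℤ × ℚ) (y y' : ℚ) : Timed Profile := do
  let D ← subQ y p.2
  let D' ← subQ y' p'.2
  let b₁ ← ltQ D 0
  let b₂ ← ltQ 0 D'
  let b₃ ← ltQ 0 D
  let b₄ ← ltQ D' 0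
  if (b₁ && b₂) || (b₃ && b₄) then
    let dx ← toQ (← subZ p'.1 p.1)
    let x ← floorQ (← divQ (← mulQ D dx) (← subQ D D'))
    let x ← addZ p.1 x
    let x' ← addZ x 1
    -- the lower line before, and the one after the crossing
    let y₁ ← if b₁ then interpolate (p.1, y) (p'.1, y') x else interpolate p p' x
    let y₂ ← if b₁ then interpolate p p' x' else interpolate (p.1, y) (p'.1, y') x'
    let l ← if ← ltZ x' p'.1 then pure [(x', y₂)] else pure []
    if ← ltZ p.1 x then return (x, y₁) :: l else return l
  else return []

def minQ (x y : ℚ) : Timed ℚ := do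
  if ← ltQ y x then return y else return x

/-- `waitFrom w p y f`: the profile after waiting is allowed, from the time `p.1` on, where `p :: f` is
the given profile and `y` the value after waiting at time `p.1`. -/
def waitFrom (w : ℚ) : ℤ × ℚ → ℚ → Profile → Timed Profile
  | p, y, [] => do
      tick 1
      return [(p.1, y)]
  | p, y, p' :: f => do
      tick 1
      let dx ← toQ (← subZ p'.1 p.1)
      let y' ← addQ y (← mulQ w dx)
      let mid ← crossing p p' y y'
      let y'' ← minQ y' p'.2
      let g ← waitFrom w p' y'' f
      let g' ← append mid g
      return (p.1, y) :: g'

/-- Second step: waiting at cost `w` per time unit. -/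
def waiting (w : ℚ) : Profile → Timed Profile
  | [] => do
      tick 1
      return []
  | p :: f => do
      tick 1
      prune (← waitFrom w p p.2 f)

/-- The breakpoint at time `t` of a minimum, put before a profile. -/
def consMin (t : ℤ) (a b : WithTop ℚ) (h : Profile) : Timed Profile :=
  match a, b with
  | ⊤, ⊤ => do
      tick 1
      return h
  | (a : ℚ), ⊤ => do
      tick 1
      return (t, a) :: h
  | ⊤, (b : ℚ) => do
      tick 1
      return (t, b) :: h
  | (a : ℚ), (b : ℚ) => do
      tick 1
      let y ← minQ a b
      return (t, y) :: h

/-- `crossing`, where the lines may be absent. -/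
def crossingTop (t t' : ℤ) (a b a' b' : WithTop ℚ) : Timed Profile :=
  match a, b, a', b' with
  | (a : ℚ), (b : ℚ), (a' : ℚ), (b' : ℚ) => crossing (t, a) (t', a') b b'
  | _, _, _, _ => do
      tick 1
      return []

/-- The minimum of two profiles, given all times where one of them has a breakpoint. -/
def minOn (f g : Profile) : List ℤ → Timed Profile
  | [] => do
      tick 1
      return []
  | [t] => do
      tick 1
      let a ← evalAt f t
      let b ← evalAt g t
      consMin t a b []
  | t :: t' :: l => do
      tick 1
      let a ← evalAt f t
      let b ← evalAt g t
      let a' ← evalAt f t'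
      let b' ← evalAt g t'
      let mid ← crossingTop t t' a b a' b'
      let h ← minOn f g (t' :: l)
      let h' ← append mid h
      consMin t a b h'

/-- Comparison of values in `ℚ ∪ {∞}`. -/
def ltTop (a b : WithTop ℚ) : Timed Bool :=
  match a, b with
  | ⊤, _ => do
      tick 1
      return false
  | (_ : ℚ), ⊤ => do
      tick 1
      return true
  | (a : ℚ), (b : ℚ) => ltQ a b

/-- The first time `t` or `t + 1`, for `t` in the list, at which `g` is less than `f`. -/
def firstBelow (f g : Profile) : List ℤ → Timed (Option ℤ)
  | [] => do
      tick 1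
      return none
  | t :: l => do
      tick 1
      if ← ltTop (← evalAt g t) (← evalAt f t) then return some t
      else
        let t' ← addZ t 1
        if ← ltTop (← evalAt g t') (← evalAt f t') then return some t'
        else firstBelow f g l

/-- The times before the first breakpoint of a profile at which its minimum with another profile may
have a breakpoint. -/
def startTimes : Profile → Timed (List ℤ)
  | [] => do
      tick 1
      return []
  | p :: _ => do
      tick 1
      let t ← subZ p.1 1
      return [t]

/-- Third step: the minimum of `f` and `g` on `[tmin, tmax]`, and the first time at which `g` is less
than `f`, if there is one. -/
def improve (tmin tmax : ℤ) (f g : Profile) : Timed (Option (ℤ × Profile)) := do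
  let l ← append (← times f) (← times g)
  let l ← append (← startTimes f) l
  let l ← append (← startTimes g) l
  let h ← minOn f g (← sortTimes tmin tmax l)
  match ← firstBelow f g (← times h) with
  | none => return none
  | some t =>
      let h' ← prune h
      return some (t, h')

/-! ### The algorithm -/

/-- The new key of an entry whose key, if it is contained in the queue, is given. -/
def decreaseKey : Option ℤ → ℤ → Timed ℤ
  | none, t => do
      tick 1
      return t
  | some k, t => do
      if ← ltZ t k then return t else return k

section Algorithm

variable (G : RoadGraph) (q : Query G)

/-- Stored profiles of all vertices, and the priority queue (as a table of keys). -/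
structure State where
  prof : Fin G.n → Profile
  queue : Fin G.n → Option ℤ

/-- The state of the abstract algorithm that a state stands for. -/
def State.toAbs {G : RoadGraph} (σ : State G) : AbsState G where
  C v := Profile.toFun (σ.prof v)
  queue := σ.queue

/-- The three steps for an edge `e` whose tail is visited at `tvisit`. -/
def relax (tvisit : ℤ) (σ : State G) (e : Fin G.n × Fin G.n) : Timed (State G) := do
  let Φ ← load G.E.length (G.Φ e)
  let drive ← load G.E.length (G.δ e : ℤ)
  let rating ← load G.n (G.ρ e.2)
  let w ← load (G.r + 1) (G.c rating)
  let c₀ ← load (G.r + 1) (G.c 0)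
  let fu ← load G.n (σ.prof e.1)
  let fv ← load G.n (σ.prof e.2)
  let g₁ ← link Φ drive G.d c₀ tvisit q.tmax fu
  let g₂ ← waiting w g₁
  match ← improve q.tmin q.tmax fv g₂ with
  | none => return σ
  | some (t, h) =>
      let key ← decreaseKey (← load G.n (σ.queue e.2)) t
      tick (2 * G.n)
      return { prof := Function.update σ.prof e.2 h
               queue := Function.update σ.queue e.2 (some key) }

/-- Relax those edges of a list that go out of `u`. -/
def relaxAll (u : Fin G.n) (tvisit : ℤ) : List (Fin G.n × Fin G.n) → State G → Timed (State G)
  | [], σ => do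
      tick 1
      return σ
  | e :: l, σ => do
      tick (G.n + 1)
      if e.1 = u then
        let σ' ← relax G q tvisit σ e
        relaxAll u tvisit l σ'
      else relaxAll u tvisit l σ

/-- An entry with the earliest key among the queue entries of the listed vertices. -/
def findMin (σ : State G) : List (Fin G.n) → Timed (Option (Fin G.n × ℤ))
  | [] => do
      tick 1
      return none
  | v :: l => do
      tick 1
      let best ← findMin σ l
      match ← load G.n (σ.queue v), best with
      | none, b => return b
      | some k, none => return some (v, k)
      | some k, some (v', k') =>
          if ← leZ k k' then return some (v, k) else return some (v', k')

/-- The times `t, t + 1, …` (`k` of them), put before a list. -/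
def consRange : ℕ → ℤ → List ℤ → Timed (List ℤ)
  | 0, _, l => do
      tick 1
      return l
  | k + 1, t, l => do
      tick 1
      let t' ← addZ t 1
      let l' ← consRange k t' l
      return t :: l'

/-- All times in `(p.1, …]` at which the profile `p :: f` is less than one time unit before. -/
def dropsFrom : ℤ × ℚ → Profile → Timed (List ℤ)
  | _, [] => do
      tick 1
      return []
  | p, p' :: f => do
      tick 1
      let l ← dropsFrom p' f
      if ← ltQ p'.2 p.2 then
        let k ← subZ p'.1 p.1
        let t ← addZ p.1 1
        consRange k.toNat t l
      else return l

/-- The times in a list at which the profile `f` is less than `best` and less than at all earlier times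
in the list. -/
def paretoFrom (f : Profile) : WithTop ℚ → List ℤ → Timed (List ℤ)
  | _, [] => do
      tick 1
      return []
  | best, t :: l => do
      tick 1
      let y ← evalAt f t
      if ← ltTop y best then
        let l' ← paretoFrom f y l
        return t :: l'
      else paretoFrom f best l

/-- The times of the Pareto-optimal time-cost-pairs of a profile. -/
def paretoTimes : Profile → Timed (List ℤ)
  | [] => do
      tick 1
      return []
  | p :: f => do
      tick 1
      let l ← dropsFrom p f
      paretoFrom (p :: f) ⊤ (p.1 :: l)

/-- Equality in `ℚ ∪ {∞}` of `a + x` and `y`, where `∞` equals nothing. -/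
def eqTop (a : WithTop ℚ) (x : ℚ) (y : WithTop ℚ) : Timed Bool :=
  match a, y with
  | (a : ℚ), (y : ℚ) => do eqQ (← addQ a x) y
  | _, _ => do
      tick 1
      return false

/-- An edge `(u, v)` of the list, and a departure time from `u`, that explain the cost `y` of being at
`v` at time `t`. -/
def findEdge (prof : Fin G.n → Profile) (v : Fin G.n) (t : ℤ) (y : WithTop ℚ) :
    List (Fin G.n × Fin G.n) → Timed (Option (Fin G.n × ℤ))
  | [] => do
      tick 1
      return none
  | e :: l => do
      tick (G.n + 1)
      if e.2 = v then
        let Φ ← load G.E.length (G.Φ e)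
        let drive ← load G.E.length (G.δ e : ℤ)
        let c₀ ← load (G.r + 1) (G.c 0)
        let x ← latestDeparture (← sortBans (← mirror Φ)) drive t
        let wait ← subZ (← subZ t x) drive
        let driveCost ← mulQ G.d (← toQ drive)
        let waitCost ← mulQ c₀ (← toQ wait)
        let f ← load G.n (prof e.1)
        if ← eqTop (← evalAt f x) (← addQ driveCost waitCost) y then return some (e.1, x)
        else findEdge prof v t y l
      else findEdge prof v t y l

/-- The earliest time `t` in an increasing list from which waiting until the time `dep` explains the
cost `y` at time `dep`; `dep` itself if there is none before it. -/
def findArrival (f : Profile) (w : ℚ) (dep : ℤ) (y : WithTop ℚ) : List ℤ → Timed ℤ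
  | [] => do
      tick 1
      return dep
  | t :: l => do
      tick 1
      if ← ltZ t dep then
        let x ← toQ (← subZ dep t)
        if ← eqTop (← evalAt f t) (← mulQ w x) y then return t
        else findArrival f w dep y l
      else return dep

/-- One round of the backward construction of a route whose first stop is `p`. -/
def extendRoute (prof : Fin G.n → Profile) (p : Stop G.n) : Timed (Option (Stop G.n)) := do
  let fv ← load G.n (prof p.vertex)
  let y ← evalAt fv p.arr
  match ← findEdge G prof p.vertex p.arr y G.E with
  | none => return none
  | some (u, x) =>
      let f ← load G.n (prof u)
      let rating ← load G.n (G.ρ u)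
      let w ← load (G.r + 1) (G.c rating)
      let y' ← evalAt f x
      let t ← findArrival f w x y' (← times f)
      return some ⟨u, t, x⟩

/-- The main loop; the construction of the routes (for the arrival times in `todo`; `route` is under
construction unless it is empty); termination with an output. -/
inductive Config where
  | loop (σ : State G)
  | extract (prof : Fin G.n → Profile) (todo : List ℤ) (route : Route G.n) (out : List (Route G.n))
  | halt (out : List (Route G.n))

/-- One iteration of the main loop or one round of the finalization phase. -/
def step : Config G → Timed (Config G)
  | .loop σ => do
      tick (G.n + 1)
      match ← findMin G σ (List.finRange G.n) with
      | some (u, t) =>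
          tick (G.n + 1)
          let σ' ← relaxAll G q u t G.E { σ with queue := Function.update σ.queue u none }
          return .loop σ'
      | none =>
          let f ← load G.n (σ.prof q.z)
          let ts ← paretoTimes f
          return .extract σ.prof ts [] []
  | .extract _ [] [] out => do
      tick 1
      return .halt out
  | .extract prof (t :: todo) [] out => do
      tick 1
      return .extract prof todo [⟨q.z, t, t⟩] out
  | .extract prof todo (p :: route) out => do
      tick (G.n + 1)
      let start ← eqZ p.arr q.tmin
      if p.vertex = q.s && start then
        return .extract prof todo [] ((p :: route) :: out)
      else
        match ← extendRoute G prof p with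
        | some p' => return .extract prof todo (p' :: p :: route) out
        | none => return .extract prof todo [] out
  | .halt out => return .halt out

/-- Initialization. -/
def init : Timed (State G) := do
  tick (2 * G.n + 1)
  let rating ← load G.n (G.ρ q.s)
  let w ← load (G.r + 1) (G.c rating)
  let y ← mulQ w (← toQ (← subZ q.tmax q.tmin))
  let f ← if ← ltZ q.tmin q.tmax then pure [(q.tmin, 0), (q.tmax, y)] else pure [(q.tmin, 0)]
  return { prof := Function.update (fun _ => []) q.s f
           queue := Function.update (fun _ => none) q.s (some q.tmin) }

/-- `Runs G q x k y`: the algorithm gets from `x` to `y` in time `k`. -/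
inductive Runs : Config G → ℕ → Config G → Prop
  | refl (x : Config G) : Runs x 0 x
  | step (x : Config G) {k : ℕ} {y : Config G} :
      Runs (step G q x).val k y → Runs x ((step G q x).time + k) y

/-- Encoding length of the input. -/
def inputSize : ℕ :=
  G.n + (G.r + 1) + bitsZ q.tmin + bitsZ q.tmax + bitsQ G.d + ∑ i, bitsQ (G.c i)
    + (G.E.map fun e =>
        1 + bitsZ (G.δ e) + ((G.Φ e).map fun I => bitsZ I.1 + bitsZ I.2).sum).sum

end Algorithm

end TempBans

/-!
If driving costs as much as waiting on edges, the costs of being on an edge depend only on the time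
spent there, and as waiting at a vertex is never more expensive, it is best to depart as late as
possible. So the optimal costs `opt v t` of being at `v` at time `t` satisfy a Bellman equation
with the latest departures `lastDep e t`, and `t ↦ opt v t - c₀ t`, the costs compared to driving
all the time, is nonincreasing in time and does not change along an edge of an optimal route.

The number of iterations is bounded by a shifting argument. Consider a journey along an edge from
the latest departure until the arrival. Unless a ban ends at the departure or begins at the
arrival, either the same departure allows for an earlier arrival, or departure and arrival can both
be shifted by a time unit in either direction (`lastDep_cases`). A route can be shifted, moreover,
by waiting longer or shorter at its last stop where it waits. Hence `opt v` is locally concave at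
`t`, with one of the `c i` as a slope in between, except if `opt v t - c₀ t` belongs to a set
`banValues` with at most two elements for each ban interval and one for the start (`opt_shift`).
The stored profiles are not optimal before the end, but they satisfy the same with a set that
grows, with each relaxation of an edge, by two elements for each ban interval on that edge and one
for the time of the visit (`LoopInv.shift`). This is an invariant (`LoopInv.relax`, `LoopInv.pop`).

A nonincreasing function attains each value for the first and for the last time at most once. So
there are few kinks at exceptional values. All convex kinks are among these, and two concave kinks
at which the same slope `c i` is crossed have a convex one in between. So profiles have few
breakpoints (`card_kinks_le`). Profiles are optimal up to the earliest key (`LoopInv.eq_opt`),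
whence a vertex is visited at its earliest arrival time or one time unit after a time at which
`opt` has a value in `banValues` for the last time or a concave kink (`GoodKey`). As the latter set
of values does not grow, there are few visits (`card_goodKey_le`), and these in turn bound the sets
for the stored profiles. All costs that occur are multiples of `1 / commonDen G` between zero and
`c₀ (tmax - tmin)`, so that all numbers are short (`IsCost.bits_le`).

The computations on lists of breakpoints are related to functions on the integers by `Repr`: a
segment between consecutive breakpoints stands for an affine function. The computed breakpoints
include all kinks (`link_repr`, `waiting_repr`, `improve_spec`), and pruning leaves only these, so
the lengths of lists are bounded by the numbers of kinks.

At the end of the main loop all profiles are optimal. The times at which the costs at the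
destination are lower than ever before are the arrival times of Pareto-optimal routes
(`isSolution_of_isOptimal`). They are found among the times at which the costs decrease, of which
there are few since no shift is possible there (`card_drops_le`). A route that is constructed
backwards arrives at each stop such that arriving earlier and waiting costs more (`Strict`). If it
waits at that stop, it has a value in `banValues` there, and otherwise the same value as at the
next stop; and it does not reach a vertex twice with the same value. So it has few stops
(`Partial.length_le`).
-/

namespace TempBans

/-! ### Results and times of compound computations -/

namespace Timed

variable {α β : Type}

@[simp] theorem val_bind (x : Timed α) (f : α → Timed β) : (x >>= f).val = (f x.val).val := rfl

@[simp] theorem time_bind (x : Timed α) (f : α → Timed β) :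
    (x >>= f).time = x.time + (f x.val).time := rfl

@[simp] theorem val_pure (a : α) : (pure a : Timed α).val = a := rfl

@[simp] theorem time_pure (a : α) : (pure a : Timed α).time = 0 := rfl

@[simp] theorem val_ite (c : Prop) [Decidable c] (x y : Timed α) :
    (if c then x else y).val = if c then x.val else y.val := by split <;> rfl

@[simp] theorem time_ite (c : Prop) [Decidable c] (x y : Timed α) :
    (if c then x else y).time = if c then x.time else y.time := by split <;> rfl

@[simp] theorem time_tick (k : ℕ) : (tick k).time = k := rfl

@[simp] theorem val_load (k : ℕ) (a : α) : (load k a).val = a := rfl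

@[simp] theorem time_load (k : ℕ) (a : α) : (load k a).time = k + 1 := rfl

end Timed

@[simp] theorem addZ_val (x y : ℤ) : (addZ x y).val = x + y := rfl
@[simp] theorem subZ_val (x y : ℤ) : (subZ x y).val = x - y := rfl
@[simp] theorem negZ_val (x : ℤ) : (negZ x).val = -x := rfl
@[simp] theorem ltZ_val (x y : ℤ) : (ltZ x y).val = decide (x < y) := rfl
@[simp] theorem leZ_val (x y : ℤ) : (leZ x y).val = decide (x ≤ y) := rfl
@[simp] theorem eqZ_val (x y : ℤ) : (eqZ x y).val = decide (x = y) := rfl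
@[simp] theorem toQ_val (x : ℤ) : (toQ x).val = (x : ℚ) := rfl
@[simp] theorem addQ_val (x y : ℚ) : (addQ x y).val = x + y := rfl
@[simp] theorem subQ_val (x y : ℚ) : (subQ x y).val = x - y := rfl
@[simp] theorem mulQ_val (x y : ℚ) : (mulQ x y).val = x * y := rfl
@[simp] theorem divQ_val (x y : ℚ) : (divQ x y).val = x / y := rfl
@[simp] theorem floorQ_val (x : ℚ) : (floorQ x).val = ⌊x⌋ := rfl
@[simp] theorem ltQ_val (x y : ℚ) : (ltQ x y).val = decide (x < y) := rfl
@[simp] theorem eqQ_val (x y : ℚ) : (eqQ x y).val = decide (x = y) := rfl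

@[simp] theorem minQ_val (x y : ℚ) : (minQ x y).val = min x y := by
  simp only [minQ, Timed.val_bind, ltQ_val, Timed.val_ite, Timed.val_pure, decide_eq_true_eq]
  split
  · exact (min_eq_right (by linarith)).symm
  · exact (min_eq_left (by linarith)).symm

@[simp] theorem append_val {α : Type} (k l : List α) : (append k l).val = k ++ l := by
  induction k with
  | nil => rfl
  | cons a k ih => simp [append, ih]

@[simp] theorem times_val (f : Profile) : (times f).val = f.map Prod.fst := by
  induction f with
  | nil => rfl
  | cons a k ih => simp [times, ih]

/-! ### Lengths of numbers -/

theorem size_add_le (a b : ℕ) : (a + b).size ≤ max a.size b.size + 1 := by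
  rw [Nat.size_le, pow_succ]
  have ha : a < 2 ^ max a.size b.size :=
    (Nat.lt_size_self a).trans_le (Nat.pow_le_pow_right (by norm_num) (le_max_left _ _))
  have hb : b < 2 ^ max a.size b.size :=
    (Nat.lt_size_self b).trans_le (Nat.pow_le_pow_right (by norm_num) (le_max_right _ _))
  omega

theorem size_mul_le (a b : ℕ) : (a * b).size ≤ a.size + b.size := by
  rw [Nat.size_le, pow_add]
  exact Nat.mul_lt_mul'' (Nat.lt_size_self a) (Nat.lt_size_self b)

theorem bitsZ_mono {x y : ℤ} (h : x.natAbs ≤ y.natAbs) : bitsZ x ≤ bitsZ y := by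
  unfold bitsZ; have := Nat.size_le_size h; omega

theorem bitsZ_add_le (x y : ℤ) : bitsZ (x + y) ≤ bitsZ x + bitsZ y := by
  unfold bitsZ
  have h1 := Nat.size_le_size (Int.natAbs_add_le x y)
  have h2 := size_add_le x.natAbs y.natAbs
  omega

theorem bitsZ_neg (x : ℤ) : bitsZ (-x) = bitsZ x := by simp [bitsZ]

theorem bitsZ_sub_le (x y : ℤ) : bitsZ (x - y) ≤ bitsZ x + bitsZ y := by
  rw [sub_eq_add_neg, ← bitsZ_neg y]; exact bitsZ_add_le _ _

theorem bitsQ_intCast (x : ℤ) : bitsQ (x : ℚ) = bitsZ x + 1 := by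
  simp [bitsQ, bitsZ, Nat.size_one]

theorem bitsQ_of_eq_div {x : ℚ} {a b : ℤ} (hb : b ≠ 0) (h : x = a / b) :
    bitsQ x ≤ a.natAbs.size + b.natAbs.size + 1 := by
  have hd : (x.den : ℤ) ∣ b := by rw [h]; exact_mod_cast Rat.den_dvd a b
  have hn : x.num.natAbs ≤ a.natAbs := by
    by_cases ha : a = 0
    · subst ha; simp [h]
    · have : x.num ∣ a := by rw [h, ← Rat.divInt_eq_div]; exact Rat.num_dvd a hb
      exact Nat.le_of_dvd (Int.natAbs_pos.2 ha) (Int.natAbs_dvd_natAbs.2 this)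
  have hd' : x.den ≤ b.natAbs :=
    Nat.le_of_dvd (Int.natAbs_pos.2 hb) (by simpa using Int.natAbs_dvd_natAbs.2 hd)
  have := Nat.size_le_size hn
  have := Nat.size_le_size hd'
  unfold bitsQ; omega

theorem bitsQ_add_le (x y : ℚ) : bitsQ (x + y) ≤ 2 * (bitsQ x + bitsQ y) := by
  have hx := x.den_ne_zero
  have hy := y.den_ne_zero
  have h : x + y = ((x.num * y.den + y.num * x.den : ℤ) : ℚ) / ((x.den * y.den : ℤ) : ℚ) := by
    push_cast
    rw [eq_div_iff (by positivity)]
    nth_rewrite 1 [← Rat.num_div_den x, ← Rat.num_div_den y]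
    field_simp
  refine (bitsQ_of_eq_div (by positivity) h).trans ?_
  have h1 := Nat.size_le_size (Int.natAbs_add_le (x.num * y.den) (y.num * x.den))
  have h2 := size_add_le (x.num * y.den : ℤ).natAbs (y.num * x.den : ℤ).natAbs
  have h3 := size_mul_le x.num.natAbs y.den
  have h4 := size_mul_le y.num.natAbs x.den
  have h5 := size_mul_le x.den y.den
  simp only [Int.natAbs_mul, Int.natAbs_natCast] at *
  unfold bitsQ; omega

theorem bitsQ_neg (x : ℚ) : bitsQ (-x) = bitsQ x := by simp [bitsQ]

theorem bitsQ_sub_le (x y : ℚ) : bitsQ (x - y) ≤ 2 * (bitsQ x + bitsQ y) := by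
  rw [sub_eq_add_neg, ← bitsQ_neg y]; exact bitsQ_add_le _ _

theorem bitsQ_mul_le (x y : ℚ) : bitsQ (x * y) ≤ bitsQ x + bitsQ y := by
  have h : x * y = ((x.num * y.num : ℤ) : ℚ) / ((x.den * y.den : ℤ) : ℚ) := by
    push_cast
    nth_rewrite 1 [← Rat.num_div_den x, ← Rat.num_div_den y]
    field_simp
  have hx := x.den_ne_zero
  have hy := y.den_ne_zero
  refine (bitsQ_of_eq_div (by positivity) h).trans ?_
  have h3 := size_mul_le x.num.natAbs y.num.natAbs
  have h5 := size_mul_le x.den y.den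
  simp only [Int.natAbs_mul, Int.natAbs_natCast] at *
  unfold bitsQ; omega

theorem bitsQ_inv (x : ℚ) : bitsQ x⁻¹ ≤ bitsQ x + 1 := by
  by_cases h0 : x = 0
  · subst h0; simp
  have h : x⁻¹ = ((x.den : ℤ) : ℚ) / ((x.num : ℤ) : ℚ) := by
    nth_rewrite 1 [← Rat.num_div_den x]
    simp
  refine (bitsQ_of_eq_div (by simpa using h0) h).trans ?_
  simp only [Int.natAbs_natCast]
  unfold bitsQ; omega

theorem bitsQ_div_le (x y : ℚ) : bitsQ (x / y) ≤ bitsQ x + bitsQ y + 1 := by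
  rw [div_eq_mul_inv]
  have := bitsQ_mul_le x y⁻¹
  have := bitsQ_inv y
  omega

theorem bitsZ_floor_le (x : ℚ) : bitsZ ⌊x⌋ ≤ bitsQ x := by
  have h : ⌊x⌋.natAbs ≤ x.num.natAbs := by
    have hd : (1 : ℤ) ≤ x.den := by exact_mod_cast x.den_pos
    have hf : ⌊x⌋ = x.num / (x.den : ℤ) := by
      conv_lhs => rw [← Rat.num_div_den x]
      exact_mod_cast Rat.floor_intCast_div_natCast x.num x.den
    rw [hf]
    have h1 := Int.ediv_mul_le x.num (b := x.den) (by omega)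
    have h2 := Int.lt_ediv_add_one_mul_self x.num (b := x.den) (by omega)
    generalize x.num / (x.den : ℤ) = k at *
    by_cases hk : 0 ≤ k
    · have : k ≤ x.num := by nlinarith
      omega
    · have h3 : (k + 1) * x.den ≤ (k + 1) * 1 := by
        apply mul_le_mul_of_nonpos_left hd; omega
      omega
  have := Nat.size_le_size h
  have h1 : 0 < x.den.size := Nat.size_pos.2 x.den_pos
  unfold bitsZ bitsQ; omega

/-! ### Open and closed time -/

/-- The time within `[x, y)` that is not covered by the ban intervals of a list (negative if `y <
x`). -/
def openTime (l : List (ℤ × ℤ)) (x y : ℤ) : ℤ := y - x - (l.map (overlap x y)).sum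

/-- Pairwise disjoint, nonempty ban intervals. -/
structure Bans (l : List (ℤ × ℤ)) : Prop where
  pos : ∀ I ∈ l, I.1 < I.2
  disj : l.Pairwise fun I J => Disjoint (Set.Ico I.1 I.2) (Set.Ico J.1 J.2)

/-- Nonempty ban intervals in chronological order. -/
structure SortedBans (l : List (ℤ × ℤ)) : Prop where
  pos : ∀ I ∈ l, I.1 < I.2
  sorted : l.Pairwise fun I J => I.2 ≤ J.1

theorem overlap_nonneg (x y : ℤ) (I : ℤ × ℤ) : 0 ≤ overlap x y I := le_max_left _ _

theorem overlap_add {x y z : ℤ} (hxy : x ≤ y) (hyz : y ≤ z) {I : ℤ × ℤ} (hI : I.1 < I.2) :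
    overlap x y I + overlap y z I = overlap x z I := by
  unfold overlap; omega

theorem overlap_of_ge {x y : ℤ} {I : ℤ × ℤ} (h : y ≤ x) : overlap x y I = 0 := by
  unfold overlap; omega

theorem openTime_cons (I : ℤ × ℤ) (l : List (ℤ × ℤ)) (x y : ℤ) :
    openTime (I :: l) x y = openTime l x y - overlap x y I := by
  simp [openTime]; ring

theorem openTime_of_ge (l : List (ℤ × ℤ)) {x y : ℤ} (h : y ≤ x) : openTime l x y = y - x := by
  induction l with
  | nil => simp [openTime]
  | cons I l ih => rw [openTime_cons, ih, overlap_of_ge h, sub_zero]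

theorem openTime_add {l : List (ℤ × ℤ)} (hl : ∀ I ∈ l, I.1 < I.2) {x y z : ℤ} (hxy : x ≤ y)
    (hyz : y ≤ z) : openTime l x y + openTime l y z = openTime l x z := by
  induction l with
  | nil => simp [openTime]
  | cons I l ih =>
    have h1 := ih fun J hJ => hl J (List.mem_cons_of_mem _ hJ)
    have h2 := overlap_add hxy hyz (hl I List.mem_cons_self)
    simp only [openTime_cons]; omega

theorem openTime_perm {l l' : List (ℤ × ℤ)} (h : l.Perm l') (x y : ℤ) :
    openTime l x y = openTime l' x y := by
  unfold openTime; rw [(h.map _).sum_eq]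

theorem openTime_eq_of_le {l : List (ℤ × ℤ)} {x y : ℤ} (h : ∀ I ∈ l, y ≤ I.1 ∨ I.2 ≤ x) :
    openTime l x y = y - x := by
  induction l with
  | nil => simp [openTime]
  | cons I l ih =>
    rw [openTime_cons, ih fun J hJ => h J (List.mem_cons_of_mem _ hJ)]
    have := h I List.mem_cons_self
    unfold overlap; omega

/-- A time unit inside of a ban interval is closed. -/
theorem openTime_succ_of_mem {l : List (ℤ × ℤ)} (hl : Bans l) {x : ℤ} {I : ℤ × ℤ} (hI : I ∈ l)
    (h1 : I.1 ≤ x) (h2 : x < I.2) : openTime l x (x + 1) = 0 := by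
  induction l with
  | nil => simp at hI
  | cons J l ih =>
    have hd := List.pairwise_cons.1 hl.disj
    rw [openTime_cons]
    rcases List.mem_cons.1 hI with rfl | hI'
    · rw [openTime_eq_of_le]
      · unfold overlap; omega
      · intro K hK
        have := Set.disjoint_left.1 (hd.1 K hK) (Set.mem_Ico.2 ⟨h1, h2⟩)
        rw [Set.mem_Ico] at this; omega
    · rw [ih ⟨fun K hK => hl.pos K (List.mem_cons_of_mem _ hK), hd.2⟩ hI']
      have := Set.disjoint_right.1 (hd.1 I hI') (Set.mem_Ico.2 ⟨h1, h2⟩)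
      rw [Set.mem_Ico] at this
      unfold overlap; omega

theorem openTime_succ {l : List (ℤ × ℤ)} (hl : Bans l) (x : ℤ) :
    openTime l x (x + 1) = 1 ∨ openTime l x (x + 1) = 0 ∧ ∃ I ∈ l, I.1 ≤ x ∧ x < I.2 := by
  by_cases h : ∃ I ∈ l, I.1 ≤ x ∧ x < I.2
  · obtain ⟨I, hI, h1, h2⟩ := h
    exact Or.inr ⟨openTime_succ_of_mem hl hI h1 h2, I, hI, h1, h2⟩
  · left
    rw [openTime_eq_of_le]
    · ring
    · intro I hI
      by_contra hc
      exact h ⟨I, hI, by omega, by omega⟩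

theorem openTime_nonneg {l : List (ℤ × ℤ)} (hl : Bans l) {x y : ℤ} (h : x ≤ y) :
    0 ≤ openTime l x y := by
  induction y, h using Int.leInduction with
  | base => rw [openTime_of_ge l le_rfl]; omega
  | succ y hxy ih =>
    rw [← openTime_add hl.pos hxy (by omega : y ≤ y + 1)]
    rcases openTime_succ hl y with h | h <;> omega

theorem openTime_mono {l : List (ℤ × ℤ)} (hl : Bans l) (x : ℤ) {y y' : ℤ} (h : y ≤ y') :
    openTime l x y ≤ openTime l x y' := by
  rcases le_total x y with hx | hx
  · rw [← openTime_add hl.pos hx h]; have := openTime_nonneg hl h; omega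
  · rw [openTime_of_ge l hx]
    rcases le_total x y' with hx' | hx'
    · have := openTime_nonneg hl hx'; omega
    · rw [openTime_of_ge l hx']; omega

theorem openTime_anti {l : List (ℤ × ℤ)} (hl : Bans l) {x x' : ℤ} (y : ℤ) (h : x ≤ x') :
    openTime l x' y ≤ openTime l x y := by
  rcases le_total x' y with hx | hx
  · rw [← openTime_add hl.pos h hx]; have := openTime_nonneg hl h; omega
  · rw [openTime_of_ge l hx]
    rcases le_total x y with hx' | hx'
    · have := openTime_nonneg hl hx'; omega
    · rw [openTime_of_ge l hx']; omega

/-! ### Sorting and mirroring ban intervals -/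

theorem insertBan_perm (I : ℤ × ℤ) (l : List (ℤ × ℤ)) : (insertBan I l).val.Perm (I :: l) := by
  induction l with
  | nil => simp [insertBan]
  | cons J l ih =>
    simp only [insertBan, Timed.val_bind, Timed.val_ite, Timed.val_pure]
    split
    · rfl
    · exact (ih.cons J).trans (List.Perm.swap _ _ _)

theorem sortBans_perm (l : List (ℤ × ℤ)) : (sortBans l).val.Perm l := by
  induction l with
  | nil => simp [sortBans]
  | cons J l ih =>
    simp only [sortBans, Timed.val_bind]
    exact (insertBan_perm _ _).trans (ih.cons J)

theorem insertBan_sorted (I : ℤ × ℤ) {l : List (ℤ × ℤ)} (h : l.Pairwise fun I J => I.1 ≤ J.1) :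
    (insertBan I l).val.Pairwise fun I J => I.1 ≤ J.1 := by
  induction l with
  | nil => simp [insertBan]
  | cons J l ih =>
    have h' := List.pairwise_cons.1 h
    simp only [insertBan, Timed.val_bind, Timed.val_ite, Timed.val_pure, leZ_val,
      decide_eq_true_eq]
    split
    · rename_i hIJ
      refine List.pairwise_cons.2 ⟨fun K hK => ?_, h⟩
      rcases List.mem_cons.1 hK with rfl | hK
      · exact hIJ
      · exact hIJ.trans (h'.1 K hK)
    · rename_i hIJ
      refine List.pairwise_cons.2 ⟨fun K hK => ?_, ih h'.2⟩
      rcases List.mem_cons.1 ((insertBan_perm I l).mem_iff.1 hK) with rfl | hK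
      · omega
      · exact h'.1 K hK

theorem sortBans_sorted {l : List (ℤ × ℤ)} (hl : Bans l) : SortedBans (sortBans l).val := by
  have hp := sortBans_perm l
  have hs : (sortBans l).val.Pairwise fun I J => I.1 ≤ J.1 := by
    clear hp hl
    induction l with
    | nil => simp [sortBans]
    | cons J l ih => simpa only [sortBans, Timed.val_bind] using insertBan_sorted J ih
  have hpos : ∀ I ∈ (sortBans l).val, I.1 < I.2 := fun I hI => hl.pos I (hp.mem_iff.1 hI)
  have hd : (sortBans l).val.Pairwise fun I J => Disjoint (Set.Ico I.1 I.2) (Set.Ico J.1 J.2) :=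
    (hp.pairwise_iff fun h => h.symm).2 hl.disj
  refine ⟨hpos, (hs.and hd).imp_of_mem fun {I J} hI hJ h => ?_⟩
  have := Set.disjoint_right.1 h.2 (Set.mem_Ico.2 ⟨le_rfl, hpos J hJ⟩)
  have h1 := h.1
  rw [Set.mem_Ico] at this; omega

theorem mirror_val (l : List (ℤ × ℤ)) : (mirror l).val = l.map fun I => (-I.2, -I.1) := by
  induction l with
  | nil => rfl
  | cons a k ih => simp [mirror, ih]

theorem mirror_bans {l : List (ℤ × ℤ)} (hl : Bans l) : Bans (mirror l).val := by
  rw [mirror_val]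
  refine ⟨?_, ?_⟩
  · intro I hI
    obtain ⟨J, hJ, rfl⟩ := List.mem_map.1 hI
    have := hl.pos J hJ; simp only; omega
  · rw [List.pairwise_map]
    refine hl.disj.imp fun {I J} h => ?_
    rw [Set.disjoint_left] at h ⊢
    intro x hx hx'
    rw [Set.mem_Ico] at hx hx'
    exact h (a := -x - 1) (Set.mem_Ico.2 (by omega)) (Set.mem_Ico.2 (by omega))

theorem openTime_mirror (l : List (ℤ × ℤ)) (x y : ℤ) :
    openTime (mirror l).val (-y) (-x) = openTime l x y := by
  rw [mirror_val]
  induction l with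
  | nil => simp [openTime]; ring
  | cons I l ih =>
    rw [List.map_cons, openTime_cons, openTime_cons, ih]
    unfold overlap; omega

/-! ### Earliest arrival and latest departure -/

/-- The computed arrival time is the one at which the required open time has just passed since the
departure. -/
theorem earliestArrival_spec {l : List (ℤ × ℤ)} (hl : SortedBans l) {rem : ℤ} (hr : 0 < rem)
    (t : ℤ) : t < (earliestArrival l rem t).val ∧
      openTime l t (earliestArrival l rem t).val = rem ∧
      openTime l t ((earliestArrival l rem t).val - 1) = rem - 1 := by
  induction l generalizing rem t with
  | nil => simp [earliestArrival, openTime]; omega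
  | cons I l ih =>
    have hI := hl.pos I List.mem_cons_self
    have hs := List.pairwise_cons.1 hl.sorted
    have hl' : SortedBans l := ⟨fun J hJ => hl.pos J (List.mem_cons_of_mem _ hJ), hs.2⟩
    -- before the end of the first ban interval, only that interval matters
    have key : ∀ y, t ≤ I.2 → I.2 ≤ y →
        openTime (I :: l) t y = I.2 - t - overlap t I.2 I + openTime l I.2 y := by
      intro y h1 h2
      have e1 : openTime l t I.2 = I.2 - t := openTime_eq_of_le fun J hJ => Or.inl (hs.1 J hJ)
      rw [openTime_cons, ← openTime_add hl'.pos h1 h2, e1, ← overlap_add h1 h2 hI]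
      have : overlap I.2 y I = 0 := by unfold overlap; omega
      omega
    simp only [earliestArrival, Timed.val_bind, Timed.val_ite, leZ_val, subZ_val, ltZ_val, addZ_val,
      decide_eq_true_eq]
    split
    · rename_i h
      obtain ⟨h1, h2, h3⟩ := ih hl' hr t
      refine ⟨h1, ?_, ?_⟩
      · rw [openTime_cons, h2]; unfold overlap; omega
      · rw [openTime_cons, h3]; unfold overlap; omega
    · rename_i h
      split
      · rename_i h'
        have : ∀ y, y ≤ t + rem → openTime (I :: l) t y = y - t := by
          intro y hy
          apply openTime_eq_of_le
          intro J hJ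
          rcases List.mem_cons.1 hJ with rfl | hJ
          · left; omega
          · have := hs.1 J hJ; left; omega
        refine ⟨by omega, ?_, ?_⟩
        · rw [this _ le_rfl]; omega
        · rw [this _ (by omega)]; omega
      · split
        · obtain ⟨h1, h2, h3⟩ := ih hl' (rem := rem - (I.1 - t)) (by omega) I.2
          refine ⟨by omega, ?_, ?_⟩
          · rw [key _ (by omega) (by omega), h2]; unfold overlap; omega
          · rw [key _ (by omega) (by omega), h3]; unfold overlap; omega
        · obtain ⟨h1, h2, h3⟩ := ih hl' hr I.2
          refine ⟨by omega, ?_, ?_⟩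
          · rw [key _ (by omega) (by omega), h2]; unfold overlap; omega
          · rw [key _ (by omega) (by omega), h3]; unfold overlap; omega

section Edge

variable (G : RoadGraph)

theorem RoadGraph.bans (e) (he : e ∈ G.E) : Bans (G.Φ e) := ⟨G.Φ_pos e he, G.Φ_disjoint e he⟩

/-- The latest departure time for arriving at the head of the edge `e` at time `t`. -/
def lastDep (e : Fin G.n × Fin G.n) (t : ℤ) : ℤ :=
  (latestDeparture (sortBans (mirror (G.Φ e)).val).val (G.δ e) t).val

/-- The earliest arrival time at the head of the edge `e` when departing at time `t`. -/
def firstArr (e : Fin G.n × Fin G.n) (t : ℤ) : ℤ :=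
  (earliestArrival (sortBans (G.Φ e)).val (G.δ e) t).val

variable {G} {e : Fin G.n × Fin G.n} (he : e ∈ G.E)

include he

theorem firstArr_spec (t : ℤ) : t < firstArr G e t ∧
    openTime (G.Φ e) t (firstArr G e t) = G.δ e ∧
    openTime (G.Φ e) t (firstArr G e t - 1) = G.δ e - 1 := by
  have h := earliestArrival_spec (sortBans_sorted (G.bans e he))
    (rem := G.δ e) (by exact_mod_cast G.δ_pos e he) t
  simp only [openTime_perm (sortBans_perm (G.Φ e))] at h
  exact h

theorem lastDep_spec (t : ℤ) : lastDep G e t < t ∧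
    openTime (G.Φ e) (lastDep G e t) t = G.δ e ∧
    openTime (G.Φ e) (lastDep G e t + 1) t = G.δ e - 1 := by
  have h := earliestArrival_spec (sortBans_sorted (mirror_bans (G.bans e he)))
    (rem := G.δ e) (by exact_mod_cast G.δ_pos e he) (-t)
  simp only [openTime_perm (sortBans_perm (mirror (G.Φ e)).val)] at h
  have hL : (earliestArrival (sortBans (mirror (G.Φ e)).val).val (G.δ e) (-t)).val
      = - lastDep G e t := by simp [lastDep, latestDeparture]
  rw [hL, openTime_mirror, show -lastDep G e t - 1 = -(lastDep G e t + 1) by ring,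
    openTime_mirror] at h
  exact ⟨by omega, h.2.1, h.2.2⟩

theorem le_lastDep_iff {x t : ℤ} : x ≤ lastDep G e t ↔ (G.δ e : ℤ) ≤ openTime (G.Φ e) x t := by
  obtain ⟨-, h1, h2⟩ := lastDep_spec he t
  constructor
  · intro h
    have := openTime_anti (G.bans e he) t h
    omega
  · intro h
    by_contra hc
    have := openTime_anti (G.bans e he) t (show lastDep G e t + 1 ≤ x by omega)
    omega

theorem firstArr_le_iff {x t : ℤ} : firstArr G e x ≤ t ↔ x ≤ lastDep G e t := by
  rw [le_lastDep_iff he]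
  obtain ⟨-, h1, h2⟩ := firstArr_spec he x
  constructor
  · intro h
    have := openTime_mono (G.bans e he) x h
    omega
  · intro h
    by_contra hc
    have := openTime_mono (G.bans e he) x (show t ≤ firstArr G e x - 1 by omega)
    omega

theorem lastDep_mono {t t' : ℤ} (h : t ≤ t') : lastDep G e t ≤ lastDep G e t' := by
  rw [le_lastDep_iff he]
  have := openTime_mono (G.bans e he) (lastDep G e t) h
  have := (lastDep_spec he t).2.1
  omega

theorem travelTime_eq (t : ℤ) : travelTime G e t = ((t - lastDep G e t).toNat : ℕ) := by
  have hlt := (lastDep_spec he t).1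
  have hmem : ∀ p : ℕ, (G.δ e : ℤ) ≤ p - G.closedTime e (t - p) t ↔ t - p ≤ lastDep G e t := by
    intro p
    rw [le_lastDep_iff he]
    have : openTime (G.Φ e) (t - p) t = p - G.closedTime e (t - p) t := by
      unfold openTime RoadGraph.closedTime; ring
    rw [this]
  apply le_antisymm
  · apply sInf_le
    exact ⟨_, (hmem _).2 (by omega), rfl⟩
  · apply le_sInf
    rintro _ ⟨p, hp, rfl⟩
    have := (hmem p).1 hp
    simp only [Nat.cast_le]
    omega

/-- Shifting a journey along an edge by a time unit is possible in both directions, unless a ban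
ends at the departure or begins at the arrival, or one can arrive earlier anyway. -/
theorem lastDep_cases (t : ℤ) : (∃ I ∈ G.Φ e, lastDep G e t = I.2) ∨ (∃ I ∈ G.Φ e, t = I.1) ∨
    lastDep G e t ≤ lastDep G e (t - 1) ∨
    (lastDep G e t - 1 ≤ lastDep G e (t - 1) ∧ lastDep G e t + 1 ≤ lastDep G e (t + 1)) := by
  have hb := G.bans e he
  have hδ := G.δ_pos e he
  obtain ⟨h0, h1, h2⟩ := lastDep_spec he t
  simp only [le_lastDep_iff he]
  set D := lastDep G e t
  by_cases hI : ∃ I ∈ G.Φ e, D = I.2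
  · exact Or.inl hI
  by_cases hA : ∃ I ∈ G.Φ e, t = I.1
  · exact Or.inr (Or.inl hA)
  right; right
  have a1 := openTime_add hb.pos (show D ≤ D + 1 by omega) (show D + 1 ≤ t by omega)
  have a2 := openTime_add hb.pos (show D - 1 ≤ D by omega) (show D ≤ t by omega)
  have a3 := openTime_add hb.pos (show D ≤ t - 1 by omega) (show t - 1 ≤ t by omega)
  have a4 := openTime_add hb.pos (show D + 1 ≤ t by omega) (show t ≤ t + 1 by omega)
  have a5 := openTime_add hb.pos (show D - 1 ≤ t - 1 by omega) (show t - 1 ≤ t by omega)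
  have o1 : openTime (G.Φ e) (D - 1) D = 1 := by
    rcases openTime_succ hb (D - 1) with h | ⟨-, I, hI', h3, h4⟩
    · simpa using h
    · exfalso
      by_cases h5 : D < I.2
      · have := openTime_succ_of_mem hb hI' (by omega) h5
        omega
      · exact hI ⟨I, hI', by omega⟩
  have o2 := openTime_succ hb (t - 1)
  rw [sub_add_cancel] at o2
  rcases openTime_succ hb t with h | ⟨-, I, hI', h3, h4⟩
  · right; omega
  · left
    have : I.1 ≠ t := fun h => hA ⟨I, hI', h.symm⟩
    have := openTime_succ_of_mem hb hI' (x := t - 1) (by omega) (by omega)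
    rw [sub_add_cancel] at this
    omega

end Edge

/-! ### Piecewise linear functions on the integers -/

/-- The value at time `t` on the line through `p` and `p'`. -/
def line (p p' : ℤ × ℚ) (t : ℤ) : ℚ :=
  p.2 + (p'.2 - p.2) * ((t - p.1 : ℤ) : ℚ) / ((p'.1 - p.1 : ℤ) : ℚ)

@[simp] theorem interpolate_val (p p' : ℤ × ℚ) (t : ℤ) : (interpolate p p' t).val = line p p' t := rfl

@[simp] theorem line_left (p p' : ℤ × ℚ) : line p p' p.1 = p.2 := by simp [line]

theorem line_right {p p' : ℤ × ℚ} (h : p.1 < p'.1) : line p p' p'.1 = p'.2 := by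
  have : ((p'.1 - p.1 : ℤ) : ℚ) ≠ 0 := by exact_mod_cast (by omega : p'.1 - p.1 ≠ 0)
  rw [line, mul_div_assoc, div_self this]; ring

theorem line_eq_slope (p p' : ℤ × ℚ) (t : ℤ) :
    line p p' t = p.2 + (p'.2 - p.2) / ((p'.1 - p.1 : ℤ) : ℚ) * (t - p.1) := by
  unfold line; push_cast; ring

/-- An affine function is determined by its values at two points. -/
theorem line_eq_of_affine {p p' : ℤ × ℚ} (h : p.1 < p'.1) {y s : ℚ} (h1 : p.2 = y + s * p.1)
    (h2 : p'.2 = y + s * p'.1) (t : ℤ) : line p p' t = y + s * t := by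
  have h0 : ((p'.1 : ℚ) - p.1) ≠ 0 := sub_ne_zero.2 (by exact_mod_cast h.ne')
  rw [line_eq_slope, h1, h2]
  push_cast
  field_simp
  ring

/-- The function `h` is finite and affine on the three integers around `t`. -/
def AffineAt (h : ℤ → WithTop ℚ) (t : ℤ) : Prop :=
  ∃ y s : ℚ, h (t - 1) = (y - s : ℚ) ∧ h t = y ∧ h (t + 1) = (y + s : ℚ)

/-- The function `h` is finite and affine from the breakpoint `p` to the breakpoint `p'`. -/
def Seg (h : ℤ → WithTop ℚ) (p p' : ℤ × ℚ) : Prop :=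
  p.1 < p'.1 ∧ ∀ t, p.1 ≤ t → t ≤ p'.1 → h t = line p p' t

theorem Seg.right {h : ℤ → WithTop ℚ} {p p' : ℤ × ℚ} (H : Seg h p p') : h p'.1 = p'.2 := by
  rw [H.2 _ H.1.le le_rfl, line_right H.1]

theorem Seg.affineAt {h : ℤ → WithTop ℚ} {p p' : ℤ × ℚ} (H : Seg h p p') {t : ℤ} (h1 : p.1 < t)
    (h2 : t < p'.1) : AffineAt h t := by
  refine ⟨line p p' t, (p'.2 - p.2) / ((p'.1 - p.1 : ℤ) : ℚ), ?_, H.2 _ h1.le h2.le, ?_⟩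
  · rw [H.2 _ (by omega) (by omega)]; congr 1; rw [line_eq_slope, line_eq_slope]; push_cast; ring
  · rw [H.2 _ (by omega) (by omega)]; congr 1; rw [line_eq_slope, line_eq_slope]; push_cast; ring

theorem seg_of_affine {h : ℤ → WithTop ℚ} {p p' : ℤ × ℚ} (hp : p.1 < p'.1) {y s : ℚ}
    (H : ∀ t, p.1 ≤ t → t ≤ p'.1 → h t = (y + s * t : ℚ)) (h1 : h p.1 = p.2) (h2 : h p'.1 = p'.2) :
    Seg h p p' := by
  refine ⟨hp, fun t ht ht' => ?_⟩
  rw [H t ht ht', line_eq_of_affine hp (y := y) (s := s)]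
  · rw [H _ le_rfl hp.le] at h1; exact_mod_cast h1.symm
  · rw [H _ hp.le le_rfl] at h2; exact_mod_cast h2.symm

theorem seg_of_succ {h : ℤ → WithTop ℚ} {p p' : ℤ × ℚ} (hp : p'.1 = p.1 + 1)
    (h1 : h p.1 = p.2) (h2 : h p'.1 = p'.2) : Seg h p p' := by
  refine ⟨by omega, fun t ht ht' => ?_⟩
  rcases (by omega : t = p.1 ∨ t = p'.1) with rfl | rfl
  · rw [line_left, h1]
  · rw [line_right (by omega), h2]

/-- A function without kinks between two points of its domain is affine there. -/
theorem affine_of_affineAt {h : ℤ → WithTop ℚ} {a b : ℤ} (hab : a < b)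
    (ha : h a ≠ ⊤) (ha' : h (a + 1) ≠ ⊤) (H : ∀ t, a < t → t < b → AffineAt h t) :
    ∃ y s : ℚ, ∀ t, a ≤ t → t ≤ b → h t = (y + s * t : ℚ) := by
  obtain ⟨y0, hy0⟩ := WithTop.ne_top_iff_exists.1 ha
  obtain ⟨y1, hy1⟩ := WithTop.ne_top_iff_exists.1 ha'
  refine ⟨y0 - (y1 - y0) * a, y1 - y0, fun t ht ht' => ?_⟩
  have key : ∀ k : ℕ, a + k + 1 ≤ b → h (a + k) = (y0 + (y1 - y0) * k : ℚ) ∧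
      h (a + k + 1) = (y0 + (y1 - y0) * (k + 1) : ℚ) := by
    intro k
    induction k with
    | zero => intro _; simp [← hy0, ← hy1]
    | succ k ih =>
      intro hk
      push_cast at hk
      obtain ⟨h1, h2⟩ := ih (by omega)
      obtain ⟨y, s, e1, e2, e3⟩ := H (a + k + 1) (by omega) (by omega)
      rw [show a + k + 1 - 1 = a + k by ring, h1] at e1
      rw [h2] at e2
      have e1' := WithTop.coe_injective e1
      have e2' := WithTop.coe_injective e2
      simp only [Nat.cast_succ]
      refine ⟨by rw [← add_assoc, h2], ?_⟩
      rw [← add_assoc, e3]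
      congr 1
      linarith
  obtain ⟨k, rfl⟩ := Int.le.dest ht
  by_cases hk : a + k + 1 ≤ b
  · rw [(key k hk).1]; congr 1; push_cast; ring
  · rcases k with _ | k
    · rw [Nat.cast_zero, add_zero] at *; omega
    · have := (key k (by push_cast at ht'; omega)).2
      push_cast
      rw [← add_assoc, this]; congr 1; ring

/-! ### Profiles that represent functions -/

/-- The profile `f` represents the function `h`. -/
structure Repr (f : Profile) (h : ℤ → WithTop ℚ) : Prop where
  chain : f.IsChain (Seg h)
  val : ∀ p ∈ f, h p.1 = p.2
  dom : ∀ t, h t ≠ ⊤ → ∃ p ∈ f, ∃ p' ∈ f, p.1 ≤ t ∧ t ≤ p'.1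

theorem Repr.pairwise {f : Profile} {h : ℤ → WithTop ℚ} (H : f.IsChain (Seg h)) :
    f.Pairwise fun p p' => p.1 < p'.1 := by
  have : IsTrans (ℤ × ℚ) fun p p' => p.1 < p'.1 := ⟨fun _ _ _ h1 h2 => lt_trans h1 h2⟩
  rw [← List.isChain_iff_pairwise]
  exact H.imp fun _ _ h => h.1

theorem toFun_eq_of_chain {h : ℤ → WithTop ℚ} (p : ℤ × ℚ) (f : Profile)
    (hc : (p :: f).IsChain (Seg h)) (hv : h p.1 = p.2) {t : ℤ} (ht : p.1 ≤ t)
    (hd : h t ≠ ⊤ → ∃ p' ∈ p :: f, t ≤ p'.1) : (evalAt (p :: f) t).val = h t := by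
  induction f generalizing p with
  | nil =>
    simp only [evalAt, Timed.val_bind, eqZ_val, Timed.val_ite, Timed.val_pure, decide_eq_true_eq]
    split
    · rename_i h'; rw [h', hv]
    · rename_i h'
      by_contra hne
      obtain ⟨p', hp', h''⟩ := hd (Ne.symm hne)
      rw [List.mem_singleton] at hp'
      subst hp'; omega
  | cons p' f ih =>
    rw [List.isChain_cons_cons] at hc
    simp only [evalAt, Timed.val_bind, ltZ_val, Timed.val_ite, Timed.val_pure, decide_eq_true_eq,
      interpolate_val]
    rw [if_neg (by omega)]
    split
    · rename_i h'; rw [hc.1.2 t ht h'.le]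
    · refine ih p' hc.2 hc.1.right (by omega) fun h' => ?_
      obtain ⟨p'', hp'', h''⟩ := hd h'
      rcases List.mem_cons.1 hp'' with rfl | hp''
      · exact ⟨p', List.mem_cons_self, by have := hc.1.1; omega⟩
      · exact ⟨p'', hp'', h''⟩

theorem Repr.evalAt_val {f : Profile} {h : ℤ → WithTop ℚ} (H : Repr f h) (t : ℤ) :
    (evalAt f t).val = h t := by
  rcases f with _ | ⟨p, f⟩
  · by_contra hne
    obtain ⟨p, hp, -⟩ := H.dom t (Ne.symm hne)
    simp at hp
  · by_cases ht : p.1 ≤ t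
    · refine toFun_eq_of_chain p f H.chain (H.val p List.mem_cons_self) ht fun h' => ?_
      obtain ⟨-, -, p', hp', -, h''⟩ := H.dom t h'
      exact ⟨p', hp', h''⟩
    · have : h t = ⊤ := by
        by_contra hne
        obtain ⟨p', hp', -, -, h1, -⟩ := H.dom t hne
        have := List.pairwise_cons.1 (Repr.pairwise H.chain)
        rcases List.mem_cons.1 hp' with rfl | hp'
        · omega
        · have := this.1 p' hp'; omega
      rw [this]
      rcases f with _ | ⟨p', f⟩
      · simp only [evalAt, Timed.val_bind, eqZ_val, Timed.val_ite, Timed.val_pure,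
          decide_eq_true_eq]
        rw [if_neg (by omega)]
      · simp only [evalAt, Timed.val_bind, ltZ_val, Timed.val_ite, Timed.val_pure,
          decide_eq_true_eq]
        rw [if_pos (by omega)]

theorem Repr.toFun_eq {f : Profile} {h : ℤ → WithTop ℚ} (H : Repr f h) : f.toFun = h :=
  funext H.evalAt_val

theorem Repr.nil {h : ℤ → WithTop ℚ} (H : ∀ t, h t = ⊤) : Repr [] h :=
  ⟨List.isChain_nil, by simp, fun t ht => absurd (H t) ht⟩

theorem affineAt_of_chain {h : ℤ → WithTop ℚ} (p : ℤ × ℚ) (f : Profile)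
    (hc : (p :: f).IsChain (Seg h)) {t : ℤ} (ht : p.1 ≤ t) (hd : ∃ p' ∈ p :: f, t ≤ p'.1)
    (hn : t ∉ (p :: f).map Prod.fst) : AffineAt h t := by
  induction f generalizing p with
  | nil =>
    obtain ⟨p', hp', h'⟩ := hd
    simp at hp' hn; subst hp'; omega
  | cons p' f ih =>
    rw [List.isChain_cons_cons] at hc
    rw [List.map_cons, List.mem_cons, not_or] at hn
    rcases lt_or_ge t p'.1 with h' | h'
    · exact hc.1.affineAt (by omega) h'
    · refine ih p' hc.2 h' ?_ hn.2
      obtain ⟨p'', hp'', h''⟩ := hd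
      rcases List.mem_cons.1 hp'' with rfl | hp''
      · exact ⟨p', List.mem_cons_self, by omega⟩
      · exact ⟨p'', hp'', h''⟩

/-- Every kink of the function is a breakpoint of the profile. -/
theorem Repr.affineAt {f : Profile} {h : ℤ → WithTop ℚ} (H : Repr f h) {t : ℤ} (ht : h t ≠ ⊤)
    (hn : t ∉ f.map Prod.fst) : AffineAt h t := by
  obtain ⟨p, hp, p', hp', h1, h2⟩ := H.dom t ht
  rcases f with _ | ⟨p0, f⟩
  · simp at hp
  · refine affineAt_of_chain p0 f H.chain ?_ ⟨p', hp', h2⟩ hn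
    rcases List.mem_cons.1 hp with rfl | hp
    · exact h1
    · have := (List.pairwise_cons.1 (Repr.pairwise H.chain)).1 p hp; omega

/-- A sorted list of points on the graph of a function with a bounded, convex domain that contains
all kinks of the function represents it. -/
theorem repr_of_kinks {f : Profile} {h : ℤ → WithTop ℚ} (hs : f.Pairwise fun p p' => p.1 < p'.1)
    (hv : ∀ p ∈ f, h p.1 = p.2) {lo hi : ℤ} (hb : ∀ t, h t ≠ ⊤ → lo ≤ t ∧ t ≤ hi)
    (hconv : ∀ t t' t'', h t ≠ ⊤ → h t'' ≠ ⊤ → t ≤ t' → t' ≤ t'' → h t' ≠ ⊤)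
    (hk : ∀ t, h t ≠ ⊤ → t ∉ f.map Prod.fst → AffineAt h t) : Repr f h := by
  refine ⟨?_, hv, ?_⟩
  · rw [List.isChain_iff_forall_rel_of_append_cons_cons]
    rintro p p' l₁ l₂ rfl
    have hs' := List.pairwise_append.1 hs
    have hs2 := List.pairwise_cons.1 hs'.2.1
    have hs3 := List.pairwise_cons.1 hs2.2
    have hlt := hs2.1 p' List.mem_cons_self
    have e1 := hv p (by simp)
    have e2 := hv p' (by simp)
    have f1 : h p.1 ≠ ⊤ := by rw [e1]; exact WithTop.coe_ne_top
    have f2 : h p'.1 ≠ ⊤ := by rw [e2]; exact WithTop.coe_ne_top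
    obtain ⟨y, s, H⟩ := affine_of_affineAt hlt f1 (hconv _ _ _ f1 f2 (by omega) (by omega))
      fun t h1 h2 => by
        refine hk t (hconv _ _ _ f1 f2 h1.le h2.le) fun hmem => ?_
        obtain ⟨q, hq, rfl⟩ := List.mem_map.1 hmem
        rcases List.mem_append.1 hq with hq | hq
        · have := hs'.2.2 q hq p List.mem_cons_self; omega
        · rcases List.mem_cons.1 hq with rfl | hq
          · omega
          · rcases List.mem_cons.1 hq with rfl | hq
            · omega
            · have := hs3.1 q hq; omega
    exact seg_of_affine hlt H e1 e2
  · intro t ht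
    -- walking away from `t` within the domain, one meets a breakpoint
    have left : ∀ k : ℕ, ∀ t, h t ≠ ⊤ → t < lo + k → ∃ p ∈ f, p.1 ≤ t := by
      intro k
      induction k with
      | zero => intro t ht h'; have := hb t ht; simp at h'; omega
      | succ k ih =>
        intro t ht h'
        by_cases hmem : t ∈ f.map Prod.fst
        · obtain ⟨q, hq, rfl⟩ := List.mem_map.1 hmem
          exact ⟨q, hq, le_rfl⟩
        · obtain ⟨y, s, h1, -⟩ := hk t ht hmem
          obtain ⟨q, hq, h2⟩ := ih (t - 1) (by rw [h1]; exact WithTop.coe_ne_top)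
            (by push_cast at h'; omega)
          exact ⟨q, hq, by omega⟩
    have right : ∀ k : ℕ, ∀ t, h t ≠ ⊤ → hi - k < t → ∃ p ∈ f, t ≤ p.1 := by
      intro k
      induction k with
      | zero => intro t ht h'; have := hb t ht; simp at h'; omega
      | succ k ih =>
        intro t ht h'
        by_cases hmem : t ∈ f.map Prod.fst
        · obtain ⟨q, hq, rfl⟩ := List.mem_map.1 hmem
          exact ⟨q, hq, le_rfl⟩
        · obtain ⟨y, s, -, -, h1⟩ := hk t ht hmem
          obtain ⟨q, hq, h2⟩ := ih (t + 1) (by rw [h1]; exact WithTop.coe_ne_top)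
            (by push_cast at h'; omega)
          exact ⟨q, hq, by omega⟩
    obtain ⟨p, hp, h1⟩ := left (t - lo + 1).toNat t ht (by omega)
    obtain ⟨p', hp', h2⟩ := right (hi - t + 1).toNat t ht (by omega)
    exact ⟨p, hp, p', hp', h1, h2⟩

/-! ### Pruning -/

/-- No inner breakpoint lies on the line between its neighbours. -/
def IsPruned : Profile → Prop
  | p :: p' :: p'' :: f => line p p'' p'.1 ≠ p'.2 ∧ IsPruned (p' :: p'' :: f)
  | _ => True

/-- An inner breakpoint on the line between its neighbours can be omitted. -/
theorem Seg.trans {h : ℤ → WithTop ℚ} {p p' p'' : ℤ × ℚ} (h1 : Seg h p p') (h2 : Seg h p' p'')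
    (hl : line p p'' p'.1 = p'.2) : Seg h p p'' := by
  have hlt1 := h1.1
  have hlt2 := h2.1
  refine ⟨by omega, fun t ht ht' => ?_⟩
  obtain ⟨y, s, e⟩ : ∃ y s : ℚ, ∀ t, line p p'' t = y + s * t := by
    refine ⟨p.2 - (p''.2 - p.2) / ((p''.1 - p.1 : ℤ) : ℚ) * p.1,
      (p''.2 - p.2) / ((p''.1 - p.1 : ℤ) : ℚ), fun t => ?_⟩
    rw [line_eq_slope]; ring
  have e0 := line_left p p''
  have e2 := line_right (p := p) (p' := p'') (by omega)
  rw [e] at hl e0 e2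
  rcases le_total t p'.1 with h | h
  · rw [h1.2 t ht h, e, line_eq_of_affine h1.1 e0.symm hl.symm]
  · rw [h2.2 t h ht', e, line_eq_of_affine h2.1 hl.symm e2.symm]

/-- Pruning keeps both ends, so that the represented function keeps its domain. -/
theorem prune_sublist (f : Profile) : (prune f).val.Sublist f ∧ (prune f).val.head? = f.head? ∧
    (prune f).val.getLast? = f.getLast? := by
  induction f with
  | nil => simp [prune]
  | cons p f ih =>
    simp only [prune, Timed.val_bind]
    obtain ⟨h1, h2, h3⟩ := ih
    generalize (prune f).val = g at *
    rcases g with _ | ⟨p', _ | ⟨p'', g⟩⟩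
    · have : f = [] := by simpa using h2.symm
      subst this; simp
    · rcases f with _ | ⟨q, f⟩
      · simp at h2
      · refine ⟨h1.cons_cons _, rfl, ?_⟩
        simp only [Timed.val_pure, List.getLast?_cons_cons] at *
        exact h3
    · rcases f with _ | ⟨q, f⟩
      · simp at h2
      · simp only [Timed.val_bind, Timed.val_ite, Timed.val_pure, eqQ_val,
          interpolate_val, decide_eq_true_eq]
        split
        · refine ⟨List.Sublist.cons_cons _ ((List.sublist_cons_self _ _).trans h1), rfl, ?_⟩
          rw [List.getLast?_cons_cons] at *
          exact h3
        · refine ⟨h1.cons_cons _, rfl, ?_⟩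
          rw [List.getLast?_cons_cons] at *
          exact h3

theorem prune_chain {h : ℤ → WithTop ℚ} {f : Profile} (hf : f.IsChain (Seg h)) :
    (prune f).val.IsChain (Seg h) := by
  induction f with
  | nil => simp [prune]
  | cons p f ih =>
    have hc := ih hf.tail
    have hh := (prune_sublist f).2.1
    simp only [prune, Timed.val_bind]
    generalize (prune f).val = g at *
    rcases g with _ | ⟨p', _ | ⟨p'', g⟩⟩
    · simp
    · rcases f with _ | ⟨q, f⟩
      · simp at hh
      · simp at hh; subst hh
        rw [List.isChain_cons_cons] at hf
        simpa using hf.1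
    · rcases f with _ | ⟨q, f⟩
      · simp at hh
      · simp at hh; subst hh
        rw [List.isChain_cons_cons] at hf hc
        simp only [Timed.val_bind, Timed.val_ite, Timed.val_pure, eqQ_val, interpolate_val,
          decide_eq_true_eq]
        split
        · rename_i hl
          exact List.isChain_cons_cons.2 ⟨hf.1.trans hc.1 hl, hc.2⟩
        · exact List.isChain_cons_cons.2 ⟨hf.1, List.isChain_cons_cons.2 hc⟩

/-- Omitting a breakpoint between `p` and `p''` does not change the line on which `p''` is
approached, hence `p''` is still needed if it was before. -/
theorem prune_isPruned {h : ℤ → WithTop ℚ} {f : Profile} (hf : f.IsChain (Seg h)) :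
    IsPruned (prune f).val := by
  induction f with
  | nil => simp [prune, IsPruned]
  | cons p f ih =>
    have hp := ih hf.tail
    have hc := prune_chain hf.tail
    have hh := (prune_sublist f).2.1
    simp only [prune, Timed.val_bind]
    rw [List.tail_cons] at hc
    generalize (prune f).val = g at *
    rcases g with _ | ⟨p', _ | ⟨p'', g⟩⟩
    · simp [IsPruned]
    · simp [IsPruned]
    · rcases f with _ | ⟨q, f⟩
      · simp at hh
      · simp at hh; subst hh
        rw [List.isChain_cons_cons] at hf hc
        simp only [Timed.val_bind, Timed.val_ite, Timed.val_pure, eqQ_val, interpolate_val,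
          decide_eq_true_eq]
        split
        · rename_i hl
          rcases g with _ | ⟨q, g⟩
          · trivial
          · refine ⟨fun hl' => hp.1 ?_, hp.2⟩
            have c1 := hf.1.1
            have c2 := hc.1.1
            have c3 := (List.isChain_cons_cons.1 hc.2).1.1
            -- the points `p, p', p''` and `p, p'', q` are collinear, hence so are `p', p'', q`
            have e := line_eq_slope p q
            have e0 := line_left p q
            have e1 := line_right (p := p) (p' := q) (by omega)
            set s := (q.2 - p.2) / ((q.1 - p.1 : ℤ) : ℚ)
            have e' : ∀ t, line p q t = (p.2 - s * p.1) + s * t := fun t => by rw [e]; ring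
            rw [e'] at e0 e1 hl'
            have := line_eq_of_affine (p := p) (p' := p'') (by omega) e0.symm hl'.symm p'.1
            rw [hl] at this
            rw [line_eq_of_affine (by omega) this e1.symm, hl']
        · rename_i hl
          exact ⟨hl, hp⟩

theorem Repr.prune {f : Profile} {h : ℤ → WithTop ℚ} (H : Repr f h) : Repr (prune f).val h := by
  obtain ⟨h1, h2, h3⟩ := prune_sublist f
  refine ⟨prune_chain H.chain, fun p hp => H.val p (h1.subset hp), fun t ht => ?_⟩
  obtain ⟨p, hp, p', hp', hpt, hpt'⟩ := H.dom t ht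
  have hne : f ≠ [] := List.ne_nil_of_mem hp
  have hs := Repr.pairwise H.chain
  refine ⟨f.head hne, ?_, f.getLast hne, ?_, ?_, ?_⟩
  · exact List.mem_of_mem_head? (by rw [h2]; exact List.head?_eq_some_head hne)
  · exact List.mem_of_mem_getLast? (by rw [h3]; exact List.getLast?_eq_some_getLast hne)
  · rcases f with _ | ⟨q, f⟩
    · exact absurd rfl hne
    · rcases List.mem_cons.1 hp with rfl | hp
      · exact hpt
      · have := (List.pairwise_cons.1 hs).1 p hp
        simp only [List.head_cons]; omega
  · rw [← List.dropLast_append_getLast hne] at hp' hs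
    rcases List.mem_append.1 hp' with hp' | hp'
    · have := (List.pairwise_append.1 hs).2.2 p' hp' _ (List.mem_singleton_self _)
      omega
    · rw [List.mem_singleton] at hp'
      rw [← hp']; exact hpt'

theorem not_affineAt_of_line_ne {h : ℤ → WithTop ℚ} {p p' p'' : ℤ × ℚ} (h1 : Seg h p p')
    (h2 : Seg h p' p'') (hl : line p p'' p'.1 ≠ p'.2) : ¬ AffineAt h p'.1 := by
  rintro ⟨y, s, e1, e2, e3⟩
  have l1 := h1.1
  have l2 := h2.1
  apply hl
  rw [h1.2 _ (by omega) (by omega)] at e1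
  rw [h1.right] at e2
  rw [h2.2 _ (by omega) (by omega)] at e3
  have e1' := WithTop.coe_injective e1
  have e2' := WithTop.coe_injective e2
  have e3' := WithTop.coe_injective e3
  have d1 : ((p'.1 : ℚ) - p.1) ≠ 0 := sub_ne_zero.2 (by exact_mod_cast l1.ne')
  have d2 : ((p''.1 : ℚ) - p'.1) ≠ 0 := sub_ne_zero.2 (by exact_mod_cast l2.ne')
  have s1 : (p'.2 - p.2) = s * (p'.1 - p.1) := by
    have r := line_right l1
    rw [line_eq_slope] at e1' r
    have : (p'.2 - p.2) / ((p'.1 - p.1 : ℤ) : ℚ) = s := by push_cast at e1' r ⊢; linarith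
    rw [← this]; push_cast; field_simp
  have s2 : (p''.2 - p'.2) = s * (p''.1 - p'.1) := by
    have r := line_left p' p''
    rw [line_eq_slope] at e3' r
    have : (p''.2 - p'.2) / ((p''.1 - p'.1 : ℤ) : ℚ) = s := by push_cast at e3' r ⊢; linarith
    rw [← this]; push_cast; field_simp
  rw [line_eq_of_affine (y := p.2 - s * p.1) (s := s) (by omega) (by ring) (by linarith)]
  linarith

/-- The breakpoints of a pruned profile are the kinks of the function that it represents. -/
theorem not_affineAt_of_isPruned {h : ℤ → WithTop ℚ} (p p' : ℤ × ℚ) (f : Profile)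
    (hc : (p :: p' :: f).IsChain (Seg h)) (hp : IsPruned (p :: p' :: f))
    (hd : ∀ t, h t ≠ ⊤ → ∃ q ∈ p :: p' :: f, t ≤ q.1) :
    ∀ q ∈ p' :: f, ¬ AffineAt h q.1 := by
  induction f generalizing p p' with
  | nil =>
    intro q hq
    rw [List.mem_singleton] at hq; subst hq
    rintro ⟨y, s, -, -, e⟩
    obtain ⟨r, hr, hr'⟩ := hd (q.1 + 1) (by rw [e]; exact WithTop.coe_ne_top)
    rw [List.isChain_cons_cons] at hc
    have := hc.1.1
    simp at hr
    rcases hr with rfl | rfl <;> omega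
  | cons p'' f ih =>
    intro q hq
    rw [List.isChain_cons_cons] at hc
    rcases List.mem_cons.1 hq with rfl | hq
    · exact not_affineAt_of_line_ne hc.1 (List.isChain_cons_cons.1 hc.2).1 hp.1
    · refine ih p' p'' hc.2 hp.2 (fun t ht => ?_) q hq
      obtain ⟨r, hr, hr'⟩ := hd t ht
      rcases List.mem_cons.1 hr with rfl | hr
      · exact ⟨p', List.mem_cons_self, by have := hc.1.1; omega⟩
      · exact ⟨r, hr, hr'⟩

/-- In a pruned profile with more than one breakpoint, each breakpoint but the first one is a place
where the represented function is not affine. -/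
theorem Repr.length_le {f : Profile} {h : ℤ → WithTop ℚ} (H : Repr f h) (hp : IsPruned f)
    {K : Finset ℤ} (hK : ∀ t, h t ≠ ⊤ → ¬ AffineAt h t → t ∈ K) : f.length ≤ K.card + 1 := by
  rcases f with _ | ⟨p, _ | ⟨p', f⟩⟩
  · simp
  · simp
  · have hs := (List.pairwise_cons.1 (Repr.pairwise H.chain)).2
    have hnd : ((p' :: f).map Prod.fst).Nodup := by
      rw [List.Nodup, List.pairwise_map]
      exact hs.imp fun h => ne_of_lt h
    have hsub : ((p' :: f).map Prod.fst).toFinset ⊆ K := by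
      intro t ht
      rw [List.mem_toFinset] at ht
      obtain ⟨q, hq, rfl⟩ := List.mem_map.1 ht
      refine hK _ ?_ (not_affineAt_of_isPruned p p' f H.chain hp (fun t ht => ?_) q hq)
      · rw [H.val q (List.mem_cons_of_mem _ hq)]; exact WithTop.coe_ne_top
      · obtain ⟨-, -, r, hr, -, h'⟩ := H.dom t ht
        exact ⟨r, hr, h'⟩
    have := Finset.card_le_card hsub
    rw [List.toFinset_card_of_nodup hnd] at this
    simp only [List.length_map, List.length_cons] at *
    omega

/-! ### Lists of times -/

theorem mem_insertTime {t x : ℤ} {l : List ℤ} : x ∈ (insertTime t l).val ↔ x = t ∨ x ∈ l := by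
  induction l with
  | nil => simp [insertTime]
  | cons k l ih =>
    simp only [insertTime, Timed.val_bind, ltZ_val, eqZ_val, Timed.val_ite, Timed.val_pure,
      decide_eq_true_eq]
    split
    · simp
    · split
      · rename_i h; subst h; simp
      · simp only [List.mem_cons, ih]; tauto

theorem insertTime_sorted {t : ℤ} {l : List ℤ} (h : l.Pairwise (· < ·)) :
    (insertTime t l).val.Pairwise (· < ·) := by
  induction l with
  | nil => simp [insertTime]
  | cons k l ih =>
    have h' := List.pairwise_cons.1 h
    simp only [insertTime, Timed.val_bind, ltZ_val, eqZ_val, Timed.val_ite, Timed.val_pure,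
      decide_eq_true_eq]
    split
    · rename_i hlt
      refine List.pairwise_cons.2 ⟨fun x hx => ?_, h⟩
      rcases List.mem_cons.1 hx with rfl | hx
      · exact hlt
      · exact hlt.trans (h'.1 x hx)
    · split
      · exact h
      · refine List.pairwise_cons.2 ⟨fun x hx => ?_, ih h'.2⟩
        rcases mem_insertTime.1 hx with rfl | hx
        · omega
        · exact h'.1 x hx

theorem mem_sortTimes {lo hi x : ℤ} {l : List ℤ} :
    x ∈ (sortTimes lo hi l).val ↔ x ∈ l ∧ lo ≤ x ∧ x ≤ hi := by
  induction l with
  | nil => simp [sortTimes]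
  | cons k l ih =>
    simp only [sortTimes, Timed.val_bind, ltZ_val, Timed.val_ite, Timed.val_pure,
      decide_eq_true_eq]
    split
    · rw [ih, List.mem_cons]
      constructor
      · tauto
      · rintro ⟨rfl | h, h1, h2⟩
        · omega
        · exact ⟨h, h1, h2⟩
    · split
      · rw [ih, List.mem_cons]
        constructor
        · tauto
        · rintro ⟨rfl | h, h1, h2⟩
          · omega
          · exact ⟨h, h1, h2⟩
      · rw [mem_insertTime, ih, List.mem_cons]
        constructor
        · rintro (rfl | h)
          · exact ⟨Or.inl rfl, by omega, by omega⟩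
          · exact ⟨Or.inr h.1, h.2⟩
        · tauto

theorem sortTimes_sorted (lo hi : ℤ) (l : List ℤ) : (sortTimes lo hi l).val.Pairwise (· < ·) := by
  induction l with
  | nil => simp [sortTimes]
  | cons k l ih =>
    simp only [sortTimes, Timed.val_bind, ltZ_val, Timed.val_ite, Timed.val_pure,
      decide_eq_true_eq]
    split
    · exact ih
    · split
      · exact ih
      · exact insertTime_sorted ih

theorem mem_arrivals {bans : List (ℤ × ℤ)} {drive tvisit : ℤ} {l : List ℤ} {k : ℤ} (hk : k ∈ l)
    (hv : tvisit ≤ k) :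
    (earliestArrival bans drive k).val ∈ (arrivals bans drive tvisit l).val := by
  induction l with
  | nil => simp at hk
  | cons t l ih =>
    simp only [arrivals, Timed.val_bind, ltZ_val, Timed.val_ite, Timed.val_pure,
      decide_eq_true_eq]
    rcases List.mem_cons.1 hk with rfl | hk
    · rw [if_neg (by omega)]; exact List.mem_cons_self
    · split
      · exact ih hk
      · exact List.mem_cons_of_mem _ (ih hk)

theorem mem_banTimes {bans : List (ℤ × ℤ)} {drive : ℤ} {l : List (ℤ × ℤ)} {I : ℤ × ℤ}
    (hI : I ∈ l) : I.1 ∈ (banTimes bans drive l).val ∧ I.2 ∈ (banTimes bans drive l).val ∧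
      (earliestArrival bans drive I.2).val - 1 ∈ (banTimes bans drive l).val ∧
      (earliestArrival bans drive I.2).val ∈ (banTimes bans drive l).val := by
  induction l with
  | nil => simp at hI
  | cons J l ih =>
    simp only [banTimes, Timed.val_bind, subZ_val, Timed.val_pure]
    rcases List.mem_cons.1 hI with rfl | hI
    · simp
    · obtain ⟨h1, h2, h3, h4⟩ := ih hI
      simp only [List.mem_cons]; tauto

/-! ### Linking -/

/-- The set of times with finite value is an interval that ends at `tmax`, and it begins at `tmin`
or later. -/
structure UpTo (tmin tmax : ℤ) (f : ℤ → WithTop ℚ) : Prop where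
  bdd : ∀ t, f t ≠ ⊤ → tmin ≤ t ∧ t ≤ tmax
  up : ∀ t t', f t ≠ ⊤ → t ≤ t' → t' ≤ tmax → f t' ≠ ⊤

theorem UpTo.conv {tmin tmax : ℤ} {f : ℤ → WithTop ℚ} (H : UpTo tmin tmax f) (t t' t'' : ℤ)
    (h : f t ≠ ⊤) (h'' : f t'' ≠ ⊤) (h1 : t ≤ t') (h2 : t' ≤ t'') : f t' ≠ ⊤ :=
  H.up t t' h h1 (h2.trans (H.bdd _ h'').2)

/-- The profile `f` linked with the edge `e`, if driving and waiting on edges cost the same. -/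
def linkFun (G : RoadGraph) (e : Fin G.n × Fin G.n) (tvisit tmax : ℤ) (f : ℤ → WithTop ℚ)
    (t : ℤ) : WithTop ℚ :=
  if tvisit ≤ lastDep G e t ∧ t ≤ tmax
  then f (lastDep G e t) + ((G.c 0 * (t - lastDep G e t) : ℚ) : WithTop ℚ) else ⊤

section Link

variable {G : RoadGraph} {e : Fin G.n × Fin G.n}

/-- If driving and waiting on edges cost the same, only the total time on the edge matters, and the
time of the visit bounds the departure from below. -/
theorem absLink_eq (q : Query G) (hd : G.d = G.c 0) (he : e ∈ G.E) (tvisit : ℤ)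
    (f : ℤ → WithTop ℚ) : absLink G q e tvisit f = linkFun G e tvisit q.tmax f := by
  funext t
  have hlt := (lastDep_spec he t).1
  have h1 : ((t - lastDep G e t).toNat : ℤ) = t - lastDep G e t := by omega
  unfold absLink linkFun
  rw [travelTime_eq he]
  have h2 : (((t - lastDep G e t).toNat : ℕ) : ℚ) = t - lastDep G e t := by exact_mod_cast h1
  simp only [h1, hd, h2]
  rw [show t - (t - lastDep G e t) = lastDep G e t by ring]
  refine if_congr (by omega) ?_ rfl
  congr 2
  ring

theorem linkFun_upTo (he : e ∈ G.E) {tmin tmax tvisit : ℤ} {f : ℤ → WithTop ℚ}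
    (hf : UpTo tmin tmax f) : UpTo tmin tmax (linkFun G e tvisit tmax f) := by
  refine ⟨fun t ht => ?_, fun t t' ht h1 h2 => ?_⟩
  · unfold linkFun at ht
    split at ht
    · rename_i h
      have := hf.bdd (lastDep G e t) fun h' => ht (by rw [h', WithTop.top_add])
      have := (lastDep_spec he t).1
      omega
    · exact absurd rfl ht
  · unfold linkFun at ht ⊢
    split at ht
    · rename_i h
      have hm := lastDep_mono he h1
      have := (lastDep_spec he t').1
      rw [if_pos ⟨by omega, h2⟩]
      have := hf.up _ _ (fun h' => ht (by rw [h', WithTop.top_add])) hm (by omega)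
      rw [WithTop.add_ne_top]
      exact ⟨this, WithTop.coe_ne_top⟩
    · exact absurd rfl ht

theorem map_fst_linkAt_sublist (mirrored : List (ℤ × ℤ)) (drive : ℤ) (d c₀ : ℚ) (f : Profile)
    (l : List ℤ) : ((linkAt mirrored drive d c₀ f l).val.map Prod.fst).Sublist l := by
  induction l with
  | nil => simp [linkAt]
  | cons t l ih =>
    simp only [linkAt, Timed.val_bind]
    split
    · exact ih.trans (List.sublist_cons_self _ _)
    · exact ih.cons_cons _

theorem mem_linkAt {mirrored : List (ℤ × ℤ)} {drive : ℤ} {d c₀ : ℚ} {f : Profile}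
    {l : List ℤ} {p : ℤ × ℚ} : p ∈ (linkAt mirrored drive d c₀ f l).val ↔ p.1 ∈ l ∧
      (evalAt f (latestDeparture mirrored drive p.1).val).val +
        ((d * drive + c₀ * ((p.1 - (latestDeparture mirrored drive p.1).val - drive : ℤ) : ℚ) : ℚ) :
          WithTop ℚ) = p.2 := by
  induction l with
  | nil => simp [linkAt]
  | cons t l ih =>
    simp only [linkAt, Timed.val_bind, subZ_val, toQ_val, mulQ_val, addQ_val]
    split
    · rename_i h
      rw [Timed.val_pure, ih, List.mem_cons]
      constructor
      · tauto
      · rintro ⟨h1 | h1, h2⟩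
        · rw [h1, show (evalAt f _).val = ⊤ from h, WithTop.top_add] at h2
          exact absurd h2 WithTop.top_ne_coe
        · exact ⟨h1, h2⟩
    · rename_i y h
      simp only [Timed.val_bind, addQ_val, Timed.val_pure, List.mem_cons, ih]
      constructor
      · rintro (rfl | h1)
        · refine ⟨Or.inl rfl, ?_⟩
          rw [h]; rfl
        · exact ⟨Or.inr h1.1, h1.2⟩
      · rintro ⟨h1 | h1, h2⟩
        · left
          subst h1
          rw [h] at h2
          have h3 := WithTop.coe_injective h2
          exact Prod.ext rfl h3.symm
        · exact Or.inr ⟨h1, h2⟩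

/-- Kinks of a linked profile come from kinks of the given profile, from ban intervals, or from the
ends of the relevant time interval. -/
theorem linkFun_affineAt (he : e ∈ G.E) {tmax tvisit : ℤ} {f : ℤ → WithTop ℚ} {t : ℤ}
    (ht : linkFun G e tvisit tmax f t ≠ ⊤)
    (h1 : t ≠ firstArr G e tvisit) (h2 : t ≠ tmax)
    (h3 : ∀ I ∈ G.Φ e, t ≠ I.1 ∧ t ≠ I.2 ∧ t ≠ firstArr G e I.2 - 1 ∧ t ≠ firstArr G e I.2)
    (h4 : AffineAt f (lastDep G e t) ∨ t ≠ firstArr G e (lastDep G e t)) :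
    AffineAt (linkFun G e tvisit tmax f) t := by
  have hb := G.bans e he
  have hδ := G.δ_pos e he
  obtain ⟨l1, l2, l3⟩ := lastDep_spec he t
  unfold linkFun at ht
  split at ht
  swap
  · exact absurd rfl ht
  rename_i hv
  have hfin : f (lastDep G e t) ≠ ⊤ := fun h' => ht (by rw [h', WithTop.top_add])
  have hv' : tvisit ≤ lastDep G e (t - 1) := by
    rw [← firstArr_le_iff he]
    have := (firstArr_le_iff he).2 hv.1
    omega
  have hm := lastDep_mono he (show t ≤ t + 1 by omega)
  have e1 : linkFun G e tvisit tmax f (t - 1) = f (lastDep G e (t - 1)) +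
      ((G.c 0 * ((t - 1 : ℤ) - lastDep G e (t - 1)) : ℚ) : WithTop ℚ) := if_pos ⟨hv', by omega⟩
  have e2 : linkFun G e tvisit tmax f t = f (lastDep G e t) +
      ((G.c 0 * (t - lastDep G e t) : ℚ) : WithTop ℚ) := if_pos hv
  have e3 : linkFun G e tvisit tmax f (t + 1) = f (lastDep G e (t + 1)) +
      ((G.c 0 * ((t + 1 : ℤ) - lastDep G e (t + 1)) : ℚ) : WithTop ℚ) :=
    if_pos ⟨by omega, by omega⟩
  have o1 := openTime_succ hb (t - 1)
  have o2 := openTime_succ hb t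
  rw [sub_add_cancel] at o1
  have a1 := openTime_add hb.pos (show lastDep G e t ≤ t - 1 by omega) (show t - 1 ≤ t by omega)
  by_cases hc : openTime (G.Φ e) t (t + 1) = 0 ∨ openTime (G.Φ e) (t - 1) t = 0
  -- the edge is closed at time `t`
  · have hc' : openTime (G.Φ e) t (t + 1) = 0 ∧ openTime (G.Φ e) (t - 1) t = 0 := by
      rcases hc with hc | hc
      · rcases o2 with o2 | ⟨-, I, hI, i1, i2⟩
        · omega
        · have := (h3 I hI).1
          have := openTime_succ_of_mem hb hI (x := t - 1) (by omega) (by omega)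
          rw [sub_add_cancel] at this
          exact ⟨hc, this⟩
      · rcases o1 with o1 | ⟨-, I, hI, i1, i2⟩
        · omega
        · have := (h3 I hI).2.1
          exact ⟨openTime_succ_of_mem hb hI (by omega) (by omega), hc⟩
    have d1 : lastDep G e (t - 1) = lastDep G e t := by
      refine le_antisymm (lastDep_mono he (by omega)) ?_
      rw [le_lastDep_iff he]; omega
    have d2 : lastDep G e (t + 1) = lastDep G e t := by
      refine le_antisymm ?_ hm
      obtain ⟨m1, m2, m3⟩ := lastDep_spec he (t + 1)
      rw [le_lastDep_iff he]
      have := openTime_add hb.pos (show lastDep G e (t + 1) ≤ t by omega) (show t ≤ t + 1 by omega)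
      omega
    obtain ⟨y, hy⟩ := WithTop.ne_top_iff_exists.1 hfin
    refine ⟨y + G.c 0 * (t - lastDep G e t), G.c 0, ?_, ?_, ?_⟩
    · rw [e1, d1, ← hy, ← WithTop.coe_add]; congr 1; push_cast; ring
    · rw [e2, ← hy, ← WithTop.coe_add]
    · rw [e3, d2, ← hy, ← WithTop.coe_add]; congr 1; push_cast; ring
  -- the edge is open at time `t`
  · have p1 : openTime (G.Φ e) t (t + 1) = 1 := by omega
    have p2 : openTime (G.Φ e) (t - 1) t = 1 := by omega
    have hEA : firstArr G e (lastDep G e t) = t := by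
      refine le_antisymm ((firstArr_le_iff he).2 le_rfl) ?_
      by_contra hlt
      have := (firstArr_le_iff he (x := lastDep G e t) (t := t - 1)).1 (by omega)
      rw [le_lastDep_iff he] at this
      omega
    have q0 := openTime_succ hb (lastDep G e t)
    have q1 := openTime_add hb.pos (show lastDep G e t ≤ lastDep G e t + 1 by omega)
      (show lastDep G e t + 1 ≤ t by omega)
    have d1 : lastDep G e (t - 1) = lastDep G e t - 1 := by
      apply le_antisymm
      · by_contra hlt
        have := (le_lastDep_iff he (x := lastDep G e t) (t := t - 1)).1 (by omega)
        omega
      · rw [le_lastDep_iff he]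
        have q2 := openTime_add hb.pos (show lastDep G e t - 1 ≤ lastDep G e t by omega)
          (show lastDep G e t ≤ t - 1 by omega)
        rcases openTime_succ hb (lastDep G e t - 1) with h | ⟨-, I, hI, i1, i2⟩
        · rw [sub_add_cancel] at h; omega
        · exfalso
          by_cases h5 : lastDep G e t < I.2
          · have := openTime_succ_of_mem hb hI (x := lastDep G e t) (by omega) h5
            omega
          · have : lastDep G e t = I.2 := by omega
            rw [this] at hEA
            exact (h3 I hI).2.2.2 hEA.symm
    have d2 : lastDep G e (t + 1) = lastDep G e t + 1 := by
      obtain ⟨m1, m2, m3⟩ := lastDep_spec he (t + 1)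
      have q2 := openTime_add hb.pos (show lastDep G e t + 1 ≤ t by omega) (show t ≤ t + 1 by omega)
      have hge : lastDep G e t + 1 ≤ lastDep G e (t + 1) := by rw [le_lastDep_iff he]; omega
      refine le_antisymm ?_ hge
      by_contra hlt
      have q3 := openTime_add hb.pos (show lastDep G e t + 1 ≤ lastDep G e (t + 1) - 1 by omega)
        (show lastDep G e (t + 1) - 1 ≤ lastDep G e (t + 1) by omega)
      have q4 := openTime_add hb.pos hge (show lastDep G e (t + 1) ≤ t + 1 by omega)
      have q5 := openTime_add hb.pos (show lastDep G e (t + 1) ≤ lastDep G e (t + 1) + 1 by omega)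
        (show lastDep G e (t + 1) + 1 ≤ t + 1 by omega)
      have q6 := openTime_nonneg hb (show lastDep G e t + 1 ≤ lastDep G e (t + 1) - 1 by omega)
      have q8 := openTime_add hb.pos (show lastDep G e (t + 1) ≤ t by omega) (show t ≤ t + 1 by omega)
      rcases openTime_succ hb (lastDep G e (t + 1) - 1) with h | ⟨-, I, hI, i1, i2⟩
      · rw [sub_add_cancel] at h; omega
      · by_cases h5 : lastDep G e (t + 1) < I.2
        · have := openTime_succ_of_mem hb hI (x := lastDep G e (t + 1)) (by omega) h5
          omega
        · have h6 : lastDep G e (t + 1) = I.2 := by omega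
          have h7 : firstArr G e I.2 ≤ t + 1 := (firstArr_le_iff he).2 h6.ge
          have h8 : ¬ firstArr G e I.2 ≤ t := by
            rw [firstArr_le_iff he, le_lastDep_iff he, ← h6]; omega
          have := (h3 I hI).2.2.1
          omega
    rcases h4 with ⟨y, s, f1, f2, f3⟩ | h4
    swap
    · exact absurd hEA.symm h4
    refine ⟨y + G.c 0 * (t - lastDep G e t), s, ?_, ?_, ?_⟩
    · rw [e1, d1, f1, ← WithTop.coe_add]; congr 1; push_cast; ring
    · rw [e2, f2, ← WithTop.coe_add]
    · rw [e3, d2, f3, ← WithTop.coe_add]; congr 1; push_cast; ring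

/-- The times at which the link is evaluated include all possible kinks by `linkFun_affineAt`. -/
theorem link_repr (he : e ∈ G.E) (hd : G.d = G.c 0) {tmin tmax : ℤ} (tvisit : ℤ) {f : Profile}
    {h : ℤ → WithTop ℚ} (hf : Repr f h) (hu : UpTo tmin tmax h) :
    Repr (link (G.Φ e) (G.δ e) G.d (G.c 0) tvisit tmax f).val (linkFun G e tvisit tmax h) := by
  have hup := linkFun_upTo he (tvisit := tvisit) hu
  simp only [link, Timed.val_bind, append_val, times_val]
  apply Repr.prune
  set ts := (sortTimes (earliestArrival (sortBans (G.Φ e)).val (G.δ e) tvisit).val tmax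
    ((earliestArrival (sortBans (G.Φ e)).val (G.δ e) tvisit).val :: tmax ::
      ((arrivals (sortBans (G.Φ e)).val (G.δ e) tvisit (List.map Prod.fst f)).val ++
        (banTimes (sortBans (G.Φ e)).val (G.δ e) (sortBans (G.Φ e)).val).val))).val with hts
  have hmem : ∀ p, p ∈ (linkAt (sortBans (mirror (G.Φ e)).val).val (G.δ e) G.d (G.c 0) f ts).val ↔
      p.1 ∈ ts ∧ linkFun G e tvisit tmax h p.1 = p.2 := by
    intro p
    rw [mem_linkAt]
    refine and_congr_right fun hp => ?_
    rw [hts, mem_sortTimes] at hp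
    have h1 : tvisit ≤ lastDep G e p.1 := (firstArr_le_iff he).1 hp.2.1
    rw [linkFun, if_pos ⟨h1, hp.2.2⟩, hf.evalAt_val, hd]
    change h (lastDep G e p.1) + ((G.c 0 * ((G.δ e : ℤ) : ℚ) +
      G.c 0 * ((p.1 - lastDep G e p.1 - (G.δ e : ℤ) : ℤ) : ℚ) : ℚ) : WithTop ℚ) = p.2 ↔ _
    rw [show (G.c 0 * ((G.δ e : ℤ) : ℚ) + G.c 0 * ((p.1 - lastDep G e p.1 - (G.δ e : ℤ) : ℤ) : ℚ))
      = G.c 0 * (p.1 - lastDep G e p.1) by push_cast; ring]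
  refine repr_of_kinks ?_ (fun p hp => ((hmem p).1 hp).2) hup.bdd hup.conv fun t ht hn => ?_
  · have := (sortTimes_sorted _ _ _).sublist (map_fst_linkAt_sublist
      (sortBans (mirror (G.Φ e)).val).val (G.δ e) G.d (G.c 0) f ts)
    rwa [List.pairwise_map] at this
  · have htop := ht
    obtain ⟨y, hy⟩ := WithTop.ne_top_iff_exists.1 ht
    have hn' : t ∉ ts := fun hmem' =>
      hn (List.mem_map.2 ⟨(t, y), (hmem (t, y)).2 ⟨hmem', hy.symm⟩, rfl⟩)
    unfold linkFun at ht
    split at ht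
    swap
    · exact absurd rfl ht
    rename_i hv
    rw [hts, mem_sortTimes] at hn'
    have hr : firstArr G e tvisit ≤ t ∧ t ≤ tmax := ⟨(firstArr_le_iff he).2 hv.1, hv.2⟩
    have hn'' : t ∉ firstArr G e tvisit :: tmax ::
      ((arrivals (sortBans (G.Φ e)).val (G.δ e) tvisit (List.map Prod.fst f)).val ++
        (banTimes (sortBans (G.Φ e)).val (G.δ e) (sortBans (G.Φ e)).val).val) :=
      fun hc => hn' ⟨hc, hr⟩
    simp only [List.mem_cons, List.mem_append, not_or] at hn''
    obtain ⟨n1, n2, n3, n4⟩ := hn''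
    refine linkFun_affineAt he htop n1 n2 (fun I hI => ?_) ?_
    · obtain ⟨b1, b2, b3, b4⟩ := mem_banTimes (bans := (sortBans (G.Φ e)).val) (drive := G.δ e)
        ((sortBans_perm (G.Φ e)).mem_iff.2 hI)
      refine ⟨fun hc => n4 (hc ▸ b1), fun hc => n4 (hc ▸ b2), fun hc => n4 ?_, fun hc => n4 ?_⟩
      · rw [hc]; exact b3
      · rw [hc]; exact b4
    · by_cases hD : lastDep G e t ∈ f.map Prod.fst
      · right
        intro hc
        apply n3
        rw [hc]
        exact mem_arrivals hD hv.1
      · left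
        exact hf.affineAt (fun h' => ht (by rw [h', WithTop.top_add])) hD

end Link

/-! ### The minimum of two lines -/

theorem line_affine (p p' : ℤ × ℚ) : ∃ y s : ℚ, ∀ t : ℤ, line p p' t = y + s * t :=
  ⟨p.2 - (p'.2 - p.2) / ((p'.1 - p.1 : ℤ) : ℚ) * p.1, (p'.2 - p.2) / ((p'.1 - p.1 : ℤ) : ℚ),
    fun t => by rw [line_eq_slope]; ring⟩

/-- A function that follows one line until the time `x` and another one from `x + 1` on. -/
theorem chain_of_two_lines {h : ℤ → WithTop ℚ} {a b x : ℤ} (hax : a ≤ x) (hxb : x < b)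
    {u v : ℤ → ℚ} (hu : ∃ y s : ℚ, ∀ t : ℤ, u t = y + s * t)
    (hv : ∃ y s : ℚ, ∀ t : ℤ, v t = y + s * t)
    (h1 : ∀ t, a ≤ t → t ≤ x → h t = u t) (h2 : ∀ t, x + 1 ≤ t → t ≤ b → h t = v t)
    {Y Y' : ℚ} (hY : h a = Y) (hY' : h b = Y') {l l' : Profile}
    (hl : l = if x + 1 < b then [(x + 1, v (x + 1))] else [])
    (hl' : l' = if a < x then (x, u x) :: l else l) :
    ((a, Y) :: (l' ++ [(b, Y')])).IsChain (Seg h) := by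
  obtain ⟨y, s, hu⟩ := hu
  obtain ⟨z, r, hv⟩ := hv
  -- the part from `x + 1` on, and the jump to it
  have tail : ∀ Z : ℚ, h x = Z → ((x, Z) :: (l ++ [(b, Y')])).IsChain (Seg h) := by
    intro Z hZ
    rw [hl]
    split
    · rename_i hlt
      have hx := h2 (x + 1) le_rfl hlt.le
      refine List.isChain_cons_cons.2 ⟨seg_of_succ rfl hZ hx, ?_⟩
      refine List.isChain_cons_cons.2 ⟨?_, List.isChain_singleton _⟩
      exact seg_of_affine (y := z) (s := r) hlt (fun t ht ht' => by rw [h2 t ht ht', hv]) hx hY'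
    · have : b = x + 1 := by omega
      exact List.isChain_cons_cons.2 ⟨seg_of_succ this hZ hY', List.isChain_singleton _⟩
  rw [hl']
  split
  · rename_i hlt
    have hx := h1 x hax le_rfl
    refine List.isChain_cons_cons.2 ⟨?_, tail _ hx⟩
    exact seg_of_affine (y := y) (s := s) hlt (fun t ht ht' => by rw [h1 t ht ht', hu]) hY hx
  · have : a = x := by omega
    subst this
    exact tail _ hY

/-- Where two lines cross between two integers, the minimum is affine up to the last integer before
the crossing, and from the next integer on. Those two are the breakpoints that are inserted. -/
theorem crossing_chain {h : ℤ → WithTop ℚ} {p p' : ℤ × ℚ} {y y' : ℚ} (hp : p.1 < p'.1)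
    (H : ∀ t, p.1 ≤ t → t ≤ p'.1 → h t = (min (line p p' t) (line (p.1, y) (p'.1, y') t) : ℚ)) :
    ((p.1, min p.2 y) :: ((crossing p p' y y').val ++ [(p'.1, min p'.2 y')])).IsChain (Seg h) := by
  have hA := line_affine p p'
  have hB := line_affine (p.1, y) (p'.1, y')
  have A1 := line_left p p'
  have A2 := line_right hp
  have B1 : line (p.1, y) (p'.1, y') p.1 = y := line_left (p.1, y) (p'.1, y')
  have B2 : line (p.1, y) (p'.1, y') p'.1 = y' := line_right (p := (p.1, y)) (p' := (p'.1, y')) hp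
  have hdx : (0 : ℚ) < p'.1 - p.1 := sub_pos.2 (by exact_mod_cast hp)
  have hY : h p.1 = (min p.2 y : ℚ) := by rw [H _ le_rfl hp.le, A1, B1]
  have hY' : h p'.1 = (min p'.2 y' : ℚ) := by rw [H _ hp.le le_rfl, A2, B2]
  have hE : ∀ t : ℤ, line (p.1, y) (p'.1, y') t - line p p' t =
      (y - p.2) + ((y' - p'.2) - (y - p.2)) / (p'.1 - p.1) * (t - p.1) := by
    intro t
    rw [line_eq_slope, line_eq_slope]
    push_cast
    field_simp
    ring
  generalize hBl : line (p.1, y) (p'.1, y') = B at *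
  generalize hAl : line p p' = A at *
  set D := y - p.2 with hD
  set D' := y' - p'.2 with hD'
  simp only [crossing, Timed.val_bind, subQ_val, ltQ_val, Timed.val_ite, subZ_val, toQ_val,
    mulQ_val, divQ_val, floorQ_val, addZ_val, interpolate_val, Timed.val_pure, ltZ_val,
    Bool.or_eq_true, Bool.and_eq_true, decide_eq_true_eq, ← hD, ← hD']
  split
  · rename_i hc
    have hne : D - D' ≠ 0 := by rcases hc with hc | hc <;> [linarith; linarith]
    set X := D * ((p'.1 - p.1 : ℤ) : ℚ) / (D - D') with hX
    have hkX : (D' - D) / (p'.1 - p.1) * X = -D := by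
      rw [hX]; push_cast; field_simp; ring
    have hX0 : 0 < X ∧ X < p'.1 - p.1 := by
      rcases hc with hc | hc
      · have hk : 0 < (D' - D) / ((p'.1 : ℚ) - p.1) := div_pos (by linarith) hdx
        have e1 : (D' - D) / ((p'.1 : ℚ) - p.1) * (p'.1 - p.1) = D' - D := by field_simp
        constructor <;> by_contra hcc <;> nlinarith
      · have hk : 0 < (D - D') / ((p'.1 : ℚ) - p.1) := div_pos (by linarith) hdx
        have hk' : (D' - D) / ((p'.1 : ℚ) - p.1) = - ((D - D') / ((p'.1 : ℚ) - p.1)) := by ring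
        have e1 : (D - D') / ((p'.1 : ℚ) - p.1) * (p'.1 - p.1) = D - D' := by field_simp
        rw [hk'] at hkX
        constructor <;> by_contra hcc <;> nlinarith
    have f1 : 0 ≤ ⌊X⌋ := Int.floor_nonneg.2 hX0.1.le
    have f2 : p.1 + ⌊X⌋ < p'.1 := by
      have h1 := Int.floor_le X
      have : (⌊X⌋ : ℚ) < ((p'.1 - p.1 : ℤ) : ℚ) := by push_cast; linarith
      have := Int.cast_lt.1 this
      omega
    have le_of : ∀ t, t ≤ p.1 + ⌊X⌋ → ((t : ℚ) - p.1) ≤ X := by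
      intro t ht
      have h1 := Int.floor_le X
      have : (t : ℚ) ≤ ((p.1 + ⌊X⌋ : ℤ) : ℚ) := by exact_mod_cast ht
      push_cast at this; linarith
    have ge_of : ∀ t, p.1 + ⌊X⌋ + 1 ≤ t → X ≤ ((t : ℚ) - p.1) := by
      intro t ht
      have h1 := Int.lt_floor_add_one X
      have : ((p.1 + ⌊X⌋ + 1 : ℤ) : ℚ) ≤ (t : ℚ) := by exact_mod_cast ht
      push_cast at this; linarith
    by_cases hb : D < 0
    · have hc' : 0 < D' := by rcases hc with hc | hc <;> linarith
      have hk : 0 < (D' - D) / ((p'.1 : ℚ) - p.1) := div_pos (by linarith) hdx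
      simp only [hb, if_true, hAl, hBl]
      refine chain_of_two_lines (x := p.1 + ⌊X⌋) (by omega) f2 hB hA ?_ ?_ hY hY' rfl
        (by split_ifs <;> rfl)
      · intro t ht ht'
        rw [H t ht (by omega), min_eq_right]
        have := hE t; have := le_of t ht'; nlinarith
      · intro t ht ht'
        rw [H t (by omega) ht', min_eq_left]
        have := hE t; have := ge_of t ht; nlinarith
    · have hc' : D' < 0 := by rcases hc with hc | hc <;> linarith
      have hk : 0 < (D - D') / ((p'.1 : ℚ) - p.1) :=
        div_pos (by rcases hc with hc | hc <;> linarith) hdx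
      have hk' : (D' - D) / ((p'.1 : ℚ) - p.1) = - ((D - D') / ((p'.1 : ℚ) - p.1)) := by ring
      rw [hk'] at hkX
      simp only [hb, if_false, hAl, hBl]
      refine chain_of_two_lines (x := p.1 + ⌊X⌋) (by omega) f2 hA hB ?_ ?_ hY hY' rfl
        (by split_ifs <;> rfl)
      · intro t ht ht'
        rw [H t ht (by omega), min_eq_left]
        have := hE t; rw [hk'] at this; have := le_of t ht'; nlinarith
      · intro t ht ht'
        rw [H t (by omega) ht', min_eq_right]
        have := hE t; rw [hk'] at this; have := ge_of t ht; nlinarith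
  · rename_i hc
    refine List.isChain_cons_cons.2 ⟨?_, List.isChain_singleton _⟩
    -- one line is below the other one at both ends, hence also between
    have hcases : (D ≤ 0 ∧ D' ≤ 0) ∨ (0 ≤ D ∧ 0 ≤ D') := by
      by_contra hcc
      simp only [not_or, not_and, not_lt, not_le] at hc hcc
      rcases lt_trichotomy D 0 with h1 | h1 | h1
      · have := hc.1 h1; have := hcc.1 h1.le; linarith
      · have := hcc.1 h1.le; have := hcc.2 h1.ge; linarith
      · have := hc.2 h1; have := hcc.2 h1.le; linarith
    have conv : ∀ t, p.1 ≤ t → t ≤ p'.1 → ∃ a b : ℚ, 0 ≤ a ∧ 0 ≤ b ∧ B t - A t = a * D + b * D' := by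
      intro t ht ht'
      have h1 : (p.1 : ℚ) ≤ t := by exact_mod_cast ht
      have h2 : (t : ℚ) ≤ p'.1 := by exact_mod_cast ht'
      refine ⟨(p'.1 - t) / (p'.1 - p.1), (t - p.1) / (p'.1 - p.1), div_nonneg (by linarith) hdx.le,
        div_nonneg (by linarith) hdx.le, ?_⟩
      rw [hE]; field_simp; ring
    rcases hcases with hc | hc
    · obtain ⟨z, s, hB⟩ := hB
      refine seg_of_affine (y := z) (s := s) hp (fun t ht ht' => ?_) hY hY'
      obtain ⟨a, b, ha, hb, e⟩ := conv t ht ht'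
      rw [H t ht ht', min_eq_right, hB]
      have := mul_nonpos_of_nonneg_of_nonpos ha hc.1
      have := mul_nonpos_of_nonneg_of_nonpos hb hc.2
      linarith
    · obtain ⟨z, s, hA⟩ := hA
      refine seg_of_affine (y := z) (s := s) hp (fun t ht ht' => ?_) hY hY'
      obtain ⟨a, b, ha, hb, e⟩ := conv t ht ht'
      rw [H t ht ht', min_eq_left, hA]
      have := mul_nonneg ha hc.1
      have := mul_nonneg hb hc.2
      linarith

/-! ### Waiting -/

section Wait

variable {G : RoadGraph} (q : Query G) (w : ℚ) {f : ℤ → WithTop ℚ}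

theorem absWait_of_lt {t : ℤ} (ht : t < q.tmin) : absWait G q w f t = ⊤ := by
  unfold absWait
  split
  · rw [Finset.Icc_eq_empty (by omega), Finset.inf_empty]
  · rfl

theorem absWait_of_gt {t : ℤ} (ht : q.tmax < t) : absWait G q w f t = ⊤ := if_neg (by omega)

/-- Waiting as a recursion in time. -/
theorem absWait_eq {t : ℤ} (ht : q.tmin ≤ t) (ht' : t ≤ q.tmax) :
    absWait G q w f t = min (f t) (absWait G q w f (t - 1) + (w : ℚ)) := by
  unfold absWait
  rw [if_pos ht', if_pos (by omega)]
  have hI : Finset.Icc q.tmin t = insert t (Finset.Icc q.tmin (t - 1)) := by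
    ext x; simp only [Finset.mem_Icc, Finset.mem_insert]; omega
  have hmap : ∀ s : Finset ℤ, s.inf (fun t' => f t' + ((w * (t - t') : ℚ) : WithTop ℚ)) =
      s.inf (fun t' => f t' + ((w * ((t - 1 : ℤ) - t') : ℚ) : WithTop ℚ)) + (w : ℚ) := by
    intro s
    have := Finset.apply_inf_eq_inf_comp (s := s)
      (f := fun t' => f t' + ((w * ((t - 1 : ℤ) - t') : ℚ) : WithTop ℚ))
      (fun x : WithTop ℚ => x + (w : ℚ)) (fun x y => ?_) (WithTop.top_add _)
    · rw [this]
      refine Finset.inf_congr rfl fun t' _ => ?_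
      simp only [Function.comp]
      rw [add_assoc, ← WithTop.coe_add]
      congr 2
      push_cast; ring
    · exact (min_add_add_right _ _ _).symm
  rw [hI, Finset.inf_insert, hmap]
  simp

theorem absWait_succ_le (t : ℤ) (ht : t < q.tmax) :
    absWait G q w f (t + 1) ≤ absWait G q w f t + (w : ℚ) := by
  rcases lt_or_ge t q.tmin with h | h
  · rw [absWait_of_lt q w h, WithTop.top_add]; exact le_top
  · rw [absWait_eq q w (by omega) (by omega), add_sub_cancel_right]
    exact min_le_right _ _

theorem absWait_le (hf : UpTo q.tmin q.tmax f) (t : ℤ) : absWait G q w f t ≤ f t := by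
  by_cases h : f t = ⊤
  · rw [h]; exact le_top
  · have := hf.bdd t h
    rw [absWait_eq q w this.1 this.2]; exact min_le_left _ _

theorem absWait_upTo : UpTo q.tmin q.tmax (absWait G q w f) := by
  refine ⟨fun t ht => ⟨?_, ?_⟩, fun t t' ht h1 h2 => ?_⟩
  · by_contra h; exact ht (absWait_of_lt q w (by omega))
  · by_contra h; exact ht (absWait_of_gt q w (by omega))
  · induction t', h1 using Int.leInduction with
    | base => exact ht
    | succ k hk ih =>
      have h3 := absWait_succ_le q w (f := f) k (by omega)
      intro h4
      rw [h4, top_le_iff, WithTop.add_eq_top] at h3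
      rcases h3 with h3 | h3
      · exact ih (by omega) h3
      · exact WithTop.coe_ne_top h3

theorem absWait_eq_top (t : ℤ) (hf : ∀ t' ≤ t, f t' = ⊤) : absWait G q w f t = ⊤ := by
  unfold absWait
  split
  · rw [Finset.inf_eq_top_iff]
    intro t' ht'
    rw [hf t' (Finset.mem_Icc.1 ht').2, WithTop.top_add]
  · rfl

/-- From one breakpoint to the next one, the profile after waiting is the minimum of two lines. -/
theorem absWait_seg {p p' : ℤ × ℚ} (hs : Seg f p p') (h1 : q.tmin ≤ p.1) (h2 : p'.1 ≤ q.tmax)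
    {y : ℚ} (hy : absWait G q w f p.1 = y) (hle : y ≤ p.2) {t : ℤ} (ht : p.1 ≤ t)
    (ht' : t ≤ p'.1) :
    absWait G q w f t = (min (line p p' t) (y + w * (t - p.1)) : ℚ) := by
  induction t, ht using Int.leInduction with
  | base => rw [hy, line_left]; congr 1; rw [min_eq_right]; ring; linarith
  | succ t ht ih =>
    rw [absWait_eq q w (by omega) (by omega), add_sub_cancel_right, ih (by omega),
      hs.2 _ (by omega) (by omega), ← WithTop.coe_add, ← WithTop.coe_min]
    congr 1
    rw [← min_add_add_right, ← min_assoc]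
    push_cast
    have hz : line p p' (t + 1) = line p p' t + (p'.2 - p.2) / ((p'.1 - p.1 : ℤ) : ℚ) := by
      rw [line_eq_slope, line_eq_slope]; push_cast; ring
    have hl : line p p' t = p.2 + (p'.2 - p.2) / ((p'.1 - p.1 : ℤ) : ℚ) * (t - p.1) :=
      line_eq_slope p p' t
    have hp : (p.1 : ℚ) ≤ t := by exact_mod_cast ht
    generalize (p'.2 - p.2) / ((p'.1 - p.1 : ℤ) : ℚ) = s at *
    rw [show y + w * ((t : ℚ) - p.1) + w = y + w * ((t : ℚ) + 1 - p.1) by ring]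
    rcases le_total s w with hsw | hsw
    · rw [min_eq_left (show line p p' (t + 1) ≤ line p p' t + w by rw [hz]; linarith)]
    · rw [min_assoc, min_eq_right (show y + w * ((t : ℚ) + 1 - p.1) ≤ line p p' t + w by
        rw [hl]; nlinarith)]

/-- Waiting, from a breakpoint `p` on at which the costs with waiting are `y`. -/
theorem waitFrom_spec (p : ℤ × ℚ) (g : Profile) (hc : (p :: g).IsChain (Seg f))
    (hb : ∀ p' ∈ p :: g, q.tmin ≤ p'.1 ∧ p'.1 ≤ q.tmax) {y : ℚ}
    (hy : absWait G q w f p.1 = y) (hle : y ≤ p.2) :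
    (waitFrom w p y g).val.IsChain (Seg (absWait G q w f)) ∧
    (waitFrom w p y g).val.head? = some (p.1, y) ∧
    (∀ p' ∈ p :: g, ∃ p'' ∈ (waitFrom w p y g).val, p''.1 = p'.1) := by
  induction g generalizing p y with
  | nil => simp [waitFrom]
  | cons p' g ih =>
    rw [List.isChain_cons_cons] at hc
    have hlt := hc.1.1
    have hb0 := hb p List.mem_cons_self
    have hb1 := hb p' (List.mem_cons_of_mem _ List.mem_cons_self)
    simp only [waitFrom, Timed.val_bind, subZ_val, toQ_val, mulQ_val, addQ_val, minQ_val,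
      append_val, Timed.val_pure]
    set y' := y + w * ((p'.1 - p.1 : ℤ) : ℚ) with hy'
    have hl : ∀ t : ℤ, line (p.1, y) (p'.1, y') t = y + w * (t - p.1) := by
      intro t
      rw [line_eq_of_affine (p := (p.1, y)) (p' := (p'.1, y')) hlt (y := y - w * p.1) (s := w)]
      · ring
      · simp
      · simp only [hy']; push_cast; ring
    have hW : ∀ t, p.1 ≤ t → t ≤ p'.1 → absWait G q w f t =
        (min (line p p' t) (line (p.1, y) (p'.1, y') t) : ℚ) := fun t ht ht' => by
      rw [hl, absWait_seg q w hc.1 hb0.1 hb1.2 hy hle ht ht']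
    have hy1 : absWait G q w f p'.1 = (min y' p'.2 : ℚ) := by
      rw [hW _ hlt.le le_rfl, line_right hlt, min_comm,
        line_right (p := (p.1, y)) (p' := (p'.1, y')) hlt]
    obtain ⟨i1, i2, i3⟩ := ih p' hc.2 (fun p'' h => hb p'' (List.mem_cons_of_mem _ h)) hy1
      (min_le_right _ _)
    have hcr := crossing_chain (y := y) (y' := y') hlt hW
    rw [min_eq_right hle, min_comm p'.2 y'] at hcr
    generalize (waitFrom w p' (min y' p'.2) g).val = r at *
    rcases r with _ | ⟨r0, r⟩
    · simp at i2
    · simp only [List.head?_cons, Option.some.injEq] at i2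
      subst i2
      refine ⟨?_, rfl, ?_⟩
      · rw [← List.cons_append] at hcr ⊢
        rw [List.isChain_append] at hcr ⊢
        refine ⟨hcr.1, i1, ?_⟩
        simpa using hcr.2.2
      · intro p'' hp''
        rcases List.mem_cons.1 hp'' with rfl | hp''
        · exact ⟨(p''.1, y), by simp, rfl⟩
        · obtain ⟨r1, hr1, e⟩ := i3 p'' hp''
          exact ⟨r1, by simp only [List.mem_cons, List.mem_append] at hr1 ⊢; tauto, e⟩

theorem IsChain.val_of_head {h : ℤ → WithTop ℚ} {f : Profile} (hc : f.IsChain (Seg h))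
    (hh : ∀ p ∈ f.head?, h p.1 = p.2) : ∀ p ∈ f, h p.1 = p.2 := by
  induction f with
  | nil => simp
  | cons p f ih =>
    intro p' hp'
    rcases List.mem_cons.1 hp' with rfl | hp'
    · exact hh p' rfl
    · refine ih hc.tail (fun p'' h'' => ?_) p' hp'
      rcases f with _ | ⟨p1, f⟩
      · simp at h''
      · simp at h''; subst h''
        exact (List.isChain_cons_cons.1 hc).1.right

theorem waiting_repr {g : Profile} (hg : Repr g f) (hu : UpTo q.tmin q.tmax f) :
    Repr (waiting w g).val (absWait G q w f) := by
  rcases g with _ | ⟨p, g⟩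
  · refine Repr.nil fun t => absWait_eq_top q w t fun t' _ => ?_
    by_contra h
    obtain ⟨p, hp, -⟩ := hg.dom t' h
    simp at hp
  · simp only [waiting, Timed.val_bind]
    apply Repr.prune
    have hb : ∀ p' ∈ p :: g, q.tmin ≤ p'.1 ∧ p'.1 ≤ q.tmax := fun p' hp' =>
      hu.bdd _ (by rw [hg.val p' hp']; exact WithTop.coe_ne_top)
    have hp := hg.val p List.mem_cons_self
    have hpb := hb p List.mem_cons_self
    have hbefore : ∀ t < p.1, f t = ⊤ := by
      intro t ht
      by_contra h
      obtain ⟨p', hp', -, -, h1, -⟩ := hg.dom t h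
      rcases List.mem_cons.1 hp' with rfl | hp'
      · omega
      · have := (List.pairwise_cons.1 (Repr.pairwise hg.chain)).1 p' hp'; omega
    have hy : absWait G q w f p.1 = p.2 := by
      rw [absWait_eq q w hpb.1 hpb.2, absWait_eq_top q w (p.1 - 1) fun t' ht' =>
        hbefore t' (by omega), hp]
      simp
    obtain ⟨h1, h2, h3⟩ := waitFrom_spec q w p g hg.chain hb hy le_rfl
    refine ⟨h1, IsChain.val_of_head h1 fun p' hp' => ?_, fun t ht => ?_⟩
    · rw [h2] at hp'
      obtain rfl : (p.1, p.2) = p' := by simpa using hp'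
      exact hy
    · have htb := (absWait_upTo q w).bdd t ht
      have hpt : p.1 ≤ t := by
        by_contra hlt
        exact ht (absWait_eq_top q w t fun t' ht' => hbefore t' (by omega))
      have hlast := hu.up p.1 q.tmax (by rw [hp]; exact WithTop.coe_ne_top) hpb.2 le_rfl
      obtain ⟨-, -, r, hr, -, hr'⟩ := hg.dom q.tmax hlast
      obtain ⟨r1, hr1, e1⟩ := h3 p List.mem_cons_self
      obtain ⟨r2, hr2, e2⟩ := h3 r hr
      exact ⟨r1, hr1, r2, hr2, by omega, by omega⟩

end Wait

/-! ### The minimum of two profiles -/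

/-- Between consecutive times of a list that contains its breakpoints, a profile is affine or
infinite, or it begins at the later one of two adjacent times. -/
theorem affine_or_top {tmin tmax : ℤ} {f : Profile} {h : ℤ → WithTop ℚ} (hf : Repr f h)
    (hu : UpTo tmin tmax h) {t t' : ℤ} (htt : t < t') (hmax : t' ≤ tmax)
    (hn : ∀ x, t < x → x < t' → x ∉ f.map Prod.fst)
    (hn' : ∀ x, t < x → x < t' → x + 1 ∉ f.head?.map Prod.fst) :
    (∃ y s : ℚ, ∀ x, t ≤ x → x ≤ t' → h x = (y + s * x : ℚ)) ∨
    (∀ x, t ≤ x → x ≤ t' → h x = ⊤) ∨ (t' = t + 1 ∧ h t = ⊤ ∧ h t' ≠ ⊤) := by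
  by_cases h1 : h t = ⊤
  · right
    by_cases h2 : h t' = ⊤
    · left
      intro x hx hx'
      by_contra hne
      exact hu.up x t' hne hx' hmax h2
    · right
      refine ⟨?_, h1, h2⟩
      rcases f with _ | ⟨p, f⟩
      · obtain ⟨p, hp, -⟩ := hf.dom t' h2
        simp at hp
      · have hp := hf.val p List.mem_cons_self
        have hpt : p.1 ≤ t' := by
          obtain ⟨p', hp', -, -, h3, -⟩ := hf.dom t' h2
          rcases List.mem_cons.1 hp' with rfl | hp'
          · exact h3
          · have := (List.pairwise_cons.1 (Repr.pairwise hf.chain)).1 p' hp'; omega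
        have htp : t < p.1 := by
          by_contra hle
          exact hu.up p.1 t (by rw [hp]; exact WithTop.coe_ne_top) (by omega) (by omega) h1
        have h3 : p.1 = t' := by
          by_contra hne
          exact hn p.1 htp (by omega) (by simp)
        by_contra hne
        exact hn' (t' - 1) (by omega) (by omega) (by simp [h3])
  · left
    refine affine_of_affineAt htt h1 (hu.up t _ h1 (by omega) (by omega)) fun x hx hx' => ?_
    exact hf.affineAt (hu.up t x h1 hx.le (by omega)) (hn x hx hx')

theorem consMin_top (t : ℤ) (l : Profile) : (consMin t ⊤ ⊤ l).val = l := rfl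

theorem consMin_coe {t : ℤ} {a b : WithTop ℚ} {l : Profile} {y : ℚ} (h : min a b = y) :
    (consMin t a b l).val = (t, y) :: l := by
  induction a using WithTop.recTopCoe with
  | top =>
    rw [min_eq_right le_top] at h
    subst h; rfl
  | coe a =>
    induction b using WithTop.recTopCoe with
    | top =>
      rw [min_eq_left le_top] at h
      rw [← WithTop.coe_injective h]; rfl
    | coe b =>
      rw [← WithTop.coe_min] at h
      rw [← WithTop.coe_injective h]
      change (t, (minQ a b).val) :: l = _
      rw [minQ_val]

theorem crossingTop_coe (t t' : ℤ) (a b a' b' : ℚ) :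
    crossingTop t t' a b a' b' = crossing (t, a) (t', a') b b' := rfl

theorem crossingTop_of_top {t t' : ℤ} {a b a' b' : WithTop ℚ} (h : a = ⊤ ∨ b = ⊤) :
    (crossingTop t t' a b a' b').val = [] := by
  unfold crossingTop
  split
  · rcases h with h | h
    · exact absurd h WithTop.coe_ne_top
    · exact absurd h WithTop.coe_ne_top
  · rfl

@[simp] theorem ltTop_val (a b : WithTop ℚ) : (ltTop a b).val = decide (a < b) := by
  induction a using WithTop.recTopCoe with
  | top => simp only [not_top_lt, decide_false]; rfl
  | coe a =>
    induction b using WithTop.recTopCoe with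
    | top => simp only [WithTop.coe_lt_top, decide_true]; rfl
    | coe b => simp only [WithTop.coe_lt_coe]; rfl

theorem mem_startTimes {f : Profile} {x : ℤ} :
    x ∈ (startTimes f).val ↔ x + 1 ∈ f.head?.map Prod.fst := by
  rcases f with _ | ⟨p, f⟩
  · simp [startTimes]
  · simp only [startTimes, Timed.val_bind, subZ_val, Timed.val_pure, List.mem_singleton,
      List.head?_cons, Option.map_some, Option.mem_def, Option.some.injEq]
    omega

section Min

variable {tmin tmax : ℤ} {f g : Profile} {h k : ℤ → WithTop ℚ}

/-- The minimum of two profiles, computed on a list of times that contains all breakpoints of both.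
The times one unit before the first breakpoints have to be in the list as well, because the minimum
may jump there from one profile to the other. -/
theorem minOn_spec (hf : Repr f h) (hg : Repr g k) (hu : UpTo tmin tmax h)
    (hv : UpTo tmin tmax k) (l : List ℤ) (hl : l.Pairwise (· < ·)) (hb : ∀ t ∈ l, t ≤ tmax)
    (ht : ∀ t₀ ∈ l.head?, ∀ x, t₀ ≤ x → x ≤ tmax →
      (x ∈ f.map Prod.fst ∨ x + 1 ∈ f.head?.map Prod.fst) ∨
      (x ∈ g.map Prod.fst ∨ x + 1 ∈ g.head?.map Prod.fst) → x ∈ l) :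
    (minOn f g l).val.IsChain (Seg fun t => min (h t) (k t)) ∧
    (∀ p ∈ (minOn f g l).val, min (h p.1) (k p.1) = p.2) ∧
    (∀ t ∈ l, min (h t) (k t) ≠ ⊤ → t ∈ (minOn f g l).val.map Prod.fst) ∧
    (∀ t₀ ∈ l.head?, ∀ y : ℚ, min (h t₀) (k t₀) = y → (minOn f g l).val.head? = some (t₀, y)) := by
  induction l with
  | nil => simp [minOn]
  | cons t l ih =>
    have hl' := List.pairwise_cons.1 hl
    have hcase : min (h t) (k t) = ⊤ ∨ ∃ y : ℚ, min (h t) (k t) = y := by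
      by_cases hc : min (h t) (k t) = ⊤
      · exact Or.inl hc
      · obtain ⟨y, hy⟩ := WithTop.ne_top_iff_exists.1 hc
        exact Or.inr ⟨y, hy.symm⟩
    rcases l with _ | ⟨t', l⟩
    · simp only [minOn, Timed.val_bind, hf.evalAt_val, hg.evalAt_val]
      rcases hcase with hc | ⟨y, hy⟩
      · have hc' := hc
        rw [min_eq_top] at hc'
        rw [hc'.1, hc'.2, consMin_top]
        simp [hc'.1, hc'.2]
      · rw [consMin_coe hy]
        simp [hy]
    · have htt := hl'.1 t' List.mem_cons_self
      have htb := hb t' (by simp)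
      obtain ⟨c1, c2, c3, c4⟩ := ih hl'.2 (fun x hx => hb x (List.mem_cons_of_mem _ hx))
        fun t₀ ht₀ x hx hx' hxx => by
          obtain rfl : t' = t₀ := by simpa using ht₀
          have := ht t (by simp) x (by omega) hx' hxx
          rcases List.mem_cons.1 this with h1 | h1
          · omega
          · exact h1
      simp only [minOn, Timed.val_bind, hf.evalAt_val, hg.evalAt_val, append_val]
      rcases hcase with hc | ⟨y, hy⟩
      · have hc' := hc
        rw [min_eq_top] at hc'
        rw [hc'.1, hc'.2, consMin_top, crossingTop_of_top (Or.inl rfl), List.nil_append]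
        refine ⟨c1, c2, fun x hx hx' => ?_, fun t₀ ht₀ y hy => ?_⟩
        · rcases List.mem_cons.1 hx with rfl | hx
          · exact absurd hc hx'
          · exact c3 x hx hx'
        · obtain rfl : t = t₀ := by simpa using ht₀
          rw [hc] at hy; exact absurd hy WithTop.top_ne_coe
      · rw [consMin_coe hy]
        have hfin' : min (h t') (k t') ≠ ⊤ := by
          intro h0
          rw [min_eq_top] at h0
          have : min (h t) (k t) ≠ ⊤ := by rw [hy]; exact WithTop.coe_ne_top
          apply this
          rw [min_eq_top]
          constructor
          · by_contra h1; exact hu.up t t' h1 htt.le htb h0.1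
          · by_contra h1; exact hv.up t t' h1 htt.le htb h0.2
        obtain ⟨y', hy'⟩ := WithTop.ne_top_iff_exists.1 hfin'
        have hhead := c4 t' (by simp) y' hy'.symm
        -- from one time to the next one, both profiles are affine or infinite, unless the times are
        -- adjacent
        have hmid : ((t, y) :: ((crossingTop t t' (h t) (k t) (h t') (k t')).val ++
            [(t', y')])).IsChain (Seg fun t => min (h t) (k t)) := by
          have adj : t' = t + 1 → h t = ⊤ ∨ k t = ⊤ →
              ((t, y) :: ((crossingTop t t' (h t) (k t) (h t') (k t')).val ++
              [(t', y')])).IsChain (Seg fun t => min (h t) (k t)) := fun h1 h2 => by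
            rw [crossingTop_of_top h2]
            exact List.isChain_cons_cons.2 ⟨seg_of_succ h1 hy hy'.symm, List.isChain_singleton _⟩
          have hnl : ∀ x, t < x → x < t' → x ∉ t :: t' :: l := fun x hx hx' hm => by
            rcases List.mem_cons.1 hm with rfl | hm
            · omega
            · rcases List.mem_cons.1 hm with rfl | hm
              · omega
              · have := (List.pairwise_cons.1 hl'.2).1 x hm; omega
          have af := affine_or_top hf hu htt htb
            (fun x hx hx' hm => hnl x hx hx' (ht t (by simp) x hx.le (by omega) (by tauto)))
            (fun x hx hx' hm => hnl x hx hx' (ht t (by simp) x hx.le (by omega) (by tauto)))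
          have ag := affine_or_top hg hv htt htb
            (fun x hx hx' hm => hnl x hx hx' (ht t (by simp) x hx.le (by omega) (by tauto)))
            (fun x hx hx' hm => hnl x hx hx' (ht t (by simp) x hx.le (by omega) (by tauto)))
          rcases af with ⟨z, s, af⟩ | af | ⟨a1, a2, -⟩
          · rcases ag with ⟨z', s', ag⟩ | ag | ⟨a1, a2, -⟩
            · have e1 := af t le_rfl htt.le
              have e2 := af t' htt.le le_rfl
              have e3 := ag t le_rfl htt.le
              have e4 := ag t' htt.le le_rfl
              rw [e1, e3, ← WithTop.coe_min] at hy
              rw [e2, e4, ← WithTop.coe_min] at hy'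
              rw [e1, e2, e3, e4, crossingTop_coe, ← WithTop.coe_injective hy,
                WithTop.coe_injective hy']
              refine crossing_chain (p := (t, z + s * t)) (p' := (t', z + s * t')) htt
                fun x hx hx' => ?_
              simp only
              rw [af x hx hx', ag x hx hx', ← WithTop.coe_min]
              congr 1
              rw [line_eq_of_affine (p := (t, z + s * t)) (p' := (t', z + s * t')) htt rfl rfl,
                line_eq_of_affine (p := (t, z' + s' * t)) (p' := (t', z' + s' * t')) htt rfl rfl]
            · rw [crossingTop_of_top (Or.inr (ag t le_rfl htt.le))]
              refine List.isChain_cons_cons.2 ⟨?_, List.isChain_singleton _⟩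
              refine seg_of_affine (y := z) (s := s) htt (fun x hx hx' => ?_) hy hy'.symm
              rw [ag x hx hx', min_eq_left le_top, af x hx hx']
            · exact adj a1 (Or.inr a2)
          · rcases ag with ⟨z', s', ag⟩ | ag | ⟨a1, a2, -⟩
            · rw [crossingTop_of_top (Or.inl (af t le_rfl htt.le))]
              refine List.isChain_cons_cons.2 ⟨?_, List.isChain_singleton _⟩
              refine seg_of_affine (y := z') (s := s') htt (fun x hx hx' => ?_) hy hy'.symm
              rw [af x hx hx', min_eq_right le_top, ag x hx hx']
            · rw [af t le_rfl htt.le, ag t le_rfl htt.le, min_self] at hy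
              exact absurd hy WithTop.top_ne_coe
            · exact adj a1 (Or.inr a2)
          · exact adj a1 (Or.inl a2)
        generalize (crossingTop t t' (h t) (k t) (h t') (k t')).val = mid at *
        generalize (minOn f g (t' :: l)).val = r at *
        have hchain : ((t, y) :: (mid ++ r)).IsChain (Seg fun t => min (h t) (k t)) := by
          rcases r with _ | ⟨r0, r⟩
          · simp at hhead
          · simp only [List.head?_cons, Option.some.injEq] at hhead
            subst hhead
            rw [← List.cons_append] at hmid ⊢
            rw [List.isChain_append] at hmid ⊢
            refine ⟨hmid.1, c1, ?_⟩
            simpa using hmid.2.2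
        refine ⟨hchain, ?_, fun x hx hx' => ?_, fun t₀ ht₀ y₀ hy₀ => ?_⟩
        · refine IsChain.val_of_head hchain fun p hp => ?_
          obtain rfl : (t, y) = p := by simpa using hp
          exact hy
        · rcases List.mem_cons.1 hx with rfl | hx
          · simp
          · have := c3 x hx hx'
            simp only [List.map_cons, List.map_append, List.mem_cons, List.mem_append]
            tauto
        · obtain rfl : t = t₀ := by simpa using ht₀
          rw [hy] at hy₀
          rw [WithTop.coe_injective hy₀]; rfl

theorem UpTo.min (hu : UpTo tmin tmax h) (hv : UpTo tmin tmax k) :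
    UpTo tmin tmax fun t => min (h t) (k t) := by
  refine ⟨fun t ht => ?_, fun t t' ht h1 h2 => ?_⟩
  · by_cases h0 : h t = ⊤
    · exact hv.bdd t fun h1 => ht (by rw [h0, h1, min_self])
    · exact hu.bdd t h0
  · intro h0
    rw [min_eq_top] at h0
    apply ht
    rw [min_eq_top]
    constructor
    · by_contra h3; exact hu.up t t' h3 h1 h2 h0.1
    · by_contra h3; exact hv.up t t' h3 h1 h2 h0.2

theorem firstBelow_none (hf : Repr f h) (hg : Repr g k) {l : List ℤ}
    (hn : (firstBelow f g l).val = none) : ∀ t ∈ l, ¬ k t < h t ∧ ¬ k (t + 1) < h (t + 1) := by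
  induction l with
  | nil => simp
  | cons t l ih =>
    simp only [firstBelow, Timed.val_bind, hf.evalAt_val, hg.evalAt_val, ltTop_val, addZ_val,
      Timed.val_ite, Timed.val_pure, decide_eq_true_eq] at hn
    split at hn
    · simp at hn
    · split at hn
      · simp at hn
      · intro x hx
        rcases List.mem_cons.1 hx with rfl | hx
        · tauto
        · exact ih hn x hx

/-- Only the given times and their successors are looked at. -/
theorem firstBelow_some (hf : Repr f h) (hg : Repr g k) {l : List ℤ} (hl : l.Pairwise (· < ·))
    {t : ℤ} (hn : (firstBelow f g l).val = some t) : k t < h t ∧ ∃ t₀ ∈ l,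
      (t = t₀ ∨ t = t₀ + 1 ∧ ¬ k t₀ < h t₀) ∧
      ∀ x ∈ l, x < t₀ → ¬ k x < h x ∧ ¬ k (x + 1) < h (x + 1) := by
  induction l with
  | nil => simp [firstBelow] at hn
  | cons t' l ih =>
    have hl' := List.pairwise_cons.1 hl
    simp only [firstBelow, Timed.val_bind, hf.evalAt_val, hg.evalAt_val, ltTop_val, addZ_val,
      Timed.val_ite, Timed.val_pure, decide_eq_true_eq] at hn
    have hfirst : ∀ x ∈ t' :: l, ¬ x < t' := fun x hx => by
      rcases List.mem_cons.1 hx with rfl | hx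
      · omega
      · have := hl'.1 x hx; omega
    split at hn
    · rename_i h1
      obtain rfl : t' = t := by simpa using hn
      exact ⟨h1, t', List.mem_cons_self, Or.inl rfl, fun x hx hlt => absurd hlt (hfirst x hx)⟩
    · rename_i h1
      split at hn
      · rename_i h2
        obtain rfl : t' + 1 = t := by simpa using hn
        exact ⟨h2, t', List.mem_cons_self, Or.inr ⟨rfl, h1⟩, fun x hx hlt =>
          absurd hlt (hfirst x hx)⟩
      · rename_i h2
        obtain ⟨i1, t₀, i2, i3, i4⟩ := ih hl'.2 hn
        refine ⟨i1, t₀, List.mem_cons_of_mem _ i2, i3, fun x hx hlt => ?_⟩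
        rcases List.mem_cons.1 hx with rfl | hx
        · exact ⟨h1, h2⟩
        · exact i4 x hx hlt

theorem exists_isLeast_lt (hv : UpTo tmin tmax k) {t : ℤ} (ht : k t < h t) :
    ∃ t', IsLeast {t | k t < h t} t' := by
  obtain ⟨t', h1, h2⟩ := Int.exists_least_of_bdd (P := fun t => k t < h t)
    ⟨tmin, fun z hz => (hv.bdd z hz.ne_top).1⟩ ⟨t, ht⟩
  exact ⟨t', h1, h2⟩

/-- The improvement is found, and with its earliest time, although only breakpoints and their
successors are compared: where one profile gets below the other one, the minimum is not affine at
that time or at the time before. -/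
theorem improve_spec (hf : Repr f h) (hg : Repr g k) (hu : UpTo tmin tmax h)
    (hv : UpTo tmin tmax k) :
    ((improve tmin tmax f g).val = none → ∀ t, ¬ k t < h t) ∧
    ∀ t f', (improve tmin tmax f g).val = some (t, f') → IsLeast {t | k t < h t} t ∧
      Repr f' (fun t => min (h t) (k t)) ∧ IsPruned f' := by
  have huv := hu.min hv
  simp only [improve, Timed.val_bind, append_val, times_val]
  have hts : ∀ x, _ ↔ _ := fun x => mem_sortTimes (lo := tmin) (hi := tmax) (x := x)
    (l := (startTimes g).val ++
      ((startTimes f).val ++ (List.map Prod.fst f ++ List.map Prod.fst g)))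
  have hsort := sortTimes_sorted tmin tmax ((startTimes g).val ++
    ((startTimes f).val ++ (List.map Prod.fst f ++ List.map Prod.fst g)))
  generalize (sortTimes tmin tmax ((startTimes g).val ++
    ((startTimes f).val ++ (List.map Prod.fst f ++ List.map Prod.fst g)))).val = ts at *
  have hmem : ∀ x, tmin ≤ x → x ≤ tmax → (x ∈ f.map Prod.fst ∨ x + 1 ∈ f.head?.map Prod.fst) ∨
      (x ∈ g.map Prod.fst ∨ x + 1 ∈ g.head?.map Prod.fst) → x ∈ ts := by
    intro x h1 h2 h3
    refine (hts _).2 ⟨?_, h1, h2⟩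
    simp only [List.mem_append, mem_startTimes]
    tauto
  obtain ⟨c1, c2, c3, -⟩ := minOn_spec hf hg hu hv ts hsort (fun x hx => ((hts _).1 hx).2.2)
    fun t₀ ht₀ x hx hx' => hmem x (((hts _).1 (List.mem_of_mem_head? ht₀)).2.1.trans hx) hx'
  generalize (minOn f g ts).val = r at *
  have hr : Repr r fun t => min (h t) (k t) := by
    have hmem' : ∀ x, x ∈ f.map Prod.fst ∨ x ∈ g.map Prod.fst → ∃ p ∈ r, p.1 = x := by
      intro x hx
      have hfin : min (h x) (k x) ≠ ⊤ := by
        intro h0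
        rw [min_eq_top] at h0
        rcases hx with hx | hx
        · obtain ⟨p, hp, rfl⟩ := List.mem_map.1 hx
          rw [hf.val p hp] at h0; exact absurd h0.1 WithTop.coe_ne_top
        · obtain ⟨p, hp, rfl⟩ := List.mem_map.1 hx
          rw [hg.val p hp] at h0; exact absurd h0.2 WithTop.coe_ne_top
      have hb := huv.bdd x hfin
      exact List.mem_map.1 (c3 x (hmem x hb.1 hb.2 (by tauto)) hfin)
    refine ⟨c1, c2, fun t ht => ?_⟩
    by_cases h0 : h t = ⊤
    · obtain ⟨p, hp, p', hp', h1, h2⟩ := hg.dom t fun h1 => ht (by rw [h0, h1, min_self])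
      obtain ⟨r1, hr1, e1⟩ := hmem' p.1 (Or.inr (List.mem_map_of_mem hp))
      obtain ⟨r2, hr2, e2⟩ := hmem' p'.1 (Or.inr (List.mem_map_of_mem hp'))
      exact ⟨r1, hr1, r2, hr2, by omega, by omega⟩
    · obtain ⟨p, hp, p', hp', h1, h2⟩ := hf.dom t h0
      obtain ⟨r1, hr1, e1⟩ := hmem' p.1 (Or.inl (List.mem_map_of_mem hp))
      obtain ⟨r2, hr2, e2⟩ := hmem' p'.1 (Or.inl (List.mem_map_of_mem hp'))
      exact ⟨r1, hr1, r2, hr2, by omega, by omega⟩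
  -- the minimum has a kink where the second profile gets less than the first one
  have hleast : ∀ t, IsLeast {t | k t < h t} t → t ∈ r.map Prod.fst ∨ t - 1 ∈ r.map Prod.fst := by
    rintro t ⟨h1, h2⟩
    by_contra hc
    rw [not_or] at hc
    have hlt : k t < h t := h1
    have hb := hv.bdd t hlt.ne_top
    have hle : h (t - 1) ≤ k (t - 1) := by
      by_contra hlt'
      have : t ≤ t - 1 := h2 (not_le.1 hlt')
      omega
    have hkt : min (h t) (k t) ≠ ⊤ := by rw [min_eq_right hlt.le]; exact hlt.ne_top
    have hnts : t ∉ ts := fun hc' => hc.1 (c3 t hc' hkt)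
    obtain ⟨y, s, e1, -, -⟩ := hr.affineAt hkt hc.1
    have hfin : min (h (t - 1)) (k (t - 1)) ≠ ⊤ :=
      ne_of_eq_of_ne e1 WithTop.coe_ne_top
    have hb1 := huv.bdd _ hfin
    obtain ⟨y', s', a1, a2, a3⟩ := hr.affineAt hfin hc.2
    rw [sub_add_cancel] at a3
    have hnts' : t - 1 ∉ ts := fun hc' => hc.2 (c3 _ hc' hfin)
    have hfin1 : h (t - 1) ≠ ⊤ := by rwa [min_eq_left hle] at hfin
    obtain ⟨y1, s1, b1, b2, b3⟩ := hf.affineAt hfin1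
      fun hc' => hnts' (hmem _ hb1.1 hb1.2 (by tauto))
    rw [sub_add_cancel] at b3
    obtain ⟨yk, sk, d1, -, -⟩ := hg.affineAt hlt.ne_top
      fun hc' => hnts (hmem _ hb.1 hb.2 (by tauto))
    obtain ⟨y2, s2, g1, g2, g3⟩ := hg.affineAt (t := t - 1) (by rw [d1]; exact WithTop.coe_ne_top)
      fun hc' => hnts' (hmem _ hb1.1 hb1.2 (by tauto))
    rw [sub_add_cancel] at g3
    rw [b3, g3, WithTop.coe_lt_coe] at hlt
    rw [b2, g2, WithTop.coe_le_coe] at hle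
    simp only at a1 a2 a3
    rw [b1, g1, ← WithTop.coe_min] at a1
    rw [b2, g2, ← WithTop.coe_min] at a2
    rw [b3, g3, ← WithTop.coe_min] at a3
    -- the minimum is affine around `t - 1`, but it is `h` at the first two times and less than `h`
    -- at the third one
    have a1' := WithTop.coe_injective a1
    have a2' := WithTop.coe_injective a2
    have a3' := WithTop.coe_injective a3
    rw [min_eq_left (by linarith)] at a1' a2'
    rw [min_eq_right (by linarith)] at a3'
    linarith
  have hrs : (r.map Prod.fst).Pairwise (· < ·) := by
    rw [List.pairwise_map]; exact Repr.pairwise c1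
  refine ⟨fun hn t ht => ?_, fun t f' hs => ?_⟩
  · split at hn
    · rename_i hnone
      have hnone' := firstBelow_none hf hg hnone
      obtain ⟨t', hl⟩ := exists_isLeast_lt hv ht
      rcases hleast t' hl with h1 | h1
      · exact (hnone' _ h1).1 hl.1
      · have := (hnone' _ h1).2
        rw [sub_add_cancel] at this
        exact this hl.1
    · simp at hn
  · split at hs
    · simp at hs
    · rename_i t' hsome
      obtain ⟨rfl, rfl⟩ : t' = t ∧ (prune r).val = f' := by simpa using hs
      refine ⟨?_, hr.prune, prune_isPruned c1⟩
      obtain ⟨i1, t₀, i2, i3, i4⟩ := firstBelow_some hf hg hrs hsome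
      obtain ⟨t'', hl⟩ := exists_isLeast_lt hv i1
      have hle : t'' ≤ t' := hl.2 i1
      suffices t' ≤ t'' by rwa [le_antisymm this hle]
      rcases hleast t'' hl with h1 | h1
      · have h2 : t₀ ≤ t'' := by
          by_contra hc
          exact (i4 _ h1 (by omega)).1 hl.1
        rcases i3 with i3 | i3
        · omega
        · rcases h2.eq_or_lt with h3 | h3
          · rw [h3] at i3
            exact absurd hl.1 i3.2
          · omega
      · have h2 : t₀ ≤ t'' - 1 := by
          by_contra hc
          have := (i4 _ h1 (by omega)).2
          rw [sub_add_cancel] at this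
          exact this hl.1
        omega

end Min

/-! ### Relaxing an edge -/

section Relax

variable {G : RoadGraph} (q : Query G) (hd : G.d = G.c 0)

/-- The profile that is offered to the head of the edge `e` when its tail, whose profile is `f`, is
visited at time `tvisit`. -/
noncomputable def offer (tvisit : ℤ) (f : ℤ → WithTop ℚ) (e : Fin G.n × Fin G.n) : ℤ → WithTop ℚ :=
  absWait G q (G.c (G.ρ e.2)) (linkFun G e tvisit q.tmax f)

/-- The new key of an entry that is improved from the time `t` on. -/
def newKey (k : Option ℤ) (t : ℤ) : ℤ :=
  match k with
  | none => t
  | some k => min k t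

theorem decreaseKey_val (k : Option ℤ) (t : ℤ) : (decreaseKey k t).val = newKey k t := by
  rcases k with _ | k
  · rfl
  · simp only [decreaseKey, Timed.val_bind, ltZ_val, Timed.val_ite, Timed.val_pure, newKey,
      decide_eq_true_eq]
    split <;> omega

theorem offer_upTo (tvisit : ℤ) (f : ℤ → WithTop ℚ) (e : Fin G.n × Fin G.n) :
    UpTo q.tmin q.tmax (offer q tvisit f e) := absWait_upTo q _

theorem absRelax_of_isLeast {σ : AbsState G} {e : Fin G.n × Fin G.n} {tvisit t : ℤ}
    (h : IsLeast {t | absWait G q (G.c (G.ρ e.2)) (absLink G q e tvisit (σ.C e.1)) t < σ.C e.2 t} t) :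
    absRelax G q tvisit σ e =
      { C := Function.update σ.C e.2 fun x => if t ≤ x ∧ x ≤ q.tmax then min (σ.C e.2 x)
          (absWait G q (G.c (G.ρ e.2)) (absLink G q e tvisit (σ.C e.1)) x) else σ.C e.2 x
        queue := Function.update σ.queue e.2 (some (newKey (σ.queue e.2) t)) } := by
  unfold absRelax
  have hex : ∃ t, IsLeast {t | absWait G q (G.c (G.ρ e.2))
    (absLink G q e tvisit (σ.C e.1)) t < σ.C e.2 t} t := ⟨t, h⟩
  simp only [hex, dif_pos]
  rw [show hex.choose = t from hex.choose_spec.unique h]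
  rfl

include hd

/-- Relaxing an edge replaces a profile by the minimum with the offered profile. -/
theorem absRelax_spec {σ : AbsState G} {e : Fin G.n × Fin G.n} (he : e ∈ G.E) (tvisit : ℤ) :
    (∀ v, (absRelax G q tvisit σ e).C v = if v = e.2 then
      fun t => min (σ.C e.2 t) (offer q tvisit (σ.C e.1) e t) else σ.C v) ∧
    (((∀ t, ¬ offer q tvisit (σ.C e.1) e t < σ.C e.2 t) ∧
        absRelax G q tvisit σ e = σ) ∨
      ∃ t, IsLeast {t | offer q tvisit (σ.C e.1) e t < σ.C e.2 t} t ∧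
        (absRelax G q tvisit σ e).queue =
          Function.update σ.queue e.2 (some (newKey (σ.queue e.2) t))) := by
  have hv := offer_upTo q tvisit (σ.C e.1) e
  have hoff : absWait G q (G.c (G.ρ e.2)) (absLink G q e tvisit (σ.C e.1)) =
      offer q tvisit (σ.C e.1) e := by
    rw [absLink_eq q hd he]; rfl
  by_cases h : ∃ t, IsLeast {t | offer q tvisit (σ.C e.1) e t < σ.C e.2 t} t
  · obtain ⟨t, hl⟩ := h
    rw [absRelax_of_isLeast q (by rw [hoff]; exact hl), hoff]
    generalize offer q tvisit (σ.C e.1) e = g at *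
    refine ⟨fun v => ?_, Or.inr ⟨t, hl, rfl⟩⟩
    split
    · rename_i hve
      subst hve
      dsimp only
      rw [Function.update_self]
      funext x
      split
      · rfl
      · rename_i hx
        symm
        apply min_eq_left
        by_contra hlt
        have hlt' := not_le.1 hlt
        have := hl.2 hlt'
        have := hv.bdd x hlt'.ne_top
        exact hx ⟨by omega, by omega⟩
    · rename_i hve
      exact Function.update_of_ne hve _ _
  · have hσ : absRelax G q tvisit σ e = σ := by
      rw [← hoff] at h
      exact dif_neg h
    rw [hσ]
    have hno : ∀ t, ¬ offer q tvisit (σ.C e.1) e t < σ.C e.2 t := fun t ht =>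
      h (exists_isLeast_lt hv ht)
    refine ⟨fun v => ?_, Or.inl ⟨hno, rfl⟩⟩
    split
    · rename_i hve
      subst hve
      funext x
      exact (min_eq_left (not_lt.1 (hno x))).symm
    · rfl

/-- The stored profiles represent functions whose domains are intervals that end at `tmax`. -/
structure Rep (σ : State G) : Prop where
  repr : ∀ v, Repr (σ.prof v) (σ.toAbs.C v)
  upTo : ∀ v, UpTo q.tmin q.tmax (σ.toAbs.C v)

/-- Relaxing an edge on stored profiles represents relaxing it on functions, and a profile that
changes is pruned. -/
theorem relax_spec {σ : State G} (hσ : Rep q σ) {e : Fin G.n × Fin G.n} (he : e ∈ G.E)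
    (tvisit : ℤ) : (relax G q tvisit σ e).val.toAbs = absRelax G q tvisit σ.toAbs e ∧
    Rep q (relax G q tvisit σ e).val ∧
    ∀ v, (relax G q tvisit σ e).val.prof v = σ.prof v ∨
      IsPruned ((relax G q tvisit σ e).val.prof v) := by
  have hoff := absRelax_spec q hd (σ := σ.toAbs) he tvisit
  have hlink := link_repr he hd tvisit (hσ.repr e.1) (hσ.upTo e.1)
  have hlu := linkFun_upTo he (tvisit := tvisit) (hσ.upTo e.1)
  have hwait : Repr (waiting (G.c (G.ρ e.2))
      (link (G.Φ e) (G.δ e) G.d (G.c 0) tvisit q.tmax (σ.prof e.1)).val).val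
      (offer q tvisit (σ.toAbs.C e.1) e) := waiting_repr q _ hlink hlu
  have himp := improve_spec (hσ.repr e.2) hwait (hσ.upTo e.2) (offer_upTo q tvisit _ e)
  simp only [relax, Timed.val_bind, Timed.val_load]
  split
  · rename_i hnone
    have hno := himp.1 hnone
    refine ⟨?_, hσ, fun v => Or.inl rfl⟩
    rcases hoff.2 with h | ⟨t, h, -⟩
    · exact h.2.symm
    · exact absurd h.1 (hno t)
  · rename_i t f' hsome
    obtain ⟨hl, hr, hp⟩ := himp.2 t f' hsome
    have hC : ∀ v, Profile.toFun (Function.update σ.prof e.2 f' v) =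
        (absRelax G q tvisit σ.toAbs e).C v := by
      intro v
      rw [hoff.1 v]
      split
      · rename_i hv
        subst hv
        rw [Function.update_self]
        exact hr.toFun_eq
      · rename_i hv
        rw [Function.update_of_ne hv]; rfl
    have heq : State.toAbs (G := G) ⟨Function.update σ.prof e.2 f',
        Function.update σ.queue e.2 (some (decreaseKey (σ.queue e.2) t).val)⟩ =
        absRelax G q tvisit σ.toAbs e := by
      rcases hoff.2 with h | ⟨t', h, hq⟩
      · exact absurd hl.1 (h.1 t)
      · obtain rfl := hl.unique h
        generalize absRelax G q tvisit σ.toAbs e = τ at *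
        rcases τ with ⟨C, Q⟩
        simp only [State.toAbs, AbsState.mk.injEq]
        refine ⟨funext hC, ?_⟩
        simp only at hq
        rw [hq, decreaseKey_val]; rfl
    simp only [Timed.val_bind, Timed.val_load, Timed.val_pure]
    refine ⟨heq, ⟨fun v => ?_, fun v => ?_⟩, fun v => ?_⟩
    · change Repr (Function.update σ.prof e.2 f' v) (Profile.toFun (Function.update σ.prof e.2 f' v))
      by_cases hv : v = e.2
      · subst hv
        rw [Function.update_self, hr.toFun_eq]; exact hr
      · rw [Function.update_of_ne hv]; exact hσ.repr v
    · change UpTo q.tmin q.tmax (Profile.toFun (Function.update σ.prof e.2 f' v))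
      by_cases hv : v = e.2
      · subst hv
        rw [Function.update_self, hr.toFun_eq]
        exact (hσ.upTo _).min (offer_upTo q tvisit _ e)
      · rw [Function.update_of_ne hv]; exact hσ.upTo v
    · by_cases hv : v = e.2
      · subst hv
        right
        simp only [Function.update_self]; exact hp
      · left
        simp only [Function.update_of_ne hv]

end Relax

/-! ### Optimal costs -/

section Opt

variable {G : RoadGraph} (q : Query G)

open Classical in
/-- The least costs of being at the vertex `v` at time `t`, by the Bellman equation, for `d = c₀`.
Then the latest departure on an edge is the best one, since waiting at a vertex never costs more
than the time on an edge. The planning horizon is not limited. -/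
noncomputable def opt (v : Fin G.n) (t : ℤ) : WithTop ℚ :=
  if t < q.tmin then ⊤ else
    min (min (if v = q.s ∧ t = q.tmin then 0 else ⊤) (opt v (t - 1) + (G.c (G.ρ v) : ℚ)))
      (Finset.univ.inf fun u : Fin G.n => if (u, v) ∈ G.E then
        opt u (lastDep G (u, v) t) + ((G.c 0 * (t - lastDep G (u, v) t) : ℚ) : WithTop ℚ) else ⊤)
termination_by (t + 1 - q.tmin).toNat
decreasing_by
  · omega
  · have := (lastDep_spec (e := (u, v)) ‹_› t).1
    omega

theorem opt_of_lt {v : Fin G.n} {t : ℤ} (h : t < q.tmin) : opt q v t = ⊤ := by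
  unfold opt; exact if_pos h

theorem opt_start : opt q q.s q.tmin ≤ 0 := by
  unfold opt
  rw [if_neg (by omega)]
  refine (min_le_left _ _).trans ((min_le_left _ _).trans ?_)
  simp

theorem opt_wait (v : Fin G.n) (t : ℤ) : opt q v (t + 1) ≤ opt q v t + (G.c (G.ρ v) : ℚ) := by
  by_cases h : t + 1 < q.tmin
  · rw [opt_of_lt q (show t < q.tmin by omega), WithTop.top_add]; exact le_top
  · rw [opt.eq_def q v (t + 1), if_neg h, add_sub_cancel_right]
    exact (min_le_left _ _).trans (min_le_right _ _)

theorem opt_edge {e : Fin G.n × Fin G.n} (he : e ∈ G.E) (t : ℤ) : opt q e.2 t ≤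
    opt q e.1 (lastDep G e t) + ((G.c 0 * (t - lastDep G e t) : ℚ) : WithTop ℚ) := by
  by_cases h : t < q.tmin
  · rw [opt_of_lt q ((lastDep_spec he t).1.trans h), WithTop.top_add]; exact le_top
  · rw [opt.eq_def q e.2 t, if_neg h]
    refine (min_le_right _ _).trans ((Finset.inf_le (Finset.mem_univ e.1)).trans ?_)
    rw [if_pos he]

theorem coe_sub_of_add_eq {a : WithTop ℚ} {x y : ℚ} (h : a + (y : ℚ) = (x : ℚ)) :
    a = (x - y : ℚ) := by
  induction a using WithTop.recTopCoe with
  | top => rw [WithTop.top_add] at h; exact absurd h WithTop.top_ne_coe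
  | coe a =>
    rw [← WithTop.coe_add] at h
    rw [← WithTop.coe_injective h]; congr 1; ring

/-- Finite optimal costs come from the start, from waiting, or from an edge. -/
theorem opt_cases {v : Fin G.n} {t : ℤ} {x : ℚ} (h : opt q v t = x) :
    (v = q.s ∧ t = q.tmin ∧ x = 0) ∨ opt q v (t - 1) = (x - G.c (G.ρ v) : ℚ) ∨
    ∃ u, (u, v) ∈ G.E ∧ opt q u (lastDep G (u, v) t) =
      (x - G.c 0 * (t - lastDep G (u, v) t) : ℚ) := by
  classical
  have h' := h
  rw [opt.eq_def q v t] at h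
  split at h
  · exact absurd h WithTop.top_ne_coe
  rcases min_choice (min (if v = q.s ∧ t = q.tmin then (0 : WithTop ℚ) else ⊤)
    (opt q v (t - 1) + (G.c (G.ρ v) : ℚ)))
      (Finset.univ.inf fun u : Fin G.n => if (u, v) ∈ G.E then
        opt q u (lastDep G (u, v) t) + ((G.c 0 * (t - lastDep G (u, v) t) : ℚ) : WithTop ℚ) else ⊤)
    with h1 | h1
  · rw [h1] at h
    rcases min_choice (if v = q.s ∧ t = q.tmin then (0 : WithTop ℚ) else ⊤)
      (opt q v (t - 1) + (G.c (G.ρ v) : ℚ)) with h2 | h2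
    · rw [h2] at h
      split at h
      · rename_i h3
        exact Or.inl ⟨h3.1, h3.2, (WithTop.coe_injective h).symm⟩
      · exact absurd h WithTop.top_ne_coe
    · rw [h2] at h
      exact Or.inr (Or.inl (coe_sub_of_add_eq h))
  · rw [h1] at h
    have hne : (Finset.univ : Finset (Fin G.n)).Nonempty := ⟨v, Finset.mem_univ v⟩
    obtain ⟨u, -, hu⟩ := Finset.exists_mem_eq_inf Finset.univ hne (fun u : Fin G.n =>
      if (u, v) ∈ G.E then opt q u (lastDep G (u, v) t) +
        ((G.c 0 * (t - lastDep G (u, v) t) : ℚ) : WithTop ℚ) else ⊤)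
    rw [hu] at h
    split at h
    · rename_i h3
      exact Or.inr (Or.inr ⟨u, h3, coe_sub_of_add_eq h⟩)
    · exact absurd h WithTop.top_ne_coe

theorem opt_ne_top_ge {v : Fin G.n} {t : ℤ} (h : opt q v t ≠ ⊤) : q.tmin ≤ t := by
  by_contra hlt
  exact h (opt_of_lt q (by omega))

theorem int_strong_induction {P : ℤ → Prop} (lo : ℤ) (base : ∀ t < lo, P t)
    (step : ∀ t, lo ≤ t → (∀ t' < t, P t') → P t) (t : ℤ) : P t := by
  have : ∀ n : ℕ, ∀ t < lo + n, P t := by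
    intro n
    induction n with
    | zero => intro t ht; exact base t (by simpa using ht)
    | succ n ih =>
      intro t ht
      rcases lt_or_ge t lo with h | h
      · exact base t h
      · exact step t h fun t' ht' => ih t' (by push_cast at ht; omega)
  exact this (t - lo + 1).toNat t (by omega)

/-- Induction along an optimal route. -/
theorem opt_induction {P : Fin G.n → ℤ → ℚ → Prop} (start : P q.s q.tmin 0)
    (wait : ∀ v t x, opt q v t = (x : ℚ) → P v t x →
      opt q v (t + 1) = (x + G.c (G.ρ v) : ℚ) → P v (t + 1) (x + G.c (G.ρ v)))
    (edge : ∀ e ∈ G.E, ∀ t x, opt q e.1 (lastDep G e t) = (x : ℚ) → P e.1 (lastDep G e t) x →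
      opt q e.2 t = (x + G.c 0 * (t - lastDep G e t) : ℚ) →
      P e.2 t (x + G.c 0 * (t - lastDep G e t)))
    (v : Fin G.n) (t : ℤ) (x : ℚ) (h : opt q v t = x) : P v t x := by
  revert v x
  induction t using int_strong_induction (lo := q.tmin) with
  | base t ht => intro v x h; rw [opt_of_lt q ht] at h; exact absurd h WithTop.top_ne_coe
  | step t ht ih =>
    intro v x h
    rcases opt_cases q h with ⟨rfl, rfl, rfl⟩ | h1 | ⟨u, hu, h1⟩
    · exact start
    · have := wait v (t - 1) _ h1 (ih _ (by omega) v _ h1)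
      rw [sub_add_cancel, sub_add_cancel] at this
      exact this h
    · have := edge (u, v) hu t _ h1 (ih _ (lastDep_spec hu t).1 u _ h1)
      rw [sub_add_cancel] at this
      exact this h

end Opt

/-! ### Values of costs -/

section Cost

variable (G : RoadGraph) (q : Query G)

/-- A common denominator of the waiting costs. -/
def commonDen : ℕ := ∏ i, (G.c i).den

/-- The values that the costs of being somewhere at time `t` may have. -/
structure IsCost (t : ℤ) (y : ℚ) : Prop where
  nonneg : 0 ≤ y
  le : y ≤ G.c 0 * (t - q.tmin)
  den : ∃ z : ℤ, y * commonDen G = z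

variable {G}

theorem c_le (i : Fin (G.r + 1)) : G.c i ≤ G.c 0 := G.c_strictAnti.antitone (Fin.zero_le i)

theorem c_mul_den (i : Fin (G.r + 1)) : ∃ z : ℤ, G.c i * commonDen G = z := by
  unfold commonDen
  rw [← Finset.mul_prod_erase Finset.univ (fun i => (G.c i).den) (Finset.mem_univ i)]
  refine ⟨(G.c i).num * ∏ j ∈ Finset.univ.erase i, ((G.c j).den : ℤ), ?_⟩
  push_cast
  rw [← mul_assoc, Rat.mul_den_eq_num]

variable {q}

theorem IsCost.add {t k : ℤ} {y : ℚ} (h : IsCost G q t y) (hk : 0 ≤ k) (i : Fin (G.r + 1)) :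
    IsCost G q (t + k) (y + G.c i * k) := by
  have hk' : (0 : ℚ) ≤ k := by exact_mod_cast hk
  have h0 := G.c_nonneg i
  have h1 := c_le i
  refine ⟨add_nonneg h.nonneg (mul_nonneg h0 hk'), ?_, ?_⟩
  · have := h.le
    push_cast
    nlinarith
  · obtain ⟨z, hz⟩ := h.den
    obtain ⟨z', hz'⟩ := c_mul_den i
    refine ⟨z + z' * k, ?_⟩
    push_cast
    rw [← hz, ← hz']; ring

theorem opt_isCost {v : Fin G.n} {t : ℤ} {x : ℚ} (h : opt q v t = x) : IsCost G q t x := by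
  refine opt_induction q (P := fun _ t x => IsCost G q t x) ?_ ?_ ?_ v t x h
  · exact ⟨le_rfl, by simp, 0, by simp⟩
  · intro v t x _ h1 _
    simpa using h1.add (k := 1) (by norm_num) (G.ρ v)
  · intro e he t x _ h1 _
    have := h1.add (k := t - lastDep G e t) (by have := (lastDep_spec he t).1; omega) 0
    rw [add_sub_cancel] at this
    push_cast at this
    exact this

theorem opt_mono (v : Fin G.n) {t t' : ℤ} (h : t ≤ t') :
    opt q v t' ≤ opt q v t + ((G.c 0 * (t' - t) : ℚ) : WithTop ℚ) := by
  induction t', h using Int.leInduction with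
  | base => simp
  | succ k hk ih =>
    refine (opt_wait q v k).trans ((add_le_add ih (WithTop.coe_le_coe.2 (c_le (G.ρ v)))).trans ?_)
    rw [add_assoc, ← WithTop.coe_add]
    refine add_le_add le_rfl (WithTop.coe_le_coe.2 (le_of_eq ?_))
    push_cast; ring

end Cost

/-! ### Shifting routes in time -/

section Shift

variable {G : RoadGraph} (q : Query G)

/-- Both shifts by a time unit, if they are possible at the tail of an edge, are possible at its
head, unless a ban begins or ends at the wrong time. Here `x` are the costs of being at the head at
time `t`. -/
theorem shift_edge {e : Fin G.n × Fin G.n} (he : e ∈ G.E) {t : ℤ} {x : ℚ} {P : Prop}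
    {lo hi : WithTop ℚ} {lo' hi' : WithTop ℚ}
    (hI : ∀ I ∈ G.Φ e, lastDep G e t ≠ I.2 ∧ t ≠ I.1)
    (hx : ∃ i, lo' + (G.c i : ℚ) ≤ (x - G.c 0 * (t - lastDep G e t) : ℚ) ∧
      hi' ≤ (x - G.c 0 * (t - lastDep G e t) + G.c i : ℚ))
    (h1 : lastDep G e t ≤ lastDep G e (t - 1) → lo + (G.c 0 : ℚ) ≤ x)
    (h2 : P → hi ≤ (x + G.c 0 : ℚ))
    (h3 : lastDep G e t - 1 ≤ lastDep G e (t - 1) →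
      lo ≤ lo' + ((G.c 0 * (t - lastDep G e t) : ℚ) : WithTop ℚ))
    (h4 : P → lastDep G e t + 1 ≤ lastDep G e (t + 1) →
      hi ≤ hi' + ((G.c 0 * (t - lastDep G e t) : ℚ) : WithTop ℚ)) :
    ∃ i, lo + (G.c i : ℚ) ≤ x ∧ (P → hi ≤ (x + G.c i : ℚ)) := by
  rcases lastDep_cases he t with ⟨I, hI', h⟩ | ⟨I, hI', h⟩ | h | ⟨ha, hb⟩
  · exact absurd h (hI I hI').1
  · exact absurd h (hI I hI').2
  · exact ⟨0, h1 h, h2⟩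
  · obtain ⟨i, hx1, hx2⟩ := hx
    refine ⟨i, ?_, fun hP => ?_⟩
    · refine (add_le_add (h3 ha) le_rfl).trans ?_
      rw [add_right_comm]
      refine (add_le_add hx1 le_rfl).trans ?_
      rw [← WithTop.coe_add]
      exact WithTop.coe_le_coe.2 (by linarith)
    · refine (h4 hP hb).trans ((add_le_add hx2 le_rfl).trans ?_)
      rw [← WithTop.coe_add]
      exact WithTop.coe_le_coe.2 (by linarith)

/-- The costs of being somewhere, compared to driving all the time, at those places and times at
which a route cannot be shifted: at the beginning, at the tail of an edge when a ban on it ends,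
and at its head when a ban on it begins. -/
noncomputable def banValues : Finset ℚ :=
  ((0 - G.c 0 * q.tmin) :: G.E.flatMap fun e => (G.Φ e).flatMap fun I =>
    [(opt q e.1 I.2).untopD 0 - G.c 0 * I.2, (opt q e.2 I.1).untopD 0 - G.c 0 * I.1]).toFinset

theorem start_mem_banValues : 0 - G.c 0 * q.tmin ∈ banValues q := by
  simp [banValues]

theorem tail_mem_banValues {e : Fin G.n × Fin G.n} (he : e ∈ G.E) {I : ℤ × ℤ} (hI : I ∈ G.Φ e)
    {y : ℚ} (h : opt q e.1 I.2 = y) : y - G.c 0 * I.2 ∈ banValues q := by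
  simp only [banValues, List.mem_toFinset, List.mem_cons, List.mem_flatMap]
  exact Or.inr ⟨e, he, I, hI, by rw [h]; simp⟩

theorem head_mem_banValues {e : Fin G.n × Fin G.n} (he : e ∈ G.E) {I : ℤ × ℤ} (hI : I ∈ G.Φ e)
    {y : ℚ} (h : opt q e.2 I.1 = y) : y - G.c 0 * I.1 ∈ banValues q := by
  simp only [banValues, List.mem_toFinset, List.mem_cons, List.mem_flatMap]
  exact Or.inr ⟨e, he, I, hI, by rw [h]; simp⟩

theorem le_coe_of_eq {a : WithTop ℚ} {x y z : ℚ} {b : WithTop ℚ} (h : a ≤ b + (x : ℚ))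
    (hb : b = (z : ℚ)) (hxy : z + x ≤ y) : a ≤ y := by
  rw [hb, ← WithTop.coe_add] at h; exact h.trans (WithTop.coe_le_coe.2 hxy)

/-- Optimal costs are locally concave except where no shift is possible. -/
theorem opt_shift {v : Fin G.n} {t : ℤ} {x : ℚ} (h : opt q v t = x) :
    x - G.c 0 * t ∈ banValues q ∨ ∃ i, opt q v (t - 1) + (G.c i : ℚ) ≤ x ∧
      opt q v (t + 1) ≤ (x + G.c i : ℚ) := by
  refine opt_induction q (P := fun v t x => x - G.c 0 * t ∈ banValues q ∨
    ∃ i, opt q v (t - 1) + (G.c i : ℚ) ≤ x ∧ opt q v (t + 1) ≤ (x + G.c i : ℚ)) ?_ ?_ ?_ v t x h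
  · exact Or.inl (start_mem_banValues q)
  · intro v t x h0 _ h1
    right
    refine ⟨G.ρ v, ?_, ?_⟩
    · rw [add_sub_cancel_right, h0, ← WithTop.coe_add]
    · exact le_coe_of_eq (opt_wait q v (t + 1)) h1 le_rfl
  · intro e he t x h0 ih h1
    have hval : x + G.c 0 * (t - lastDep G e t) - G.c 0 * t = x - G.c 0 * lastDep G e t := by ring
    rcases ih with ih | ih
    · left; rw [hval]; exact ih
    by_cases hI : ∃ I ∈ G.Φ e, lastDep G e t = I.2
    · obtain ⟨I, hI, h2⟩ := hI
      left; rw [hval]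
      rw [h2] at h0 ⊢
      exact tail_mem_banValues q he hI h0
    by_cases hA : ∃ I ∈ G.Φ e, t = I.1
    · obtain ⟨I, hI', rfl⟩ := hA
      left
      exact head_mem_banValues q he hI' h1
    right
    have edge' : ∀ D t', D ≤ lastDep G e t' → opt q e.2 t' ≤ opt q e.1 D +
        ((G.c 0 * (t' - D) : ℚ) : WithTop ℚ) := by
      intro D t' hD
      refine (opt_edge q he t').trans ((add_le_add (opt_mono e.1 hD) le_rfl).trans (le_of_eq ?_))
      rw [add_assoc, ← WithTop.coe_add]; congr 2; ring
    have := shift_edge (P := True) he (t := t) (x := x + G.c 0 * (t - lastDep G e t))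
      (lo := opt q e.2 (t - 1)) (hi := opt q e.2 (t + 1))
      (lo' := opt q e.1 (lastDep G e t - 1)) (hi' := opt q e.1 (lastDep G e t + 1))
      (fun I hI' => ⟨fun h2 => hI ⟨I, hI', h2⟩, fun h2 => hA ⟨I, hI', h2⟩⟩)
      (by rw [add_sub_cancel_right]; exact ih) (fun h2 => ?_) (fun _ => ?_) (fun h2 => ?_)
      (fun _ h2 => ?_)
    · obtain ⟨i, h3, h4⟩ := this
      exact ⟨i, h3, h4 trivial⟩
    · have := edge' _ _ h2
      rw [h0, ← WithTop.coe_add] at this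
      refine (add_le_add this le_rfl).trans ?_
      rw [← WithTop.coe_add]
      exact WithTop.coe_le_coe.2 (by push_cast; linarith)
    · refine le_coe_of_eq (opt_wait q e.2 t) h1 ?_
      have := c_le (G.ρ e.2); linarith
    · refine (edge' _ _ h2).trans (le_of_eq ?_)
      congr 2; push_cast; ring
    · refine (edge' _ _ h2).trans (le_of_eq ?_)
      congr 2; push_cast; ring

end Shift

/-! ### Invariants of the main loop -/

section Invariants

variable {G : RoadGraph} (q : Query G)

/-- What holds for the profiles at any time: in particular, they are not below the optimum, and
waiting is taken account of. -/
structure Profiles (C : Fin G.n → ℤ → WithTop ℚ) : Prop where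
  upTo : ∀ v, UpTo q.tmin q.tmax (C v)
  wait : ∀ v t, t < q.tmax → C v (t + 1) ≤ C v t + (G.c (G.ρ v) : ℚ)
  opt_le : ∀ v t, opt q v t ≤ C v t
  cost : ∀ v t y, C v t = (y : ℚ) → IsCost G q t y
  start : C q.s q.tmin ≤ 0

/-- The profiles take account of traversing the edge `e` such that its head is reached at time `t`.
-/
def Relaxed (C : Fin G.n → ℤ → WithTop ℚ) (e : Fin G.n × Fin G.n) (t : ℤ) : Prop :=
  C e.2 t ≤ C e.1 (lastDep G e t) + ((G.c 0 * (t - lastDep G e t) : ℚ) : WithTop ℚ)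

/-- Those keys that a vertex can have when it is visited: it cannot be reached earlier, or its
optimal costs at the time before either are determined by a ban interval or have a concave kink
there. -/
def GoodKey (v : Fin G.n) (k : ℤ) : Prop :=
  k ≤ q.tmax ∧ ∃ y : ℚ, opt q v k = y ∧ (opt q v (k - 1) = ⊤ ∨ ∃ x : ℚ, opt q v (k - 1) = x ∧
    ((y < x + G.c 0 ∧ x - G.c 0 * (k - 1 : ℤ) ∈ banValues q) ∨
      ∃ i, y < x + G.c i ∧ opt q v (k - 1 - 1) + (G.c i : ℚ) ≤ x))

/-- The invariant of the main loop. The vertices and keys in `popped` have been visited, the last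
one at time `tvisit`, and the edges in `pending` have not been relaxed yet on this visit. The
values in `Φ` are the costs, compared to driving all the time, at those places and times at which a
route that the profiles take account of cannot be shifted. -/
structure LoopInv (Φ : Finset ℚ) (popped : Finset (Fin G.n × ℤ)) (tvisit : ℤ)
    (pending : List (Fin G.n × Fin G.n)) (σ : AbsState G) : Prop where
  profiles : Profiles q σ.C
  shift : ∀ v t x, σ.C v t = (x : ℚ) → x - G.c 0 * t ∈ Φ ∨
    ∃ i, σ.C v (t - 1) + (G.c i : ℚ) ≤ x ∧ (t < q.tmax → σ.C v (t + 1) ≤ (x + G.c i : ℚ))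
  final_shift : ∀ v t x, σ.C v t = (x : ℚ) → opt q v t = x → x - G.c 0 * t ∈ banValues q ∨
    ∃ i, opt q v (t - 1) + (G.c i : ℚ) ≤ x ∧ (t < q.tmax → σ.C v (t + 1) ≤ (x + G.c i : ℚ))
  relaxed : ∀ e ∈ G.E, ∀ t ≤ q.tmax, Relaxed σ.C e t ∨
    (∃ k, σ.queue e.1 = some k ∧ k ≤ lastDep G e t) ∨ (e ∈ pending ∧ tvisit ≤ lastDep G e t)
  key : ∀ v k, σ.queue v = some k → σ.C v k ≠ ⊤ ∧
    (σ.C v (k - 1) = opt q v (k - 1) → GoodKey q v k)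
  popped_good : ∀ p ∈ popped, GoodKey q p.1 p.2
  popped_le : ∀ p ∈ popped, ∀ v k, σ.queue v = some k → p.2 ≤ k ∧ (v = p.1 → p.2 < k)
  popped_le' : ∀ p ∈ popped, p.2 ≤ tvisit

variable {q}

theorem Profiles.mono {C : Fin G.n → ℤ → WithTop ℚ} (H : Profiles q C) (v : Fin G.n) {t t' : ℤ}
    (h : t ≤ t') (ht' : t' ≤ q.tmax) :
    C v t' ≤ C v t + ((G.c 0 * (t' - t) : ℚ) : WithTop ℚ) := by
  induction t', h using Int.leInduction with
  | base => simp
  | succ k hk ih =>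
    refine (H.wait v k (by omega)).trans
      ((add_le_add (ih (by omega)) (WithTop.coe_le_coe.2 (c_le (G.ρ v)))).trans ?_)
    rw [add_assoc, ← WithTop.coe_add]
    refine add_le_add le_rfl (WithTop.coe_le_coe.2 (le_of_eq ?_))
    push_cast; ring

/-- New values at which routes cannot be shifted when the edge is relaxed. -/
noncomputable def newValues (C : Fin G.n → ℤ → WithTop ℚ) (e : Fin G.n × Fin G.n) (tvisit : ℤ) :
    Finset ℚ :=
  ((tvisit :: (G.Φ e).flatMap fun I => [lastDep G e I.1, I.2]).map fun D =>
    (C e.1 D).untopD 0 - G.c 0 * D).toFinset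

/-! ### Offered profiles -/

theorem linkFun_cases {e : Fin G.n × Fin G.n} {tvisit tmax : ℤ} {f : ℤ → WithTop ℚ} {t : ℤ} {x : ℚ}
    (h : linkFun G e tvisit tmax f t = x) : tvisit ≤ lastDep G e t ∧ t ≤ tmax ∧
      f (lastDep G e t) = (x - G.c 0 * (t - lastDep G e t) : ℚ) := by
  unfold linkFun at h
  split at h
  · rename_i h'
    exact ⟨h'.1, h'.2, coe_sub_of_add_eq h⟩
  · exact absurd h WithTop.top_ne_coe

/-- An offered value comes from the edge or from waiting at its head. -/
theorem offer_cases {e : Fin G.n × Fin G.n} {tvisit : ℤ} {f : ℤ → WithTop ℚ} {t : ℤ} {x : ℚ}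
    (h : offer q tvisit f e t = x) : linkFun G e tvisit q.tmax f t = x ∨
      offer q tvisit f e (t - 1) = (x - G.c (G.ρ e.2) : ℚ) := by
  have hb := (offer_upTo q tvisit f e).bdd t (by rw [h]; exact WithTop.coe_ne_top)
  have h' := absWait_eq (f := linkFun G e tvisit q.tmax f) q (G.c (G.ρ e.2)) hb.1 hb.2
  change offer q tvisit f e t = min _ (offer q tvisit f e (t - 1) + _) at h'
  rw [h] at h'
  rcases min_choice (linkFun G e tvisit q.tmax f t)
    (offer q tvisit f e (t - 1) + (G.c (G.ρ e.2) : ℚ)) with h1 | h1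
  · rw [h1] at h'; exact Or.inl h'.symm
  · rw [h1] at h'; exact Or.inr (coe_sub_of_add_eq h'.symm)

/-- Induction on the waiting time at the head of an edge. -/
theorem offer_induction {e : Fin G.n × Fin G.n} {tvisit : ℤ} {f : ℤ → WithTop ℚ}
    {P : ℤ → ℚ → Prop} (link : ∀ t x, linkFun G e tvisit q.tmax f t = (x : ℚ) → P t x)
    (wait : ∀ t x, P t x → P (t + 1) (x + G.c (G.ρ e.2))) {t : ℤ} {x : ℚ}
    (h : offer q tvisit f e t = x) : P t x := by
  revert x
  induction t using int_strong_induction (lo := q.tmin) with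
  | base t ht =>
    intro x h
    have := (offer_upTo q tvisit f e).bdd t (by rw [h]; exact WithTop.coe_ne_top)
    omega
  | step t ht ih =>
    intro x h
    rcases offer_cases h with h1 | h1
    · exact link t x h1
    · have := wait _ _ (ih (t - 1) (by omega) h1)
      rwa [sub_add_cancel, sub_add_cancel] at this

section Offer

variable {e : Fin G.n × Fin G.n} (he : e ∈ G.E) {tvisit : ℤ} {C : Fin G.n → ℤ → WithTop ℚ}
  (H : Profiles q C)

theorem offer_wait (tvisit : ℤ) (f : ℤ → WithTop ℚ) (e : Fin G.n × Fin G.n) {t : ℤ}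
    (ht : t < q.tmax) : offer q tvisit f e (t + 1) ≤
      offer q tvisit f e t + (G.c (G.ρ e.2) : ℚ) := absWait_succ_le q _ t ht

include he

/-- Driving takes time, so a visit improves profiles only at later times. This makes the keys of
consecutive visits monotone. -/
theorem offer_lt_top_gt {f : ℤ → WithTop ℚ} {t : ℤ} (h : offer q tvisit f e t ≠ ⊤) : tvisit < t := by
  obtain ⟨x, hx⟩ := WithTop.ne_top_iff_exists.1 h
  refine offer_induction (P := fun t _ => tvisit < t) (fun t x h => ?_)
    (fun t x h => by omega) hx.symm
  have := (linkFun_cases h).1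
  have := (lastDep_spec he t).1
  omega

include H

/-- Any sufficiently early departure not before the visit counts, not only the latest one. -/
theorem offer_le {D t : ℤ} (hD : D ≤ lastDep G e t) (hv : tvisit ≤ D) (ht : t ≤ q.tmax) :
    offer q tvisit (C e.1) e t ≤ C e.1 D + ((G.c 0 * (t - D) : ℚ) : WithTop ℚ) := by
  refine (absWait_le q _ (linkFun_upTo he (H.upTo e.1)) t).trans ?_
  rw [linkFun, if_pos ⟨hv.trans hD, ht⟩]
  have := (lastDep_spec he t).1
  refine (add_le_add (H.mono e.1 hD (by omega)) le_rfl).trans (le_of_eq ?_)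
  rw [add_assoc, ← WithTop.coe_add]; congr 2; ring

theorem offer_opt_le (t : ℤ) : opt q e.2 t ≤ offer q tvisit (C e.1) e t := by
  by_cases h : offer q tvisit (C e.1) e t = ⊤
  · rw [h]; exact le_top
  obtain ⟨x, hx⟩ := WithTop.ne_top_iff_exists.1 h
  rw [← hx]
  refine offer_induction (P := fun t x => opt q e.2 t ≤ (x : ℚ)) (fun t x h => ?_)
    (fun t x h => ?_) hx.symm
  · obtain ⟨-, -, h1⟩ := linkFun_cases h
    have h2 := H.opt_le e.1 (lastDep G e t)
    rw [h1] at h2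
    refine (opt_edge q he t).trans ((add_le_add h2 le_rfl).trans ?_)
    rw [← WithTop.coe_add]
    exact WithTop.coe_le_coe.2 (by linarith)
  · exact (opt_wait q e.2 t).trans (add_le_add h le_rfl)

theorem offer_cost {t : ℤ} {x : ℚ} (h : offer q tvisit (C e.1) e t = x) : IsCost G q t x := by
  refine offer_induction (P := IsCost G q) (fun t x h => ?_) (fun t x h => ?_) h
  · obtain ⟨-, -, h1⟩ := linkFun_cases h
    have h2 := (H.cost _ _ _ h1).add (k := t - lastDep G e t)
      (by have := (lastDep_spec he t).1; omega) 0
    rw [add_sub_cancel] at h2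
    push_cast at h2
    rwa [sub_add_cancel] at h2
  · simpa using h.add (k := 1) (by norm_num) (G.ρ e.2)

/-- The profiles after relaxing an edge. -/
theorem Profiles.relax {C' : Fin G.n → ℤ → WithTop ℚ}
    (hC : ∀ v, C' v = if v = e.2 then fun t => min (C e.2 t) (offer q tvisit (C e.1) e t) else C v) :
    Profiles q C' := by
  have hcase : ∀ v, C' v = C v ∨
      v = e.2 ∧ C' v = fun t => min (C e.2 t) (offer q tvisit (C e.1) e t) := by
    intro v
    rw [hC v]
    split
    · rename_i h; exact Or.inr ⟨h, rfl⟩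
    · exact Or.inl rfl
  refine ⟨fun v => ?_, fun v t ht => ?_, fun v t => ?_, fun v t y hy => ?_, ?_⟩
  · rcases hcase v with h | ⟨rfl, h⟩ <;> rw [h]
    · exact H.upTo v
    · exact (H.upTo _).min (offer_upTo q _ _ e)
  · rcases hcase v with h | ⟨rfl, h⟩ <;> rw [h]
    · exact H.wait v t ht
    · simp only
      rw [← min_add_add_right]
      exact min_le_min (H.wait _ t ht) (offer_wait tvisit _ e ht)
  · rcases hcase v with h | ⟨rfl, h⟩ <;> rw [h]
    · exact H.opt_le v t
    · exact le_min (H.opt_le _ t) (offer_opt_le he H t)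
  · rcases hcase v with h | ⟨rfl, h⟩ <;> rw [h] at hy
    · exact H.cost v t y hy
    · simp only at hy
      rcases min_choice (C e.2 t) (offer q tvisit (C e.1) e t) with h1 | h1 <;> rw [h1] at hy
      · exact H.cost _ t y hy
      · exact offer_cost he H hy
  · rcases hcase q.s with h | ⟨h', h⟩ <;> rw [h]
    · exact H.start
    · refine (min_le_left _ _).trans ?_
      rw [← h']; exact H.start

end Offer

/-- How the queue changes when an edge is relaxed. -/
theorem absRelax_queue (hd : G.d = G.c 0) {σ : AbsState G} {e : Fin G.n × Fin G.n} (he : e ∈ G.E)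
    (tvisit : ℤ) :
    (∀ v, v ≠ e.2 → (absRelax G q tvisit σ e).queue v = σ.queue v) ∧
    (∀ t, offer q tvisit (σ.C e.1) e t < σ.C e.2 t →
      ∃ k, (absRelax G q tvisit σ e).queue e.2 = some k ∧ k ≤ t) ∧
    (∀ k, σ.queue e.2 = some k → ∃ k', (absRelax G q tvisit σ e).queue e.2 = some k' ∧ k' ≤ k) ∧
    (∀ k, (absRelax G q tvisit σ e).queue e.2 = some k →
      (∀ t < k, ¬ offer q tvisit (σ.C e.1) e t < σ.C e.2 t) ∧
      (σ.queue e.2 = some k ∨ offer q tvisit (σ.C e.1) e k < σ.C e.2 k)) := by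
  rcases (absRelax_spec q hd he tvisit (σ := σ)).2 with ⟨h1, h2⟩ | ⟨t, h1, h2⟩
  · rw [h2]
    exact ⟨fun _ _ => rfl, fun t ht => absurd ht (h1 t), fun k hk => ⟨k, hk, le_rfl⟩,
      fun k hk => ⟨fun t _ => h1 t, Or.inl hk⟩⟩
  · rw [h2]
    have hlt : ∀ x < t, ¬ offer q tvisit (σ.C e.1) e x < σ.C e.2 x := fun x hx hc => by
      have := h1.2 hc; omega
    have hle : newKey (σ.queue e.2) t ≤ t := by
      unfold newKey; split <;> omega
    refine ⟨fun v hv => Function.update_of_ne hv _ _, fun x hx => ⟨_, Function.update_self _ _ _,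
      hle.trans (h1.2 hx)⟩, fun k hk => ⟨_, Function.update_self _ _ _, ?_⟩, fun k hk => ?_⟩
    · rw [hk]; exact min_le_left _ _
    · rw [Function.update_self, Option.some.injEq] at hk
      refine ⟨fun x hx => hlt x (by omega), ?_⟩
      rcases hq : σ.queue e.2 with _ | k'
      · rw [hq] at hk
        have : t = k := hk
        rw [← this]; exact Or.inr h1.1
      · rw [hq] at hk
        have hk' : min k' t = k := hk
        rcases min_choice k' t with h | h
        · left; rw [← hk', h]
        · right; rw [← hk', h]; exact h1.1

/-- An edge passes the value of its tail at the departure on to its head. -/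
theorem value_mem_newValues (C : Fin G.n → ℤ → WithTop ℚ) (e : Fin G.n × Fin G.n) (tvisit : ℤ)
    {t : ℤ} {x : ℚ} (h : C e.1 (lastDep G e t) = (x - G.c 0 * (t - lastDep G e t) : ℚ))
    (hc : lastDep G e t = tvisit ∨ ∃ I ∈ G.Φ e, lastDep G e t = I.2 ∨ t = I.1) :
    x - G.c 0 * t ∈ newValues C e tvisit := by
  rw [newValues, List.mem_toFinset, List.mem_map]
  refine ⟨lastDep G e t, ?_, ?_⟩
  · rcases hc with hc | ⟨I, hI, hc | hc⟩
    · rw [hc]; exact List.mem_cons_self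
    · refine List.mem_cons_of_mem _ (List.mem_flatMap.2 ⟨I, hI, ?_⟩)
      rw [hc]; simp
    · refine List.mem_cons_of_mem _ (List.mem_flatMap.2 ⟨I, hI, ?_⟩)
      rw [hc]; simp
  · rw [h, WithTop.untopD_coe]; ring

/-- Relaxing a pending edge preserves the invariant. -/
theorem LoopInv.relax (hd : G.d = G.c 0) {Φ : Finset ℚ} {popped : Finset (Fin G.n × ℤ)} {tvisit : ℤ}
    {pending : List (Fin G.n × Fin G.n)} {σ : AbsState G} {e : Fin G.n × Fin G.n} (he : e ∈ G.E)
    (H : LoopInv q Φ popped tvisit (e :: pending) σ) :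
    LoopInv q (Φ ∪ newValues σ.C e tvisit) popped tvisit pending (absRelax G q tvisit σ e) := by
  have hC := (absRelax_spec q hd he tvisit (σ := σ)).1
  obtain ⟨Q1, Q2, Q3, Q4⟩ := absRelax_queue (q := q) hd he tvisit (σ := σ)
  have P := H.profiles
  generalize absRelax G q tvisit σ e = σ' at *
  have P' := P.relax he hC
  have hle : ∀ v t, σ'.C v t ≤ σ.C v t := by
    intro v t
    rw [hC v]
    split
    · rename_i h; subst h; exact min_le_left _ _
    · exact le_rfl
  have hleo : ∀ t, σ'.C e.2 t ≤ offer q tvisit (σ.C e.1) e t := by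
    intro t
    rw [hC e.2, if_pos rfl]; exact min_le_right _ _
  have hval : ∀ v t (x : ℚ), σ'.C v t = x → σ.C v t = x ∨
      v = e.2 ∧ offer q tvisit (σ.C e.1) e t = x := by
    intro v t x h
    rw [hC v] at h
    split at h
    · rename_i h'; subst h'
      simp only at h
      rcases min_choice (σ.C e.2 t) (offer q tvisit (σ.C e.1) e t) with h1 | h1 <;> rw [h1] at h
      · exact Or.inl h
      · exact Or.inr ⟨rfl, h⟩
    · exact Or.inl h
  have hsame : ∀ v t, σ'.C v t = σ.C v t ∨
      v = e.2 ∧ offer q tvisit (σ.C e.1) e t < σ.C e.2 t := by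
    intro v t
    rw [hC v]
    split
    · rename_i h'; subst h'
      rcases lt_or_ge (offer q tvisit (σ.C e.1) e t) (σ.C e.2 t) with h1 | h1
      · exact Or.inr ⟨rfl, h1⟩
      · exact Or.inl (min_eq_left h1)
    · exact Or.inl rfl
  -- shifting an offered route at the head of the edge
  have hshift : ∀ t (x : ℚ) (lo lo' : WithTop ℚ),
      linkFun G e tvisit q.tmax (σ.C e.1) t = x →
      (∀ I ∈ G.Φ e, lastDep G e t ≠ I.2 ∧ t ≠ I.1) →
      (∃ i, lo' + (G.c i : ℚ) ≤ (x - G.c 0 * (t - lastDep G e t) : ℚ) ∧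
        (lastDep G e t < q.tmax →
          σ.C e.1 (lastDep G e t + 1) ≤ (x - G.c 0 * (t - lastDep G e t) + G.c i : ℚ))) →
      (lastDep G e t ≤ lastDep G e (t - 1) → lo + (G.c 0 : ℚ) ≤ x) →
      (lastDep G e t - 1 ≤ lastDep G e (t - 1) →
        lo ≤ lo' + ((G.c 0 * (t - lastDep G e t) : ℚ) : WithTop ℚ)) →
      ∃ i, lo + (G.c i : ℚ) ≤ x ∧ (t < q.tmax → σ'.C e.2 (t + 1) ≤ (x + G.c i : ℚ)) := by
    intro t x lo lo' hl hI ⟨i, hi1, hi2⟩ h1 h3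
    obtain ⟨l1, l2, l3⟩ := linkFun_cases hl
    have hlt := (lastDep_spec he t).1
    refine shift_edge (lo' := lo') (hi' := σ.C e.1 (lastDep G e t + 1)) he hI
      ⟨i, hi1, hi2 (by omega)⟩ h1 (fun h => ?_) h3 (fun h h' => ?_)
    · have h5 := (hleo t).trans (absWait_le q _ (linkFun_upTo he (P.upTo e.1)) t)
      rw [hl] at h5
      refine (P'.wait e.2 t h).trans ((add_le_add h5 le_rfl).trans ?_)
      rw [← WithTop.coe_add]
      exact WithTop.coe_le_coe.2 (by have := c_le (G.ρ e.2); linarith)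
    · refine (hleo (t + 1)).trans ((offer_le he P h' (by omega) (by omega)).trans (le_of_eq ?_))
      congr 2; push_cast; ring
  refine ⟨P', ?_, ?_, ?_, ?_, H.popped_good, ?_, H.popped_le'⟩
  -- `shift`: an offered route can be shifted unless the edge excludes this, or it has a value in
  -- `Φ` already at the tail
  · intro v t x hx
    rcases hval v t x hx with h | ⟨rfl, h⟩
    · rcases H.shift v t x h with h1 | ⟨i, h1, h2⟩
      · exact Or.inl (Finset.mem_union_left _ h1)
      · exact Or.inr ⟨i, (add_le_add (hle _ _) le_rfl).trans h1, fun ht => (hle _ _).trans (h2 ht)⟩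
    · rcases offer_cases h with h1 | h1
      · obtain ⟨l1, l2, l3⟩ := linkFun_cases h1
        by_cases hc : lastDep G e t = tvisit ∨ ∃ I ∈ G.Φ e, lastDep G e t = I.2 ∨ t = I.1
        · exact Or.inl (Finset.mem_union_right _ (value_mem_newValues σ.C e tvisit l3 hc))
        rw [not_or] at hc
        rcases H.shift _ _ _ l3 with h2 | h2
        · left
          refine Finset.mem_union_left _ ?_
          rwa [show x - G.c 0 * (t - lastDep G e t) - G.c 0 * lastDep G e t = x - G.c 0 * t by
            ring] at h2
        right
        refine hshift t x _ _ h1 (fun I hI => ?_) h2 (fun h3 => ?_) (fun h3 => ?_)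
        · have h4 : ¬ (lastDep G e t = I.2 ∨ t = I.1) := fun h4 => hc.2 ⟨I, hI, h4⟩
          tauto
        · have h4 := (hleo (t - 1)).trans (offer_le he P h3 l1 (by omega))
          rw [l3, ← WithTop.coe_add] at h4
          refine (add_le_add h4 le_rfl).trans ?_
          rw [← WithTop.coe_add]
          exact WithTop.coe_le_coe.2 (by push_cast; linarith)
        · refine (hleo (t - 1)).trans ((offer_le he P h3 (by omega) (by omega)).trans (le_of_eq ?_))
          congr 2; push_cast; ring
      · right
        refine ⟨G.ρ e.2, ?_, fun ht => ?_⟩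
        · refine (add_le_add (hleo _) le_rfl).trans ?_
          rw [h1, ← WithTop.coe_add]
          exact WithTop.coe_le_coe.2 (by linarith)
        · refine (hleo _).trans ((offer_wait _ _ _ ht).trans ?_)
          rw [h, ← WithTop.coe_add]
  -- `final_shift`: if the new value is optimal, so is the value at the tail
  · intro v t x hx hopt
    rcases hval v t x hx with h | ⟨rfl, h⟩
    · rcases H.final_shift v t x h hopt with h1 | ⟨i, h1, h2⟩
      · exact Or.inl h1
      · exact Or.inr ⟨i, h1, fun ht => (hle _ _).trans (h2 ht)⟩
    · rcases offer_cases h with h1 | h1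
      · obtain ⟨l1, l2, l3⟩ := linkFun_cases h1
        have hou : opt q e.1 (lastDep G e t) = (x - G.c 0 * (t - lastDep G e t) : ℚ) := by
          refine le_antisymm ((P.opt_le _ _).trans l3.le) ?_
          have h2 := opt_edge q he t
          rw [hopt] at h2
          generalize opt q e.1 (lastDep G e t) = a at *
          induction a using WithTop.recTopCoe with
          | top => exact le_top
          | coe a =>
            rw [← WithTop.coe_add] at h2
            have := WithTop.coe_le_coe.1 h2
            exact WithTop.coe_le_coe.2 (by linarith)
        have hv : x - G.c 0 * (t - lastDep G e t) - G.c 0 * lastDep G e t = x - G.c 0 * t := by ring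
        by_cases hI : ∃ I ∈ G.Φ e, lastDep G e t = I.2
        · obtain ⟨I, hI, h2⟩ := hI
          left
          rw [← hv, h2]
          rw [h2] at hou
          exact tail_mem_banValues q he hI hou
        by_cases hA : ∃ I ∈ G.Φ e, t = I.1
        · obtain ⟨I, hI', rfl⟩ := hA
          left
          exact head_mem_banValues q he hI' hopt
        rcases H.final_shift _ _ _ l3 hou with h2 | h2
        · left; rwa [hv] at h2
        right
        have hopt' : ∀ D, D ≤ lastDep G e (t - 1) → opt q e.2 (t - 1) ≤ opt q e.1 D +
            ((G.c 0 * ((t - 1 : ℤ) - D) : ℚ) : WithTop ℚ) := by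
          intro D hD
          refine (opt_edge q he _).trans ((add_le_add (opt_mono e.1 hD) le_rfl).trans (le_of_eq ?_))
          rw [add_assoc, ← WithTop.coe_add]; congr 2; ring
        refine hshift t x _ _ h1 (fun I hI' => ⟨fun h3 => hI ⟨I, hI', h3⟩, fun h3 => hA ⟨I, hI', h3⟩⟩)
          h2 (fun h3 => ?_) (fun h3 => ?_)
        · have h4 := hopt' _ h3
          rw [hou, ← WithTop.coe_add] at h4
          refine (add_le_add h4 le_rfl).trans ?_
          rw [← WithTop.coe_add]
          exact WithTop.coe_le_coe.2 (by push_cast; linarith)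
        · refine (hopt' _ h3).trans (le_of_eq ?_)
          congr 2; push_cast; ring
      · right
        refine ⟨G.ρ e.2, ?_, fun ht => ?_⟩
        · refine (add_le_add (offer_opt_le (tvisit := tvisit) he P _) le_rfl).trans ?_
          rw [h1, ← WithTop.coe_add]
          exact WithTop.coe_le_coe.2 (by linarith)
        · refine (hleo _).trans ((offer_wait _ _ _ ht).trans ?_)
          rw [h, ← WithTop.coe_add]
  -- `relaxed`: either the profile of the tail did not change at the departure, or the tail is queued
  · intro e' he' t ht
    have key : σ'.C e'.2 t ≤ σ.C e'.1 (lastDep G e' t) +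
        ((G.c 0 * (t - lastDep G e' t) : ℚ) : WithTop ℚ) → Relaxed σ'.C e' t ∨
        (∃ k, σ'.queue e'.1 = some k ∧ k ≤ lastDep G e' t) := by
      intro h
      rcases hsame e'.1 (lastDep G e' t) with h1 | ⟨h1, h2⟩
      · left; unfold Relaxed; rwa [h1]
      · right; rw [h1]; exact Q2 _ h2
    rcases H.relaxed e' he' t ht with h | ⟨k, h, hk⟩ | ⟨h, hv⟩
    · exact (key ((hle _ _).trans h)).imp_right Or.inl
    · right; left
      by_cases hv : e'.1 = e.2
      · rw [hv] at h ⊢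
        obtain ⟨k', h1, h2⟩ := Q3 k h
        exact ⟨k', h1, h2.trans hk⟩
      · exact ⟨k, by rw [Q1 _ hv, h], hk⟩
    · rcases List.mem_cons.1 h with rfl | h
      · exact (key ((hleo t).trans (offer_le he P le_rfl hv ht))).imp_right Or.inl
      · exact Or.inr (Or.inr ⟨h, hv⟩)
  -- `key`: if the profile is optimal one time unit before the key, `final_shift` for that time
  -- bounds the old costs at the key, which are above the optimum there
  · intro v k hk
    by_cases hv : v = e.2
    · subst hv
      obtain ⟨q1, q2⟩ := Q4 k hk
      have hsame' : σ'.C e.2 (k - 1) = σ.C e.2 (k - 1) := by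
        rcases hsame e.2 (k - 1) with h | ⟨-, h⟩
        · exact h
        · exact absurd h (q1 _ (by omega))
      rcases q2 with q2 | q2
      · obtain ⟨h1, h2⟩ := H.key _ k q2
        refine ⟨fun h => h1 (top_le_iff.1 (h ▸ hle e.2 k)), ?_⟩
        rw [hsame']; exact h2
      · refine ⟨fun h => ?_, fun h => ?_⟩
        · have := hleo k
          rw [h, top_le_iff] at this
          exact absurd q2 (by rw [this]; exact not_top_lt)
        · have hb := (offer_upTo q tvisit (σ.C e.1) e).bdd k q2.ne_top
          have hlt := (offer_opt_le he P k).trans_lt q2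
          obtain ⟨y, hy⟩ := WithTop.ne_top_iff_exists.1 hlt.ne_top
          refine ⟨hb.2, y, hy.symm, ?_⟩
          rw [← hy] at hlt
          by_cases htop : opt q e.2 (k - 1) = ⊤
          · exact Or.inl htop
          obtain ⟨x, hx⟩ := WithTop.ne_top_iff_exists.1 htop
          right
          refine ⟨x, hx.symm, ?_⟩
          rw [hsame', ← hx] at h
          rcases H.final_shift _ _ x h hx.symm with h1 | ⟨i, h1, h2⟩
          · left
            refine ⟨?_, h1⟩
            have h3 := P.wait e.2 (k - 1) (by omega)
            rw [sub_add_cancel, h, ← WithTop.coe_add] at h3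
            have := WithTop.coe_lt_coe.1 (hlt.trans_le h3)
            have := c_le (G.ρ e.2)
            linarith
          · right
            have h3 := h2 (by omega)
            rw [sub_add_cancel] at h3
            exact ⟨i, WithTop.coe_lt_coe.1 (hlt.trans_le h3), h1⟩
    · rw [Q1 v hv] at hk
      have hsame' : σ'.C v = σ.C v := by rw [hC v, if_neg hv]
      rw [hsame']; exact H.key v k hk
  -- `popped_le`: an offer is finite only after the visit
  · intro p hp v k hk
    by_cases hv : v = e.2
    · subst hv
      obtain ⟨q1, q2⟩ := Q4 k hk
      rcases q2 with q2 | q2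
      · exact H.popped_le p hp _ k q2
      · have := offer_lt_top_gt he q2.ne_top
        have := H.popped_le' p hp
        exact ⟨by omega, fun _ => by omega⟩
    · rw [Q1 v hv] at hk
      exact H.popped_le p hp v k hk

end Invariants

/-! ### Iterations of the main loop -/

section Iteration

variable {G : RoadGraph} {q : Query G}

/-- Profiles are optimal up to the earliest key in the queue: an optimal route to that time departs
before from the tails of its edges, which have been relaxed for such departures. -/
theorem LoopInv.eq_opt {Φ : Finset ℚ} {popped : Finset (Fin G.n × ℤ)} {tvisit : ℤ} {σ : AbsState G}
    (H : LoopInv q Φ popped tvisit [] σ) {t : ℤ} (ht : t ≤ q.tmax)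
    (hq : ∀ v k, σ.queue v = some k → t ≤ k) (v : Fin G.n) : σ.C v t = opt q v t := by
  revert v
  induction t using int_strong_induction (lo := q.tmin) with
  | base t h =>
    intro v
    rw [opt_of_lt q h]
    by_contra hne
    have := (H.profiles.upTo v).bdd t hne
    omega
  | step t h ih =>
    intro v
    refine le_antisymm ?_ (H.profiles.opt_le v t)
    have ih' : ∀ t' < t, ∀ v, σ.C v t' = opt q v t' := fun t' ht' =>
      ih t' ht' (by omega) fun v k hk => ht'.le.trans (hq v k hk)
    by_cases htop : opt q v t = ⊤
    · rw [htop]; exact le_top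
    obtain ⟨x, hx⟩ := WithTop.ne_top_iff_exists.1 htop
    rw [← hx]
    rcases opt_cases q hx.symm with ⟨rfl, rfl, rfl⟩ | h1 | ⟨u, hu, h1⟩
    · exact H.profiles.start
    · have h2 := H.profiles.wait v (t - 1) (by omega)
      rw [sub_add_cancel] at h2
      exact le_coe_of_eq h2 ((ih' _ (by omega) v).trans h1) (by linarith)
    · rcases H.relaxed (u, v) hu t ht with h2 | ⟨k, h2, h3⟩ | h2
      · exact le_coe_of_eq h2 ((ih' _ (lastDep_spec hu t).1 u).trans h1) (by linarith)
      · have := hq _ _ h2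
        have := (lastDep_spec hu t).1
        omega
      · simp at h2

/-- Removing an entry with the earliest key from the queue. Its key is good since the profiles are
optimal before. -/
theorem LoopInv.pop {Φ : Finset ℚ} {popped : Finset (Fin G.n × ℤ)} {tvisit : ℤ} {σ : AbsState G}
    (H : LoopInv q Φ popped tvisit [] σ) {u : Fin G.n} {t : ℤ} (hu : σ.queue u = some t)
    (hq : ∀ v k, σ.queue v = some k → t ≤ k) : (u, t) ∉ popped ∧
    LoopInv q Φ (insert (u, t) popped) t (G.E.filter fun e => e.1 = u)
      { σ with queue := Function.update σ.queue u none } := by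
  have hqu : ∀ v k, Function.update σ.queue u none v = some k → v ≠ u ∧ σ.queue v = some k := by
    intro v k hk
    by_cases hv : v = u
    · rw [hv, Function.update_self] at hk
      exact absurd hk (by simp)
    · rw [Function.update_of_ne hv] at hk
      exact ⟨hv, hk⟩
  obtain ⟨k1, k2⟩ := H.key u t hu
  have ht := ((H.profiles.upTo u).bdd t k1).2
  refine ⟨fun h => absurd ((H.popped_le _ h u t hu).2 rfl) (lt_irrefl _), H.profiles, H.shift,
    H.final_shift, ?_, fun v k hk => H.key v k (hqu v k hk).2, ?_, ?_, ?_⟩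
  · intro e he x hx
    rcases H.relaxed e he x hx with h | ⟨k, h, hk⟩ | h
    · exact Or.inl h
    · by_cases heu : e.1 = u
      · rw [heu, hu, Option.some.injEq] at h
        exact Or.inr (Or.inr ⟨List.mem_filter.2 ⟨he, by simpa using heu⟩, by omega⟩)
      · exact Or.inr (Or.inl ⟨k, by simpa only [Function.update_of_ne heu] using h, hk⟩)
    · simp at h
  · intro p hp
    rcases Finset.mem_insert.1 hp with rfl | hp
    · exact k2 (H.eq_opt (by omega) (fun v k hk => by have := hq v k hk; omega) u)
    · exact H.popped_good p hp
  · intro p hp v k hk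
    obtain ⟨hv, hk⟩ := hqu v k hk
    rcases Finset.mem_insert.1 hp with rfl | hp
    · exact ⟨hq v k hk, fun h => absurd h hv⟩
    · exact H.popped_le p hp v k hk
  · intro p hp
    rcases Finset.mem_insert.1 hp with rfl | hp
    · exact le_rfl
    · exact (H.popped_le p hp u t hu).1

theorem card_newValues_le (C : Fin G.n → ℤ → WithTop ℚ) (e : Fin G.n × Fin G.n) (tvisit : ℤ) :
    (newValues C e tvisit).card ≤ 1 + 2 * (G.Φ e).length := by
  refine (List.toFinset_card_le _).trans ?_
  simp [List.length_flatMap]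
  omega

/-- The number of all ban intervals. -/
def RoadGraph.banCount (G : RoadGraph) : ℕ := (G.E.map fun e => (G.Φ e).length).sum

theorem length_le_banCount {e : Fin G.n × Fin G.n} (he : e ∈ G.E) :
    (G.Φ e).length ≤ G.banCount :=
  List.single_le_sum (by simp) _ (List.mem_map.2 ⟨e, he, rfl⟩)

theorem card_banValues_le (q : Query G) : (banValues q).card ≤ 1 + 2 * G.banCount := by
  refine (List.toFinset_card_le _).trans ?_
  rw [List.length_cons, RoadGraph.banCount, List.length_flatMap]
  simp only [List.length_flatMap, List.length_cons, List.length_nil]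
  simp only [List.map_const', List.sum_replicate, smul_eq_mul]
  rw [add_comm, add_le_add_iff_left, ← List.sum_map_mul_left]
  refine List.sum_le_sum fun e _ => ?_
  omega

/-! ### The state after initialization -/

theorem absInit_C (v : Fin G.n) (t : ℤ) : (absInit G q).C v t = if v = q.s ∧ q.tmin ≤ t ∧ t ≤ q.tmax
    then ((G.c (G.ρ q.s) * (t - q.tmin) : ℚ) : WithTop ℚ) else ⊤ := rfl

theorem absInit_eq_coe {v : Fin G.n} {t : ℤ} {x : ℚ} (h : (absInit G q).C v t = x) :
    v = q.s ∧ q.tmin ≤ t ∧ t ≤ q.tmax ∧ x = G.c (G.ρ q.s) * (t - q.tmin) := by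
  rw [absInit_C] at h
  split at h
  · rename_i h'
    exact ⟨h'.1, h'.2.1, h'.2.2, (WithTop.coe_injective h).symm⟩
  · exact absurd h WithTop.top_ne_coe

theorem absInit_upTo (v : Fin G.n) : UpTo q.tmin q.tmax ((absInit G q).C v) := by
  constructor
  · intro t ht
    obtain ⟨x, hx⟩ := WithTop.ne_top_iff_exists.1 ht
    obtain ⟨-, h1, h2, -⟩ := absInit_eq_coe hx.symm
    exact ⟨h1, h2⟩
  · intro t t' ht h h'
    obtain ⟨x, hx⟩ := WithTop.ne_top_iff_exists.1 ht
    obtain ⟨h0, h1, h2, -⟩ := absInit_eq_coe hx.symm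
    rw [absInit_C, if_pos ⟨h0, by omega, by omega⟩]
    exact WithTop.coe_ne_top

theorem opt_s_le (t : ℤ) (ht : q.tmin ≤ t) :
    opt q q.s t ≤ ((G.c (G.ρ q.s) * (t - q.tmin) : ℚ) : WithTop ℚ) := by
  induction t, ht using Int.leInduction with
  | base => simpa using opt_start q
  | succ k hk ih =>
    refine (opt_wait q q.s k).trans ((add_le_add ih le_rfl).trans (le_of_eq ?_))
    rw [← WithTop.coe_add]; congr 1; push_cast; ring

/-- Initially, the start is the only place and time at which the known routes cannot be shifted. -/
theorem absInit_loopInv (q : Query G) :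
    LoopInv q {0 - G.c 0 * q.tmin} ∅ q.tmin [] (absInit G q) := by
  have hwait : ∀ v t, t < q.tmax → (absInit G q).C v (t + 1) ≤
      (absInit G q).C v t + (G.c (G.ρ v) : ℚ) := by
    intro v t ht
    by_cases h : (absInit G q).C v t = ⊤
    · rw [h, WithTop.top_add]; exact le_top
    obtain ⟨x, hx⟩ := WithTop.ne_top_iff_exists.1 h
    obtain ⟨rfl, h1, h2, rfl⟩ := absInit_eq_coe hx.symm
    rw [← hx, absInit_C, if_pos ⟨rfl, by omega, by omega⟩, ← WithTop.coe_add]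
    exact WithTop.coe_le_coe.2 (by push_cast; linarith)
  have hopt : ∀ v t, opt q v t ≤ (absInit G q).C v t := by
    intro v t
    rw [absInit_C]
    split
    · rename_i h
      rw [h.1]; exact opt_s_le t h.2.1
    · exact le_top
  have hshift : ∀ v t (x : ℚ), (absInit G q).C v t = x → (t = q.tmin ∧ x = 0) ∨
      (absInit G q).C v (t - 1) + (G.c (G.ρ v) : ℚ) ≤ x := by
    intro v t x hx
    obtain ⟨rfl, h1, h2, rfl⟩ := absInit_eq_coe hx
    rcases h1.eq_or_lt with h | h
    · left; exact ⟨h.symm, by rw [h]; simp⟩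
    · right
      rw [absInit_C, if_pos ⟨rfl, by omega, by omega⟩, ← WithTop.coe_add]
      exact WithTop.coe_le_coe.2 (by push_cast; linarith)
  refine ⟨⟨absInit_upTo, hwait, hopt, ?_, ?_⟩, ?_, ?_, ?_, ?_, by simp, by simp, by simp⟩
  · intro v t x hx
    obtain ⟨rfl, h1, h2, rfl⟩ := absInit_eq_coe hx
    have h0 : IsCost G q q.tmin 0 := ⟨le_rfl, by simp, 0, by simp⟩
    have := h0.add (k := t - q.tmin) (by omega) (G.ρ q.s)
    simpa using this
  · rw [absInit_C, if_pos ⟨rfl, le_rfl, q.tmin_le_tmax⟩]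
    simp
  · intro v t x hx
    rcases hshift v t x hx with ⟨rfl, rfl⟩ | h
    · left; simp
    · exact Or.inr ⟨_, h, fun ht => (hwait v t ht).trans (by rw [hx, ← WithTop.coe_add])⟩
  · intro v t x hx _
    rcases hshift v t x hx with ⟨rfl, rfl⟩ | h
    · exact Or.inl (start_mem_banValues q)
    · exact Or.inr ⟨_, (add_le_add (hopt _ _) le_rfl).trans h,
        fun ht => (hwait v t ht).trans (by rw [hx, ← WithTop.coe_add])⟩
  · intro e he t ht
    by_cases h : (absInit G q).C e.1 (lastDep G e t) = ⊤
    · left; rw [Relaxed, h, WithTop.top_add]; exact le_top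
    · right; left
      obtain ⟨x, hx⟩ := WithTop.ne_top_iff_exists.1 h
      obtain ⟨h0, h1, -, -⟩ := absInit_eq_coe hx.symm
      exact ⟨q.tmin, by rw [h0]; simp [absInit], h1⟩
  · intro v k hk
    simp only [absInit] at hk
    split at hk
    · rename_i hv
      subst hv
      obtain rfl := Option.some_injective _ hk
      refine ⟨?_, fun _ => ⟨q.tmin_le_tmax, 0, le_antisymm (opt_start q) ?_, Or.inl
        (opt_of_lt q (by omega))⟩⟩
      · rw [absInit_C, if_pos ⟨rfl, le_rfl, q.tmin_le_tmax⟩]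
        exact WithTop.coe_ne_top
      · by_cases h : opt q q.s q.tmin = ⊤
        · rw [h]; exact le_top
        · obtain ⟨x, hx⟩ := WithTop.ne_top_iff_exists.1 h
          rw [← hx]
          exact WithTop.coe_le_coe.2 (opt_isCost hx.symm).nonneg
    · exact absurd hk (by simp)

theorem init_val : (init G q).val =
    { prof := Function.update (fun _ => []) q.s (if q.tmin < q.tmax then
        [(q.tmin, 0), (q.tmax, G.c (G.ρ q.s) * ((q.tmax - q.tmin : ℤ) : ℚ))] else [(q.tmin, 0)])
      queue := Function.update (fun _ => none) q.s (some q.tmin) } := by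
  simp only [init, Timed.val_bind, Timed.val_load, Timed.val_ite, ltZ_val, Timed.val_pure,
    decide_eq_true_eq, mulQ_val, toQ_val, subZ_val]
  split <;> rfl

theorem init_repr (v : Fin G.n) : Repr ((init G q).val.prof v) ((absInit G q).C v) := by
  rw [init_val]
  by_cases hv : v = q.s
  · subst hv
    simp only [Function.update_self]
    have htop : ∀ t, (absInit G q).C q.s t ≠ ⊤ → q.tmin ≤ t ∧ t ≤ q.tmax := (absInit_upTo q.s).bdd
    have h0 : (absInit G q).C q.s q.tmin = (0 : ℚ) := by
      rw [absInit_C, if_pos ⟨rfl, le_rfl, q.tmin_le_tmax⟩]; simp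
    split
    · rename_i h
      have h1 : (absInit G q).C q.s q.tmax = (G.c (G.ρ q.s) * ((q.tmax - q.tmin : ℤ) : ℚ) : ℚ) := by
        rw [absInit_C, if_pos ⟨rfl, by omega, le_rfl⟩]; push_cast; rfl
      refine ⟨?_, ?_, fun t ht => ⟨_, List.mem_cons_self, _, List.mem_cons_of_mem _
        List.mem_cons_self, htop t ht⟩⟩
      · refine List.IsChain.cons_cons (seg_of_affine h (y := - (G.c (G.ρ q.s) * q.tmin))
          (s := G.c (G.ρ q.s)) (fun t h2 h3 => ?_) h0 h1) (List.IsChain.singleton _)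
        rw [absInit_C, if_pos ⟨rfl, h2, h3⟩]; congr 1; ring
      · simp only [List.mem_cons, List.not_mem_nil, or_false]
        rintro p (rfl | rfl)
        · exact h0
        · exact h1
    · rename_i h
      refine ⟨List.IsChain.singleton _, ?_, fun t ht => ⟨_, List.mem_cons_self, _,
        List.mem_cons_self, ?_⟩⟩
      · simp only [List.mem_cons, List.not_mem_nil, or_false]
        rintro p rfl
        exact h0
      · have := htop t ht
        exact ⟨this.1, by omega⟩
  · simp only [Function.update_of_ne hv]
    refine Repr.nil fun t => ?_
    rw [absInit_C, if_neg (fun h => hv h.1)]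

theorem init_toAbs : (init G q).val.toAbs = absInit G q := by
  have h1 : (init G q).val.toAbs.C = (absInit G q).C := funext fun v => (init_repr v).toFun_eq
  have h2 : (init G q).val.toAbs.queue = (absInit G q).queue := by
    rw [init_val]
    funext v
    simp [State.toAbs, absInit, Function.update_apply]
  rcases h : (init G q).val.toAbs with ⟨C, Q⟩
  rw [h] at h1 h2
  simp only at h1 h2
  rw [h1, h2]

theorem init_rep : Rep q (init G q).val := by
  refine ⟨fun v => ?_, fun v => ?_⟩
  · rw [init_toAbs]; exact init_repr v
  · rw [init_toAbs]; exact absInit_upTo v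

theorem init_length_le (v : Fin G.n) : ((init G q).val.prof v).length ≤ 2 := by
  rw [init_val]
  by_cases hv : v = q.s
  · subst hv
    simp only [Function.update_self]
    split <;> simp
  · simp [Function.update_of_ne hv]

end Iteration

/-! ### Counting kinks -/

/-- If any two elements of `Z` are separated by an element of `X`, then `Z` has at most one element
more than `X`. -/
theorem card_le_of_separated {Z X : Finset ℤ}
    (h : ∀ z ∈ Z, ∀ z' ∈ Z, z < z' → ∃ x ∈ X, z < x ∧ x < z') : Z.card ≤ X.card + 1 := by
  have hlt : ∀ z ∈ Z, ∀ z' ∈ Z, z < z' →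
      (X.filter (· < z)).card < (X.filter (· < z')).card := by
    intro z hz z' hz' hlt
    obtain ⟨x, hx, h1, h2⟩ := h z hz z' hz' hlt
    refine Finset.card_lt_card (Finset.ssubset_iff_subset_ne.2 ⟨fun y hy => ?_, fun heq => ?_⟩)
    · rw [Finset.mem_filter] at hy ⊢
      exact ⟨hy.1, by omega⟩
    · have : x ∈ X.filter (· < z) := by rw [heq, Finset.mem_filter]; exact ⟨hx, h2⟩
      rw [Finset.mem_filter] at this
      omega
  rw [← Finset.card_range (X.card + 1)]
  refine Finset.card_le_card_of_injOn (fun z => (X.filter (· < z)).card) (fun z _ => ?_)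
    fun z hz z' hz' heq => ?_
  · have := Finset.card_filter_le X (· < z)
    simp only [Finset.coe_range, Set.mem_Iio]
    omega
  · by_contra hne
    simp only at heq
    rcases lt_or_gt_of_ne hne with h1 | h1
    · have := hlt z hz z' hz' h1; omega
    · have := hlt z' hz' z hz h1; omega

/-- If a function grows faster later, there is a convex kink in between. -/
theorem exists_convex_kink {f : ℤ → ℚ} {t t' : ℤ} (h : t < t')
    (hf : f (t + 1) - f t < f t' - f (t' - 1)) :
    ∃ x, t < x ∧ x < t' ∧ f x - f (x - 1) < f (x + 1) - f x := by
  by_contra hno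
  push Not at hno
  have : ∀ k, t + 1 ≤ k → k ≤ t' → f k - f (k - 1) ≤ f (t + 1) - f t := by
    intro k hk
    induction k, hk using Int.leInduction with
    | base => intro _; rw [add_sub_cancel_right]
    | succ k hk ih =>
      intro hk'
      have h1 := hno k (by omega) (by omega)
      have h2 := ih (by omega)
      rw [add_sub_cancel_right]
      linarith
  exact absurd (this t' (by omega) le_rfl) (not_le.2 hf)

section Kinks

variable {r : ℕ} {c : Fin (r + 1) → ℚ} {c₀ : ℚ} {f : ℤ → ℚ} {a b : ℤ}
  -- growth by at most `c₀` per time unit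
  (hw : ∀ t, a ≤ t → t < b → f (t + 1) ≤ f t + c₀) {Φ : Finset ℚ}
  -- local concavity, with a slope `c i` in between, except at values in `Φ`
  (hs : ∀ t, a < t → t < b → f t - c₀ * t ∈ Φ ∨ ∃ i, f (t - 1) + c i ≤ f t ∧ f (t + 1) ≤ f t + c i)

include hw

theorem sub_anti {t t' : ℤ} (h : t ≤ t') (ha : a ≤ t) (hb : t' ≤ b) :
    f t' - c₀ * t' ≤ f t - c₀ * t := by
  induction t', h using Int.leInduction with
  | base => exact le_rfl
  | succ k hk ih =>
    have := hw k (by omega) (by omega)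
    have := ih (by omega)
    push_cast
    linarith

/-- `f t - c₀ t` is nonincreasing, so each of its values is attained for the first time once only.
-/
theorem card_first_le {X : Finset ℤ} (hX : ∀ t ∈ X, a < t ∧ t ≤ b ∧ f t - c₀ * t ∈ Φ ∧
    f t < f (t - 1) + c₀) : X.card ≤ Φ.card := by
  refine Finset.card_le_card_of_injOn (fun t => f t - c₀ * t) (fun t ht => (hX t ht).2.2.1) ?_
  have key : ∀ t ∈ X, ∀ t' ∈ X, t < t' → f t' - c₀ * t' < f t - c₀ * t := by
    intro t ht t' ht' h
    have h1 := hX t ht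
    have h2 := hX t' ht'
    have := sub_anti hw (show t ≤ t' - 1 by omega) (by omega) (by omega)
    push_cast at this
    linarith
  intro t ht t' ht' heq
  simp only at heq
  by_contra hne
  rcases lt_or_gt_of_ne hne with h | h
  · exact absurd heq (key t ht t' ht' h).ne'
  · exact absurd heq (key t' ht' t ht h).ne

/-- Each value of `f t - c₀ t` is attained for the last time once only. -/
theorem card_last_le {X : Finset ℤ} (hX : ∀ t ∈ X, a ≤ t ∧ t < b ∧ f t - c₀ * t ∈ Φ ∧
    f (t + 1) < f t + c₀) : X.card ≤ Φ.card := by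
  refine Finset.card_le_card_of_injOn (fun t => f t - c₀ * t) (fun t ht => (hX t ht).2.2.1) ?_
  have key : ∀ t ∈ X, ∀ t' ∈ X, t < t' → f t' - c₀ * t' < f t - c₀ * t := by
    intro t ht t' ht' h
    have h1 := hX t ht
    have h2 := hX t' ht'
    have := sub_anti hw (show t + 1 ≤ t' by omega) (by omega) (by omega)
    push_cast at this
    linarith
  intro t ht t' ht' heq
  simp only at heq
  by_contra hne
  rcases lt_or_gt_of_ne hne with h | h
  · exact absurd heq (key t ht t' ht' h).ne'
  · exact absurd heq (key t' ht' t ht h).ne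

include hs

/-- At a convex kink, no shift is possible, and the function grows by less than `c₀`. -/
theorem exists_first_between {t t' : ℤ} (h : t < t') (ha : a ≤ t) (hb : t' ≤ b)
    (hf : f (t + 1) - f t < f t' - f (t' - 1)) :
    ∃ x, t < x ∧ x < t' ∧ a < x ∧ x ≤ b ∧ f x - c₀ * x ∈ Φ ∧ f x < f (x - 1) + c₀ := by
  obtain ⟨x, h1, h2, h3⟩ := exists_convex_kink h hf
  refine ⟨x, h1, h2, by omega, by omega, ?_, ?_⟩
  · rcases hs x (by omega) (by omega) with h4 | ⟨i, h4, h5⟩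
    · exact h4
    · linarith
  · have := hw x (by omega) (by omega)
    linarith

/-- Concave kinks at which the slope `s` is crossed are separated by convex kinks. -/
theorem card_crossing_le {s : ℚ} {Z : Finset ℤ}
    (hZ : ∀ t ∈ Z, a < t ∧ t < b ∧ f (t + 1) < f t + s ∧ f (t - 1) + s ≤ f t) :
    Z.card ≤ Φ.card + 1 := by
  classical
  refine (card_le_of_separated (X := (Finset.Icc a b).filter fun x => a < x ∧ x ≤ b ∧
    f x - c₀ * x ∈ Φ ∧ f x < f (x - 1) + c₀) fun t ht t' ht' h => ?_).trans
    (Nat.succ_le_succ (card_first_le hw fun x hx => (Finset.mem_filter.1 hx).2))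
  have h1 := hZ t ht
  have h2 := hZ t' ht'
  obtain ⟨x, h3, h4, h5⟩ := exists_first_between hw hs h (by omega) (by omega)
    (by linarith)
  exact ⟨x, Finset.mem_filter.2 ⟨Finset.mem_Icc.2 ⟨by omega, by omega⟩, h5⟩, h3, h4⟩

/-- The same as `card_crossing_le` for kinks at which the strict inequality is on the left. -/
theorem card_crossing_le' {s : ℚ} {Z : Finset ℤ}
    (hZ : ∀ t ∈ Z, a < t ∧ t < b ∧ f (t + 1) ≤ f t + s ∧ f (t - 1) + s < f t) :
    Z.card ≤ Φ.card + 1 := by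
  classical
  refine (card_le_of_separated (X := (Finset.Icc a b).filter fun x => a < x ∧ x ≤ b ∧
    f x - c₀ * x ∈ Φ ∧ f x < f (x - 1) + c₀) fun t ht t' ht' h => ?_).trans
    (Nat.succ_le_succ (card_first_le hw fun x hx => (Finset.mem_filter.1 hx).2))
  have h1 := hZ t ht
  have h2 := hZ t' ht'
  obtain ⟨x, h3, h4, h5⟩ := exists_first_between hw hs h (by omega) (by omega)
    (by linarith)
  exact ⟨x, Finset.mem_filter.2 ⟨Finset.mem_Icc.2 ⟨by omega, by omega⟩, h5⟩, h3, h4⟩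

/-- There are few kinks: at each of them a value in `Φ` is attained for the first or the last time,
or one of the slopes `c i` is crossed. -/
theorem card_kinks_le {K : Finset ℤ}
    (hK : ∀ t ∈ K, a < t ∧ t < b ∧ f (t + 1) - f t ≠ f t - f (t - 1)) :
    K.card ≤ 2 * Φ.card + (r + 1) * (2 * (Φ.card + 1)) := by
  classical
  have hsub : K ⊆ (K.filter fun t => f t - c₀ * t ∈ Φ ∧ f t < f (t - 1) + c₀) ∪
      (K.filter fun t => f t - c₀ * t ∈ Φ ∧ f (t + 1) < f t + c₀) ∪
      Finset.univ.biUnion fun i => (K.filter fun t => f (t + 1) < f t + c i ∧ f (t - 1) + c i ≤ f t) ∪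
        (K.filter fun t => f (t + 1) ≤ f t + c i ∧ f (t - 1) + c i < f t) := by
    intro t ht
    obtain ⟨h1, h2, h3⟩ := hK t ht
    simp only [Finset.mem_union, Finset.mem_filter, Finset.mem_biUnion, Finset.mem_univ, true_and,
      ht]
    rcases hs t h1 h2 with h4 | ⟨i, h4, h5⟩
    · left
      rcases lt_or_ge (f t) (f (t - 1) + c₀) with h5 | h5
      · exact Or.inl ⟨h4, h5⟩
      · refine Or.inr ⟨h4, lt_of_le_of_ne (hw t h1.le h2) fun h6 => h3 ?_⟩
        have := hw (t - 1) (by omega) (by omega)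
        rw [sub_add_cancel] at this
        linarith
    · right
      refine ⟨i, ?_⟩
      rcases lt_or_ge (f (t + 1)) (f t + c i) with h6 | h6
      · exact Or.inl ⟨h6, h4⟩
      · refine Or.inr ⟨h5, lt_of_le_of_ne h4 fun h7 => h3 ?_⟩
        linarith
  refine (Finset.card_le_card hsub).trans ((Finset.card_union_le _ _).trans (add_le_add
    ((Finset.card_union_le _ _).trans ?_) ?_))
  · rw [two_mul]
    refine add_le_add (card_first_le hw fun t ht => ?_) (card_last_le hw fun t ht => ?_)
    · obtain ⟨h1, h2, h3⟩ := Finset.mem_filter.1 ht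
      have := hK t h1
      exact ⟨this.1, this.2.1.le, h2, h3⟩
    · obtain ⟨h1, h2, h3⟩ := Finset.mem_filter.1 ht
      have := hK t h1
      exact ⟨this.1.le, this.2.1, h2, h3⟩
  · refine Finset.card_biUnion_le.trans ((Finset.sum_le_card_nsmul _ _ (2 * (Φ.card + 1)) fun i _ =>
      (Finset.card_union_le _ _).trans ?_).trans (le_of_eq (by simp)))
    · rw [two_mul]
      refine add_le_add (card_crossing_le hw hs (s := c i) fun t ht => ?_)
        (card_crossing_le' hw hs (s := c i) fun t ht => ?_)
      · obtain ⟨h1, h2, h3⟩ := Finset.mem_filter.1 ht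
        have := hK t h1
        exact ⟨this.1, this.2.1, h2, h3⟩
      · obtain ⟨h1, h2, h3⟩ := Finset.mem_filter.1 ht
        have := hK t h1
        exact ⟨this.1, this.2.1, h2, h3⟩

end Kinks

/-! ### Lengths of profiles and number of visits -/

section Counts

variable {G : RoadGraph} {q : Query G}

/-- A bound on the length of profiles, where `k` bounds the number of values at which routes cannot
be shifted. -/
def lengthBound (r k : ℕ) : ℕ := 2 * k + (r + 1) * (2 * (k + 1)) + 3

/-- Profiles are short: breakpoints other than the first and the last one are kinks. -/
theorem length_le_lengthBound {Φ : Finset ℚ} {f : Profile} {h : ℤ → WithTop ℚ} {w : Fin (G.r + 1)}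
    (hr : Repr f h) (hp : f.length ≤ 2 ∨ IsPruned f) (hu : UpTo q.tmin q.tmax h)
    (hw : ∀ t, t < q.tmax → h (t + 1) ≤ h t + (G.c w : ℚ))
    (hs : ∀ t x, h t = (x : ℚ) → x - G.c 0 * t ∈ Φ ∨ ∃ i, h (t - 1) + (G.c i : ℚ) ≤ x ∧
      (t < q.tmax → h (t + 1) ≤ (x + G.c i : ℚ))) : f.length ≤ lengthBound G.r Φ.card := by
  classical
  rcases hp with hp | hp
  · rw [lengthBound]; omega
  by_cases hex : ∃ t, h t ≠ ⊤
  swap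
  · push Not at hex
    have : f.length ≤ (∅ : Finset ℤ).card + 1 := hr.length_le hp fun t ht => absurd (hex t) ht
    rw [lengthBound]; simp at this; omega
  obtain ⟨a, ha, hmin⟩ := Int.exists_least_of_bdd (P := fun t => h t ≠ ⊤)
    ⟨q.tmin, fun z hz => (hu.bdd z hz).1⟩ hex
  have hcoe : ∀ t, a ≤ t → t ≤ q.tmax → h t = ((h t).untopD 0 : ℚ) := by
    intro t h1 h2
    obtain ⟨x, hx⟩ := WithTop.ne_top_iff_exists.1 (hu.up a t ha h1 h2)
    rw [← hx, WithTop.untopD_coe]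
  set g : ℤ → ℚ := fun t => (h t).untopD 0 with hg
  have hle := hr.length_le hp (K := insert a (insert q.tmax ((Finset.Ioo a q.tmax).filter
    fun t => g (t + 1) - g t ≠ g t - g (t - 1)))) fun t ht hna => by
    simp only [Finset.mem_insert, Finset.mem_filter, Finset.mem_Ioo]
    have h1 := hmin t ht
    have h2 := (hu.bdd t ht).2
    by_cases h3 : t = a
    · exact Or.inl h3
    by_cases h4 : t = q.tmax
    · exact Or.inr (Or.inl h4)
    refine Or.inr (Or.inr ⟨⟨by omega, by omega⟩, fun h5 => hna ⟨g t, g t - g (t - 1), ?_,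
      hcoe t (by omega) (by omega), ?_⟩⟩)
    · rw [hcoe (t - 1) (by omega) (by omega)]; congr 1; ring
    · rw [hcoe (t + 1) (by omega) (by omega)]; congr 1; change g (t + 1) = _; linarith
  have hcard := card_kinks_le (c := G.c) (c₀ := G.c 0) (f := g) (a := a) (b := q.tmax) (Φ := Φ)
    (fun t h1 h2 => ?_) (fun t h1 h2 => ?_) (K := (Finset.Ioo a q.tmax).filter
    fun t => g (t + 1) - g t ≠ g t - g (t - 1)) fun t ht => by
      simp only [Finset.mem_filter, Finset.mem_Ioo] at ht
      exact ⟨ht.1.1, ht.1.2, ht.2⟩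
  · have h1 := Finset.card_insert_le a (insert q.tmax ((Finset.Ioo a q.tmax).filter
      fun t => g (t + 1) - g t ≠ g t - g (t - 1)))
    have h2 := Finset.card_insert_le q.tmax ((Finset.Ioo a q.tmax).filter
      fun t => g (t + 1) - g t ≠ g t - g (t - 1))
    rw [lengthBound]
    omega
  · have h3 := hw t h2
    rw [hcoe t h1 h2.le, hcoe (t + 1) (by omega) (by omega), ← WithTop.coe_add] at h3
    exact (WithTop.coe_le_coe.1 h3).trans (by have := c_le w; simp only [g]; linarith)
  · rcases hs t _ (hcoe t h1.le h2.le) with h3 | ⟨i, h3, h4⟩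
    · exact Or.inl h3
    · right
      refine ⟨i, ?_, ?_⟩
      · rw [hcoe (t - 1) (by omega) (by omega), ← WithTop.coe_add] at h3
        exact WithTop.coe_le_coe.1 h3
      · have h4 := h4 h2
        rw [hcoe (t + 1) (by omega) (by omega)] at h4
        exact WithTop.coe_le_coe.1 h4

/-- A bound on the number of visits of a vertex. -/
def visitBound (r k : ℕ) : ℕ := 1 + k + (r + 1) * (k + 1)

/-- A vertex has few good keys: such a key is the earliest time at which the vertex can be reached,
or the time before it has a value in `banValues` for the last time, or is a concave kink at which
one of the slopes `c i` is crossed. -/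
theorem card_goodKey_le {v : Fin G.n} {K : Finset ℤ} (hK : ∀ k ∈ K, GoodKey q v k) :
    K.card ≤ visitBound G.r (banValues q).card := by
  classical
  by_cases hex : ∃ t, opt q v t ≠ ⊤
  swap
  · push Not at hex
    have : K = ∅ := Finset.eq_empty_of_forall_notMem fun k hk => by
      obtain ⟨-, y, hy, -⟩ := hK k hk
      rw [hex k] at hy; exact absurd hy WithTop.top_ne_coe
    rw [this]; simp
  obtain ⟨a, ha, hmin⟩ := Int.exists_least_of_bdd (P := fun t => opt q v t ≠ ⊤)
    ⟨q.tmin, fun z hz => opt_ne_top_ge q hz⟩ hex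
  have hfin : ∀ t, a ≤ t → opt q v t ≠ ⊤ := by
    intro t h1 h2
    have h3 := opt_mono (q := q) v h1
    rw [h2, top_le_iff, WithTop.add_eq_top] at h3
    rcases h3 with h3 | h3
    · exact ha h3
    · exact WithTop.coe_ne_top h3
  have hcoe : ∀ t, a ≤ t → opt q v t = ((opt q v t).untopD 0 : ℚ) := by
    intro t h1
    obtain ⟨x, hx⟩ := WithTop.ne_top_iff_exists.1 (hfin t h1)
    rw [← hx, WithTop.untopD_coe]
  set g : ℤ → ℚ := fun t => (opt q v t).untopD 0 with hg
  have hw : ∀ t, a ≤ t → t < q.tmax + 1 → g (t + 1) ≤ g t + G.c 0 := by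
    intro t h1 _
    have h3 := opt_wait q v t
    rw [hcoe t h1, hcoe (t + 1) (by omega), ← WithTop.coe_add] at h3
    exact (WithTop.coe_le_coe.1 h3).trans (by have := c_le (G.ρ v); simp only [g]; linarith)
  have hs : ∀ t, a < t → t < q.tmax + 1 → g t - G.c 0 * t ∈ banValues q ∨
      ∃ i, g (t - 1) + G.c i ≤ g t ∧ g (t + 1) ≤ g t + G.c i := by
    intro t h1 _
    rcases opt_shift q (hcoe t h1.le) with h3 | ⟨i, h3, h4⟩
    · exact Or.inl h3
    · right
      refine ⟨i, ?_, ?_⟩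
      · rw [hcoe (t - 1) (by omega), ← WithTop.coe_add] at h3
        exact WithTop.coe_le_coe.1 h3
      · rw [hcoe (t + 1) (by omega)] at h4
        exact WithTop.coe_le_coe.1 h4
  have hinj : Function.Injective fun t : ℤ => t + 1 := fun x y h => by simpa using h
  have hsub : K ⊆ insert a (((Finset.Ico a q.tmax).filter fun t => g t - G.c 0 * t ∈ banValues q ∧
      g (t + 1) < g t + G.c 0).image (fun t => t + 1) ∪
      Finset.univ.biUnion fun i => ((Finset.Ioo a q.tmax).filter fun t => g (t + 1) < g t + G.c i ∧
        g (t - 1) + G.c i ≤ g t).image fun t => t + 1) := by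
    intro k hk
    obtain ⟨h1, y, hy, h2⟩ := hK k hk
    have hak := hmin k (by rw [hy]; exact WithTop.coe_ne_top)
    rw [Finset.mem_insert]
    by_cases hka : k = a
    · exact Or.inl hka
    right
    have hgk : g k = y := by simp only [g]; rw [hy, WithTop.untopD_coe]
    rcases h2 with h2 | ⟨x, hx, h2⟩
    · exact absurd h2 (hfin _ (by omega))
    have hgx : g (k - 1) = x := by simp only [g]; rw [hx, WithTop.untopD_coe]
    rw [Finset.mem_union]
    rcases h2 with ⟨h2, h3⟩ | ⟨i, h2, h3⟩
    · left
      refine Finset.mem_image.2 ⟨k - 1, Finset.mem_filter.2 ⟨Finset.mem_Ico.2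
        ⟨by omega, by omega⟩, ?_, ?_⟩, by ring⟩
      · rw [hgx]; exact h3
      · rw [sub_add_cancel, hgk, hgx]; exact h2
    · right
      have hk1 : a ≤ k - 1 - 1 := by
        refine hmin _ fun h4 => ?_
        rw [h4, WithTop.top_add, top_le_iff] at h3
        exact WithTop.coe_ne_top h3
      rw [hcoe _ hk1, ← WithTop.coe_add] at h3
      refine Finset.mem_biUnion.2 ⟨i, Finset.mem_univ i, Finset.mem_image.2 ⟨k - 1,
        Finset.mem_filter.2 ⟨Finset.mem_Ioo.2 ⟨by omega, by omega⟩, ?_, ?_⟩, by ring⟩⟩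
      · rw [sub_add_cancel, hgk, hgx]; exact h2
      · rw [hgx]; exact WithTop.coe_le_coe.1 h3
  refine (Finset.card_le_card hsub).trans ((Finset.card_insert_le _ _).trans ?_)
  rw [visitBound, add_assoc, add_comm 1]
  refine Nat.succ_le_succ ((Finset.card_union_le _ _).trans (add_le_add ?_ ?_))
  · rw [Finset.card_image_of_injective _ hinj]
    refine card_last_le hw fun t ht => ?_
    obtain ⟨h1, h2⟩ := Finset.mem_filter.1 ht
    rw [Finset.mem_Ico] at h1
    exact ⟨h1.1, by omega, h2⟩
  · refine Finset.card_biUnion_le.trans ((Finset.sum_le_card_nsmul _ _ ((banValues q).card + 1)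
      fun i _ => ?_).trans (le_of_eq (by simp)))
    rw [Finset.card_image_of_injective _ hinj]
    refine card_crossing_le hw hs (s := G.c i) fun t ht => ?_
    obtain ⟨h1, h2⟩ := Finset.mem_filter.1 ht
    rw [Finset.mem_Ioo] at h1
    exact ⟨h1.1, by omega, h2⟩

/-- The main loop has few iterations. -/
theorem LoopInv.card_popped_le {Φ : Finset ℚ} {popped : Finset (Fin G.n × ℤ)} {tvisit : ℤ}
    {pending : List (Fin G.n × Fin G.n)} {σ : AbsState G}
    (H : LoopInv q Φ popped tvisit pending σ) :
    popped.card ≤ G.n * visitBound G.r (banValues q).card := by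
  classical
  rw [Finset.card_eq_sum_card_fiberwise (f := Prod.fst) (t := Finset.univ)
    (fun _ _ => Finset.mem_coe.2 (Finset.mem_univ _))]
  refine (Finset.sum_le_card_nsmul _ _ (visitBound G.r (banValues q).card) fun v _ => ?_).trans
    (le_of_eq (by simp))
  rw [← Finset.card_image_of_injOn (f := Prod.snd) (s := popped.filter fun p => p.1 = v)]
  · refine card_goodKey_le (q := q) (v := v) fun k hk => ?_
    obtain ⟨p, hp, rfl⟩ := Finset.mem_image.1 hk
    obtain ⟨h1, rfl⟩ := Finset.mem_filter.1 hp
    exact H.popped_good p h1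
  · intro p hp p' hp' h
    have h1 := (Finset.mem_filter.1 hp).2
    have h2 := (Finset.mem_filter.1 hp').2
    exact Prod.ext (h1.trans h2.symm) h

end Counts

/-! ### Times of computations on profiles -/

/-- A bound on the time of an operation whose operands have length at most `b`. -/
def opTime (b : ℕ) : ℕ := 4 * b ^ 2

theorem opTime_mono {b b' : ℕ} (h : b ≤ b') : opTime b ≤ opTime b' :=
  Nat.mul_le_mul_left 4 (Nat.pow_le_pow_left h 2)

theorem opTime_pos {b : ℕ} (h : 0 < b) : 1 ≤ opTime b := by
  have : 0 < 4 * b ^ 2 := by positivity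
  exact this

theorem sq_le_opTime {x b : ℕ} (h : x ≤ 2 * b) : x ^ 2 ≤ opTime b :=
  (Nat.pow_le_pow_left h 2).trans (by unfold opTime; ring_nf; rfl)

theorem bitsZ_pos (x : ℤ) : 0 < bitsZ x := Nat.succ_pos _

theorem bitsQ_pos (x : ℚ) : 0 < bitsQ x := Nat.succ_pos _

theorem bitsZ_zero : bitsZ 0 = 1 := rfl

theorem bitsZ_one : bitsZ 1 = 2 := by simp [bitsZ, Nat.size_one]

theorem bitsQ_zero : bitsQ 0 = 2 := by simp [bitsQ, Nat.size_one]

section Ops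

variable {b : ℕ} {x y : ℤ} {u v : ℚ}

theorem addZ_time_le (hx : bitsZ x ≤ b) (hy : bitsZ y ≤ b) : (addZ x y).time ≤ opTime b :=
  sq_le_opTime (by omega)

theorem subZ_time_le (hx : bitsZ x ≤ b) (hy : bitsZ y ≤ b) : (subZ x y).time ≤ opTime b :=
  sq_le_opTime (by omega)

theorem ltZ_time_le (hx : bitsZ x ≤ b) (hy : bitsZ y ≤ b) : (ltZ x y).time ≤ opTime b :=
  sq_le_opTime (by omega)

theorem leZ_time_le (hx : bitsZ x ≤ b) (hy : bitsZ y ≤ b) : (leZ x y).time ≤ opTime b :=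
  sq_le_opTime (by omega)

theorem eqZ_time_le (hx : bitsZ x ≤ b) (hy : bitsZ y ≤ b) : (eqZ x y).time ≤ opTime b :=
  sq_le_opTime (by omega)

theorem negZ_time_le (hx : bitsZ x ≤ b) : (negZ x).time ≤ opTime b := sq_le_opTime (by omega)

theorem toQ_time_le (hx : bitsZ x ≤ b) : (toQ x).time ≤ opTime b := sq_le_opTime (by omega)

theorem addQ_time_le (hu : bitsQ u ≤ b) (hv : bitsQ v ≤ b) : (addQ u v).time ≤ opTime b :=
  sq_le_opTime (by omega)

theorem subQ_time_le (hu : bitsQ u ≤ b) (hv : bitsQ v ≤ b) : (subQ u v).time ≤ opTime b :=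
  sq_le_opTime (by omega)

theorem mulQ_time_le (hu : bitsQ u ≤ b) (hv : bitsQ v ≤ b) : (mulQ u v).time ≤ opTime b :=
  sq_le_opTime (by omega)

theorem divQ_time_le (hu : bitsQ u ≤ b) (hv : bitsQ v ≤ b) : (divQ u v).time ≤ opTime b :=
  sq_le_opTime (by omega)

theorem ltQ_time_le (hu : bitsQ u ≤ b) (hv : bitsQ v ≤ b) : (ltQ u v).time ≤ opTime b :=
  sq_le_opTime (by omega)

theorem eqQ_time_le (hu : bitsQ u ≤ b) (hv : bitsQ v ≤ b) : (eqQ u v).time ≤ opTime b :=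
  sq_le_opTime (by omega)

theorem floorQ_time_le (hu : bitsQ u ≤ b) : (floorQ u).time ≤ opTime b := sq_le_opTime (by omega)

theorem minQ_time_le (hu : bitsQ u ≤ b) (hv : bitsQ v ≤ b) : (minQ u v).time ≤ opTime b := by
  have := ltQ_time_le hv hu
  simp only [minQ, Timed.time_bind, Timed.time_ite, Timed.time_pure, ite_self]
  omega

end Ops

/-- All times and costs in a profile have length at most `b`. -/
def BitsLe (b : ℕ) (f : Profile) : Prop := ∀ p ∈ f, bitsZ p.1 ≤ b ∧ bitsQ p.2 ≤ b

/-- If the value is finite, it has length at most `b`. -/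
def BitsTop (b : ℕ) (a : WithTop ℚ) : Prop := ∀ x : ℚ, a = x → bitsQ x ≤ b

theorem BitsLe.mono {b b' : ℕ} {f : Profile} (h : BitsLe b f) (hb : b ≤ b') : BitsLe b' f :=
  fun p hp => ⟨(h p hp).1.trans hb, (h p hp).2.trans hb⟩

theorem BitsLe.tail {b : ℕ} {p : ℤ × ℚ} {f : Profile} (h : BitsLe b (p :: f)) : BitsLe b f :=
  fun p hp => h p (List.mem_cons_of_mem _ hp)

theorem BitsLe.head {b : ℕ} {p : ℤ × ℚ} {f : Profile} (h : BitsLe b (p :: f)) :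
    bitsZ p.1 ≤ b ∧ bitsQ p.2 ≤ b := h p List.mem_cons_self

theorem BitsLe.cons {b : ℕ} {p : ℤ × ℚ} {f : Profile} (h : BitsLe b f) (h1 : bitsZ p.1 ≤ b)
    (h2 : bitsQ p.2 ≤ b) : BitsLe b (p :: f) := by
  intro p' hp'
  rcases List.mem_cons.1 hp' with rfl | hp'
  · exact ⟨h1, h2⟩
  · exact h p' hp'

theorem BitsLe.append {b : ℕ} {f g : Profile} (hf : BitsLe b f) (hg : BitsLe b g) :
    BitsLe b (f ++ g) := by
  intro p hp
  rcases List.mem_append.1 hp with hp | hp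
  · exact hf p hp
  · exact hg p hp

theorem bitsLe_nil {b : ℕ} : BitsLe b [] := fun _ hp => absurd hp List.not_mem_nil

theorem bitsTop_top {b : ℕ} : BitsTop b ⊤ := fun _ h => absurd h WithTop.top_ne_coe

theorem bitsTop_coe {b : ℕ} {x : ℚ} : BitsTop b x ↔ bitsQ x ≤ b :=
  ⟨fun h => h x rfl, fun h y hy => by rwa [← WithTop.coe_injective hy]⟩

theorem BitsTop.mono {b b' : ℕ} {a : WithTop ℚ} (h : BitsTop b a) (hb : b ≤ b') : BitsTop b' a :=
  fun x hx => (h x hx).trans hb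

/-- In this and the following bounds, the lengths of results are linear in the lengths of the
operands, with rough constant factors. -/
theorem interpolate_le {b : ℕ} {p p' : ℤ × ℚ} {t : ℤ} (hp : bitsZ p.1 ≤ b ∧ bitsQ p.2 ≤ b)
    (hp' : bitsZ p'.1 ≤ b ∧ bitsQ p'.2 ≤ b) (ht : bitsZ t ≤ b) :
    bitsQ (interpolate p p' t).val ≤ 24 * b ∧ (interpolate p p' t).time ≤ 8 * opTime (24 * b) := by
  have hb := bitsZ_pos t
  have v1 := bitsQ_sub_le p'.2 p.2
  have v2 := bitsZ_sub_le p'.1 p.1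
  have v3 := bitsQ_intCast (p'.1 - p.1)
  have v4 := bitsZ_sub_le t p.1
  have v5 := bitsQ_intCast (t - p.1)
  have v6 := bitsQ_mul_le (p'.2 - p.2) ((t - p.1 : ℤ) : ℚ)
  have v7 := bitsQ_div_le ((p'.2 - p.2) * ((t - p.1 : ℤ) : ℚ)) ((p'.1 - p.1 : ℤ) : ℚ)
  have v8 := bitsQ_add_le p.2 ((p'.2 - p.2) * ((t - p.1 : ℤ) : ℚ) / ((p'.1 - p.1 : ℤ) : ℚ))
  have t1 := subQ_time_le (b := 24 * b) (u := p'.2) (v := p.2) (by omega) (by omega)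
  have t2 := subZ_time_le (b := 24 * b) (x := p'.1) (y := p.1) (by omega) (by omega)
  have t3 := toQ_time_le (b := 24 * b) (x := p'.1 - p.1) (by omega)
  have t4 := subZ_time_le (b := 24 * b) (x := t) (y := p.1) (by omega) (by omega)
  have t5 := toQ_time_le (b := 24 * b) (x := t - p.1) (by omega)
  have t6 := mulQ_time_le (b := 24 * b) (u := p'.2 - p.2) (v := ((t - p.1 : ℤ) : ℚ))
    (by omega) (by omega)
  have t7 := divQ_time_le (b := 24 * b) (u := (p'.2 - p.2) * ((t - p.1 : ℤ) : ℚ))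
    (v := ((p'.1 - p.1 : ℤ) : ℚ)) (by omega) (by omega)
  have t8 := addQ_time_le (b := 24 * b) (u := p.2) (v := (p'.2 - p.2) * ((t - p.1 : ℤ) : ℚ) /
    ((p'.1 - p.1 : ℤ) : ℚ)) (by omega) (by omega)
  constructor
  · simp only [interpolate, Timed.val_bind, subQ_val, subZ_val, toQ_val, mulQ_val, divQ_val,
      addQ_val]
    omega
  · simp only [interpolate, Timed.time_bind, subQ_val, subZ_val, toQ_val, mulQ_val, divQ_val]
    omega

theorem evalAt_le {b : ℕ} {f : Profile} {t : ℤ} (hf : BitsLe b f) (ht : bitsZ t ≤ b) :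
    BitsTop (24 * b) (evalAt f t).val ∧
      (evalAt f t).time ≤ (f.length + 1) * (11 * opTime (24 * b)) := by
  have hb := bitsZ_pos t
  have ho := opTime_pos (b := 24 * b) (by omega)
  induction f with
  | nil => simp only [evalAt, Timed.val_bind, Timed.val_pure, Timed.time_bind, Timed.time_pure,
      Timed.time_tick, List.length_nil]; exact ⟨bitsTop_top, by omega⟩
  | cons p f ih =>
    have hp := hf.head
    rcases f with _ | ⟨p', f⟩
    · have t1 := eqZ_time_le (b := 24 * b) (x := t) (y := p.1) (by omega) (by omega)
      simp only [evalAt, Timed.val_bind, Timed.val_ite, Timed.val_pure, Timed.time_bind,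
        Timed.time_ite, Timed.time_pure, Timed.time_tick, ite_self, List.length_cons,
        List.length_nil]
      refine ⟨?_, by omega⟩
      split
      · exact bitsTop_coe.2 (by omega)
      · exact bitsTop_top
    · have hp' := hf.tail.head
      obtain ⟨i1, i2⟩ := ih hf.tail
      obtain ⟨l1, l2⟩ := interpolate_le hp hp' ht
      have t1 := ltZ_time_le (b := 24 * b) (x := t) (y := p.1) (by omega) (by omega)
      have t2 := ltZ_time_le (b := 24 * b) (x := t) (y := p'.1) (by omega) (by omega)
      simp only [evalAt, Timed.val_bind, Timed.val_ite, Timed.val_pure, Timed.time_bind,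
        Timed.time_ite, Timed.time_pure, Timed.time_tick, List.length_cons] at i2 ⊢
      have e : (f.length + 1 + 1 + 1) * (11 * opTime (24 * b)) =
        (f.length + 1 + 1) * (11 * opTime (24 * b)) + 11 * opTime (24 * b) := by ring
      constructor
      · split
        · exact bitsTop_top
        · split
          · exact bitsTop_coe.2 l1
          · exact i1
      · rw [e]
        split
        · omega
        · split <;> omega

theorem BitsLe.prune {b : ℕ} {f : Profile} (hf : BitsLe b f) : BitsLe b (prune f).val :=
  fun p hp => hf p ((prune_sublist f).1.subset hp)

theorem prune_time_le {b : ℕ} {f : Profile} (hf : BitsLe b f) :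
    (TempBans.prune f).time ≤ f.length * (10 * opTime (24 * b)) + 1 := by
  induction f with
  | nil => simp [TempBans.prune]
  | cons p f ih =>
    have hp := hf.head
    have hb := bitsZ_pos p.1
    have ho := opTime_pos (b := 24 * b) (by omega)
    have i2 := ih hf.tail
    have hpr := hf.tail.prune
    have e : (f.length + 1) * (10 * opTime (24 * b)) =
      f.length * (10 * opTime (24 * b)) + 10 * opTime (24 * b) := by ring
    simp only [TempBans.prune, Timed.time_bind, Timed.time_tick, List.length_cons]
    rw [e]
    split
    · rename_i p' p'' g hg
      rw [hg] at hpr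
      have hp' := hpr.head
      have hp'' := hpr.tail.head
      obtain ⟨l1, l2⟩ := interpolate_le hp hp'' hp'.1
      have t1 := eqQ_time_le (b := 24 * b) (v := p'.2) l1 (by omega)
      simp only [Timed.time_bind, Timed.time_ite, Timed.time_pure, ite_self]
      omega
    · simp only [Timed.time_pure]
      omega

/-! ### Times of computations on lists of times -/

section Lists

variable {b : ℕ}

theorem insertTime_length_le (t : ℤ) (l : List ℤ) : (insertTime t l).val.length ≤ l.length + 1 := by
  induction l with
  | nil => simp [insertTime]
  | cons k l ih =>
    simp only [insertTime, Timed.val_bind, Timed.val_ite, Timed.val_pure, List.length_cons]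
    split
    · simp
    · split <;> simp; omega

theorem insertTime_time_le {t : ℤ} {l : List ℤ} (ht : bitsZ t ≤ b) (hl : ∀ k ∈ l, bitsZ k ≤ b) :
    (insertTime t l).time ≤ (l.length + 1) * (3 * opTime b) := by
  have hb := bitsZ_pos t
  have ho := opTime_pos (b := b) (by omega)
  induction l with
  | nil => simp [insertTime]; omega
  | cons k l ih =>
    have hk := hl k List.mem_cons_self
    have t1 := ltZ_time_le ht hk
    have t2 := eqZ_time_le ht hk
    have i := ih fun k hk => hl k (List.mem_cons_of_mem _ hk)
    have e : (l.length + 1 + 1) * (3 * opTime b) =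
      (l.length + 1) * (3 * opTime b) + 3 * opTime b := by ring
    simp only [insertTime, Timed.time_bind, Timed.time_ite, Timed.time_pure, Timed.time_tick,
      List.length_cons]
    rw [e]
    split
    · omega
    · split <;> omega

theorem sortTimes_length_le (lo hi : ℤ) (l : List ℤ) :
    (sortTimes lo hi l).val.length ≤ l.length := by
  induction l with
  | nil => simp [sortTimes]
  | cons t l ih =>
    simp only [sortTimes, Timed.val_bind, Timed.val_ite, Timed.val_pure, List.length_cons]
    have := insertTime_length_le t (sortTimes lo hi l).val
    split
    · omega
    · split <;> omega

theorem sortTimes_bits (lo hi : ℤ) {l : List ℤ} (hl : ∀ k ∈ l, bitsZ k ≤ b) :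
    ∀ k ∈ (sortTimes lo hi l).val, bitsZ k ≤ b := fun k hk => hl k (mem_sortTimes.1 hk).1

theorem sortTimes_time_le {lo hi : ℤ} {l : List ℤ} {M : ℕ} (hM : l.length ≤ M)
    (hlo : bitsZ lo ≤ b) (hhi : bitsZ hi ≤ b) (hl : ∀ k ∈ l, bitsZ k ≤ b) :
    (sortTimes lo hi l).time ≤ (l.length + 1) * ((M + 2) * (3 * opTime b)) := by
  have hb := bitsZ_pos lo
  have ho := opTime_pos (b := b) (by omega)
  have e0 : (M + 2) * (3 * opTime b) = (M + 1) * (3 * opTime b) + 3 * opTime b := by ring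
  induction l with
  | nil =>
    simp only [sortTimes, Timed.time_bind, Timed.time_tick, Timed.time_pure, List.length_nil]
    omega
  | cons t l ih =>
    have ht := hl t List.mem_cons_self
    have t1 := ltZ_time_le ht hlo
    have t2 := ltZ_time_le hhi ht
    have hl' := fun k hk => hl k (List.mem_cons_of_mem t hk)
    rw [List.length_cons] at hM
    have i := ih (by omega) hl'
    have t3 := insertTime_time_le ht (sortTimes_bits lo hi hl')
    have t4 : ((sortTimes lo hi l).val.length + 1) * (3 * opTime b) ≤ (M + 1) * (3 * opTime b) :=
      Nat.mul_le_mul_right _ (by have := sortTimes_length_le lo hi l; omega)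
    have e : (l.length + 1 + 1) * ((M + 2) * (3 * opTime b)) =
      (l.length + 1) * ((M + 2) * (3 * opTime b)) + (M + 2) * (3 * opTime b) := by ring
    simp only [sortTimes, Timed.time_bind, Timed.time_ite, Timed.time_pure, Timed.time_tick,
      List.length_cons]
    rw [e]
    split
    · omega
    · split <;> omega

theorem append_time {α : Type} (k l : List α) : (append k l).time = k.length + 1 := by
  induction k with
  | nil => rfl
  | cons a k ih =>
    simp only [append, Timed.time_bind, Timed.time_tick, Timed.time_pure, ih, List.length_cons]
    omega

theorem times_time (f : Profile) : (times f).time = f.length + 1 := by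
  induction f with
  | nil => rfl
  | cons a k ih =>
    simp only [times, Timed.time_bind, Timed.time_tick, Timed.time_pure, ih, List.length_cons]
    omega

theorem times_bits {f : Profile} (hf : BitsLe b f) : ∀ k ∈ (times f).val, bitsZ k ≤ b := by
  intro k hk
  rw [times_val] at hk
  obtain ⟨p, hp, rfl⟩ := List.mem_map.1 hk
  exact (hf p hp).1

end Lists

/-! ### Times of linking -/

section LinkTime

variable {b : ℕ}

/-- The end points of all ban intervals have length at most `b`. -/
def BanBits (b : ℕ) (l : List (ℤ × ℤ)) : Prop := ∀ I ∈ l, bitsZ I.1 ≤ b ∧ bitsZ I.2 ≤ b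

theorem insertBan_time_le {I : ℤ × ℤ} {l : List (ℤ × ℤ)} (hI : bitsZ I.1 ≤ b) (hl : BanBits b l) :
    (insertBan I l).time ≤ (l.length + 1) * (2 * opTime b) := by
  have hb := bitsZ_pos I.1
  have ho := opTime_pos (b := b) (by omega)
  induction l with
  | nil => simp [insertBan]; omega
  | cons J l ih =>
    have t1 := leZ_time_le hI (hl J List.mem_cons_self).1
    have i := ih fun k hk => hl k (List.mem_cons_of_mem _ hk)
    have e : (l.length + 1 + 1) * (2 * opTime b) =
      (l.length + 1) * (2 * opTime b) + 2 * opTime b := by ring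
    simp only [insertBan, Timed.time_bind, Timed.time_ite, Timed.time_pure, Timed.time_tick,
      List.length_cons]
    rw [e]
    split <;> omega

theorem BanBits.sortBans {l : List (ℤ × ℤ)} (hl : BanBits b l) : BanBits b (sortBans l).val :=
  fun I hI => hl I ((sortBans_perm l).mem_iff.1 hI)

theorem BanBits.mirror {l : List (ℤ × ℤ)} (hl : BanBits b l) : BanBits b (mirror l).val := by
  intro I hI
  rw [mirror_val] at hI
  obtain ⟨J, hJ, rfl⟩ := List.mem_map.1 hI
  simp only [bitsZ_neg]
  exact ⟨(hl J hJ).2, (hl J hJ).1⟩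

theorem length_mirror (l : List (ℤ × ℤ)) : (TempBans.mirror l).val.length = l.length := by
  rw [mirror_val, List.length_map]

theorem length_sortBans (l : List (ℤ × ℤ)) : (TempBans.sortBans l).val.length = l.length :=
  (sortBans_perm l).length_eq

theorem sortBans_time_le {l : List (ℤ × ℤ)} {M : ℕ} (hM : l.length ≤ M) (hb : 0 < b)
    (hl : BanBits b l) :
    (TempBans.sortBans l).time ≤ (l.length + 1) * ((M + 1) * (2 * opTime b)) := by
  have ho := opTime_pos (b := b) (by omega)
  have e0 : (M + 1) * (2 * opTime b) = M * (2 * opTime b) + 2 * opTime b := by ring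
  induction l with
  | nil =>
    simp only [TempBans.sortBans, Timed.time_bind, Timed.time_tick, Timed.time_pure,
      List.length_nil]
    omega
  | cons I l ih =>
    rw [List.length_cons] at hM
    have hl' : BanBits b l := fun k hk => hl k (List.mem_cons_of_mem I hk)
    have i := ih (by omega) hl'
    have t3 := insertBan_time_le (hl I List.mem_cons_self).1 hl'.sortBans
    rw [length_sortBans] at t3
    have t4 : (l.length + 1) * (2 * opTime b) ≤ M * (2 * opTime b) := Nat.mul_le_mul_right _ hM
    have e : (l.length + 1 + 1) * ((M + 1) * (2 * opTime b)) =
      (l.length + 1) * ((M + 1) * (2 * opTime b)) + (M + 1) * (2 * opTime b) := by ring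
    simp only [TempBans.sortBans, Timed.time_bind, Timed.time_tick, List.length_cons]
    rw [e]
    omega

theorem mirror_time_le {l : List (ℤ × ℤ)} (hb : 0 < b) (hl : BanBits b l) :
    (TempBans.mirror l).time ≤ (l.length + 1) * (3 * opTime b) := by
  have ho := opTime_pos (b := b) (by omega)
  induction l with
  | nil =>
    simp only [TempBans.mirror, Timed.time_bind, Timed.time_tick, Timed.time_pure,
      List.length_nil]
    omega
  | cons I l ih =>
    have i := ih fun k hk => hl k (List.mem_cons_of_mem I hk)
    have hI := hl I List.mem_cons_self
    have t1 := negZ_time_le hI.1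
    have t2 := negZ_time_le hI.2
    have e : (l.length + 1 + 1) * (3 * opTime b) =
      (l.length + 1) * (3 * opTime b) + 3 * opTime b := by ring
    simp only [TempBans.mirror, Timed.time_bind, Timed.time_tick, Timed.time_pure,
      List.length_cons]
    rw [e]
    omega

theorem earliestArrival_le {l : List (ℤ × ℤ)} {rem t : ℤ} (hl : BanBits b l) (h0 : 0 ≤ rem)
    (hr : bitsZ rem ≤ b) (ht : bitsZ t ≤ b) : bitsZ (earliestArrival l rem t).val ≤ 2 * b ∧
      (earliestArrival l rem t).time ≤ (l.length + 1) * (6 * opTime (2 * b)) := by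
  have hb := bitsZ_pos rem
  have ho := opTime_pos (b := 2 * b) (by omega)
  induction l generalizing rem t with
  | nil =>
    have v1 := bitsZ_add_le t rem
    have t1 := addZ_time_le (b := 2 * b) (x := t) (y := rem) (by omega) (by omega)
    simp only [earliestArrival, Timed.time_bind, Timed.val_bind, addZ_val, Timed.time_tick,
      List.length_nil]
    omega
  | cons I l ih =>
    have hI := hl I List.mem_cons_self
    have hl' : BanBits b l := fun k hk => hl k (List.mem_cons_of_mem I hk)
    have v1 := bitsZ_add_le t rem
    have v2 := bitsZ_sub_le I.1 t
    have t1 := addZ_time_le (b := 2 * b) (x := t) (y := rem) (by omega) (by omega)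
    have t2 := leZ_time_le (b := 2 * b) (x := I.2) (y := t) (by omega) (by omega)
    have t3 := subZ_time_le (b := 2 * b) (x := I.1) (y := t) (by omega) (by omega)
    have t4 := leZ_time_le (b := 2 * b) (x := rem) (y := I.1 - t) (by omega) (by omega)
    have t5 := ltZ_time_le (b := 2 * b) (x := 0) (y := I.1 - t) (by rw [bitsZ_zero]; omega)
      (by omega)
    have t6 := subZ_time_le (b := 2 * b) (x := rem) (y := I.1 - t) (by omega) (by omega)
    have e : (l.length + 1 + 1) * (6 * opTime (2 * b)) =
      (l.length + 1) * (6 * opTime (2 * b)) + 6 * opTime (2 * b) := by ring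
    simp only [earliestArrival, Timed.time_bind, Timed.val_bind, addZ_val, subZ_val, leZ_val, ltZ_val,
      Timed.val_ite, Timed.time_ite, Timed.time_tick, List.length_cons, decide_eq_true_eq]
    rw [e]
    split
    · have := ih hl' h0 hr ht hb
      omega
    · split
      · omega
      · split
        · have hr' : bitsZ (rem - (I.1 - t)) ≤ bitsZ rem := bitsZ_mono (by omega)
          have := ih hl' (rem := rem - (I.1 - t)) (by omega) (hr'.trans hr) hI.2 (bitsZ_pos _)
          omega
        · have := ih hl' h0 hr hI.2 hb
          omega

theorem latestDeparture_le {l : List (ℤ × ℤ)} {rem t : ℤ} (hl : BanBits b l) (h0 : 0 ≤ rem)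
    (hr : bitsZ rem ≤ b) (ht : bitsZ t ≤ b) : bitsZ (latestDeparture l rem t).val ≤ 2 * b ∧
      (latestDeparture l rem t).time ≤ (l.length + 2) * (6 * opTime (2 * b)) := by
  obtain ⟨h1, h2⟩ := earliestArrival_le hl h0 hr (t := -t) (by rwa [bitsZ_neg])
  have t1 := negZ_time_le (b := 2 * b) (x := t) (by omega)
  have t2 := negZ_time_le (b := 2 * b) (x := (earliestArrival l rem (-t)).val) (by omega)
  have e : (l.length + 2) * (6 * opTime (2 * b)) =
      (l.length + 1) * (6 * opTime (2 * b)) + 6 * opTime (2 * b) := by ring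
  simp only [latestDeparture, Timed.val_bind, Timed.time_bind, negZ_val, bitsZ_neg]
  rw [e]
  omega

theorem arrivals_le {bans : List (ℤ × ℤ)} {drive tvisit : ℤ} {l : List ℤ} (hb : BanBits b bans)
    (h0 : 0 ≤ drive) (hr : bitsZ drive ≤ b) (ht : bitsZ tvisit ≤ b) (hl : ∀ k ∈ l, bitsZ k ≤ b) :
    (∀ k ∈ (arrivals bans drive tvisit l).val, bitsZ k ≤ 2 * b) ∧
    (arrivals bans drive tvisit l).val.length ≤ l.length ∧
    (arrivals bans drive tvisit l).time ≤
      (l.length + 1) * ((bans.length + 1) * (8 * opTime (2 * b))) := by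
  have hb0 := bitsZ_pos drive
  have ho := opTime_pos (b := 2 * b) (by omega)
  have e0 : (bans.length + 1) * (8 * opTime (2 * b)) = (bans.length + 1) * (6 * opTime (2 * b)) +
    bans.length * (2 * opTime (2 * b)) + 2 * opTime (2 * b) := by ring
  induction l with
  | nil =>
    simp only [arrivals, Timed.time_bind, Timed.time_tick, Timed.time_pure, Timed.val_bind,
      Timed.val_pure, List.length_nil]
    refine ⟨by simp, le_rfl, by omega⟩
  | cons k l ih =>
    have hk := hl k List.mem_cons_self
    obtain ⟨i1, i2, i3⟩ := ih fun k hk => hl k (List.mem_cons_of_mem _ hk)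
    obtain ⟨a1, a2⟩ := earliestArrival_le hb h0 hr hk
    have t1 := ltZ_time_le (b := 2 * b) (x := k) (y := tvisit) (by omega) (by omega)
    have e : (l.length + 1 + 1) * ((bans.length + 1) * (8 * opTime (2 * b))) =
      (l.length + 1) * ((bans.length + 1) * (8 * opTime (2 * b))) +
      (bans.length + 1) * (8 * opTime (2 * b)) := by ring
    simp only [arrivals, Timed.time_bind, Timed.time_tick, Timed.time_pure, Timed.val_bind,
      Timed.val_pure, Timed.time_ite, Timed.val_ite, List.length_cons]
    rw [e]
    split
    · exact ⟨i1, by omega, by omega⟩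
    · refine ⟨fun k' hk' => ?_, by simpa using i2, by omega⟩
      rcases List.mem_cons.1 hk' with rfl | hk'
      · exact a1
      · exact i1 k' hk'

theorem banTimes_le {bans l : List (ℤ × ℤ)} {drive : ℤ} (hb : BanBits b bans)
    (h0 : 0 ≤ drive) (hr : bitsZ drive ≤ b) (hl : BanBits b l) :
    (∀ k ∈ (banTimes bans drive l).val, bitsZ k ≤ 3 * b + 1) ∧
    (banTimes bans drive l).val.length = 4 * l.length ∧
    (banTimes bans drive l).time ≤
      (l.length + 1) * ((bans.length + 1) * (8 * opTime (2 * b))) := by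
  have hb0 := bitsZ_pos drive
  have ho := opTime_pos (b := 2 * b) (by omega)
  have e0 : (bans.length + 1) * (8 * opTime (2 * b)) = (bans.length + 1) * (6 * opTime (2 * b)) +
    bans.length * (2 * opTime (2 * b)) + 2 * opTime (2 * b) := by ring
  induction l with
  | nil =>
    simp only [banTimes, Timed.time_bind, Timed.time_tick, Timed.time_pure, Timed.val_bind,
      Timed.val_pure, List.length_nil]
    refine ⟨by simp, by simp, by omega⟩
  | cons I l ih =>
    have hI := hl I List.mem_cons_self
    obtain ⟨i1, i2, i3⟩ := ih fun k hk => hl k (List.mem_cons_of_mem _ hk)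
    obtain ⟨a1, a2⟩ := earliestArrival_le hb h0 hr hI.2
    have v1 := bitsZ_sub_le (earliestArrival bans drive I.2).val 1
    rw [bitsZ_one] at v1
    have t1 := subZ_time_le (b := 2 * b) (y := 1) a1 (by rw [bitsZ_one]; omega)
    have e : (l.length + 1 + 1) * ((bans.length + 1) * (8 * opTime (2 * b))) =
      (l.length + 1) * ((bans.length + 1) * (8 * opTime (2 * b))) +
      (bans.length + 1) * (8 * opTime (2 * b)) := by ring
    simp only [banTimes, Timed.time_bind, Timed.time_tick, Timed.time_pure, Timed.val_bind,
      Timed.val_pure, subZ_val, List.length_cons]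
    rw [e]
    refine ⟨fun k' hk' => ?_, by omega, by omega⟩
    simp only [List.mem_cons] at hk'
    rcases hk' with rfl | rfl | rfl | rfl | hk'
    · omega
    · omega
    · omega
    · omega
    · exact i1 k' hk'

theorem linkAt_le {mirrored : List (ℤ × ℤ)} {drive : ℤ} {d c₀ : ℚ} {f : Profile} {l : List ℤ}
    (hm : BanBits b mirrored) (h0 : 0 ≤ drive) (hr : bitsZ drive ≤ b) (hd : bitsQ d ≤ b)
    (hc : bitsQ c₀ ≤ b) (hf : BitsLe b f) (hl : ∀ k ∈ l, bitsZ k ≤ b) :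
    BitsLe (132 * b) (linkAt mirrored drive d c₀ f l).val ∧
    (linkAt mirrored drive d c₀ f l).time ≤
      (l.length + 1) * ((mirrored.length + f.length + 2) * (22 * opTime (48 * b))) := by
  have hb0 := bitsZ_pos drive
  have ho := opTime_pos (b := 48 * b) (by omega)
  set op := opTime (48 * b) with hop
  have e0 : (mirrored.length + f.length + 2) * (22 * op) = (mirrored.length + 2) * (6 * op) +
    (f.length + 1) * (11 * op) + (mirrored.length * (16 * op) + f.length * (11 * op) + 21 * op) := by
    ring
  induction l with
  | nil =>
    simp only [linkAt, Timed.time_bind, Timed.time_tick, Timed.time_pure, Timed.val_bind,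
      Timed.val_pure, List.length_nil]
    exact ⟨bitsLe_nil, by omega⟩
  | cons t l ih =>
    have ht := hl t List.mem_cons_self
    obtain ⟨i1, i2⟩ := ih fun k hk => hl k (List.mem_cons_of_mem _ hk)
    obtain ⟨x1, x2⟩ := latestDeparture_le hm h0 hr ht
    have x3 : (mirrored.length + 2) * (6 * opTime (2 * b)) ≤ (mirrored.length + 2) * (6 * op) :=
      Nat.mul_le_mul_left _ (Nat.mul_le_mul_left _ (opTime_mono (by omega)))
    obtain ⟨y1, y2⟩ := evalAt_le (b := 2 * b) (hf.mono (by omega)) x1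
    rw [show 24 * (2 * b) = 48 * b by ring] at y1 y2
    rw [← hop] at y2
    simp only [linkAt, Timed.time_bind, Timed.time_tick, Timed.val_bind, subZ_val,
      toQ_val, mulQ_val, addQ_val, List.length_cons]
    generalize latestDeparture mirrored drive t = X at *
    have v1 := bitsZ_sub_le t X.val
    have v2 := bitsZ_sub_le (t - X.val) drive
    have v3 := bitsQ_intCast drive
    have v4 := bitsQ_mul_le d drive
    have v5 := bitsQ_intCast (t - X.val - drive)
    have v6 := bitsQ_mul_le c₀ ((t - X.val - drive : ℤ) : ℚ)
    have v7 := bitsQ_add_le (d * drive) (c₀ * ((t - X.val - drive : ℤ) : ℚ))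
    have t1 := subZ_time_le (b := 48 * b) (x := t) (y := X.val) (by omega) (by omega)
    have t2 := subZ_time_le (b := 48 * b) (x := t - X.val) (y := drive) (by omega) (by omega)
    have t3 := toQ_time_le (b := 48 * b) (x := drive) (by omega)
    have t4 := mulQ_time_le (b := 48 * b) (u := d) (v := drive) (by omega) (by omega)
    have t5 := toQ_time_le (b := 48 * b) (x := t - X.val - drive) (by omega)
    have t6 := mulQ_time_le (b := 48 * b) (u := c₀) (v := ((t - X.val - drive : ℤ) : ℚ))
      (by omega) (by omega)
    have t7 := addQ_time_le (b := 48 * b) (u := d * drive)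
      (v := c₀ * ((t - X.val - drive : ℤ) : ℚ)) (by omega) (by omega)
    have e : (l.length + 1 + 1) * ((mirrored.length + f.length + 2) * (22 * op)) =
      (l.length + 1) * ((mirrored.length + f.length + 2) * (22 * op)) +
      (mirrored.length + f.length + 2) * (22 * op) := by ring
    rw [e]
    rw [← hop] at t1 t2 t3 t4 t5 t6 t7
    split
    · rename_i hy
      simp only [Timed.val_pure, Timed.time_pure]
      exact ⟨i1, by omega⟩
    · rename_i y hy
      have hy' := y1 y hy
      have v8 := bitsQ_add_le y (d * drive + c₀ * ((t - X.val - drive : ℤ) : ℚ))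
      have t8 := addQ_time_le (b := 48 * b) (u := y)
        (v := d * drive + c₀ * ((t - X.val - drive : ℤ) : ℚ)) (by omega) (by omega)
      rw [← hop] at t8
      simp only [Timed.val_bind, addQ_val, Timed.val_pure, Timed.time_bind, Timed.time_pure]
      exact ⟨i1.cons (by simp only; omega) (by simp only; omega), by omega⟩

theorem linkAt_length_le (mirrored : List (ℤ × ℤ)) (drive : ℤ) (d c₀ : ℚ) (f : Profile)
    (l : List ℤ) : (linkAt mirrored drive d c₀ f l).val.length ≤ l.length := by
  simpa using (map_fst_linkAt_sublist mirrored drive d c₀ f l).length_le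

theorem link_le {Φ : List (ℤ × ℤ)} {drive tvisit tmax : ℤ} {d c₀ : ℚ} {f : Profile} {n : ℕ}
    (hΦ : BanBits b Φ) (h0 : 0 ≤ drive) (hr : bitsZ drive ≤ b) (hd : bitsQ d ≤ b)
    (hc : bitsQ c₀ ≤ b) (hv : bitsZ tvisit ≤ b) (hmax : bitsZ tmax ≤ b) (hf : BitsLe b f)
    (hn : f.length + 4 * Φ.length + 5 ≤ n) :
    BitsLe (528 * b) (link Φ drive d c₀ tvisit tmax f).val ∧
    (link Φ drive d c₀ tvisit tmax f).val.length ≤ n ∧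
    (link Φ drive d c₀ tvisit tmax f).time ≤ 200 * (n * n * opTime (13000 * b)) := by
  have hb0 := bitsZ_pos drive
  set op := opTime (13000 * b) with hop
  have ho : 1 ≤ op := opTime_pos (b := 13000 * b) (by omega)
  have hle : ∀ k, k ≤ 13000 * b → opTime k ≤ op := fun k hk => opTime_mono hk
  have hbound : ∀ x y c k, x ≤ n → y ≤ n → k ≤ 13000 * b → x * (y * (c * opTime k)) ≤
      c * (n * n * op) := by
    intro x y c k hx hy hk
    calc x * (y * (c * opTime k)) = c * (x * y * opTime k) := by ring
      _ ≤ c * (n * n * op) := Nat.mul_le_mul_left _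
        (Nat.mul_le_mul (Nat.mul_le_mul hx hy) (hle k hk))
  have hbound' : ∀ x c k, x ≤ n → k ≤ 13000 * b → x * (c * opTime k) ≤ c * (n * n * op) := by
    intro x c k hx hk
    have := hbound x 1 c k hx (by omega) hk
    rwa [one_mul] at this
  have hn2 : n ≤ n * n * op := by
    calc n = n * 1 * 1 := by ring
      _ ≤ n * n * op := Nat.mul_le_mul (Nat.mul_le_mul_left _ (by omega)) ho
  have s1 := sortBans_time_le (M := Φ.length) le_rfl (by omega) hΦ
  have s2 := mirror_time_le (by omega) hΦ
  have s3 := sortBans_time_le (M := Φ.length) (by rw [length_mirror]) (by omega) hΦ.mirror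
  rw [length_mirror] at s3
  obtain ⟨a1, a2⟩ := earliestArrival_le hΦ.sortBans h0 hr hv
  obtain ⟨b1, b2, b3⟩ := arrivals_le hΦ.sortBans h0 hr hv (times_bits hf)
  obtain ⟨c1, c2, c3⟩ := banTimes_le hΦ.sortBans h0 hr hΦ.sortBans
  have hlen : (times f).val.length = f.length := by rw [times_val, List.length_map]
  rw [length_sortBans] at a2 b3 c2 c3
  rw [hlen] at b2 b3
  simp only [link, Timed.val_bind, Timed.time_bind, append_val, append_time, times_time]
  generalize (earliestArrival (TempBans.sortBans Φ).val drive tvisit) = A at *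
  generalize (arrivals (TempBans.sortBans Φ).val drive tvisit (times f).val) = l₁ at *
  generalize (banTimes (TempBans.sortBans Φ).val drive (TempBans.sortBans Φ).val) = l₂ at *
  have hl : ∀ k ∈ A.val :: tmax :: (l₁.val ++ l₂.val), bitsZ k ≤ 4 * b := by
    intro k hk
    simp only [List.mem_cons, List.mem_append] at hk
    rcases hk with rfl | rfl | hk | hk
    · omega
    · omega
    · have := b1 k hk; omega
    · have := c1 k hk; omega
  have hlen2 : (A.val :: tmax :: (l₁.val ++ l₂.val)).length ≤ n - 2 := by
    simp only [List.length_cons, List.length_append]; omega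
  have d1 := sortTimes_time_le (lo := A.val) (hi := tmax) hlen2 (by omega) (by omega) hl
  have d2 := sortTimes_bits A.val tmax hl
  have d3 := sortTimes_length_le A.val tmax (A.val :: tmax :: (l₁.val ++ l₂.val))
  generalize sortTimes A.val tmax (A.val :: tmax :: (l₁.val ++ l₂.val)) = ts at *
  obtain ⟨e1, e2⟩ := linkAt_le (b := 4 * b) (mirrored := (TempBans.sortBans (TempBans.mirror Φ).val).val)
    (drive := drive) (d := d) (c₀ := c₀) (f := f) (l := ts.val)
    (fun I hI => by have := hΦ.mirror.sortBans I hI; omega) h0 (by omega) (by omega) (by omega)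
    (hf.mono (by omega)) d2
  have e3 := linkAt_length_le (TempBans.sortBans (TempBans.mirror Φ).val).val drive d c₀ f ts.val
  rw [length_sortBans, length_mirror] at e2
  generalize linkAt (TempBans.sortBans (TempBans.mirror Φ).val).val drive d c₀ f ts.val = g at *
  have f1 := prune_time_le e1
  have f2 := (prune_sublist g.val).1.length_le
  refine ⟨e1.prune.mono (by omega), by omega, ?_⟩
  have g1 := hbound (Φ.length + 1) (Φ.length + 1) 2 b (by omega) (by omega) (by omega)
  have g2 := hbound' (Φ.length + 1) 3 b (by omega) (by omega)
  have g3 := hbound' (Φ.length + 1) 6 (2 * b) (by omega) (by omega)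
  have g4 := hbound (f.length + 1) (Φ.length + 1) 8 (2 * b) (by omega) (by omega) (by omega)
  have g5 := hbound (Φ.length + 1) (Φ.length + 1) 8 (2 * b) (by omega) (by omega) (by omega)
  have g6 := hbound ((A.val :: tmax :: (l₁.val ++ l₂.val)).length + 1) (n - 2 + 2) 3 (4 * b)
    (by omega) (by omega) (by omega)
  have g7 := hbound (ts.val.length + 1) (Φ.length + f.length + 2) 22 (48 * (4 * b)) (by omega)
    (by omega) (by omega)
  have g8 := hbound' g.val.length 10 (24 * (132 * (4 * b))) (by omega) (by omega)
  omega

end LinkTime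

/-! ### Times of waiting and of minima -/

section MinTime

variable {b : ℕ}

theorem crossing_le {p p' : ℤ × ℚ} {y y' : ℚ} (hp : bitsZ p.1 ≤ b ∧ bitsQ p.2 ≤ b)
    (hp' : bitsZ p'.1 ≤ b ∧ bitsQ p'.2 ≤ b) (hy : bitsQ y ≤ b) (hy' : bitsQ y' ≤ b) :
    BitsLe (1200 * b) (crossing p p' y y').val ∧ (crossing p p' y y').val.length ≤ 2 ∧
    (crossing p p' y y').time ≤ 40 * opTime (1200 * b) := by
  have hb0 := bitsQ_pos y
  have ho := opTime_pos (b := 1200 * b) (by omega)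
  obtain ⟨op, hop⟩ : ∃ op, op = opTime (1200 * b) := ⟨_, rfl⟩
  have v1 := bitsQ_sub_le y p.2
  have v2 := bitsQ_sub_le y' p'.2
  generalize hD : y - p.2 = D at v1
  generalize hD' : y' - p'.2 = D' at v2
  have v3 := bitsZ_sub_le p'.1 p.1
  have v4 := bitsQ_intCast (p'.1 - p.1)
  have v5 := bitsQ_mul_le D ((p'.1 - p.1 : ℤ) : ℚ)
  have v6 := bitsQ_sub_le D D'
  have v7 := bitsQ_div_le (D * ((p'.1 - p.1 : ℤ) : ℚ)) (D - D')
  have v8 := bitsZ_floor_le (D * ((p'.1 - p.1 : ℤ) : ℚ) / (D - D'))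
  have v9 := bitsZ_add_le p.1 ⌊D * ((p'.1 - p.1 : ℤ) : ℚ) / (D - D')⌋
  have v10 := bitsZ_add_le (p.1 + ⌊D * ((p'.1 - p.1 : ℤ) : ℚ) / (D - D')⌋) 1
  rw [bitsZ_one] at v10
  have t1 := subQ_time_le (b := 1200 * b) (u := y) (v := p.2) (by omega) (by omega)
  have t2 := subQ_time_le (b := 1200 * b) (u := y') (v := p'.2) (by omega) (by omega)
  have t3 := ltQ_time_le (b := 1200 * b) (u := D) (v := 0) (by omega) (by rw [bitsQ_zero]; omega)
  have t4 := ltQ_time_le (b := 1200 * b) (u := 0) (v := D') (by rw [bitsQ_zero]; omega) (by omega)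
  have t5 := ltQ_time_le (b := 1200 * b) (u := 0) (v := D) (by rw [bitsQ_zero]; omega) (by omega)
  have t6 := ltQ_time_le (b := 1200 * b) (u := D') (v := 0) (by omega) (by rw [bitsQ_zero]; omega)
  have t7 := subZ_time_le (b := 1200 * b) (x := p'.1) (y := p.1) (by omega) (by omega)
  have t8 := toQ_time_le (b := 1200 * b) (x := p'.1 - p.1) (by omega)
  have t9 := mulQ_time_le (b := 1200 * b) (u := D) (v := ((p'.1 - p.1 : ℤ) : ℚ)) (by omega) (by omega)
  have t10 := subQ_time_le (b := 1200 * b) (u := D) (v := D') (by omega) (by omega)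
  have t11 := divQ_time_le (b := 1200 * b) (u := D * ((p'.1 - p.1 : ℤ) : ℚ)) (v := D - D')
    (by omega) (by omega)
  have t12 := floorQ_time_le (b := 1200 * b) (u := D * ((p'.1 - p.1 : ℤ) : ℚ) / (D - D')) (by omega)
  have t13 := addZ_time_le (b := 1200 * b) (x := p.1)
    (y := ⌊D * ((p'.1 - p.1 : ℤ) : ℚ) / (D - D')⌋) (by omega) (by omega)
  have t14 := addZ_time_le (b := 1200 * b) (x := p.1 + ⌊D * ((p'.1 - p.1 : ℤ) : ℚ) / (D - D')⌋)
    (y := 1) (by omega) (by rw [bitsZ_one]; omega)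
  simp only [crossing, Timed.val_bind, Timed.time_bind, Timed.val_ite, Timed.time_ite,
    Timed.val_pure, Timed.time_pure, subQ_val, subZ_val, toQ_val, mulQ_val, divQ_val, floorQ_val,
    addZ_val, hD, hD']
  generalize p.1 + ⌊D * ((p'.1 - p.1 : ℤ) : ℚ) / (D - D')⌋ = x at *
  have t15 := ltZ_time_le (b := 1200 * b) (x := x + 1) (y := p'.1) (by omega) (by omega)
  have t16 := ltZ_time_le (b := 1200 * b) (x := p.1) (y := x) (by omega) (by omega)
  have i1 : ∀ t, bitsZ t ≤ 50 * b → bitsQ (interpolate p p' t).val ≤ 1200 * b ∧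
      (interpolate p p' t).time ≤ 8 * opTime (1200 * b) := by
    intro t ht
    have := interpolate_le (b := 50 * b) (p := p) (p' := p') (t := t) (by omega) (by omega) ht
    rwa [show 24 * (50 * b) = 1200 * b by ring] at this
  have i2 : ∀ t, bitsZ t ≤ 50 * b → bitsQ (interpolate (p.1, y) (p'.1, y') t).val ≤ 1200 * b ∧
      (interpolate (p.1, y) (p'.1, y') t).time ≤ 8 * opTime (1200 * b) := by
    intro t ht
    have := interpolate_le (b := 50 * b) (p := (p.1, y)) (p' := (p'.1, y')) (t := t)
      ⟨by simp only; omega, by simp only; omega⟩ ⟨by simp only; omega, by simp only; omega⟩ ht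
    rwa [show 24 * (50 * b) = 1200 * b by ring] at this
  have j1 := i1 x (by omega)
  have j2 := i1 (x + 1) (by omega)
  have j3 := i2 x (by omega)
  have j4 := i2 (x + 1) (by omega)
  rw [← hop] at ho t1 t2 t3 t4 t5 t6 t7 t8 t9 t10 t11 t12 t13 t14 t15 t16 j1 j2 j3 j4 ⊢
  have tail : ∀ (c c' : Bool) (y₁ y₂ : ℚ), bitsQ y₁ ≤ 1200 * b → bitsQ y₂ ≤ 1200 * b →
      BitsLe (1200 * b) (if c = true then (if c' = true then [(x, y₁), (x + 1, y₂)]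
        else [(x + 1, y₂)]) else if c' = true then [(x, y₁)] else []) ∧
      (if c = true then (if c' = true then [(x, y₁), (x + 1, y₂)]
        else [(x + 1, y₂)]) else if c' = true then [(x, y₁)] else []).length ≤ 2 := by
    intro c c' y₁ y₂ h1 h2
    have k2 : BitsLe (1200 * b) [(x + 1, y₂)] := bitsLe_nil.cons (by simp only; omega) h2
    have k1 : ∀ f, BitsLe (1200 * b) f → BitsLe (1200 * b) ((x, y₁) :: f) := fun f hf =>
      hf.cons (by simp only; omega) h1
    cases c <;> cases c' <;> simp only [Bool.false_eq_true, if_false, if_true]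
    · exact ⟨bitsLe_nil, by simp⟩
    · exact ⟨k1 _ bitsLe_nil, by simp⟩
    · exact ⟨k2, by simp⟩
    · exact ⟨k1 _ k2, by simp⟩
  have htime : ∀ {y₁ y₂ : ℕ}, y₁ ≤ 8 * op → y₂ ≤ 8 * op → _ :=
    fun h1 h2 => Nat.add_le_add t1 <| Nat.add_le_add t2 <| Nat.add_le_add t3 <|
      Nat.add_le_add t4 <| Nat.add_le_add t5 <| Nat.add_le_add t6 <| Nat.add_le_add t7 <|
      Nat.add_le_add t8 <| Nat.add_le_add t9 <| Nat.add_le_add t10 <| Nat.add_le_add t11 <|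
      Nat.add_le_add t12 <| Nat.add_le_add t13 <| Nat.add_le_add t14 <| Nat.add_le_add h1 <|
      Nat.add_le_add h2 <| Nat.add_le_add t15 <| Nat.add_le_add (le_refl 0) <|
      Nat.add_le_add t16 (le_refl 0)
  clear v1 v2 v3 v4 v5 v6 v7 v8 v9 v10 hD hD'
  split
  · by_cases hc : (ltQ D 0).val = true
    · simp only [hc, if_true, ite_self]
      obtain ⟨h1, h2⟩ := tail (ltZ (x + 1) p'.1).val (ltZ p.1 x).val _ _ j3.1 j2.1
      exact ⟨h1, h2, (htime j3.2 j2.2).trans (by clear * -; omega)⟩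
    · simp only [hc, ite_self]
      obtain ⟨h1, h2⟩ := tail (ltZ (x + 1) p'.1).val (ltZ p.1 x).val _ _ j1.1 j4.1
      exact ⟨h1, h2, (htime j1.2 j4.2).trans (by clear * -; omega)⟩
  · exact ⟨bitsLe_nil, by simp, by omega⟩

/-- The costs `y` with waiting at the first breakpoint come from some breakpoint `(t₀, y₀)` before,
with one multiplication. So their length does not grow with the number of steps of the recursion. -/
theorem waitFrom_le {w : ℚ} {p : ℤ × ℚ} {y : ℚ} {f : Profile} (hw : bitsQ w ≤ b)
    (hf : BitsLe b (p :: f))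
    (hy : ∃ y₀ t₀, bitsQ y₀ ≤ b ∧ bitsZ t₀ ≤ b ∧ y = y₀ + w * ((p.1 - t₀ : ℤ) : ℚ)) :
    BitsLe (12000 * b) (waitFrom w p y f).val ∧ (waitFrom w p y f).val.length ≤ 3 * f.length + 1 ∧
    (waitFrom w p y f).time ≤ (f.length + 1) * (50 * opTime (12000 * b)) := by
  have hb0 := bitsQ_pos w
  have ho := opTime_pos (b := 12000 * b) (by omega)
  -- the value after waiting comes from an earlier breakpoint
  have hbits : ∀ y₀ : ℚ, ∀ t t₀ : ℤ, bitsQ y₀ ≤ b → bitsZ t ≤ b → bitsZ t₀ ≤ b →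
      bitsQ (y₀ + w * ((t - t₀ : ℤ) : ℚ)) ≤ 10 * b := by
    intro y₀ t t₀ h1 h2 h3
    have v1 := bitsZ_sub_le t t₀
    have v2 := bitsQ_intCast (t - t₀)
    have v3 := bitsQ_mul_le w ((t - t₀ : ℤ) : ℚ)
    have v4 := bitsQ_add_le y₀ (w * ((t - t₀ : ℤ) : ℚ))
    omega
  induction f generalizing p y with
  | nil =>
    obtain ⟨y₀, t₀, h1, h2, rfl⟩ := hy
    have := hbits y₀ p.1 t₀ h1 hf.head.1 h2
    have := hf.head.1
    simp only [waitFrom, Timed.val_bind, Timed.val_pure, Timed.time_bind, Timed.time_pure,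
      Timed.time_tick, List.length_nil, List.length_singleton]
    exact ⟨bitsLe_nil.cons (by simp only; omega) (by simp only; omega), le_rfl, by omega⟩
  | cons p' f ih =>
    have hp := hf.head
    have hp' := hf.tail.head
    have hybits : bitsQ y ≤ 10 * b := by
      obtain ⟨y₀, t₀, h1, h2, rfl⟩ := hy
      exact hbits y₀ p.1 t₀ h1 hp.1 h2
    obtain ⟨hybits', hy''⟩ : bitsQ (y + w * ((p'.1 - p.1 : ℤ) : ℚ)) ≤ 10 * b ∧
        ∃ y₀ t₀, bitsQ y₀ ≤ b ∧ bitsZ t₀ ≤ b ∧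
          min (y + w * ((p'.1 - p.1 : ℤ) : ℚ)) p'.2 = y₀ + w * ((p'.1 - t₀ : ℤ) : ℚ) := by
      obtain ⟨y₀, t₀, h1, h2, rfl⟩ := hy
      have e : y₀ + w * ((p.1 - t₀ : ℤ) : ℚ) + w * ((p'.1 - p.1 : ℤ) : ℚ) =
        y₀ + w * ((p'.1 - t₀ : ℤ) : ℚ) := by push_cast; ring
      rw [e]
      refine ⟨hbits y₀ p'.1 t₀ h1 hp'.1 h2, ?_⟩
      rcases min_choice (y₀ + w * ((p'.1 - t₀ : ℤ) : ℚ)) p'.2 with h | h <;> rw [h]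
      · exact ⟨y₀, t₀, h1, h2, rfl⟩
      · exact ⟨p'.2, p'.1, hp'.2, hp'.1, by simp⟩
    have i := ih hf.tail hy''
    obtain ⟨c1, c2, c3⟩ := crossing_le (b := 10 * b) (p := p) (p' := p') (by omega) (by omega)
      hybits hybits'
    rw [show 1200 * (10 * b) = 12000 * b by ring] at c1 c3
    have v1 := bitsZ_sub_le p'.1 p.1
    have v2 := bitsQ_intCast (p'.1 - p.1)
    have v3 := bitsQ_mul_le w ((p'.1 - p.1 : ℤ) : ℚ)
    have t1 := subZ_time_le (b := 12000 * b) (x := p'.1) (y := p.1) (by omega) (by omega)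
    have t2 := toQ_time_le (b := 12000 * b) (x := p'.1 - p.1) (by omega)
    have t3 := mulQ_time_le (b := 12000 * b) (u := w) (v := ((p'.1 - p.1 : ℤ) : ℚ))
      (by omega) (by omega)
    have t4 := addQ_time_le (b := 12000 * b) (u := y) (v := w * ((p'.1 - p.1 : ℤ) : ℚ))
      (by omega) (by omega)
    have t5 := minQ_time_le (b := 12000 * b) (u := y + w * ((p'.1 - p.1 : ℤ) : ℚ)) (v := p'.2)
      (by omega) (by omega)
    have e : (f.length + 1 + 1) * (50 * opTime (12000 * b)) =
      (f.length + 1) * (50 * opTime (12000 * b)) + 50 * opTime (12000 * b) := by ring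
    simp only [waitFrom, Timed.val_bind, Timed.time_bind, Timed.val_pure, Timed.time_pure,
      Timed.time_tick, subZ_val, toQ_val, mulQ_val, addQ_val, minQ_val, append_val, append_time,
      List.length_cons, List.length_append]
    generalize waitFrom w p' (min (y + w * ((p'.1 - p.1 : ℤ) : ℚ)) p'.2) f = r at *
    rw [e]
    refine ⟨(c1.append i.1).cons ?_ ?_, by omega, by omega⟩ <;> simp only <;> omega

theorem waiting_le {w : ℚ} {f : Profile} {n : ℕ} (hw : bitsQ w ≤ b) (hf : BitsLe b f)
    (hn : f.length + 1 ≤ n) :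
    BitsLe (12000 * b) (waiting w f).val ∧ (waiting w f).val.length ≤ 3 * n ∧
    (waiting w f).time ≤ n * (81 * opTime (300000 * b)) := by
  have hb0 := bitsQ_pos w
  have ho := opTime_pos (b := 300000 * b) (by omega)
  rcases f with _ | ⟨p, f⟩
  · have : 1 * (81 * opTime (300000 * b)) ≤ n * (81 * opTime (300000 * b)) :=
      Nat.mul_le_mul_right _ (by omega)
    simp only [waiting, Timed.val_bind, Timed.time_bind, Timed.val_pure, Timed.time_pure,
      Timed.time_tick, List.length_nil]
    exact ⟨bitsLe_nil, by omega, by omega⟩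
  · obtain ⟨h1, h2, h3⟩ := waitFrom_le (y := p.2) hw hf ⟨p.2, p.1, hf.head.2, hf.head.1, by simp⟩
    have h4 := prune_time_le h1
    have h5 := (prune_sublist (waitFrom w p p.2 f).val).1.length_le
    simp only [waiting, Timed.val_bind, Timed.time_bind, Timed.time_tick]
    rw [List.length_cons] at hn
    have h6 : (f.length + 1) * (50 * opTime (12000 * b)) ≤ n * (50 * opTime (300000 * b)) :=
      Nat.mul_le_mul (by omega) (Nat.mul_le_mul_left _ (opTime_mono (by omega)))
    have h7 : (waitFrom w p p.2 f).val.length * (10 * opTime (24 * (12000 * b))) ≤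
      (3 * n) * (10 * opTime (300000 * b)) :=
      Nat.mul_le_mul (by omega) (Nat.mul_le_mul_left _ (opTime_mono (by omega)))
    have h8 : 2 * 1 ≤ n * opTime (300000 * b) := Nat.mul_le_mul (by omega) ho
    have e1 : n * (81 * opTime (300000 * b)) = n * (50 * opTime (300000 * b)) +
      (3 * n) * (10 * opTime (300000 * b)) + n * opTime (300000 * b) := by ring
    exact ⟨h1.prune, by omega, by omega⟩

theorem consMin_le {t : ℤ} {x y : WithTop ℚ} {f : Profile} (ht : bitsZ t ≤ b) (hx : BitsTop b x)
    (hy : BitsTop b y) (hf : BitsLe b f) : BitsLe b (consMin t x y f).val ∧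
      (consMin t x y f).val.length ≤ f.length + 1 ∧ (consMin t x y f).time ≤ 2 * opTime b := by
  have hb := bitsZ_pos t
  have ho := opTime_pos (b := b) (by omega)
  induction x using WithTop.recTopCoe with
  | top =>
    induction y using WithTop.recTopCoe with
    | top =>
      refine ⟨hf, Nat.le_succ _, ?_⟩
      change 1 + 0 ≤ _; omega
    | coe y =>
      refine ⟨hf.cons (p := (t, y)) ht (bitsTop_coe.1 hy), le_rfl, ?_⟩
      change 1 + 0 ≤ _; omega
  | coe x =>
    induction y using WithTop.recTopCoe with
    | top =>
      refine ⟨hf.cons (p := (t, x)) ht (bitsTop_coe.1 hx), le_rfl, ?_⟩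
      change 1 + 0 ≤ _; omega
    | coe y =>
      have hx' := bitsTop_coe.1 hx
      have hy' := bitsTop_coe.1 hy
      have h1 : bitsQ (minQ x y).val ≤ b := by
        rw [minQ_val]; rcases min_choice x y with h | h <;> rw [h] <;> assumption
      refine ⟨hf.cons (p := (t, (minQ x y).val)) ht h1, le_rfl, ?_⟩
      have := minQ_time_le hx' hy'
      change 1 + ((minQ x y).time + 0) ≤ _; omega

theorem crossingTop_le {t t' : ℤ} {x y x' y' : WithTop ℚ} (ht : bitsZ t ≤ b) (ht' : bitsZ t' ≤ b)
    (hx : BitsTop b x) (hy : BitsTop b y) (hx' : BitsTop b x') (hy' : BitsTop b y') :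
    BitsLe (1200 * b) (crossingTop t t' x y x' y').val ∧
    (crossingTop t t' x y x' y').val.length ≤ 2 ∧
    (crossingTop t t' x y x' y').time ≤ 40 * opTime (1200 * b) := by
  have hb := bitsZ_pos t
  have ho := opTime_pos (b := 1200 * b) (by omega)
  have htop : ∀ r : Timed Profile, r = (do tick 1; return []) → BitsLe (1200 * b) r.val ∧
      r.val.length ≤ 2 ∧ r.time ≤ 40 * opTime (1200 * b) := by
    rintro r rfl
    simp only [Timed.val_bind, Timed.time_bind, Timed.val_pure, Timed.time_pure, Timed.time_tick]
    exact ⟨bitsLe_nil, by simp, by omega⟩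
  induction x using WithTop.recTopCoe with
  | top => exact htop _ rfl
  | coe x =>
    induction y using WithTop.recTopCoe with
    | top => exact htop _ rfl
    | coe y =>
      induction x' using WithTop.recTopCoe with
      | top => exact htop _ rfl
      | coe x' =>
        induction y' using WithTop.recTopCoe with
        | top => exact htop _ rfl
        | coe y' =>
          exact crossing_le (p := (t, x)) (p' := (t', x')) ⟨ht, bitsTop_coe.1 hx⟩
            ⟨ht', bitsTop_coe.1 hx'⟩ (bitsTop_coe.1 hy) (bitsTop_coe.1 hy')

theorem ltTop_time_le {x y : WithTop ℚ} (hb : 0 < b) (hx : BitsTop b x) (hy : BitsTop b y) :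
    (ltTop x y).time ≤ opTime b := by
  have ho := opTime_pos (b := b) (by omega)
  induction x using WithTop.recTopCoe with
  | top => change 1 + 0 ≤ _; omega
  | coe x =>
    induction y using WithTop.recTopCoe with
    | top => change 1 + 0 ≤ _; omega
    | coe y => exact ltQ_time_le (bitsTop_coe.1 hx) (bitsTop_coe.1 hy)

theorem minOn_le {f g : Profile} {l : List ℤ} {n : ℕ} (hb : 0 < b) (hf : BitsLe b f)
    (hg : BitsLe b g) (hl : ∀ t ∈ l, bitsZ t ≤ b) (hn : f.length + g.length + 4 ≤ n) :
    BitsLe (28800 * b) (minOn f g l).val ∧ (minOn f g l).val.length ≤ 3 * l.length ∧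
    (minOn f g l).time ≤ (l.length + 1) * (n * (60 * opTime (28800 * b))) := by
  have ho := opTime_pos (b := 28800 * b) (by omega)
  set op := opTime (28800 * b) with hop
  have hEv : ∀ (h : Profile), BitsLe b h → h.length + 1 ≤ n → ∀ t, bitsZ t ≤ b →
      BitsTop (24 * b) (evalAt h t).val ∧ (evalAt h t).time ≤ n * (11 * op) := by
    intro h hh hn t ht
    obtain ⟨h1, h2⟩ := evalAt_le hh ht
    exact ⟨h1, h2.trans (Nat.mul_le_mul hn (Nat.mul_le_mul_left _ (opTime_mono (by omega))))⟩
  have e0 : n * (60 * op) = n * (11 * op) + n * (11 * op) + n * (11 * op) + n * (11 * op) +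
    n * (16 * op) := by ring
  have e1 : 4 * (16 * op) ≤ n * (16 * op) := Nat.mul_le_mul_right _ (by omega)
  induction l with
  | nil =>
    simp only [minOn, Timed.val_bind, Timed.time_bind, Timed.val_pure, Timed.time_pure,
      Timed.time_tick, List.length_nil]
    exact ⟨bitsLe_nil, le_rfl, by omega⟩
  | cons t l ih =>
    have ht := hl t List.mem_cons_self
    have i := ih fun t ht => hl t (List.mem_cons_of_mem _ ht)
    obtain ⟨f1, f2⟩ := hEv f hf (by omega) t ht
    obtain ⟨g1, g2⟩ := hEv g hg (by omega) t ht
    have e : (l.length + 1 + 1) * (n * (60 * op)) = (l.length + 1) * (n * (60 * op)) +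
      n * (60 * op) := by ring
    rcases l with _ | ⟨t', l⟩
    · have c := consMin_le (b := 28800 * b) (t := t) (f := []) (by omega) (f1.mono (by omega))
        (g1.mono (by omega)) bitsLe_nil
      simp only [minOn, Timed.val_bind, Timed.time_bind, Timed.time_tick, List.length_cons,
        List.length_nil] at c e ⊢
      exact ⟨c.1, by omega, by omega⟩
    · have ht' := hl t' (List.mem_cons_of_mem _ List.mem_cons_self)
      obtain ⟨f3, f4⟩ := hEv f hf (by omega) t' ht'
      obtain ⟨g3, g4⟩ := hEv g hg (by omega) t' ht'
      simp only [minOn, Timed.val_bind, Timed.time_bind, Timed.time_tick, List.length_cons,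
        append_val, append_time] at i e ⊢
      generalize evalAt f t = x at *
      generalize evalAt g t = y at *
      generalize evalAt f t' = x' at *
      generalize evalAt g t' = y' at *
      obtain ⟨k1, k2, k3⟩ := crossingTop_le (b := 24 * b) (t := t) (t' := t') (by omega) (by omega)
        f1 g1 f3 g3
      rw [show 1200 * (24 * b) = 28800 * b by ring] at k1 k3
      generalize crossingTop t t' x.val y.val x'.val y'.val = m at *
      generalize minOn f g (t' :: l) = r at *
      have c := consMin_le (b := 28800 * b) (t := t) (f := m.val ++ r.val) (by omega)
        (f1.mono (by omega)) (g1.mono (by omega)) (k1.append i.1)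
      rw [List.length_append] at c
      rw [e]
      exact ⟨c.1, by omega, by omega⟩

theorem firstBelow_time_le {f g : Profile} {l : List ℤ} {n : ℕ} (hb : 0 < b) (hf : BitsLe b f)
    (hg : BitsLe b g) (hl : ∀ t ∈ l, bitsZ t ≤ b) (hn : f.length + g.length + 4 ≤ n) :
    (firstBelow f g l).time ≤ (l.length + 1) * (n * (60 * opTime (72 * b))) := by
  have ho := opTime_pos (b := 72 * b) (by omega)
  set op := opTime (72 * b) with hop
  have hEv : ∀ (h : Profile), BitsLe b h → h.length + 1 ≤ n → ∀ t, bitsZ t ≤ 3 * b →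
      BitsTop (72 * b) (evalAt h t).val ∧ (evalAt h t).time ≤ n * (11 * op) := by
    intro h hh hn t ht
    obtain ⟨h1, h2⟩ := evalAt_le (hh.mono (by omega)) ht
    rw [show 24 * (3 * b) = 72 * b by ring] at h1 h2
    exact ⟨h1, h2.trans (Nat.mul_le_mul_right _ hn)⟩
  have e0 : n * (60 * op) = n * (11 * op) + n * (11 * op) + n * (11 * op) + n * (11 * op) +
    n * (16 * op) := by ring
  have e1 : 4 * (16 * op) ≤ n * (16 * op) := Nat.mul_le_mul_right _ (by omega)
  induction l with
  | nil =>
    simp only [firstBelow, Timed.time_bind, Timed.time_pure, Timed.time_tick, List.length_nil]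
    omega
  | cons t l ih =>
    have ht := hl t List.mem_cons_self
    have i := ih fun t ht => hl t (List.mem_cons_of_mem _ ht)
    have v1 := bitsZ_add_le t 1
    have t1 := addZ_time_le (b := 72 * b) (x := t) (y := 1) (by omega) (by rw [bitsZ_one]; omega)
    rw [bitsZ_one] at v1
    obtain ⟨f1, f2⟩ := hEv f hf (by omega) t (by omega)
    obtain ⟨g1, g2⟩ := hEv g hg (by omega) t (by omega)
    obtain ⟨f3, f4⟩ := hEv f hf (by omega) (t + 1) (by omega)
    obtain ⟨g3, g4⟩ := hEv g hg (by omega) (t + 1) (by omega)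
    have e : (l.length + 1 + 1) * (n * (60 * op)) = (l.length + 1) * (n * (60 * op)) +
      n * (60 * op) := by ring
    have t2 := ltTop_time_le (by omega) g1 f1
    have t3 := ltTop_time_le (by omega) g3 f3
    simp only [firstBelow, Timed.time_bind, Timed.time_pure, Timed.time_tick, Timed.time_ite,
      addZ_val, List.length_cons]
    rw [e]
    split
    · omega
    · split <;> omega

theorem startTimes_le {f : Profile} (hb : 0 < b) (hf : BitsLe b f) :
    (∀ t ∈ (startTimes f).val, bitsZ t ≤ 3 * b) ∧ (startTimes f).val.length ≤ 1 ∧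
    (startTimes f).time ≤ 2 * opTime (2 * b) := by
  have ho := opTime_pos (b := 2 * b) (by omega)
  rcases f with _ | ⟨p, f⟩
  · simp only [startTimes, Timed.val_bind, Timed.time_bind, Timed.val_pure, Timed.time_pure,
      Timed.time_tick]
    exact ⟨by simp, by simp, by omega⟩
  · have hp := hf.head.1
    have v1 := bitsZ_sub_le p.1 1
    rw [bitsZ_one] at v1
    have t1 := subZ_time_le (b := 2 * b) (x := p.1) (y := 1) (by omega) (by rw [bitsZ_one]; omega)
    simp only [startTimes, Timed.val_bind, Timed.time_bind, Timed.val_pure, Timed.time_pure,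
      Timed.time_tick, subZ_val, List.mem_singleton, forall_eq, List.length_singleton]
    exact ⟨by omega, le_rfl, by omega⟩

theorem improve_time_le {tmin tmax : ℤ} {f g : Profile} {n : ℕ} (hmin : bitsZ tmin ≤ b)
    (hmax : bitsZ tmax ≤ b) (hf : BitsLe b f) (hg : BitsLe b g)
    (hn : f.length + g.length + 5 ≤ n) :
    (improve tmin tmax f g).time ≤ 500 * (n * n * opTime (8000000 * b)) := by
  have hb : 0 < b := (bitsZ_pos tmin).trans_le hmin
  set op := opTime (8000000 * b) with hop
  have ho : 1 ≤ op := opTime_pos (b := 8000000 * b) (by omega)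
  have hbound : ∀ x y c k, x ≤ 3 * n → y ≤ n → k ≤ 8000000 * b → x * (y * (c * opTime k)) ≤
      (3 * c) * (n * n * op) := by
    intro x y c k hx hy hk
    calc x * (y * (c * opTime k)) = c * (x * y * opTime k) := by ring
      _ ≤ c * (3 * n * n * op) := Nat.mul_le_mul_left _
        (Nat.mul_le_mul (Nat.mul_le_mul hx hy) (opTime_mono hk))
      _ = _ := by ring
  have hn2 : n ≤ n * n * op := by
    calc n = n * 1 * 1 := by ring
      _ ≤ n * n * op := Nat.mul_le_mul (Nat.mul_le_mul_left _ (by omega)) ho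
  obtain ⟨s1, s2, s3⟩ := startTimes_le hb hf
  obtain ⟨s4, s5, s6⟩ := startTimes_le hb hg
  simp only [improve, Timed.time_bind, append_val, append_time, times_time, times_val,
    List.length_map]
  have hl : ∀ t ∈ (startTimes g).val ++ ((startTimes f).val ++
      (List.map Prod.fst f ++ List.map Prod.fst g)), bitsZ t ≤ 3 * b := by
    intro t ht
    simp only [List.mem_append, ← times_val] at ht
    rcases ht with ht | ht | ht | ht
    · exact s4 t ht
    · exact s1 t ht
    · have := times_bits hf t ht; omega
    · have := times_bits hg t ht; omega
  have hlen : ((startTimes g).val ++ ((startTimes f).val ++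
      (List.map Prod.fst f ++ List.map Prod.fst g))).length ≤ n - 3 := by
    simp only [List.length_append, List.length_map]; omega
  have d1 := sortTimes_time_le (lo := tmin) (hi := tmax) hlen (by omega) (by omega) hl
  have d2 := sortTimes_bits tmin tmax hl
  have d3 := sortTimes_length_le tmin tmax ((startTimes g).val ++ ((startTimes f).val ++
      (List.map Prod.fst f ++ List.map Prod.fst g)))
  generalize startTimes f = lf at *
  generalize startTimes g = lg at *
  generalize sortTimes tmin tmax (lg.val ++ (lf.val ++
      (List.map Prod.fst f ++ List.map Prod.fst g))) = ts at *
  obtain ⟨m1, m2, m3⟩ := minOn_le (b := 3 * b) (n := n) (by omega) (hf.mono (by omega))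
    (hg.mono (by omega)) d2 (by omega)
  generalize minOn f g ts.val = h at *
  have hb1 := firstBelow_time_le (b := 28800 * (3 * b)) (n := n) (by omega) (hf.mono (by omega))
    (hg.mono (by omega)) (times_bits m1) (by omega)
  rw [times_val, List.length_map] at hb1
  have p1 := prune_time_le m1
  have g1 := hbound ((lg.val ++ (lf.val ++
      (List.map Prod.fst f ++ List.map Prod.fst g))).length + 1) (n - 3 + 2) 3 (3 * b) (by omega)
      (by omega) (by omega)
  have g2 := hbound (ts.val.length + 1) n 60 (28800 * (3 * b)) (by omega) (by omega) (by omega)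
  have g3 := hbound (h.val.length + 1) n 60 (72 * (28800 * (3 * b))) (by omega) (by omega)
    (by omega)
  have g4 := hbound h.val.length 1 10 (24 * (28800 * (3 * b))) (by omega) (by omega) (by omega)
  have g5 := hbound 1 1 2 (2 * b) (by omega) (by omega) (by omega)
  rw [one_mul] at g4 g5
  split
  · simp only [Timed.time_pure]
    omega
  · simp only [Timed.time_bind, Timed.time_pure]
    omega

end MinTime

/-! ### Lengths of the numbers that occur -/

section Size

variable (G : RoadGraph) (q : Query G)

theorem n_le_inputSize : G.n ≤ inputSize G q := by unfold inputSize; omega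

theorem r_le_inputSize : G.r + 1 ≤ inputSize G q := by unfold inputSize; omega

theorem bits_tmin_le : bitsZ q.tmin ≤ inputSize G q := by unfold inputSize; omega

theorem bits_tmax_le : bitsZ q.tmax ≤ inputSize G q := by unfold inputSize; omega

theorem bits_d_le : bitsQ G.d ≤ inputSize G q := by unfold inputSize; omega

theorem sum_bits_c_le : ∑ i, bitsQ (G.c i) ≤ inputSize G q := by unfold inputSize; omega

theorem bits_c_le (i : Fin (G.r + 1)) : bitsQ (G.c i) ≤ inputSize G q :=
  (Finset.single_le_sum (f := fun i => bitsQ (G.c i)) (fun _ _ => Nat.zero_le _)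
    (Finset.mem_univ i)).trans (sum_bits_c_le G q)

theorem sum_edges_le : (G.E.map fun e => 1 + bitsZ (G.δ e) +
    ((G.Φ e).map fun I => bitsZ I.1 + bitsZ I.2).sum).sum ≤ inputSize G q := by
  unfold inputSize; omega

variable {G} {q}

theorem edge_le {e : Fin G.n × Fin G.n} (he : e ∈ G.E) : 1 + bitsZ (G.δ e) +
    ((G.Φ e).map fun I => bitsZ I.1 + bitsZ I.2).sum ≤ inputSize G q :=
  (List.single_le_sum (fun _ _ => Nat.zero_le _) _ (List.mem_map.2 ⟨e, he, rfl⟩)).trans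
    (sum_edges_le G q)

theorem bits_δ_le {e : Fin G.n × Fin G.n} (he : e ∈ G.E) : bitsZ (G.δ e) ≤ inputSize G q := by
  have := edge_le (q := q) he; omega

theorem banBits_Φ {e : Fin G.n × Fin G.n} (he : e ∈ G.E) : BanBits (inputSize G q) (G.Φ e) := by
  intro I hI
  have h1 := edge_le (q := q) he
  have h2 : bitsZ I.1 + bitsZ I.2 ≤ ((G.Φ e).map fun I => bitsZ I.1 + bitsZ I.2).sum :=
    List.single_le_sum (fun _ _ => Nat.zero_le _) _ (List.mem_map.2 ⟨I, hI, rfl⟩)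
  omega

theorem length_le_sum {α : Type} (l : List α) (f : α → ℕ) (hf : ∀ a ∈ l, 1 ≤ f a) :
    l.length ≤ (l.map f).sum := by
  induction l with
  | nil => simp
  | cons a l ih =>
    have := hf a List.mem_cons_self
    have := ih fun a ha => hf a (List.mem_cons_of_mem _ ha)
    simp only [List.length_cons, List.map_cons, List.sum_cons]
    omega

theorem edges_length_le : G.E.length ≤ inputSize G q :=
  (length_le_sum _ _ fun e _ => by omega).trans (sum_edges_le G q)

theorem edges_banCount_le : G.E.length + G.banCount ≤ inputSize G q := by
  refine le_trans ?_ (sum_edges_le G q)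
  unfold RoadGraph.banCount
  induction G.E with
  | nil => simp
  | cons e l ih =>
    have := length_le_sum (G.Φ e) (fun I => bitsZ I.1 + bitsZ I.2)
      fun I _ => by have := bitsZ_pos I.1; omega
    simp only [List.length_cons, List.map_cons, List.sum_cons]
    omega

theorem bits_time_le {t : ℤ} (h1 : q.tmin ≤ t) (h2 : t ≤ q.tmax) : bitsZ t ≤ inputSize G q := by
  rcases le_total 0 t with h | h
  · exact (bitsZ_mono (by omega)).trans (bits_tmax_le G q)
  · exact (bitsZ_mono (by omega)).trans (bits_tmin_le G q)

theorem size_prod_le {ι : Type} (s : Finset ι) (f : ι → ℕ) :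
    (∏ i ∈ s, f i).size ≤ 1 + ∑ i ∈ s, (f i).size := by
  classical
  induction s using Finset.induction_on with
  | empty => simp [Nat.size_one]
  | insert i s hi ih =>
    rw [Finset.prod_insert hi, Finset.sum_insert hi]
    have := size_mul_le (f i) (∏ i ∈ s, f i)
    omega

/-- Costs are fractions with denominator `commonDen G` between zero and the costs of driving during
the whole horizon, so numerator and denominator are short. -/
theorem IsCost.bits_le {t : ℤ} {y : ℚ} (h : IsCost G q t y) (ht : t ≤ q.tmax) :
    bitsQ y ≤ 10 * inputSize G q := by
  have hN := (bitsZ_pos q.tmin).trans_le (bits_tmin_le G q)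
  have hQ0 : 0 < commonDen G := Finset.prod_pos fun i _ => (G.c i).den_pos
  have hQ : (commonDen G).size ≤ 1 + inputSize G q := by
    refine (size_prod_le _ _).trans (Nat.add_le_add_left ((Finset.sum_le_sum fun i _ => ?_).trans
      (sum_bits_c_le G q)) 1)
    unfold bitsQ; omega
  obtain ⟨z, hz⟩ := h.den
  have hQ0' : (0 : ℚ) < commonDen G := by exact_mod_cast hQ0
  have h1 : y = (z : ℚ) / ((commonDen G : ℤ) : ℚ) := by
    rw [← hz]; push_cast; field_simp
  have h2 := bitsQ_of_eq_div (by exact_mod_cast hQ0.ne') h1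
  have hz0 : 0 ≤ z := by
    have : (0 : ℚ) ≤ z := by rw [← hz]; exact mul_nonneg h.nonneg hQ0'.le
    exact_mod_cast this
  have h3 : z ≤ ⌊G.c 0 * ((q.tmax - q.tmin : ℤ) : ℚ) * ((commonDen G : ℤ) : ℚ)⌋ := by
    rw [Int.le_floor, ← hz]
    push_cast
    refine mul_le_mul_of_nonneg_right (h.le.trans (mul_le_mul_of_nonneg_left ?_ (G.c_nonneg 0)))
      hQ0'.le
    have : (t : ℚ) ≤ q.tmax := by exact_mod_cast ht
    linarith
  have h4 : bitsZ z ≤ bitsZ ⌊G.c 0 * ((q.tmax - q.tmin : ℤ) : ℚ) * ((commonDen G : ℤ) : ℚ)⌋ :=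
    bitsZ_mono (by omega)
  have h5 := bitsZ_floor_le (G.c 0 * ((q.tmax - q.tmin : ℤ) : ℚ) * ((commonDen G : ℤ) : ℚ))
  have h6 := bitsQ_mul_le (G.c 0 * ((q.tmax - q.tmin : ℤ) : ℚ)) ((commonDen G : ℤ) : ℚ)
  have h7 := bitsQ_mul_le (G.c 0) ((q.tmax - q.tmin : ℤ) : ℚ)
  have h8 := bitsQ_intCast (q.tmax - q.tmin)
  have h9 := bitsQ_intCast (commonDen G : ℤ)
  have h10 := bitsZ_sub_le q.tmax q.tmin
  have h11 := bits_tmin_le G q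
  have h12 := bits_tmax_le G q
  have h13 := bits_c_le G q 0
  have h14 : bitsZ (commonDen G : ℤ) = (commonDen G).size + 1 := by simp [bitsZ]
  have h15 : bitsZ z = z.natAbs.size + 1 := rfl
  simp only [Int.natAbs_natCast] at h2
  omega

end Size

/-! ### Time of an iteration of the main loop -/

section LoopTime

variable {G : RoadGraph} {q : Query G}

/-- A bound on the time for relaxing an edge, where `b` bounds the lengths of numbers and `L` the
lengths of profiles. -/
def relaxTime (b L : ℕ) : ℕ := 10000 * ((L + 4 * b + 20) * (L + 4 * b + 20) * opTime (10 ^ 14 * b))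

theorem le_opTime (b : ℕ) {k : ℕ} (hk : b ≤ k) : b ≤ opTime k := by
  unfold opTime
  have := Nat.le_self_pow (n := 2) (by norm_num) k
  omega

theorem decreaseKey_time_le {b : ℕ} {k : Option ℤ} {t : ℤ} (ht : bitsZ t ≤ b)
    (hk : ∀ k', k = some k' → bitsZ k' ≤ b) : (decreaseKey k t).time ≤ opTime b := by
  have ho := opTime_pos ((bitsZ_pos t).trans_le ht)
  rcases k with _ | k
  · change 1 + 0 ≤ _; omega
  · have := ltZ_time_le ht (hk k rfl)
    simp only [decreaseKey, Timed.time_bind, Timed.time_ite, Timed.time_pure, ite_self]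
    omega

theorem relax_time_le (hd : G.d = G.c 0) {σ : State G} (hσ : Rep q σ) {e : Fin G.n × Fin G.n}
    (he : e ∈ G.E) {tvisit : ℤ} {b L : ℕ} (hb : inputSize G q ≤ b) (hv : bitsZ tvisit ≤ b)
    (hf : ∀ v, BitsLe b (σ.prof v)) (hL : ∀ v, (σ.prof v).length ≤ L)
    (hk : ∀ v k, σ.queue v = some k → bitsZ k ≤ b) :
    (relax G q tvisit σ e).time ≤ relaxTime b L := by
  have hb0 := bitsZ_pos tvisit
  have hlink := link_repr he hd tvisit (hσ.repr e.1) (hσ.upTo e.1)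
  have hlu := linkFun_upTo he (tvisit := tvisit) (hσ.upTo e.1)
  have hwait : Repr (waiting (G.c (G.ρ e.2))
      (link (G.Φ e) (G.δ e) G.d (G.c 0) tvisit q.tmax (σ.prof e.1)).val).val
      (offer q tvisit (σ.toAbs.C e.1) e) := waiting_repr q _ hlink hlu
  have himp := improve_spec (hσ.repr e.2) hwait (hσ.upTo e.2) (offer_upTo q tvisit _ e)
  have s1 := n_le_inputSize G q
  have s2 := r_le_inputSize G q
  have s3 := edges_length_le (G := G) (q := q)
  have s4 := bits_tmin_le G q
  have s5 := bits_tmax_le G q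
  have s6 := length_le_banCount he
  have s7 := edges_banCount_le (G := G) (q := q)
  have hL1 := hL e.1
  have hL2 := hL e.2
  obtain ⟨l1, l2, l3⟩ := link_le (b := b) (Φ := G.Φ e) (drive := G.δ e) (tvisit := tvisit)
    (tmax := q.tmax) (d := G.d) (c₀ := G.c 0) (f := σ.prof e.1) (n := L + 4 * b + 5)
    (fun I hI => by have := banBits_Φ (q := q) he I hI; omega) (by omega)
    ((bits_δ_le he).trans hb) ((bits_d_le G q).trans hb) ((bits_c_le G q 0).trans hb) hv (by omega)
    (hf e.1) (by omega)
  simp only [relax, Timed.time_bind, Timed.val_load, Timed.time_load]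
  generalize link (G.Φ e) (G.δ e) G.d (G.c 0) tvisit q.tmax (σ.prof e.1) = g₁ at *
  obtain ⟨w1, w2, w3⟩ := waiting_le (b := 528 * b) (w := G.c (G.ρ e.2)) (f := g₁.val)
    (n := L + 4 * b + 6) (by have := bits_c_le G q (G.ρ e.2); omega) l1 (by omega)
  generalize waiting (G.c (G.ρ e.2)) g₁.val = g₂ at *
  have i1 := improve_time_le (b := 12000 * (528 * b)) (tmin := q.tmin) (tmax := q.tmax)
    (f := σ.prof e.2) (g := g₂.val) (n := 4 * (L + 4 * b + 20)) (by omega) (by omega)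
    ((hf e.2).mono (by omega)) w1 (by omega)
  set n := L + 4 * b + 20 with hn
  set op := opTime (10 ^ 14 * b) with hop
  have hle : ∀ k, k ≤ 10 ^ 14 * b → opTime k ≤ op := fun k hk => opTime_mono hk
  have hbop : b ≤ op := le_opTime b (by omega)
  have hbound : ∀ x y c k, x ≤ n → y ≤ n → k ≤ 10 ^ 14 * b → x * (y * (c * opTime k)) ≤
      c * (n * n * op) := by
    intro x y c k hx hy hk
    calc x * (y * (c * opTime k)) = c * (x * y * opTime k) := by ring
      _ ≤ c * (n * n * op) := Nat.mul_le_mul_left _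
        (Nat.mul_le_mul (Nat.mul_le_mul hx hy) (hle k hk))
  have g1 := hbound (L + 4 * b + 5) (L + 4 * b + 5) 200 (13000 * b) (by omega) (by omega) (by omega)
  have g2 := hbound (L + 4 * b + 6) 1 81 (300000 * (528 * b)) (by omega) (by omega) (by omega)
  have g3 := hbound n n 8000 (8000000 * (12000 * (528 * b))) le_rfl le_rfl (by omega)
  have g4 := hbound 1 1 1 b (by omega) (by omega) (by omega)
  have hn2 : 20 * 20 * op ≤ n * n * op :=
    Nat.mul_le_mul_right _ (Nat.mul_le_mul (by omega) (by omega))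
  rw [relaxTime, ← hn, ← hop]
  have r1 : 200 * ((L + 4 * b + 5) * (L + 4 * b + 5) * opTime (13000 * b)) =
    (L + 4 * b + 5) * ((L + 4 * b + 5) * (200 * opTime (13000 * b))) := by ring
  have r3 : 500 * (4 * n * (4 * n) * opTime (8000000 * (12000 * (528 * b)))) =
    n * (n * (8000 * opTime (8000000 * (12000 * (528 * b))))) := by ring
  rw [r1] at l3
  rw [r3] at i1
  rw [one_mul] at g2
  rw [one_mul, one_mul, one_mul] at g4
  have key : ∀ x, x ≤ 4 * op + opTime b → G.E.length + 1 + (G.E.length + 1 + (G.n + 1 +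
      (G.r + 1 + 1 + (G.r + 1 + 1 + (G.n + 1 + (G.n + 1 + (g₁.time + (g₂.time +
      ((improve q.tmin q.tmax (σ.prof e.2) g₂.val).time + x))))))))) ≤
      10000 * (n * n * op) := by
    intro x hx
    omega
  apply key
  split
  · simp only [Timed.time_pure]; omega
  · rename_i t h' hsome
    obtain ⟨hl, -, -⟩ := himp.2 t h' hsome
    have hb1 := (offer_upTo q tvisit (σ.toAbs.C e.1) e).bdd t hl.1.ne_top
    have := decreaseKey_time_le ((bits_time_le hb1.1 hb1.2).trans hb) (hk e.2)
    simp only [Timed.time_bind, Timed.time_load, Timed.time_tick, Timed.time_pure, Timed.val_load]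
    omega

/-- The invariant of the main loop, for stored profiles. -/
structure StateInv (q : Query G) (Φ : Finset ℚ) (popped : Finset (Fin G.n × ℤ)) (tvisit : ℤ)
    (pending : List (Fin G.n × Fin G.n)) (σ : State G) : Prop where
  rep : Rep q σ
  short : ∀ v, (σ.prof v).length ≤ 2 ∨ IsPruned (σ.prof v)
  inv : LoopInv q Φ popped tvisit pending σ.toAbs
  bits_tvisit : bitsZ tvisit ≤ inputSize G q

section

variable {Φ : Finset ℚ} {popped : Finset (Fin G.n × ℤ)} {tvisit : ℤ}
  {pending : List (Fin G.n × Fin G.n)} {σ : State G}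

theorem StateInv.bitsLe (H : StateInv q Φ popped tvisit pending σ) (v : Fin G.n) :
    BitsLe (10 * inputSize G q) (σ.prof v) := by
  intro p hp
  have h1 := (H.rep.repr v).val p hp
  have h2 := (H.rep.upTo v).bdd p.1 (by rw [h1]; exact WithTop.coe_ne_top)
  refine ⟨(bits_time_le h2.1 h2.2).trans (by omega), ?_⟩
  exact (H.inv.profiles.cost v p.1 p.2 h1).bits_le h2.2

theorem StateInv.length_le (H : StateInv q Φ popped tvisit pending σ) (v : Fin G.n) :
    (σ.prof v).length ≤ lengthBound G.r Φ.card :=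
  length_le_lengthBound (H.rep.repr v) (H.short v) (H.rep.upTo v) (H.inv.profiles.wait v)
    (H.inv.shift v)

theorem StateInv.key_bits (H : StateInv q Φ popped tvisit pending σ) (v : Fin G.n) (k : ℤ)
    (hk : σ.queue v = some k) : bitsZ k ≤ inputSize G q := by
  have h := (H.rep.upTo v).bdd k (H.inv.key v k hk).1
  exact bits_time_le h.1 h.2

theorem StateInv.relax (hd : G.d = G.c 0) {e : Fin G.n × Fin G.n} (he : e ∈ G.E)
    (H : StateInv q Φ popped tvisit (e :: pending) σ) :
    (relax G q tvisit σ e).val.toAbs = absRelax G q tvisit σ.toAbs e ∧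
    StateInv q (Φ ∪ newValues σ.toAbs.C e tvisit) popped tvisit pending (relax G q tvisit σ e).val ∧
    (TempBans.relax G q tvisit σ e).time ≤
      relaxTime (10 * inputSize G q) (lengthBound G.r Φ.card) := by
  obtain ⟨h1, h2, h3⟩ := relax_spec q hd H.rep he tvisit
  refine ⟨h1, ⟨h2, fun v => ?_, ?_, H.bits_tvisit⟩, ?_⟩
  · rcases h3 v with h | h
    · rw [h]; exact H.short v
    · exact Or.inr h
  · rw [h1]; exact H.inv.relax hd he
  · exact relax_time_le hd H.rep he (by omega) (by have := H.bits_tvisit; omega) H.bitsLe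
      H.length_le fun v k hk => by have := H.key_bits v k hk; omega

end

theorem lengthBound_mono (r : ℕ) {k k' : ℕ} (h : k ≤ k') : lengthBound r k ≤ lengthBound r k' := by
  unfold lengthBound
  have : (r + 1) * (2 * (k + 1)) ≤ (r + 1) * (2 * (k' + 1)) := Nat.mul_le_mul_left _ (by omega)
  omega

theorem relaxTime_mono {b L L' : ℕ} (h : L ≤ L') : relaxTime b L ≤ relaxTime b L' := by
  unfold relaxTime
  gcongr

/-- Relaxing all edges out of the visited vertex. The number of values at which routes cannot be
shifted grows by at most `1 + 2 |Φ(e)|` with each edge. -/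
theorem relaxAll_spec (hd : G.d = G.c 0) {u : Fin G.n} {tvisit : ℤ} {popped : Finset (Fin G.n × ℤ)}
    {M : ℕ} (l : List (Fin G.n × Fin G.n)) (hl : ∀ e ∈ l, e ∈ G.E) {Φ : Finset ℚ} {σ : State G}
    (H : StateInv q Φ popped tvisit (l.filter fun e => e.1 = u) σ)
    (hM : Φ.card + (l.map fun e => 1 + 2 * (G.Φ e).length).sum ≤ M) :
    (relaxAll G q u tvisit l σ).val.toAbs =
      (l.filter fun e => e.1 = u).foldl (absRelax G q tvisit) σ.toAbs ∧
    (∃ Φ' : Finset ℚ, Φ'.card ≤ M ∧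
      StateInv q Φ' popped tvisit [] (relaxAll G q u tvisit l σ).val) ∧
    (relaxAll G q u tvisit l σ).time ≤ (l.length + 1) *
      (inputSize G q + 1 + relaxTime (10 * inputSize G q) (lengthBound G.r M)) := by
  have hn := n_le_inputSize G q
  induction l generalizing Φ σ with
  | nil =>
    simp only [relaxAll, Timed.val_bind, Timed.val_pure, Timed.time_bind, Timed.time_pure,
      Timed.time_tick, List.length_nil]
    exact ⟨rfl, ⟨Φ, by simpa using hM, H⟩, by omega⟩
  | cons e l ih =>
    have hl' := fun e he => hl e (List.mem_cons_of_mem _ he)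
    have he := hl e List.mem_cons_self
    rw [List.map_cons, List.sum_cons] at hM
    have e1 : ∀ X : ℕ, (l.length + 1 + 1) * X = (l.length + 1) * X + X := fun X => by ring
    by_cases hu : e.1 = u
    · rw [List.filter_cons_of_pos (by simpa using hu)] at H ⊢
      obtain ⟨h1, h2, h3⟩ := H.relax hd he
      have hcard : (Φ ∪ newValues σ.toAbs.C e tvisit).card ≤ Φ.card + (1 + 2 * (G.Φ e).length) :=
        (Finset.card_union_le _ _).trans (Nat.add_le_add_left (card_newValues_le _ _ _) _)
      obtain ⟨i1, i2, i3⟩ := ih hl' h2 (by omega)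
      have h4 := h3.trans (relaxTime_mono (lengthBound_mono G.r (show Φ.card ≤ M by omega)))
      simp only [relaxAll, hu, if_true, Timed.val_bind, Timed.time_bind, Timed.time_tick,
        List.length_cons, List.foldl_cons]
      rw [h1] at i1
      rw [e1]
      exact ⟨i1, i2, by omega⟩
    · rw [List.filter_cons_of_neg (by simpa using hu)] at H ⊢
      obtain ⟨i1, i2, i3⟩ := ih hl' H (by omega)
      simp only [relaxAll, hu, if_false, Timed.val_bind, Timed.time_bind, Timed.time_tick,
        List.length_cons]
      rw [e1]
      exact ⟨i1, i2, by omega⟩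

/-- The search for an entry with the earliest key. -/
theorem findMin_spec (σ : State G) (l : List (Fin G.n)) :
    ((findMin G σ l).val = none → ∀ v ∈ l, σ.queue v = none) ∧
    ∀ u t, (findMin G σ l).val = some (u, t) → σ.queue u = some t ∧
      ∀ v ∈ l, ∀ k, σ.queue v = some k → t ≤ k := by
  induction l with
  | nil => simp [findMin]
  | cons v l ih =>
    obtain ⟨i1, i2⟩ := ih
    simp only [findMin, Timed.val_bind, Timed.val_load]
    generalize (findMin G σ l).val = best at *
    rcases hv : σ.queue v with _ | k
    · simp only [Timed.val_pure]
      refine ⟨fun h x hx => ?_, fun u t h => ⟨(i2 u t h).1, fun x hx k hk => ?_⟩⟩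
      · rcases List.mem_cons.1 hx with rfl | hx
        · exact hv
        · exact i1 h x hx
      · rcases List.mem_cons.1 hx with rfl | hx
        · rw [hv] at hk; exact absurd hk (by simp)
        · exact (i2 u t h).2 x hx k hk
    · rcases best with _ | ⟨v', k'⟩
      · simp only [Timed.val_pure]
        refine ⟨fun h => absurd h (by simp), fun u t h => ?_⟩
        simp only [Option.some.injEq, Prod.mk.injEq] at h
        obtain ⟨rfl, rfl⟩ := h
        refine ⟨hv, fun x hx k' hk' => ?_⟩
        rcases List.mem_cons.1 hx with rfl | hx
        · rw [hv, Option.some.injEq] at hk'; omega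
        · rw [i1 rfl x hx] at hk'; exact absurd hk' (by simp)
      · obtain ⟨j1, j2⟩ := i2 v' k' rfl
        simp only [Timed.val_bind, leZ_val, Timed.val_ite, Timed.val_pure, decide_eq_true_eq]
        refine ⟨fun h => ?_, fun u t h => ?_⟩
        · split at h <;> exact absurd h (by simp)
        · split at h
          · simp only [Option.some.injEq, Prod.mk.injEq] at h
            obtain ⟨rfl, rfl⟩ := h
            refine ⟨hv, fun x hx k'' hk'' => ?_⟩
            rcases List.mem_cons.1 hx with rfl | hx
            · rw [hv, Option.some.injEq] at hk''; omega
            · have := j2 x hx k'' hk''; omega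
          · simp only [Option.some.injEq, Prod.mk.injEq] at h
            obtain ⟨rfl, rfl⟩ := h
            refine ⟨j1, fun x hx k'' hk'' => ?_⟩
            rcases List.mem_cons.1 hx with rfl | hx
            · rw [hv, Option.some.injEq] at hk''; omega
            · exact j2 x hx k'' hk''

theorem findMin_time_le {σ : State G} {b : ℕ}
    (hk : ∀ v k, σ.queue v = some k → bitsZ k ≤ b) (l : List (Fin G.n)) :
    (findMin G σ l).time ≤ (l.length + 1) * (G.n + 2 + opTime b) := by
  induction l with
  | nil =>
    simp only [findMin, Timed.time_bind, Timed.time_tick, Timed.time_pure, List.length_nil]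
    omega
  | cons v l ih =>
    have e1 : ∀ X : ℕ, (l.length + 1 + 1) * X = (l.length + 1) * X + X := fun X => by ring
    have h2 := (findMin_spec σ l).2
    simp only [findMin, Timed.time_bind, Timed.time_tick, Timed.val_load, Timed.time_load,
      List.length_cons]
    rw [e1]
    generalize findMin G σ l = best at *
    rcases hv : σ.queue v with _ | k
    · simp only [Timed.time_pure]; omega
    · rcases hbest : best.val with _ | ⟨v', k'⟩
      · simp only [Timed.time_pure]; omega
      · have := leZ_time_le (hk v k hv) (hk v' k' (h2 v' k' hbest).1)
        simp only [Timed.time_bind, Timed.time_ite, Timed.time_pure, ite_self]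
        omega

end LoopTime

/-! ### Running the main loop -/

section Loop

variable {G : RoadGraph} {q : Query G}

theorem Runs.trans {x y w : Config G} {k l : ℕ} (h : Runs G q x k y) (h' : Runs G q y l w) :
    Runs G q x (k + l) w := by
  induction h with
  | refl x => rwa [zero_add]
  | step x _ ih =>
    rw [add_assoc]; exact Runs.step x (ih h')

theorem Runs.one (x : Config G) : Runs G q x (TempBans.step G q x).time (TempBans.step G q x).val := by
  have := Runs.step (q := q) x (Runs.refl (TempBans.step G q x).val)
  rwa [add_zero] at this

/-- A bound on the time of an iteration of the main loop, where `N` is the encoding length of the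
input and `M` bounds the number of values at which routes cannot be shifted. -/
def iterTime (N M : ℕ) : ℕ :=
  2 * (N + 1) + (N + 1) * (N + 2 + opTime N) + (N + 1) * (N + 1 + relaxTime (10 * N) (lengthBound N M))

theorem lengthBound_mono' {r r' : ℕ} (k : ℕ) (h : r ≤ r') : lengthBound r k ≤ lengthBound r' k := by
  unfold lengthBound
  have : (r + 1) * (2 * (k + 1)) ≤ (r' + 1) * (2 * (k + 1)) := Nat.mul_le_mul_right _ (by omega)
  omega

theorem iterTime_mono (N : ℕ) {M M' : ℕ} (h : M ≤ M') : iterTime N M ≤ iterTime N M' := by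
  unfold iterTime
  have := Nat.mul_le_mul_left (N + 1) (Nat.add_le_add_left
    (relaxTime_mono (b := 10 * N) (lengthBound_mono N h)) (N + 1))
  omega

/-- An iteration of the main loop. -/
theorem StateInv.step (hd : G.d = G.c 0) {Φ : Finset ℚ} {popped : Finset (Fin G.n × ℤ)} {tvisit : ℤ}
    {σ : State G} (H : StateInv q Φ popped tvisit [] σ) : (∀ v, σ.queue v = none) ∨
    ∃ σ' Φ' u t, (TempBans.step G q (.loop σ)).val = .loop σ' ∧ (u, t) ∉ popped ∧
      StateInv q Φ' (insert (u, t) popped) t [] σ' ∧ Φ'.card ≤ Φ.card + 2 * inputSize G q ∧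
      AbsIteration G q σ.toAbs σ'.toAbs ∧ (TempBans.step G q (.loop σ)).time ≤
        iterTime (inputSize G q) (Φ.card + 2 * inputSize G q) := by
  obtain ⟨f1, f2⟩ := findMin_spec σ (List.finRange G.n)
  have f3 := findMin_time_le (b := inputSize G q) H.key_bits (List.finRange G.n)
  rw [List.length_finRange] at f3
  rcases hmin : (findMin G σ (List.finRange G.n)).val with _ | ⟨u, t⟩
  · exact Or.inl fun v => f1 hmin v (List.mem_finRange v)
  · right
    obtain ⟨g1, g2⟩ := f2 u t hmin
    have hmin' : ∀ v k, σ.queue v = some k → t ≤ k := fun v k hk => g2 v (List.mem_finRange v) k hk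
    obtain ⟨p1, p2⟩ := H.inv.pop (u := u) (t := t) g1 hmin'
    have hS : StateInv q Φ (insert (u, t) popped) t (G.E.filter fun e => e.1 = u)
        { σ with queue := Function.update σ.queue u none } :=
      ⟨⟨H.rep.repr, H.rep.upTo⟩, H.short, p2, H.key_bits u t g1⟩
    have hsum : (G.E.map fun e => 1 + 2 * (G.Φ e).length).sum = G.E.length + 2 * G.banCount := by
      unfold RoadGraph.banCount
      induction G.E with
      | nil => rfl
      | cons e l ih => simp only [List.map_cons, List.sum_cons, List.length_cons, ih]; omega
    have hb := edges_banCount_le (G := G) (q := q)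
    obtain ⟨r1, ⟨Φ', r2, r3⟩, r4⟩ := relaxAll_spec hd G.E (fun _ h => h) hS
      (M := Φ.card + 2 * inputSize G q) (by rw [hsum]; omega)
    refine ⟨_, Φ', u, t, ?_, p1, r3, r2, ⟨u, t, g1, hmin', r1⟩, ?_⟩
    · simp only [TempBans.step, Timed.val_bind, hmin, Timed.val_pure]
    · simp only [TempBans.step, Timed.time_bind, Timed.time_tick, hmin, Timed.time_pure]
      have s1 := n_le_inputSize G q
      have s2 := r_le_inputSize G q
      have s3 := edges_length_le (G := G) (q := q)
      have t1 : (G.n + 1) * (G.n + 2 + opTime (inputSize G q)) ≤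
        (inputSize G q + 1) * (inputSize G q + 2 + opTime (inputSize G q)) :=
        Nat.mul_le_mul (by omega) (by omega)
      have t2 := relaxTime_mono (b := 10 * inputSize G q) (lengthBound_mono'
        (Φ.card + 2 * inputSize G q) (show G.r ≤ inputSize G q by omega))
      have t3 := Nat.mul_le_mul (show G.E.length + 1 ≤ inputSize G q + 1 by omega)
        (Nat.add_le_add_left t2 (inputSize G q + 1))
      unfold iterTime
      omega

theorem init_stateInv (q : Query G) :
    StateInv q {0 - G.c 0 * q.tmin} ∅ q.tmin [] (init G q).val := by
  refine ⟨init_rep, fun v => Or.inl (init_length_le v), ?_, bits_tmin_le G q⟩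
  rw [init_toAbs]
  exact absInit_loopInv q

/-- A bound on the number of iterations of the main loop. -/
def iterations (N : ℕ) : ℕ := N * visitBound N (1 + 2 * N)

theorem card_banValues_le_inputSize (q : Query G) :
    (banValues q).card ≤ 1 + 2 * inputSize G q := by
  have := card_banValues_le q
  have := edges_banCount_le (G := G) (q := q)
  omega

theorem StateInv.card_popped_le {Φ : Finset ℚ} {popped : Finset (Fin G.n × ℤ)} {tvisit : ℤ}
    {pending : List (Fin G.n × Fin G.n)} {σ : State G}
    (H : StateInv q Φ popped tvisit pending σ) : popped.card ≤ iterations (inputSize G q) := by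
  have s1 := n_le_inputSize G q
  have s2 := r_le_inputSize G q
  refine H.inv.card_popped_le.trans (Nat.mul_le_mul s1 ?_)
  have h := card_banValues_le_inputSize q
  unfold visitBound
  have := Nat.mul_le_mul (show G.r + 1 ≤ inputSize G q + 1 by omega) (Nat.add_le_add_right h 1)
  omega

/-- A bound on the number of values at which routes cannot be shifted. -/
def valueBound (N : ℕ) : ℕ := 1 + 2 * N * iterations N

/-- The main loop ends, by induction on the number `j` of further iterations that the bound on the
number of visits allows. -/
theorem loop_terminates (hd : G.d = G.c 0) (j : ℕ) {Φ : Finset ℚ} {popped : Finset (Fin G.n × ℤ)}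
    {tvisit : ℤ} {σ : State G} (H : StateInv q Φ popped tvisit [] σ)
    (hΦ : Φ.card ≤ 1 + 2 * inputSize G q * popped.card)
    (hj : iterations (inputSize G q) ≤ popped.card + j) :
    ∃ k σ' Φ' popped' tvisit', Runs G q (.loop σ) k (.loop σ') ∧
      k ≤ j * iterTime (inputSize G q) (valueBound (inputSize G q)) ∧
      StateInv q Φ' popped' tvisit' [] σ' ∧ Φ'.card ≤ valueBound (inputSize G q) ∧
      ∀ v, σ'.queue v = none := by
  have hM : Φ.card ≤ valueBound (inputSize G q) := by
    have := Nat.mul_le_mul_left (2 * inputSize G q) H.card_popped_le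
    unfold valueBound
    omega
  induction j generalizing Φ popped tvisit σ with
  | zero =>
    -- a further visit would exceed the bound
    rcases H.step hd with h | ⟨σ', Φ', u, t, -, h2, h3, -⟩
    · exact ⟨0, σ, Φ, popped, tvisit, Runs.refl _, by omega, H, hM, h⟩
    · have h4 := h3.card_popped_le
      rw [Finset.card_insert_of_notMem h2] at h4
      omega
  | succ j ih =>
    rcases H.step hd with h | ⟨σ', Φ', u, t, h1, h2, h3, h4, -, h6⟩
    · exact ⟨0, σ, Φ, popped, tvisit, Runs.refl _, by omega, H, hM, h⟩
    · have hc := Finset.card_insert_of_notMem h2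
      have hp := h3.card_popped_le
      have e1 : 2 * inputSize G q * (popped.card + 1) =
        2 * inputSize G q * popped.card + 2 * inputSize G q := by ring
      have hM' : Φ.card + 2 * inputSize G q ≤ valueBound (inputSize G q) := by
        have := Nat.mul_le_mul_left (2 * inputSize G q) hp
        rw [hc, e1] at this
        unfold valueBound
        omega
      obtain ⟨k, σ'', Φ'', popped'', tvisit'', i1, i2, i3⟩ := ih h3 (by rw [hc, e1]; omega)
        (by omega) (by omega)
      have hrun := Runs.one (q := q) (.loop σ)
      rw [h1] at hrun
      refine ⟨_, σ'', Φ'', popped'', tvisit'', hrun.trans i1, ?_, i3⟩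
      have h7 := h6.trans (iterTime_mono (inputSize G q) hM')
      rw [Nat.succ_mul]
      omega

/-- Configurations of the finalization phase. -/
def Config.IsFinal : Config G → Prop
  | .loop _ => False
  | _ => True

theorem step_isFinal {x : Config G} (hx : x.IsFinal) : (TempBans.step G q x).val.IsFinal := by
  rcases x with σ | ⟨prof, _ | ⟨t, todo⟩, _ | ⟨p, route⟩, out⟩ | out
  · exact hx.elim
  · trivial
  · simp only [TempBans.step, Timed.val_bind, Timed.val_ite]
    split
    · trivial
    · split <;> trivial
  · trivial
  · simp only [TempBans.step, Timed.val_bind, Timed.val_ite]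
    split
    · trivial
    · split <;> trivial
  · trivial

theorem Runs.isFinal {x y : Config G} {k : ℕ} (h : Runs G q x k y) (hx : x.IsFinal) :
    y.IsFinal := by
  induction h with
  | refl x => exact hx
  | step x _ ih => exact ih (step_isFinal hx)

theorem loop_of_queue_empty {σ : State G} (h : ∀ v, σ.queue v = none) :
    (TempBans.step G q (.loop σ)).val =
      .extract σ.prof (paretoTimes (σ.prof q.z)).val [] [] ∧
    (TempBans.step G q (.loop σ)).time = G.n + 1 + ((findMin G σ (List.finRange G.n)).time +
      (G.n + 1 + (paretoTimes (σ.prof q.z)).time)) := by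
  have hmin : (findMin G σ (List.finRange G.n)).val = none := by
    rcases hmin : (findMin G σ (List.finRange G.n)).val with _ | ⟨u, t⟩
    · rfl
    · have := ((findMin_spec σ _).2 u t hmin).1
      rw [h u] at this
      exact absurd this (by simp)
  constructor
  · simp only [TempBans.step, Timed.val_bind, hmin, Timed.val_pure, Timed.val_load]
  · simp only [TempBans.step, Timed.time_bind, Timed.time_tick, hmin, Timed.time_pure,
      Timed.time_load, Timed.val_load, add_zero]

/-- Each state between two iterations comes from iterations on functions. -/
theorem StateInv.loop_sound (hd : G.d = G.c 0) {k : ℕ} {x y : Config G} (h : Runs G q x k y) :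
    ∀ {Φ : Finset ℚ} {popped : Finset (Fin G.n × ℤ)} {tvisit : ℤ} {σ σ' : State G},
      StateInv q Φ popped tvisit [] σ → x = .loop σ → y = .loop σ' →
      Relation.ReflTransGen (AbsIteration G q) σ.toAbs σ'.toAbs := by
  induction h with
  | refl x =>
    rintro Φ popped tvisit σ σ' - rfl h
    obtain rfl := Config.loop.inj h
    exact Relation.ReflTransGen.refl
  | step x h ih =>
    rintro Φ popped tvisit σ σ' H rfl rfl
    rcases H.step hd with h0 | ⟨σ₁, Φ', u, t, h1, h2, h3, h4, h5, -⟩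
    · rw [(loop_of_queue_empty h0).1] at h
      exact (h.isFinal trivial).elim
    · exact Relation.ReflTransGen.head h5 (ih h3 h1 rfl)

end Loop

/-! ### Arrival times of Pareto-optimal routes -/

theorem bitsZ_le_of_between {x y t : ℤ} {b : ℕ} (hx : bitsZ x ≤ b) (hy : bitsZ y ≤ b)
    (h1 : x ≤ t) (h2 : t ≤ y) : bitsZ t ≤ b := by
  rcases le_total 0 t with h | h
  · exact (bitsZ_mono (by omega)).trans hy
  · exact (bitsZ_mono (by omega)).trans hx

theorem mem_consRange {k : ℕ} {t x : ℤ} {l : List ℤ} :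
    x ∈ (consRange k t l).val ↔ (t ≤ x ∧ x < t + k) ∨ x ∈ l := by
  induction k generalizing t with
  | zero =>
    simp only [consRange, Timed.val_bind, Timed.val_pure, Nat.cast_zero, add_zero]
    constructor
    · exact Or.inr
    · rintro (h | h)
      · omega
      · exact h
  | succ k ih =>
    simp only [consRange, Timed.val_bind, Timed.val_pure, addZ_val, List.mem_cons, ih]
    push_cast
    rw [← or_assoc]
    refine or_congr_left ?_
    omega

theorem consRange_pairwise {k : ℕ} {t : ℤ} {l : List ℤ} (hl : l.Pairwise (· < ·))
    (h : ∀ x ∈ l, t + k ≤ x) : (consRange k t l).val.Pairwise (· < ·) := by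
  induction k generalizing t with
  | zero => simpa [consRange] using hl
  | succ k ih =>
    simp only [consRange, Timed.val_bind, Timed.val_pure, addZ_val]
    push_cast at h
    refine List.pairwise_cons.2 ⟨fun x hx => ?_, ih fun x hx => by have := h x hx; omega⟩
    rcases mem_consRange.1 hx with hx | hx
    · omega
    · have := h x hx; omega

theorem length_consRange (k : ℕ) (t : ℤ) (l : List ℤ) :
    (consRange k t l).val.length = k + l.length := by
  induction k generalizing t with
  | zero => simp [consRange]
  | succ k ih =>
    simp only [consRange, Timed.val_bind, Timed.val_pure, addZ_val, List.length_cons, ih]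
    omega

theorem consRange_time_le {k : ℕ} {t y : ℤ} {l : List ℤ} {b : ℕ} (h2 : 2 ≤ b) (ht : bitsZ t ≤ b)
    (hy : bitsZ y ≤ b) (h : t + k ≤ y + 1) :
    (consRange k t l).time ≤ k * (2 * opTime b) + 1 := by
  have ho := opTime_pos (b := b) (by omega)
  induction k generalizing t with
  | zero => simp [consRange]
  | succ k ih =>
    have t1 := addZ_time_le (b := b) ht (y := 1) (by rw [bitsZ_one]; exact h2)
    simp only [consRange, Timed.time_bind, Timed.time_tick, Timed.time_pure, addZ_val]
    push_cast at h
    have e : (k + 1) * (2 * opTime b) = k * (2 * opTime b) + 2 * opTime b := by ring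
    rcases Nat.eq_zero_or_pos k with rfl | hk
    · simp only [consRange, Timed.time_bind, Timed.time_tick, Timed.time_pure]
      omega
    · have := ih (t := t + 1) (bitsZ_le_of_between ht hy (by omega) (by omega)) (by omega)
      omega

theorem Seg.lt_pred_iff {h : ℤ → WithTop ℚ} {p p' : ℤ × ℚ} (H : Seg h p p') {t : ℤ}
    (h1 : p.1 < t) (h2 : t ≤ p'.1) : h t < h (t - 1) ↔ p'.2 < p.2 := by
  rw [H.2 t h1.le h2, H.2 (t - 1) (by omega) (by omega), WithTop.coe_lt_coe, line_eq_slope,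
    line_eq_slope]
  have hpos : (0 : ℚ) < ((p'.1 - p.1 : ℤ) : ℚ) := by
    have := H.1
    exact_mod_cast (by omega : 0 < p'.1 - p.1)
  have e : (p'.2 - p.2) / ((p'.1 - p.1 : ℤ) : ℚ) < 0 ↔ p'.2 < p.2 := by
    rw [div_neg_iff]
    constructor
    · rintro (h | h)
      · linarith [h.2]
      · linarith [h.1]
    · intro h
      exact Or.inr ⟨by linarith, hpos⟩
  rw [← e]
  push_cast
  constructor <;> intro h <;> linarith

/-- The times at which a profile decreases. On a segment it decreases everywhere or nowhere. -/
theorem dropsFrom_spec {h : ℤ → WithTop ℚ} (p : ℤ × ℚ) (f : Profile)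
    (hc : (p :: f).IsChain (Seg h)) : (dropsFrom p f).val.Pairwise (· < ·) ∧
      ∀ t, t ∈ (dropsFrom p f).val ↔ p.1 < t ∧ (∃ p' ∈ f, t ≤ p'.1) ∧ h t < h (t - 1) := by
  induction f generalizing p with
  | nil => simp [dropsFrom]
  | cons p' f ih =>
    rw [List.isChain_cons_cons] at hc
    obtain ⟨ih1, ih2⟩ := ih p' hc.2
    have hlt := hc.1.1
    have hs := (List.pairwise_cons.1 (Repr.pairwise hc.2)).1
    have hex : ∀ t, (∃ p'' ∈ p' :: f, t ≤ p''.1) ↔ t ≤ p'.1 ∨ ∃ p'' ∈ f, t ≤ p''.1 := by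
      intro t; simp
    simp only [dropsFrom, Timed.val_bind, Timed.val_ite, Timed.val_pure, subZ_val, addZ_val,
      ltQ_val, decide_eq_true_eq]
    have hk : ((p'.1 - p.1).toNat : ℤ) = p'.1 - p.1 := Int.toNat_of_nonneg (by omega)
    split
    · rename_i hdrop
      refine ⟨consRange_pairwise ih1 fun x hx => ?_, fun t => ?_⟩
      · have := ((ih2 x).1 hx).1
        omega
      · rw [mem_consRange, hk, ih2, hex]
        constructor
        · rintro (h1 | ⟨h1, h2, h3⟩)
          · exact ⟨by omega, Or.inl (by omega),
              (hc.1.lt_pred_iff (by omega) (by omega)).2 hdrop⟩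
          · exact ⟨by omega, Or.inr h2, h3⟩
        · rintro ⟨h1, h2, h3⟩
          by_cases h4 : t ≤ p'.1
          · exact Or.inl ⟨by omega, by omega⟩
          · exact Or.inr ⟨by omega, h2.resolve_left h4, h3⟩
    · rename_i hdrop
      refine ⟨ih1, fun t => ?_⟩
      rw [ih2, hex]
      constructor
      · rintro ⟨h1, h2, h3⟩
        exact ⟨by omega, Or.inr h2, h3⟩
      · rintro ⟨h1, h2, h3⟩
        by_cases h4 : t ≤ p'.1
        · exact absurd ((hc.1.lt_pred_iff h1 h4).1 h3) hdrop
        · exact ⟨by omega, h2.resolve_left h4, h3⟩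

theorem dropsFrom_time_le {b : ℕ} (h2 : 2 ≤ b) (p : ℤ × ℚ) (f : Profile)
    (hs : (p :: f).Pairwise fun p p' => p.1 < p'.1) (hb : BitsLe b (p :: f)) :
    (dropsFrom p f).time ≤
      (f.length + 1) * (6 * opTime b) + (dropsFrom p f).val.length * (2 * opTime b) := by
  have ho := opTime_pos (b := b) (by omega)
  induction f generalizing p with
  | nil => simp only [dropsFrom, Timed.time_bind, Timed.time_tick, Timed.time_pure, List.length_nil]
           omega
  | cons p' f ih =>
    have h1 := ih p' hs.tail hb.tail
    have hlt := (List.pairwise_cons.1 hs).1 p' List.mem_cons_self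
    have t1 := ltQ_time_le hb.tail.head.2 hb.head.2
    have t2 := subZ_time_le hb.tail.head.1 hb.head.1
    have t3 := addZ_time_le (b := b) hb.head.1 (y := 1) (by rw [bitsZ_one]; exact h2)
    have hk : ((p'.1 - p.1).toNat : ℤ) = p'.1 - p.1 := Int.toNat_of_nonneg (by omega)
    have t4 := consRange_time_le (k := (p'.1 - p.1).toNat) (t := p.1 + 1)
      (l := (dropsFrom p' f).val) h2 (bitsZ_le_of_between hb.head.1 hb.tail.head.1 (by omega)
        (by omega)) hb.tail.head.1 (by omega)
    have e : (f.length + 1 + 1) * (6 * opTime b) = (f.length + 1) * (6 * opTime b) + 6 * opTime b := by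
      ring
    simp only [dropsFrom, Timed.val_bind, Timed.val_ite, Timed.val_pure, Timed.time_bind,
      Timed.time_tick, Timed.time_ite, Timed.time_pure, List.length_cons, subZ_val, addZ_val]
    rw [e]
    split
    · rw [length_consRange, Nat.add_mul (p'.1 - p.1).toNat]
      omega
    · omega

/-- Filtering a list for the times with values below all values before. -/
theorem mem_paretoFrom {f : Profile} {best : WithTop ℚ} {l : List ℤ} (hl : l.Pairwise (· < ·))
    {t : ℤ} : t ∈ (paretoFrom f best l).val ↔ t ∈ l ∧ f.toFun t < best ∧
      ∀ t' ∈ l, t' < t → f.toFun t < f.toFun t' := by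
  induction l generalizing best with
  | nil => simp [paretoFrom]
  | cons t₀ l ih =>
    obtain ⟨h0, hl⟩ := List.pairwise_cons.1 hl
    have e : (evalAt f t₀).val = f.toFun t₀ := rfl
    simp only [paretoFrom, Timed.val_bind, Timed.val_ite, Timed.val_pure, ltTop_val, e,
      decide_eq_true_eq]
    split
    · rename_i hb
      rw [List.mem_cons, ih hl]
      constructor
      · rintro (rfl | ⟨h1, h2, h3⟩)
        · refine ⟨List.mem_cons_self, hb, fun t' ht' hlt => ?_⟩
          rcases List.mem_cons.1 ht' with rfl | ht'
          · omega
          · have := h0 t' ht'; omega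
        · refine ⟨List.mem_cons_of_mem _ h1, h2.trans hb, fun t' ht' hlt => ?_⟩
          rcases List.mem_cons.1 ht' with rfl | ht'
          · exact h2
          · exact h3 t' ht' hlt
      · rintro ⟨h1, h2, h3⟩
        rcases List.mem_cons.1 h1 with rfl | h1
        · exact Or.inl rfl
        · exact Or.inr ⟨h1, h3 t₀ List.mem_cons_self (h0 t h1),
            fun t' ht' => h3 t' (List.mem_cons_of_mem _ ht')⟩
    · rename_i hb
      rw [ih hl]
      constructor
      · rintro ⟨h1, h2, h3⟩
        refine ⟨List.mem_cons_of_mem _ h1, h2, fun t' ht' hlt => ?_⟩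
        rcases List.mem_cons.1 ht' with rfl | ht'
        · exact h2.trans_le (not_lt.1 hb)
        · exact h3 t' ht' hlt
      · rintro ⟨h1, h2, h3⟩
        rcases List.mem_cons.1 h1 with rfl | h1
        · exact absurd h2 hb
        · exact ⟨h1, h2, fun t' ht' => h3 t' (List.mem_cons_of_mem _ ht')⟩

theorem paretoFrom_sublist (f : Profile) (best : WithTop ℚ) (l : List ℤ) :
    (paretoFrom f best l).val.Sublist l := by
  induction l generalizing best with
  | nil => simp [paretoFrom]
  | cons t l ih =>
    simp only [paretoFrom, Timed.val_bind, Timed.val_ite, Timed.val_pure]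
    split
    · exact (ih _).cons_cons t
    · exact (ih _).cons t

theorem paretoFrom_time_le {b : ℕ} {f : Profile} (hf : BitsLe b f) {l : List ℤ}
    (hl : ∀ t ∈ l, bitsZ t ≤ b) {best : WithTop ℚ} (hbest : BitsTop (24 * b) best) :
    (paretoFrom f best l).time ≤ (l.length + 1) * ((f.length + 2) * (11 * opTime (24 * b))) + 1 := by
  induction l generalizing best with
  | nil => simp only [paretoFrom, Timed.time_bind, Timed.time_tick, Timed.time_pure]; omega
  | cons t l ih =>
    have ht := hl t List.mem_cons_self
    have hb := bitsZ_pos t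
    have ho := opTime_pos (b := 24 * b) (by omega)
    obtain ⟨v1, t1⟩ := evalAt_le hf ht
    have t2 := ltTop_time_le (b := 24 * b) (by omega) v1 hbest
    have i1 := ih (fun t ht => hl t (List.mem_cons_of_mem _ ht)) hbest
    have i2 := ih (fun t ht => hl t (List.mem_cons_of_mem _ ht)) v1
    have e1 : (l.length + 1 + 1) * ((f.length + 2) * (11 * opTime (24 * b))) =
      (l.length + 1) * ((f.length + 2) * (11 * opTime (24 * b))) +
        ((f.length + 1) * (11 * opTime (24 * b)) + 11 * opTime (24 * b)) := by ring
    simp only [paretoFrom, Timed.time_bind, Timed.time_tick, Timed.time_ite, Timed.time_pure,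
      List.length_cons]
    rw [e1]
    split <;> omega

theorem Repr.le_of_ne_top {h : ℤ → WithTop ℚ} {p : ℤ × ℚ} {f : Profile} (H : Repr (p :: f) h)
    {t : ℤ} (ht : h t ≠ ⊤) : p.1 ≤ t := by
  obtain ⟨p', hp', -, -, h1, -⟩ := H.dom t ht
  rcases List.mem_cons.1 hp' with rfl | hp'
  · exact h1
  · have := (List.pairwise_cons.1 (Repr.pairwise H.chain)).1 p' hp'
    omega

theorem cons_dropsFrom_pairwise {h : ℤ → WithTop ℚ} {p : ℤ × ℚ} {f : Profile}
    (hc : (p :: f).IsChain (Seg h)) : (p.1 :: (dropsFrom p f).val).Pairwise (· < ·) :=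
  List.pairwise_cons.2 ⟨fun t ht => (((dropsFrom_spec p f hc).2 t).1 ht).1, (dropsFrom_spec p f hc).1⟩

theorem paretoTimes_pairwise {f : Profile} {h : ℤ → WithTop ℚ} (H : Repr f h) :
    (paretoTimes f).val.Pairwise (· < ·) := by
  rcases f with _ | ⟨p, f⟩
  · simp [paretoTimes]
  · simp only [paretoTimes, Timed.val_bind]
    exact (cons_dropsFrom_pairwise H.chain).sublist (paretoFrom_sublist _ _ _)

/-- It suffices to look at times at which the profile decreases: between two of them it only grows.
-/
theorem mem_paretoTimes {f : Profile} {h : ℤ → WithTop ℚ} (H : Repr f h) {t : ℤ} :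
    t ∈ (paretoTimes f).val ↔ h t ≠ ⊤ ∧ ∀ t' < t, h t < h t' := by
  rcases f with _ | ⟨p, f⟩
  · simp only [paretoTimes, Timed.val_bind, Timed.val_pure, List.not_mem_nil, false_iff, not_and]
    intro ht
    obtain ⟨p, hp, -⟩ := H.dom t ht
    exact absurd hp List.not_mem_nil
  · have hd := (dropsFrom_spec p f H.chain).2
    simp only [paretoTimes, Timed.val_bind]
    rw [mem_paretoFrom (cons_dropsFrom_pairwise H.chain), H.toFun_eq, List.mem_cons]
    constructor
    · rintro ⟨h1, h2, h3⟩
      refine ⟨h2.ne, fun t' ht' => ?_⟩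
      by_cases hp : p.1 ≤ t'
      · induction t', hp using Int.leInduction with
        | base => exact h3 _ List.mem_cons_self ht'
        | succ k hk ih =>
          by_cases hmem : k + 1 ∈ (dropsFrom p f).val
          · exact h3 _ (List.mem_cons_of_mem _ hmem) ht'
          · have hlt := ih (by omega)
            refine hlt.trans_le (not_lt.1 fun hk' => hmem ((hd _).2 ⟨by omega, ?_, ?_⟩))
            · obtain ⟨-, -, p', hp', -, h4⟩ := H.dom _ h2.ne
              rcases List.mem_cons.1 hp' with rfl | hp'
              · omega
              · exact ⟨p', hp', by omega⟩
            · rwa [add_sub_cancel_right]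
      · have : h t' = ⊤ := by
          by_contra hne
          exact hp (H.le_of_ne_top hne)
        rwa [this]
    · rintro ⟨h1, h2⟩
      refine ⟨?_, lt_top_iff_ne_top.2 h1, fun t' _ => h2 t'⟩
      rcases (H.le_of_ne_top h1).eq_or_lt with h3 | h3
      · exact Or.inl h3.symm
      · refine Or.inr ((hd t).2 ⟨h3, ?_, h2 _ (by omega)⟩)
        obtain ⟨-, -, p', hp', -, h4⟩ := H.dom _ h1
        rcases List.mem_cons.1 hp' with rfl | hp'
        · omega
        · exact ⟨p', hp', h4⟩

theorem paretoTimes_time_le {b : ℕ} (h2 : 2 ≤ b) {f : Profile} {h : ℤ → WithTop ℚ} (H : Repr f h)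
    (hb : BitsLe b f) {D : ℕ} (hD : ∀ l : List ℤ, l.Nodup →
      (∀ t ∈ l, h (t - 1) ≠ ⊤ ∧ h t < h (t - 1)) → l.length ≤ D) :
    (paretoTimes f).val.length ≤ D + 1 ∧
    (paretoTimes f).time ≤ (f.length + D + 2) * (6 * opTime b) +
      (D + 2) * ((f.length + 2) * (11 * opTime (24 * b))) + 2 := by
  rcases f with _ | ⟨p, f⟩
  · simp only [paretoTimes, Timed.val_bind, Timed.val_pure, Timed.time_bind, Timed.time_tick,
      Timed.time_pure, List.length_nil]
    omega
  · have hd := dropsFrom_spec p f H.chain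
    have hlen : (dropsFrom p f).val.length ≤ D := by
      refine hD _ (hd.1.imp fun h => h.ne) fun t ht => ?_
      obtain ⟨h3, ⟨p', hp', h4⟩, h5⟩ := (hd.2 t).1 ht
      refine ⟨fun htop => ?_, h5⟩
      have hdom : ∀ (p : ℤ × ℚ) (f : Profile), (p :: f).IsChain (Seg h) → h p.1 ≠ ⊤ →
          ∀ p' ∈ p :: f, ∀ x, p.1 ≤ x → x ≤ p'.1 → h x ≠ ⊤ := by
        intro p f
        induction f generalizing p with
        | nil =>
          intro _ hp p' hp' x hx hx'
          rw [List.mem_singleton] at hp'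
          subst hp'
          rwa [show x = p'.1 by omega]
        | cons p₁ f ih =>
          intro hc hp p' hp' x hx hx'
          rw [List.isChain_cons_cons] at hc
          by_cases hle : x ≤ p₁.1
          · rw [hc.1.2 x hx hle]; exact WithTop.coe_ne_top
          · refine ih p₁ hc.2 (by rw [hc.1.right]; exact WithTop.coe_ne_top) p' ?_ x (by omega) hx'
            rcases List.mem_cons.1 hp' with rfl | hp'
            · have := hc.1.1; omega
            · exact hp'
      exact hdom p f H.chain (by rw [H.val p List.mem_cons_self]; exact WithTop.coe_ne_top) p'
        (List.mem_cons_of_mem _ hp') (t - 1) (by omega) (by omega) htop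
    have t1 := dropsFrom_time_le h2 p f (Repr.pairwise H.chain) hb
    have hbits : ∀ t ∈ p.1 :: (dropsFrom p f).val, bitsZ t ≤ b := by
      intro t ht
      rcases List.mem_cons.1 ht with rfl | ht
      · exact hb.head.1
      · obtain ⟨h3, ⟨p', hp', h4⟩, -⟩ := (hd.2 t).1 ht
        exact bitsZ_le_of_between hb.head.1 (hb.tail p' hp').1 h3.le h4
    have t2 := paretoFrom_time_le hb hbits (best := ⊤) bitsTop_top
    have l1 := (paretoFrom_sublist (p :: f) ⊤ (p.1 :: (dropsFrom p f).val)).length_le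
    simp only [paretoTimes, Timed.val_bind, Timed.time_bind, Timed.time_tick, List.length_cons]
      at t2 l1 ⊢
    generalize (dropsFrom p f).val = l at *
    generalize (dropsFrom p f).time = T1 at *
    generalize (paretoFrom (p :: f) ⊤ (p.1 :: l)).time = T2 at *
    refine ⟨by omega, ?_⟩
    have m1 := Nat.mul_le_mul_right ((f.length + 1 + 2) * (11 * opTime (24 * b)))
      (show l.length + 1 + 1 ≤ D + 2 by omega)
    have m2 := Nat.mul_le_mul_right (2 * opTime b) hlen
    have e : (f.length + 1 + D + 2) * (6 * opTime b) = (f.length + 1) * (6 * opTime b) +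
      D * (2 * opTime b) + (D * (4 * opTime b) + 12 * opTime b) := by ring
    omega

/-! ### The backward construction of routes -/

section Backward

variable {G : RoadGraph} {q : Query G}

theorem eqTop_val {a y : WithTop ℚ} {x : ℚ} :
    (eqTop a x y).val = true ↔ ∃ a' : ℚ, a = a' ∧ y = (a' + x : ℚ) := by
  induction a using WithTop.recTopCoe with
  | top => exact ⟨fun h => absurd h Bool.false_ne_true,
      fun ⟨_, h, _⟩ => absurd h WithTop.top_ne_coe⟩
  | coe a =>
    induction y using WithTop.recTopCoe with
    | top => exact ⟨fun h => absurd h Bool.false_ne_true,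
        fun ⟨_, _, h⟩ => absurd h WithTop.top_ne_coe⟩
    | coe y =>
      change decide (a + x = y) = true ↔ _
      rw [decide_eq_true_eq]
      constructor
      · rintro rfl; exact ⟨a, rfl, rfl⟩
      · rintro ⟨a', h1, h2⟩
        rw [WithTop.coe_injective h1, WithTop.coe_injective h2]

theorem eqTop_time_le {b : ℕ} {a y : WithTop ℚ} {x : ℚ} (ha : BitsTop b a) (hx : bitsQ x ≤ b)
    (hy : BitsTop b y) : (eqTop a x y).time ≤ 2 * opTime (4 * b) := by
  have hb := bitsQ_pos x
  have ho := opTime_pos (b := 4 * b) (by omega)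
  induction a using WithTop.recTopCoe with
  | top => change 1 + 0 ≤ _; omega
  | coe a =>
    induction y using WithTop.recTopCoe with
    | top => change 1 + 0 ≤ _; omega
    | coe y =>
      rw [bitsTop_coe] at ha hy
      have v := bitsQ_add_le a x
      have t1 := addQ_time_le (b := 4 * b) (u := a) (v := x) (by omega) (by omega)
      have t2 := eqQ_time_le (b := 4 * b) (u := a + x) (v := y) (by omega) (by omega)
      change (addQ a x).time + (eqQ (a + x) y).time ≤ _
      omega

/-- The optimal costs of being at `v` at time `t`, within the planning horizon. -/
noncomputable def optUpTo (q : Query G) (v : Fin G.n) (t : ℤ) : WithTop ℚ :=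
  if t ≤ q.tmax then opt q v t else ⊤

theorem optUpTo_of_le {v : Fin G.n} {t : ℤ} (h : t ≤ q.tmax) : optUpTo q v t = opt q v t := if_pos h

theorem optUpTo_ne_top {v : Fin G.n} {t : ℤ} (h : optUpTo q v t ≠ ⊤) :
    t ≤ q.tmax ∧ opt q v t ≠ ⊤ := by
  unfold optUpTo at h
  split at h
  · exact ⟨‹_›, h⟩
  · exact absurd rfl h

/-- The stored profiles, with at most `L` breakpoints each, are the optimal costs. -/
structure Exact (q : Query G) (L : ℕ) (prof : Fin G.n → Profile) : Prop where
  repr : ∀ v, Repr (prof v) (optUpTo q v)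
  bits : ∀ v, BitsLe (10 * inputSize G q) (prof v)
  short : ∀ v, (prof v).length ≤ L

theorem StateInv.exact {Φ : Finset ℚ} {popped : Finset (Fin G.n × ℤ)} {tvisit : ℤ} {σ : State G}
    (H : StateInv q Φ popped tvisit [] σ) (hq : ∀ v, σ.queue v = none) :
    Exact q (lengthBound G.r Φ.card) σ.prof := by
  refine ⟨fun v => ?_, H.bitsLe, H.length_le⟩
  have e : σ.toAbs.C v = optUpTo q v := by
    funext t
    unfold optUpTo
    split
    · refine H.inv.eq_opt ‹_› (fun v k hk => ?_) v
      exact absurd ((hq v).symm.trans hk) (by simp)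
    · by_contra hne
      have := ((H.rep.upTo v).bdd t hne).2
      omega
  rw [← e]
  exact H.rep.repr v

theorem Exact.evalAt_val {L : ℕ} {prof : Fin G.n → Profile} (H : Exact q L prof) (v : Fin G.n)
    {t : ℤ} (ht : t ≤ q.tmax) : (evalAt (prof v) t).val = opt q v t :=
  ((H.repr v).evalAt_val t).trans (optUpTo_of_le ht)

/-- The search for an edge that explains the costs `y` at `v`: the result is correct, and an edge is
found if there is one. -/
theorem findEdge_spec (hd : G.d = G.c 0) {L : ℕ} {prof : Fin G.n → Profile} (H : Exact q L prof)
    {v : Fin G.n} {t : ℤ} (ht : t ≤ q.tmax) {y : WithTop ℚ} (l : List (Fin G.n × Fin G.n))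
    (hl : ∀ e ∈ l, e ∈ G.E) :
    (∀ u x, (findEdge G prof v t y l).val = some (u, x) → (u, v) ∈ l ∧ x = lastDep G (u, v) t ∧
      ∃ a : ℚ, opt q u x = a ∧ y = (a + G.c 0 * (t - x) : ℚ)) ∧
    ((findEdge G prof v t y l).val = none → ∀ u, (u, v) ∈ l → ∀ a : ℚ,
      opt q u (lastDep G (u, v) t) = a → y ≠ (a + G.c 0 * (t - lastDep G (u, v) t) : ℚ)) := by
  induction l with
  | nil => simp [findEdge]
  | cons e l ih =>
    obtain ⟨ih1, ih2⟩ := ih fun e he => hl e (List.mem_cons_of_mem _ he)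
    have he := hl e List.mem_cons_self
    obtain ⟨u₀, v₀⟩ := e
    have hx := (lastDep_spec he t).1
    have hev := H.evalAt_val u₀ (t := lastDep G (u₀, v₀) t) (by omega)
    have hcost : G.d * ((G.δ (u₀, v₀) : ℤ) : ℚ) +
        G.c 0 * ((t - lastDep G (u₀, v₀) t - G.δ (u₀, v₀) : ℤ) : ℚ) =
        G.c 0 * (t - lastDep G (u₀, v₀) t) := by
      rw [hd]; push_cast; ring
    have hL : (latestDeparture (sortBans (mirror (G.Φ (u₀, v₀))).val).val (G.δ (u₀, v₀)) t).val =
        lastDep G (u₀, v₀) t :=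
      rfl
    simp only [findEdge, Timed.val_bind, Timed.val_ite, Timed.val_pure, Timed.val_load, hL, subZ_val,
      toQ_val, mulQ_val, addQ_val, hcost, hev]
    by_cases hv : v₀ = v
    · subst hv
      simp only [if_true]
      split
      · rename_i hex
        rw [eqTop_val] at hex
        obtain ⟨a, h1, h2⟩ := hex
        refine ⟨?_, fun h => absurd h (by simp)⟩
        rintro u x h
        obtain ⟨rfl, rfl⟩ := Prod.mk.inj (Option.some.inj h)
        exact ⟨List.mem_cons_self, rfl, a, h1, h2⟩
      · rename_i hex
        refine ⟨fun u x h => ?_, fun h u hu a ha hy => ?_⟩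
        · obtain ⟨h1, h2⟩ := ih1 u x h
          exact ⟨List.mem_cons_of_mem _ h1, h2⟩
        · rcases List.mem_cons.1 hu with hu | hu
          · obtain ⟨rfl, -⟩ := Prod.mk.inj hu
            exact hex (eqTop_val.2 ⟨a, ha, hy⟩)
          · exact ih2 h u hu a ha hy
    · rw [if_neg hv]
      refine ⟨fun u x h => ?_, fun h u hu a ha hy => ?_⟩
      · obtain ⟨h1, h2⟩ := ih1 u x h
        exact ⟨List.mem_cons_of_mem _ h1, h2⟩
      · rcases List.mem_cons.1 hu with hu | hu
        · exact absurd (Prod.mk.inj hu).2.symm hv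
        · exact ih2 h u hu a ha hy

/-- A bound on the time for one edge in the search for an edge, where `b` bounds the input and `L`
the number of breakpoints. -/
def edgeTime (b L : ℕ) : ℕ := (b + L + 3) * (b + L + 3) * (40 * opTime (1000 * b))

theorem sum_le_edgeTime {b L op : ℕ} (T : ℕ) (ho : 1 ≤ op) (hop : op = opTime (1000 * b)) :
    (b + 1) + ((b + 1) + ((b + 1) + ((b + 1) + ((b + 1) * (3 * op) +
      ((b + 1) * ((b + 1) * (2 * op)) + ((b + 2) * (6 * op) + (op + (op + (op + (op + (op + (op +
      ((b + 1) + ((L + 1) * (11 * op) + (op + (2 * op + T)))))))))))))))) ≤ edgeTime b L + T := by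
  have e2 : edgeTime b L = (b + 1) * ((b + 1) * (2 * op)) + (b + 2) * (6 * op) +
      (L + 1) * (11 * op) + (b + 1) * (3 * op) + 20 * op + 5 * (b * op) +
      (38 * (b * b * op) + 40 * (L * L * op) + 80 * (b * L * op) + 222 * (b * op) +
        229 * (L * op) + 312 * op) := by
    rw [hop]; unfold edgeTime; ring
  have e3 : b ≤ b * op := Nat.le_mul_of_pos_right b (by omega)
  omega

/-- The time for looking at one edge, before a further time `T`. -/
theorem edge_rest_time_le {L : ℕ} {prof : Fin G.n → Profile} (H : Exact q L prof)
    {e : Fin G.n × Fin G.n} (he : e ∈ G.E) {t : ℤ} (ht : bitsZ t ≤ inputSize G q) {y : WithTop ℚ}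
    (hy : BitsTop (240 * inputSize G q) y) (T : ℕ) :
    (G.n + 1) + ((G.E.length + 1) + ((G.E.length + 1) + ((G.r + 1 + 1) + ((mirror (G.Φ e)).time +
      ((sortBans (mirror (G.Φ e)).val).time +
      ((latestDeparture (sortBans (mirror (G.Φ e)).val).val (G.δ e) t).time +
      ((subZ t (lastDep G e t)).time + ((subZ (subZ t (lastDep G e t)).val (G.δ e)).time +
      ((toQ (G.δ e)).time + ((mulQ G.d (toQ (G.δ e)).val).time +
      ((toQ (subZ (subZ t (lastDep G e t)).val (G.δ e)).val).time +
      ((mulQ (G.c 0) (toQ (subZ (subZ t (lastDep G e t)).val (G.δ e)).val).val).time + ((G.n + 1) +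
      ((evalAt (prof e.1) (lastDep G e t)).time + ((addQ (mulQ G.d (toQ (G.δ e)).val).val
        (mulQ (G.c 0) (toQ (subZ (subZ t (lastDep G e t)).val (G.δ e)).val).val).val).time +
      ((eqTop (evalAt (prof e.1) (lastDep G e t)).val (addQ (mulQ G.d (toQ (G.δ e)).val).val
        (mulQ (G.c 0) (toQ (subZ (subZ t (lastDep G e t)).val (G.δ e)).val).val).val).val
        y).time + T)))))))))))))))) ≤ edgeTime (inputSize G q) L + T := by
  simp only [subZ_val, toQ_val, mulQ_val, addQ_val]
  obtain ⟨b, hb⟩ : ∃ b, b = inputSize G q := ⟨_, rfl⟩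
  have hn := n_le_inputSize G q
  have hr := r_le_inputSize G q
  have hm := edges_length_le (G := G) (q := q)
  have hΦ : BanBits (inputSize G q) (G.Φ e) := banBits_Φ he
  have hδ : bitsZ (G.δ e) ≤ inputSize G q := bits_δ_le he
  have hΦl : (G.Φ e).length ≤ inputSize G q :=
    ((length_le_banCount he).trans (Nat.le_add_left _ _)).trans edges_banCount_le
  have wd := bits_d_le G q
  have wc := bits_c_le G q 0
  have hf := H.bits e.1
  have hfl := H.short e.1
  have hb0 := bitsZ_pos t
  rw [← hb] at hn hr hm ht hy hΦ hδ hΦl wd wc hf ⊢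
  obtain ⟨op, hop⟩ : ∃ op, op = opTime (1000 * b) := ⟨_, rfl⟩
  have ho : 1 ≤ op := by rw [hop]; exact opTime_pos (by omega)
  have key := sum_le_edgeTime (b := b) (L := L) T ho hop
  have hmo : ∀ {k}, k ≤ 1000 * b → opTime k ≤ op := fun h => by rw [hop]; exact opTime_mono h
  clear hop hb
  refine le_trans ?_ key
  clear key
  have v3 := (latestDeparture_le (rem := G.δ e) (t := t) hΦ.mirror.sortBans
    (by exact_mod_cast Nat.zero_le _) hδ ht).1
  have hL : (latestDeparture (sortBans (mirror (G.Φ e)).val).val (G.δ e) t).val = lastDep G e t :=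
    rfl
  rw [hL] at v3
  clear hL
  generalize lastDep G e t = x at *
  have v4 := bitsZ_sub_le t x
  have v5 := bitsZ_sub_le (t - x) (G.δ e)
  have v6 := bitsQ_intCast (G.δ e : ℤ)
  have v7 := bitsQ_intCast (t - x - G.δ e)
  have v8 := bitsQ_mul_le G.d ((G.δ e : ℤ) : ℚ)
  have v9 := bitsQ_mul_le (G.c 0) ((t - x - G.δ e : ℤ) : ℚ)
  have v10 := bitsQ_add_le (G.d * ((G.δ e : ℤ) : ℚ)) (G.c 0 * ((t - x - G.δ e : ℤ) : ℚ))
  have hx : bitsZ x ≤ 10 * b := by omega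
  have hb1 : 0 < b := by omega
  refine Nat.add_le_add (by omega) (Nat.add_le_add (by omega) (Nat.add_le_add (by omega)
    (Nat.add_le_add (by omega) (Nat.add_le_add ?_ (Nat.add_le_add ?_ (Nat.add_le_add ?_
    (Nat.add_le_add ?_ (Nat.add_le_add ?_ (Nat.add_le_add ?_ (Nat.add_le_add ?_ (Nat.add_le_add ?_
    (Nat.add_le_add ?_ (Nat.add_le_add (by omega) (Nat.add_le_add ?_ (Nat.add_le_add ?_
    (Nat.add_le_add_right ?_ T))))))))))))))))
  · exact (mirror_time_le hb1 hΦ).trans (Nat.mul_le_mul (by omega)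
      (Nat.mul_le_mul_left 3 (hmo (by omega))))
  · refine (sortBans_time_le (M := b) (by rw [length_mirror]; exact hΦl) hb1 hΦ.mirror).trans ?_
    rw [length_mirror]
    exact Nat.mul_le_mul (by omega) (Nat.mul_le_mul_left _ (Nat.mul_le_mul_left 2 (hmo (by omega))))
  · refine (latestDeparture_le hΦ.mirror.sortBans (by exact_mod_cast Nat.zero_le _) hδ ht).2.trans ?_
    rw [length_sortBans, length_mirror]
    exact Nat.mul_le_mul (by omega) (Nat.mul_le_mul_left 6 (hmo (by omega)))
  · exact (subZ_time_le (b := 1000 * b) (by omega) (by omega)).trans (hmo le_rfl)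
  · exact (subZ_time_le (b := 1000 * b) (by omega) (by omega)).trans (hmo le_rfl)
  · exact (toQ_time_le (b := 1000 * b) (by omega)).trans (hmo le_rfl)
  · exact (mulQ_time_le (b := 1000 * b) (by omega) (by omega)).trans (hmo le_rfl)
  · exact (toQ_time_le (b := 1000 * b) (by omega)).trans (hmo le_rfl)
  · exact (mulQ_time_le (b := 1000 * b) (by omega) (by omega)).trans (hmo le_rfl)
  · exact (evalAt_le hf hx).2.trans (Nat.mul_le_mul (by omega)
      (Nat.mul_le_mul_left 11 (hmo (by omega))))
  · exact (addQ_time_le (b := 1000 * b) (by omega) (by omega)).trans (hmo le_rfl)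
  · exact (eqTop_time_le (b := 240 * b) ((evalAt_le hf hx).1.mono (by omega)) (by omega) hy).trans
      (Nat.mul_le_mul_left 2 (hmo (by omega)))

theorem findEdge_time_le {L : ℕ} {prof : Fin G.n → Profile} (H : Exact q L prof) {v : Fin G.n}
    {t : ℤ} (ht : bitsZ t ≤ inputSize G q) {y : WithTop ℚ} (hy : BitsTop (240 * inputSize G q) y)
    (l : List (Fin G.n × Fin G.n)) (hl : ∀ e ∈ l, e ∈ G.E) :
    (findEdge G prof v t y l).time ≤ (l.length + 1) * edgeTime (inputSize G q) L := by
  induction l with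
  | nil =>
    rw [List.length_nil, zero_add, one_mul]
    exact Nat.mul_pos (Nat.mul_pos (Nat.succ_pos _) (Nat.succ_pos _))
      (Nat.mul_pos (by norm_num) (opTime_pos (by have := (bitsZ_pos t).trans_le ht; omega)))
  | cons e l ih =>
    have ih := ih fun e he => hl e (List.mem_cons_of_mem _ he)
    have hrest := edge_rest_time_le H (hl e List.mem_cons_self) ht hy
    rw [List.length_cons, Nat.succ_mul, Nat.add_comm (_ * _) (edgeTime _ _), findEdge]
    by_cases hv : e.2 = v
    · rw [if_pos hv]
      refine (hrest _).trans (Nat.add_le_add_left ?_ _)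
      beta_reduce
      split
      · exact Nat.zero_le _
      · exact ih
    · rw [if_neg hv]
      exact Nat.add_le_add (le_trans (Nat.le_add_right _ _) (hrest 0)) ih

/-- The optimal costs at time `t` do not come from waiting: being at `v` one time unit before and
waiting there costs more. -/
def Strict (q : Query G) (v : Fin G.n) (t : ℤ) : Prop :=
  opt q v t < opt q v (t - 1) + (G.c (G.ρ v) : ℚ)

theorem opt_wait_le (v : Fin G.n) {t t' : ℤ} (h : t ≤ t') :
    opt q v t' ≤ opt q v t + ((G.c (G.ρ v) * (t' - t) : ℚ) : WithTop ℚ) := by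
  induction t', h using Int.leInduction with
  | base => simp
  | succ k hk ih =>
    refine (opt_wait q v k).trans ((add_le_add ih le_rfl).trans ?_)
    rw [add_assoc, ← WithTop.coe_add]
    refine add_le_add le_rfl (WithTop.coe_le_coe.2 (le_of_eq ?_))
    push_cast; ring

/-- The search finds the earliest breakpoint, or the departure time itself, from which waiting until
the departure explains the costs. -/
theorem findArrival_mem {f : Profile} {h : ℤ → WithTop ℚ} (H : Repr f h) {w : ℚ} {dep : ℤ} {a : ℚ}
    (ha : h dep = a) {l : List ℤ} (hl : l.Pairwise (· < ·)) :
    ((findArrival f w dep a l).val ≤ dep ∧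
      h (findArrival f w dep a l).val = (a - w * (dep - (findArrival f w dep a l).val) : ℚ)) ∧
    ∀ t ∈ l, t < dep → h t = (a - w * (dep - t) : ℚ) → (findArrival f w dep a l).val ≤ t := by
  induction l with
  | nil => simp [findArrival, ha]
  | cons t l ih =>
    obtain ⟨h0, hl⟩ := List.pairwise_cons.1 hl
    obtain ⟨ih1, ih2⟩ := ih hl
    have e : (∃ a' : ℚ, h t = a' ∧ (a : WithTop ℚ) = (a' + w * ((dep - t : ℤ) : ℚ) : ℚ)) ↔
        h t = (a - w * (dep - t) : ℚ) := by
      constructor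
      · rintro ⟨a', h1, h2⟩
        rw [h1, WithTop.coe_injective h2]
        congr 1
        push_cast
        ring
      · intro h1
        refine ⟨_, h1, ?_⟩
        congr 1
        push_cast
        ring
    simp only [findArrival, Timed.val_bind, Timed.val_ite, Timed.val_pure, ltZ_val, subZ_val, toQ_val,
      mulQ_val, eqTop_val, H.evalAt_val, e, decide_eq_true_eq]
    by_cases hlt : t < dep
    · simp only [hlt, if_true]
      split
      · rename_i ht
        refine ⟨⟨hlt.le, ht⟩, fun t' ht' _ _ => ?_⟩
        rcases List.mem_cons.1 ht' with rfl | ht'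
        · exact le_rfl
        · exact (h0 t' ht').le
      · rename_i ht
        refine ⟨ih1, fun t' ht' h1 h2 => ?_⟩
        rcases List.mem_cons.1 ht' with rfl | ht'
        · exact absurd h2 ht
        · exact ih2 t' ht' h1 h2
    · simp only [hlt, if_false]
      refine ⟨⟨le_rfl, by rw [ha]; congr 1; ring⟩, fun t' ht' h1 _ => ?_⟩
      rcases List.mem_cons.1 ht' with rfl | ht'
      · exact absurd h1 hlt
      · have := h0 t' ht'; omega

/-- The earliest time from which waiting explains the costs is a breakpoint: before, the profile
grows differently. -/
theorem findArrival_spec {L : ℕ} {prof : Fin G.n → Profile} (H : Exact q L prof) {u : Fin G.n}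
    {x : ℤ} (hx : x ≤ q.tmax) {a : ℚ} (ha : opt q u x = a) {t : ℤ}
    (ht : t = (findArrival (prof u) (G.c (G.ρ u)) x a ((prof u).map Prod.fst)).val) :
    t ≤ x ∧ opt q u t = (a - G.c (G.ρ u) * (x - t) : ℚ) ∧ Strict q u t := by
  have hs : ((prof u).map Prod.fst).Pairwise (· < ·) :=
    List.pairwise_map.2 (Repr.pairwise (H.repr u).chain)
  obtain ⟨⟨h1, h2⟩, h3⟩ := findArrival_mem (H.repr u) (w := G.c (G.ρ u)) (dep := x) (a := a)
    ((optUpTo_of_le hx).trans ha) hs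
  rw [← ht] at h1 h2 h3
  rw [optUpTo_of_le (by omega)] at h2
  refine ⟨h1, h2, ?_⟩
  by_contra hns
  have hpred : ∀ k : ℤ, opt q u k = (a - G.c (G.ρ u) * (x - k) : ℚ) → ¬ Strict q u k →
      opt q u (k - 1) = (a - G.c (G.ρ u) * (x - (k - 1 : ℤ)) : ℚ) := by
    intro k hk hk'
    have hw := opt_wait q u (k - 1)
    rw [sub_add_cancel] at hw
    have := le_antisymm (not_lt.1 hk') hw
    rw [hk] at this
    rw [coe_sub_of_add_eq this]
    congr 1
    push_cast
    ring
  -- the least time with the right value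
  obtain ⟨k, ⟨hk1, hk2⟩, hmin⟩ := Int.exists_least_of_bdd
    (P := fun k => k < t ∧ opt q u k = (a - G.c (G.ρ u) * (x - k) : ℚ))
    ⟨q.tmin, fun z hz => opt_ne_top_ge q (by rw [hz.2]; exact WithTop.coe_ne_top)⟩
    ⟨t - 1, by omega, hpred t h2 hns⟩
  have hstrict : Strict q u k := by
    by_contra hk'
    have := hmin (k - 1) ⟨by omega, hpred k hk2 hk'⟩
    omega
  have hsucc : opt q u (k + 1) = (a - G.c (G.ρ u) * (x - (k + 1 : ℤ)) : ℚ) := by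
    have u1 := opt_wait q u k
    have u2 := opt_wait_le (q := q) u (show k + 1 ≤ x by omega)
    rw [hk2, ← WithTop.coe_add] at u1
    obtain ⟨y, hy⟩ := WithTop.ne_top_iff_exists.1 (ne_top_of_le_ne_top WithTop.coe_ne_top u1)
    rw [← hy] at u1 u2 ⊢
    rw [ha, ← WithTop.coe_add] at u2
    have u1' := WithTop.coe_le_coe.1 u1
    have u2' := WithTop.coe_le_coe.1 u2
    congr 1
    push_cast at u2' ⊢
    linarith
  -- up to `k` the profile grows by less than the costs of waiting, afterwards by these costs
  have hbp : k ∈ (prof u).map Prod.fst := by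
    by_contra hk
    obtain ⟨y, s, e1, e2, e3⟩ := (H.repr u).affineAt (t := k)
      (by rw [optUpTo_of_le (by omega), hk2]; exact WithTop.coe_ne_top) hk
    rw [optUpTo_of_le (by omega)] at e1 e2 e3
    rw [hk2] at e2
    rw [hsucc] at e3
    have e2' := WithTop.coe_injective e2
    have e3' := WithTop.coe_injective e3
    unfold Strict at hstrict
    rw [hk2, e1, ← WithTop.coe_add, WithTop.coe_lt_coe] at hstrict
    push_cast at e3'
    linarith
  have := h3 k hbp (by omega) (by rw [optUpTo_of_le (by omega)]; exact hk2)
  omega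

theorem findArrival_time_le {f : Profile} {b : ℕ} (hf : BitsLe b f) {w : ℚ} {dep : ℤ}
    {y : WithTop ℚ} (hw : bitsQ w ≤ b) (hdep : bitsZ dep ≤ b) (hy : BitsTop (24 * b) y) {l : List ℤ}
    (hl : ∀ t ∈ l, bitsZ t ≤ b) : (findArrival f w dep y l).time ≤
      (l.length + 1) * ((f.length + 2) * (11 * opTime (96 * b))) := by
  have hb0 := bitsZ_pos dep
  have ho := opTime_pos (b := 96 * b) (by omega)
  have e0 : (f.length + 2) * (11 * opTime (96 * b)) =
    (f.length + 1) * (11 * opTime (96 * b)) + 11 * opTime (96 * b) := by ring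
  induction l with
  | nil =>
    simp only [findArrival, Timed.time_bind, Timed.time_tick, Timed.time_pure, List.length_nil]
    omega
  | cons t l ih =>
    have ih := ih fun t ht => hl t (List.mem_cons_of_mem _ ht)
    have ht := hl t List.mem_cons_self
    have v1 := bitsZ_sub_le dep t
    have v2 := bitsQ_intCast (dep - t)
    have v3 := bitsQ_mul_le w ((dep - t : ℤ) : ℚ)
    obtain ⟨v4, t4⟩ := evalAt_le hf ht
    have t4' := t4.trans (Nat.mul_le_mul_left _ (Nat.mul_le_mul_left 11
      (opTime_mono (show 24 * b ≤ 96 * b by omega))))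
    have t1 := ltZ_time_le (b := 96 * b) (x := t) (y := dep) (by omega) (by omega)
    have t2 := subZ_time_le (b := 96 * b) (x := dep) (y := t) (by omega) (by omega)
    have t3 := toQ_time_le (b := 96 * b) (x := dep - t) (by omega)
    have t5 := mulQ_time_le (b := 96 * b) (u := w) (v := ((dep - t : ℤ) : ℚ)) (by omega) (by omega)
    have t6 := eqTop_time_le (x := w * ((dep - t : ℤ) : ℚ)) v4 (by omega) hy
    rw [show 4 * (24 * b) = 96 * b by ring] at t6
    have e1 : (l.length + 1 + 1) * ((f.length + 2) * (11 * opTime (96 * b))) =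
      (l.length + 1) * ((f.length + 2) * (11 * opTime (96 * b))) +
        (f.length + 2) * (11 * opTime (96 * b)) := by ring
    simp only [findArrival, Timed.time_bind, Timed.time_tick, Timed.time_ite, Timed.time_pure,
      subZ_val, toQ_val, mulQ_val, List.length_cons]
    rw [e1]
    split
    · split <;> omega
    · omega

end Backward

/-! ### Routes under construction -/

section Backward

variable {G : RoadGraph} {q : Query G}

/-- A bound on the time of a round of the construction of a route. -/
def roundTime (N L : ℕ) : ℕ :=
  (N + 1) * edgeTime N L + (L + 5) * ((L + 2) * (11 * opTime (960 * N))) + 10 * (N + 1) + L + opTime N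

theorem mem_of_opt_eq {v : Fin G.n} {t : ℤ} {a : ℚ} (h : opt q v t = a) : q.tmin ≤ t :=
  opt_ne_top_ge q (by rw [h]; exact WithTop.coe_ne_top)

/-- A stop other than the start has a stop before it. Since arriving earlier and waiting costs more,
the costs come from an edge. -/
theorem extendRoute_spec (hd : G.d = G.c 0) {L : ℕ} {prof : Fin G.n → Profile} (H : Exact q L prof)
    {p : Stop G.n} (hp : p.arr ≤ q.tmax) {y : ℚ} (hy : opt q p.vertex p.arr = y)
    (hs : Strict q p.vertex p.arr) (hne : ¬(p.vertex = q.s ∧ p.arr = q.tmin)) :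
    ∃ p', (extendRoute G prof p).val = some p' ∧
      G.n + 1 + opTime (inputSize G q) + (extendRoute G prof p).time ≤ roundTime (inputSize G q) L ∧
      (p'.vertex, p.vertex) ∈ G.E ∧ p'.dep = lastDep G (p'.vertex, p.vertex) p.arr ∧
      p'.arr ≤ p'.dep ∧ Strict q p'.vertex p'.arr ∧ ∃ a : ℚ, opt q p'.vertex p'.arr = a ∧
        opt q p'.vertex p'.dep = (a + G.c (G.ρ p'.vertex) * (p'.dep - p'.arr) : ℚ) ∧
        y = a + G.c (G.ρ p'.vertex) * (p'.dep - p'.arr) + G.c 0 * (p.arr - p'.dep) := by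
  have hev := H.evalAt_val p.vertex hp
  obtain ⟨f1, f2⟩ := findEdge_spec hd H (v := p.vertex) hp (y := opt q p.vertex p.arr) G.E
    fun _ h => h
  rcases hf : (findEdge G prof p.vertex p.arr (opt q p.vertex p.arr) G.E).val with _ | ⟨u, x⟩
  · exfalso
    rcases opt_cases q hy with ⟨h1, h2, -⟩ | h | ⟨u, hu, h⟩
    · exact hne ⟨h1, h2⟩
    · unfold Strict at hs
      rw [h, hy, ← WithTop.coe_add, sub_add_cancel] at hs
      exact lt_irrefl _ hs
    · exact f2 hf u hu _ h (by rw [hy, sub_add_cancel])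
  · obtain ⟨hu, hx, a, ha, hya⟩ := f1 u x hf
    have hlt := (lastDep_spec hu p.arr).1
    rw [← hx] at hlt
    have hxm : x ≤ q.tmax := by omega
    have hev' := H.evalAt_val u hxm
    obtain ⟨t, ht⟩ : ∃ t, t = (findArrival (prof u) (G.c (G.ρ u)) x a ((prof u).map Prod.fst)).val :=
      ⟨_, rfl⟩
    obtain ⟨g1, g2, g3⟩ := findArrival_spec H hxm ha ht
    have hbt := bits_time_le (mem_of_opt_eq hy) hp
    have hbx := bits_time_le (mem_of_opt_eq ha) hxm
    have hb := H.bits p.vertex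
    have hb' := H.bits u
    have s1 := H.short p.vertex
    have s2 := H.short u
    have n1 := n_le_inputSize G q
    have n2 := r_le_inputSize G q
    have n3 := edges_length_le (G := G) (q := q)
    have wc := bits_c_le G q (G.ρ u)
    obtain ⟨v1, t1⟩ := evalAt_le hb (hbt.trans (by omega))
    obtain ⟨v2, t2⟩ := evalAt_le hb' (hbx.trans (by omega))
    rw [hev] at v1
    rw [hev', ha] at v2
    have t3 := findEdge_time_le H (v := p.vertex) hbt (v1.mono (by omega)) G.E fun _ h => h
    have t4 := findArrival_time_le hb' (w := G.c (G.ρ u)) (dep := x) (wc.trans (by omega))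
      (hbx.trans (by omega)) v2 (times_bits hb')
    refine ⟨⟨u, t, x⟩, ?_, ?_, hu, hx, g1, g3, _, g2, ?_, ?_⟩
    · simp only [extendRoute, Timed.val_bind, Timed.val_load, hev, hf, hev', ha, times_val,
        Timed.val_pure, ht]
    · have e : (extendRoute G prof p).time = (G.n + 1) + ((evalAt (prof p.vertex) p.arr).time +
          ((findEdge G prof p.vertex p.arr (opt q p.vertex p.arr) G.E).time + ((G.n + 1) +
          ((G.n + 1) + ((G.r + 1 + 1) + ((evalAt (prof u) x).time + ((prof u).length + 1 +
          (findArrival (prof u) (G.c (G.ρ u)) x a (times (prof u)).val).time))))))) := by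
        simp only [extendRoute, Timed.time_bind, Timed.time_load, Timed.val_load, hev, hf, hev', ha,
          times_time, Timed.time_pure, add_zero]
      rw [e]
      clear e f1 f2
      rw [times_val, List.length_map] at t4
      obtain ⟨op, hop⟩ : ∃ op, op = 11 * opTime (960 * inputSize G q) := ⟨_, rfl⟩
      have hop1 : 11 * opTime (24 * (10 * inputSize G q)) ≤ op := by
        rw [hop]; exact Nat.mul_le_mul_left 11 (opTime_mono (by omega))
      have t1' := t1.trans (Nat.mul_le_mul (Nat.succ_le_succ s1) hop1)
      have t2' := t2.trans (Nat.mul_le_mul (Nat.succ_le_succ s2) hop1)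
      have t3' := t3.trans (Nat.mul_le_mul_right (edgeTime (inputSize G q) L) (Nat.succ_le_succ n3))
      have hop2 : 11 * opTime (96 * (10 * inputSize G q)) ≤ op := by
        rw [hop]; exact Nat.mul_le_mul_left 11 (opTime_mono (by omega))
      have t4' := t4.trans (Nat.mul_le_mul (Nat.succ_le_succ s2)
        (Nat.mul_le_mul (Nat.add_le_add_right s2 2) hop2))
      rw [← times_val] at t4'
      unfold roundTime
      rw [← hop]
      have e2 : (L + 5) * ((L + 2) * op) = (L + 1) * ((L + 2) * op) + 2 * ((L + 1) * op) +
        (2 * ((L + 1) * op) + 4 * op) := by ring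
      rw [e2]
      clear * - t1' t2' t3' t4' n1 n2 s1 s2
      generalize opTime (inputSize G q) = o at *
      generalize (evalAt (prof p.vertex) p.arr).time = T1 at *
      generalize (evalAt (prof u) x).time = T2 at *
      generalize (findEdge G prof p.vertex p.arr (opt q p.vertex p.arr) G.E).time = T3 at *
      generalize (findArrival (prof u) (G.c (G.ρ u)) x a (times (prof u)).val).time = T4 at *
      generalize (L + 1) * ((L + 2) * op) = A at *
      generalize (L + 1) * op = B at *
      simp only [Nat.succ_eq_add_one] at *
      generalize (inputSize G q + 1) * edgeTime (inputSize G q) L = C at *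
      omega
    · rw [ha]; congr 1; ring
    · change y = a - G.c (G.ρ u) * (x - t) + G.c (G.ρ u) * (x - t) + G.c 0 * (p.arr - x)
      rw [hy] at hya
      rw [WithTop.coe_injective hya]
      ring

/-- A route from a stop `p` to the destination that is reached at time `t₀`, as constructed
backwards. -/
structure Partial (q : Query G) (t₀ : ℤ) (p : Stop G.n) (R : Route G.n) : Prop where
  chain : (p :: R).IsChain (Leg G)
  arr_le : ∀ r ∈ p :: R, r.arr ≤ r.dep
  last : (p :: R).getLast? = some ⟨q.z, t₀, t₀⟩
  sorted : (p :: R).Pairwise fun r r' => r.arr < r'.arr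
  le : ∀ r ∈ p :: R, r.arr ≤ t₀
  strict : ∀ r ∈ p :: R, Strict q r.vertex r.arr
  value : ∀ r ∈ p :: R, ∃ a : ℚ, opt q r.vertex r.arr = a ∧
    a - G.c 0 * r.arr ∈ insert ((opt q q.z t₀).untopD 0 - G.c 0 * t₀) (banValues q)
  cost : ∃ a : ℚ, opt q p.vertex p.arr = a ∧ opt q q.z t₀ = (a + travelCost G (p :: R) : ℚ)

/-- No vertex is reached twice with the same value compared to driving all the time: it would not be
more expensive to wait there, but the second arrival is strict. -/
theorem Partial.length_le {t₀ : ℤ} {p : Stop G.n} {R : Route G.n} (H : Partial q t₀ p R) :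
    (p :: R).length ≤ G.n * ((banValues q).card + 1) := by
  classical
  have hnd : ((p :: R).map fun r =>
      (r.vertex, (opt q r.vertex r.arr).untopD 0 - G.c 0 * r.arr)).Nodup := by
    rw [List.Nodup, List.pairwise_map]
    refine H.sorted.imp_of_mem fun {r r'} hr hr' hlt heq => ?_
    obtain ⟨h1, h2⟩ := Prod.mk.inj heq
    obtain ⟨a, ha, -⟩ := H.value r hr
    obtain ⟨a', ha', -⟩ := H.value r' hr'
    have hs := H.strict r' hr'
    unfold Strict at hs
    have hm := opt_mono (q := q) r'.vertex (show r.arr ≤ r'.arr - 1 by omega)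
    rw [ha, ha', WithTop.untopD_coe, WithTop.untopD_coe] at h2
    rw [← h1, ha, ← WithTop.coe_add] at hm
    rw [← h1] at hs ha'
    have hs' := hs.trans_le (add_le_add hm (WithTop.coe_le_coe.2 (c_le (G.ρ r.vertex))))
    rw [ha', ← WithTop.coe_add, WithTop.coe_lt_coe] at hs'
    push_cast at hs'
    linarith
  rw [← List.length_map (as := p :: R), ← List.toFinset_card_of_nodup hnd]
  have hsub : ((p :: R).map fun r => (r.vertex, (opt q r.vertex r.arr).untopD 0 -
      G.c 0 * r.arr)).toFinset ⊆ Finset.univ ×ˢ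
      insert ((opt q q.z t₀).untopD 0 - G.c 0 * t₀) (banValues q) := by
    intro x hx
    rw [List.mem_toFinset, List.mem_map] at hx
    obtain ⟨r, hr, rfl⟩ := hx
    obtain ⟨a, ha, hmem⟩ := H.value r hr
    refine Finset.mem_product.2 ⟨Finset.mem_univ _, ?_⟩
    rw [ha, WithTop.untopD_coe]
    exact hmem
  refine (Finset.card_le_card hsub).trans ?_
  rw [Finset.card_product, Finset.card_univ, Fintype.card_fin]
  exact Nat.mul_le_mul_left _ (Finset.card_insert_le _ _)

theorem openTime_eq_closedTime (e : Fin G.n × Fin G.n) (x y : ℤ) :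
    openTime (G.Φ e) x y = y - x - G.closedTime e x y := rfl

/-- If waiting from `t` until `x` is optimal but not waiting before `t`, the optimal costs have a
convex kink at `t`, so the arrival at that time cannot be shifted. -/
theorem value_of_wait {u : Fin G.n} {t x : ℤ} (h : t < x) {a : ℚ} (ha : opt q u t = a)
    (hx : opt q u x = (a + G.c (G.ρ u) * (x - t) : ℚ)) (hs : Strict q u t) :
    a - G.c 0 * t ∈ banValues q := by
  rcases opt_shift q ha with h1 | ⟨i, h1, h2⟩
  · exact h1
  · exfalso
    unfold Strict at hs
    obtain ⟨y, hy⟩ : ∃ y : ℚ, opt q u (t - 1) = y := by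
      rcases hc : opt q u (t - 1) with _ | y
      · rw [hc] at h1
        exact absurd (top_le_iff.1 h1) WithTop.coe_ne_top
      · exact ⟨y, rfl⟩
    rw [hy, ← WithTop.coe_add] at h1 hs
    rw [ha] at hs
    have h1' := WithTop.coe_le_coe.1 h1
    have hs' := WithTop.coe_lt_coe.1 hs
    have h3 := (opt_wait_le (q := q) u (show t + 1 ≤ x by omega)).trans (add_le_add h2 le_rfl)
    rw [hx, ← WithTop.coe_add] at h3
    have h3' := WithTop.coe_le_coe.1 h3
    push_cast at h3'
    linarith

/-- The stop that is put in front has the same value as the next one if there is no waiting at it.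
-/
theorem Partial.extend (hd : G.d = G.c 0) {t₀ : ℤ} {p p' : Stop G.n} {R : Route G.n}
    (H : Partial q t₀ p R) {y : ℚ} (hy : opt q p.vertex p.arr = y)
    (he : (p'.vertex, p.vertex) ∈ G.E) (hdep : p'.dep = lastDep G (p'.vertex, p.vertex) p.arr)
    (harr : p'.arr ≤ p'.dep) (hs : Strict q p'.vertex p'.arr) {a : ℚ}
    (ha : opt q p'.vertex p'.arr = a)
    (hx : opt q p'.vertex p'.dep = (a + G.c (G.ρ p'.vertex) * (p'.dep - p'.arr) : ℚ))
    (hcost : y = a + G.c (G.ρ p'.vertex) * (p'.dep - p'.arr) + G.c 0 * (p.arr - p'.dep)) :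
    Partial q t₀ p' (p :: R) := by
  obtain ⟨l1, l2, -⟩ := lastDep_spec he p.arr
  rw [← hdep] at l1 l2
  have hle := H.le p List.mem_cons_self
  refine ⟨List.isChain_cons_cons.2 ⟨⟨he, ?_, ?_⟩, H.chain⟩, ?_, ?_, ?_, ?_, ?_, ?_, a, ha, ?_⟩
  · have := (le_lastDep_iff he (x := p'.dep) (t := p.arr)).1 hdep.le
    have h0 : 0 ≤ G.closedTime (p'.vertex, p.vertex) p'.dep p.arr := by
      unfold RoadGraph.closedTime
      refine List.sum_nonneg fun x hx => ?_
      obtain ⟨I, -, rfl⟩ := List.mem_map.1 hx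
      exact overlap_nonneg _ _ _
    rw [openTime_eq_closedTime] at this
    omega
  · rw [openTime_eq_closedTime] at l2
    omega
  · intro r hr
    rcases List.mem_cons.1 hr with rfl | hr
    · exact harr
    · exact H.arr_le r hr
  · rw [List.getLast?_cons_cons]
    exact H.last
  · refine List.pairwise_cons.2 ⟨fun r hr => ?_, H.sorted⟩
    rcases List.mem_cons.1 hr with rfl | hr
    · omega
    · have := (List.pairwise_cons.1 H.sorted).1 r hr
      omega
  · intro r hr
    rcases List.mem_cons.1 hr with rfl | hr
    · omega
    · exact H.le r hr
  · intro r hr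
    rcases List.mem_cons.1 hr with rfl | hr
    · exact hs
    · exact H.strict r hr
  · intro r hr
    rcases List.mem_cons.1 hr with rfl | hr
    · refine ⟨a, ha, ?_⟩
      rcases harr.eq_or_lt with h | h
      · obtain ⟨b, hb, hmem⟩ := H.value p List.mem_cons_self
        rw [hb] at hy
        rw [WithTop.coe_injective hy, hcost, ← h] at hmem
        rw [show a - G.c 0 * r.arr = a + G.c (G.ρ r.vertex) * (r.arr - r.arr) +
          G.c 0 * (p.arr - r.arr) - G.c 0 * p.arr by ring]
        exact hmem
      · exact Finset.mem_insert_of_mem (value_of_wait h ha hx hs)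
    · exact H.value r hr
  · obtain ⟨b, hb, hz⟩ := H.cost
    rw [hb] at hy
    rw [hz, WithTop.coe_injective hy, hcost]
    congr 1
    rw [show travelCost G (p' :: p :: R) = G.c (G.ρ p'.vertex) * (p'.dep - p'.arr) +
      (G.c 0 * (p.arr - p'.dep - G.δ (p'.vertex, p.vertex)) + G.d * G.δ (p'.vertex, p.vertex)) +
      travelCost G (p :: R) from rfl, hd]
    ring

theorem partial_start {t₀ : ℤ} {y : ℚ} (hy : opt q q.z t₀ = y)
    (hs : opt q q.z t₀ < opt q q.z (t₀ - 1)) : Partial q t₀ ⟨q.z, t₀, t₀⟩ [] := by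
  have hm : ∀ {P : Stop G.n → Prop}, P ⟨q.z, t₀, t₀⟩ → ∀ r ∈ [(⟨q.z, t₀, t₀⟩ : Stop G.n)], P r := by
    intro P hP r hr
    rw [List.mem_singleton] at hr
    rwa [hr]
  refine ⟨List.isChain_singleton _, hm le_rfl, rfl, List.pairwise_singleton _ _, hm le_rfl, hm ?_,
    hm ⟨y, hy, ?_⟩, y, hy, ?_⟩
  · refine hs.trans_le (le_add_of_nonneg_right ?_)
    exact WithTop.coe_le_coe.2 (G.c_nonneg _)
  · rw [hy, WithTop.untopD_coe]
    exact Finset.mem_insert_self _ _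
  · rw [hy]
    congr 1
    simp [travelCost]

/-- An optimal route for its arrival time. -/
def IsOptimal (q : Query G) (R : Route G.n) : Prop :=
  Feasible G q R ∧ opt q q.z (arrivalTime G R) = travelCost G R

theorem opt_start_eq : opt q q.s q.tmin = (0 : ℚ) := by
  refine le_antisymm (opt_start q) ?_
  obtain ⟨y, hy⟩ := WithTop.ne_top_iff_exists.1
    (ne_top_of_le_ne_top WithTop.coe_ne_top (opt_start q : _ ≤ ((0 : ℚ) : WithTop ℚ)))
  rw [← hy]
  exact WithTop.coe_le_coe.2 (opt_isCost hy.symm).nonneg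

theorem Partial.isOptimal {t₀ : ℤ} (ht : t₀ ≤ q.tmax) {p : Stop G.n} {R : Route G.n}
    (H : Partial q t₀ p R) (h1 : p.vertex = q.s) (h2 : p.arr = q.tmin) :
    IsOptimal q (p :: R) ∧ arrivalTime G (p :: R) = t₀ := by
  have harr : arrivalTime G (p :: R) = t₀ := by
    unfold arrivalTime
    rw [H.last]
    rfl
  refine ⟨⟨⟨⟨p, rfl, h1, h2⟩, ⟨_, H.last, rfl, ht⟩, H.arr_le, H.chain⟩, ?_⟩, harr⟩
  obtain ⟨a, ha, hz⟩ := H.cost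
  rw [h1, h2, opt_start_eq] at ha
  rw [harr, hz, ← WithTop.coe_injective ha, zero_add]

/-- The construction of a route, by induction on the number `j` of stops that can still be put in
front. -/
theorem runs_route (hd : G.d = G.c 0) {L : ℕ} {prof : Fin G.n → Profile} (H : Exact q L prof)
    {t₀ : ℤ} (ht : t₀ ≤ q.tmax) (todo : List ℤ) (out : List (Route G.n)) (j : ℕ) {p : Stop G.n}
    {R : Route G.n} (HR : Partial q t₀ p R)
    (hj : G.n * ((banValues q).card + 1) ≤ (p :: R).length + j) :
    ∃ k R', Runs G q (.extract prof todo (p :: R) out) k (.extract prof todo [] (R' :: out)) ∧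
      k ≤ (j + 1) * roundTime (inputSize G q) L ∧ IsOptimal q R' ∧ arrivalTime G R' = t₀ := by
  induction j generalizing p R with
  | zero | succ j ih =>
    obtain ⟨y, hy⟩ : ∃ y : ℚ, opt q p.vertex p.arr = y := by
      obtain ⟨a, ha, -⟩ := HR.cost
      exact ⟨a, ha⟩
    have hp := (HR.le p List.mem_cons_self).trans ht
    have heq := eqZ_time_le (bits_time_le (mem_of_opt_eq hy) hp) (bits_tmin_le G q)
    by_cases hs : p.vertex = q.s ∧ p.arr = q.tmin
    · have hn := n_le_inputSize G q
      have hrun := Runs.one (q := q) (.extract prof todo (p :: R) out)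
      have e1 : (step G q (.extract prof todo (p :: R) out)).val =
          .extract prof todo [] ((p :: R) :: out) := by
        simp [step, hs.1, hs.2]
      have e2 : (step G q (.extract prof todo (p :: R) out)).time =
          G.n + 1 + (eqZ p.arr q.tmin).time := by
        simp [step, hs.1, hs.2]
      rw [e1] at hrun
      refine ⟨_, _, hrun, ?_, HR.isOptimal ht hs.1 hs.2⟩
      rw [e2]
      refine le_trans ?_ (Nat.le_mul_of_pos_left _ (Nat.succ_pos _))
      unfold roundTime
      generalize opTime (inputSize G q) = o at *
      omega
    · obtain ⟨p', h1, h2, h3, h4, h5, h6, a, h7, h8, h9⟩ :=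
        extendRoute_spec hd H hp hy (HR.strict p List.mem_cons_self) hs
      have HR' := HR.extend hd hy h3 h4 h5 h6 h7 h8 h9
      have hlen := HR'.length_le
      have hrun := Runs.one (q := q) (.extract prof todo (p :: R) out)
      have e1 : (step G q (.extract prof todo (p :: R) out)).val =
          .extract prof todo (p' :: p :: R) out := by
        simp [step, hs, h1]
      have e2 : (step G q (.extract prof todo (p :: R) out)).time ≤ roundTime (inputSize G q) L := by
        refine le_trans (le_of_eq ?_) (le_trans (Nat.add_le_add_right
          (Nat.add_le_add_left heq (G.n + 1)) _) h2)
        simp [step, hs, h1, add_assoc]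
      rw [e1] at hrun
      -- if there are no further rounds, the extended route is too long
      first
      | (rw [List.length_cons] at hlen; omega)
      | (obtain ⟨k, R', i1, i2, i3⟩ := ih HR' (by rw [List.length_cons]; omega)
         refine ⟨_, R', hrun.trans i1, ?_, i3⟩
         rw [Nat.succ_mul]
         omega)

/-- The construction of all routes. The output is in reverse order of the given times. -/
theorem runs_extract (hd : G.d = G.c 0) {L : ℕ} {prof : Fin G.n → Profile} (H : Exact q L prof)
    (todo : List ℤ) (out : List (Route G.n)) (htodo : ∀ t ∈ todo, t ≤ q.tmax ∧
      opt q q.z t < opt q q.z (t - 1)) (hout : ∀ R ∈ out, IsOptimal q R) :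
    ∃ k out', Runs G q (.extract prof todo [] out) k (.halt out') ∧
      k ≤ todo.length * ((G.n * ((banValues q).card + 1) + 1) * roundTime (inputSize G q) L + 1) + 1 ∧
      (∀ R ∈ out', IsOptimal q R) ∧
      out'.map (arrivalTime G) = todo.reverse ++ out.map (arrivalTime G) := by
  induction todo generalizing out with
  | nil =>
    refine ⟨_, out, Runs.one (q := q) (.extract prof [] [] out), ?_, hout, rfl⟩
    simp [step]
  | cons t todo ih =>
    obtain ⟨h1, h2⟩ := htodo t List.mem_cons_self
    obtain ⟨y, hy⟩ := WithTop.ne_top_iff_exists.1 (ne_top_of_lt h2)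
    obtain ⟨k, R, r1, r2, r3, r4⟩ := runs_route hd H h1 todo out
      (G.n * ((banValues q).card + 1)) (partial_start hy.symm h2) (Nat.le_add_left _ _)
    obtain ⟨k', out', i1, i2, i3, i4⟩ := ih (R :: out)
      (fun t ht => htodo t (List.mem_cons_of_mem _ ht)) (by
        intro R' hR'
        rcases List.mem_cons.1 hR' with rfl | hR'
        · exact r3
        · exact hout R' hR')
    refine ⟨_, out', ((Runs.one (q := q) (.extract prof (t :: todo) [] out)).trans r1).trans i1,
      ?_, i3, ?_⟩
    · have e : (step G q (.extract prof (t :: todo) [] out)).time = 1 := rfl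
      rw [e, List.length_cons, Nat.succ_mul]
      omega
    · rw [i4, List.map_cons, r4, List.reverse_cons, List.append_assoc, List.singleton_append]

end Backward

/-! ### The output -/

section Output

variable {G : RoadGraph} {q : Query G}

/-- No route is cheaper than the Bellman optimum. -/
theorem opt_le_add_travelCost (hd : G.d = G.c 0) (p : Stop G.n) (R : Route G.n)
    (hc : (p :: R).IsChain (Leg G)) (ha : ∀ r ∈ p :: R, r.arr ≤ r.dep) {l : Stop G.n}
    (hl : (p :: R).getLast? = some l) : opt q l.vertex l.arr ≤
      opt q p.vertex p.arr + (travelCost G (p :: R) : ℚ) := by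
  have hw := ha p List.mem_cons_self
  have hwait : (0 : ℚ) ≤ G.c (G.ρ p.vertex) * (p.dep - p.arr) :=
    mul_nonneg (G.c_nonneg _) (by have : (p.arr : ℚ) ≤ p.dep := by exact_mod_cast hw
                                  linarith)
  induction R generalizing p with
  | nil =>
    obtain rfl : p = l := by simpa using hl
    refine le_add_of_nonneg_right (WithTop.coe_le_coe.2 ?_)
    simpa [travelCost] using hwait
  | cons p' R ih =>
    rw [List.isChain_cons_cons] at hc
    rw [List.getLast?_cons_cons] at hl
    have hw' := ha p' (List.mem_cons_of_mem _ List.mem_cons_self)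
    have h1 := ih p' hc.2 (fun r hr => ha r (List.mem_cons_of_mem _ hr)) hl hw'
      (mul_nonneg (G.c_nonneg _) (by have : (p'.arr : ℚ) ≤ p'.dep := by exact_mod_cast hw'
                                     linarith))
    obtain ⟨he, -, hclosed⟩ := hc.1
    have hle : p.dep ≤ lastDep G (p.vertex, p'.vertex) p'.arr := by
      rw [le_lastDep_iff he, openTime_eq_closedTime]
      omega
    have h2 := opt_edge q he p'.arr
    have h3 := opt_mono (q := q) p.vertex hle
    have h4 := opt_wait_le (q := q) p.vertex hw
    refine h1.trans ((add_le_add (h2.trans (add_le_add (h3.trans (add_le_add h4 le_rfl)) le_rfl))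
      le_rfl).trans ?_)
    rw [add_assoc, add_assoc, add_assoc, ← WithTop.coe_add, ← WithTop.coe_add, ← WithTop.coe_add]
    refine add_le_add le_rfl (WithTop.coe_le_coe.2 (le_of_eq ?_))
    rw [show travelCost G (p :: p' :: R) = G.c (G.ρ p.vertex) * (p.dep - p.arr) +
      (G.c 0 * (p'.arr - p.dep - G.δ (p.vertex, p'.vertex)) + G.d * G.δ (p.vertex, p'.vertex)) +
      travelCost G (p' :: R) from rfl, hd]
    ring

theorem Feasible.opt_le (hd : G.d = G.c 0) {R : Route G.n} (H : Feasible G q R) :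
    arrivalTime G R ≤ q.tmax ∧ opt q q.z (arrivalTime G R) ≤ (travelCost G R : ℚ) := by
  obtain ⟨⟨p, hp, hs, hmin⟩, ⟨l, hl, hz, hmax⟩, harr, hc⟩ := H
  have hl' : R.getLast? = some l := hl
  have e : arrivalTime G R = l.arr := by
    unfold arrivalTime
    rw [hl']
    rfl
  rw [e]
  refine ⟨(harr l (List.mem_of_getLast? hl')).trans hmax, ?_⟩
  rcases R with _ | ⟨p₀, R⟩
  · simp at hp
  · obtain rfl : p₀ = p := by simpa using hp
    have := opt_le_add_travelCost (q := q) hd p₀ R hc harr hl'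
    rw [hz, hs, hmin, opt_start_eq, ← WithTop.coe_add, zero_add] at this
    exact this

/-- Optimal routes, one for each time that is earlier than all times with equal or smaller costs. -/
theorem isSolution_of_isOptimal (hd : G.d = G.c 0) {ts : List ℤ} (hts : ts.Nodup)
    (hmem : ∀ t, t ∈ ts ↔ optUpTo q q.z t ≠ ⊤ ∧ ∀ t' < t, optUpTo q q.z t < optUpTo q q.z t')
    {out : List (Route G.n)} (hout : ∀ R ∈ out, IsOptimal q R)
    (harr : out.map (arrivalTime G) = ts.reverse) : IsSolution G q out := by
  have hnd : (out.map (arrivalTime G)).Nodup := by rw [harr]; exact List.nodup_reverse.2 hts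
  have hinj : ∀ R ∈ out, ∀ R' ∈ out, arrivalTime G R = arrivalTime G R' → R = R' := by
    intro R hR R' hR' h
    exact List.inj_on_of_nodup_map hnd hR hR' h
  have hin : ∀ R ∈ out, arrivalTime G R ∈ ts := by
    intro R hR
    rw [← List.mem_reverse, ← harr]
    exact List.mem_map_of_mem hR
  have hpareto : ∀ R ∈ out, ParetoOptimal G q R := by
    intro R hR
    obtain ⟨hf, hopt⟩ := hout R hR
    refine ⟨hf, fun R' hR' => ?_⟩
    obtain ⟨h1, h2⟩ := ((hmem _).1 (hin R hR))
    obtain ⟨h3, h4⟩ := hR'.opt_le hd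
    have h5 := (hf.opt_le hd).1
    rcases lt_trichotomy (arrivalTime G R) (arrivalTime G R') with h | h | h
    · exact Or.inr (Or.inl h)
    · rw [← h, hopt] at h4
      rcases (WithTop.coe_le_coe.1 h4).eq_or_lt with h6 | h6
      · exact Or.inr (Or.inr ⟨h6, h⟩)
      · exact Or.inl h6
    · left
      have := h2 _ h
      rw [optUpTo_of_le h5, optUpTo_of_le h3, hopt] at this
      exact WithTop.coe_lt_coe.1 (this.trans_le h4)
  refine ⟨hnd.of_map, ⟨hpareto, fun R hR R' hR' h _ => hinj R hR R' hR' h⟩, ?_⟩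
  rintro S ⟨hS1, hS2⟩ hsub R hR
  obtain ⟨hf, hR'⟩ := hS1 R hR
  obtain ⟨h1, h2⟩ := hf.opt_le hd
  -- the earliest time at which the destination can be reached with costs not above those of `R`
  obtain ⟨t, ⟨ht1, ht2⟩, hmin⟩ := Int.exists_least_of_bdd
    (P := fun t => t ≤ arrivalTime G R ∧ opt q q.z t ≤ (travelCost G R : ℚ))
    ⟨q.tmin, fun z hz => opt_ne_top_ge q (ne_top_of_le_ne_top WithTop.coe_ne_top hz.2)⟩
    ⟨_, le_rfl, h2⟩
  have ht : t ∈ ts := by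
    rw [hmem, optUpTo_of_le (ht1.trans h1)]
    refine ⟨ne_top_of_le_ne_top WithTop.coe_ne_top ht2, fun t' ht' => ?_⟩
    rw [optUpTo_of_le (by omega)]
    by_contra hle
    have := hmin t' ⟨by omega, (not_lt.1 hle).trans ht2⟩
    omega
  rw [← List.mem_reverse, ← harr] at ht
  obtain ⟨R₁, hR₁, rfl⟩ := List.mem_map.1 ht
  obtain ⟨hf₁, hopt₁⟩ := hout R₁ hR₁
  rw [hopt₁] at ht2
  have ht2 := WithTop.coe_le_coe.1 ht2
  rcases hR' R₁ hf₁ with h | h | ⟨h, h'⟩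
  · exact absurd ht2 (not_le.2 h)
  · omega
  · rw [hS2 R hR R₁ (hsub hR₁) h' h]
    exact hR₁

/-- Optimal costs decrease at few times: no shift is possible there, and the values compared to
driving all the time are different. -/
theorem card_drops_le (v : Fin G.n) (l : List ℤ) (hl : l.Nodup)
    (h : ∀ t ∈ l, optUpTo q v (t - 1) ≠ ⊤ ∧ optUpTo q v t < optUpTo q v (t - 1)) :
    l.length ≤ (banValues q).card := by
  have hval : ∀ t ∈ l, ∃ x y : ℚ, opt q v t = x ∧ opt q v (t - 1) = y ∧ x < y := by
    intro t ht
    obtain ⟨h1, h2⟩ := h t ht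
    obtain ⟨h3, -⟩ := optUpTo_ne_top (ne_top_of_lt h2)
    rw [optUpTo_of_le h3, optUpTo_of_le (by omega)] at h2
    rw [optUpTo_of_le (by omega)] at h1
    obtain ⟨x, hx⟩ := WithTop.ne_top_iff_exists.1 (ne_top_of_lt h2)
    obtain ⟨y, hy⟩ := WithTop.ne_top_iff_exists.1 h1
    rw [← hx, ← hy] at h2
    exact ⟨x, y, hx.symm, hy.symm, WithTop.coe_lt_coe.1 h2⟩
  have key : ∀ t ∈ l, ∀ t' ∈ l, t < t' →
      (opt q v t').untopD 0 - G.c 0 * t' < (opt q v t).untopD 0 - G.c 0 * t := by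
    intro t ht t' ht' hlt
    obtain ⟨x, -, hx, -⟩ := hval t ht
    obtain ⟨x', y', hx', hy', hxy⟩ := hval t' ht'
    have hm := opt_mono (q := q) v (show t ≤ t' - 1 by omega)
    rw [hx, hy', ← WithTop.coe_add] at hm
    have hm' := WithTop.coe_le_coe.1 hm
    have h0 := G.c_nonneg 0
    rw [hx, hx', WithTop.untopD_coe, WithTop.untopD_coe]
    push_cast at hm'
    linarith
  rw [← List.toFinset_card_of_nodup hl]
  refine Finset.card_le_card_of_injOn (fun t : ℤ => (opt q v t).untopD 0 - G.c 0 * t)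
    (fun t ht => ?_) fun t ht t' ht' heq => ?_
  · obtain ⟨x, y, hx, hy, hxy⟩ := hval t (List.mem_toFinset.1 ht)
    simp only [hx, WithTop.untopD_coe]
    refine (opt_shift q hx).resolve_right ?_
    rintro ⟨i, hi, -⟩
    rw [hy, ← WithTop.coe_add] at hi
    have := WithTop.coe_le_coe.1 hi
    have := G.c_nonneg i
    linarith
  · have ht := List.mem_toFinset.1 ht
    have ht' := List.mem_toFinset.1 ht'
    simp only at heq
    rcases lt_trichotomy t t' with hlt | hlt | hlt
    · exact absurd heq (key t ht t' ht' hlt).ne'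
    · exact hlt
    · exact absurd heq (key t' ht' t ht hlt).ne

/-- The construction of the output from optimal profiles. -/
theorem finalization (hd : G.d = G.c 0) {L : ℕ} {prof : Fin G.n → Profile} (H : Exact q L prof) :
    (paretoTimes (prof q.z)).time ≤
      (L + (1 + 2 * inputSize G q) + 2) * (6 * opTime (10 * inputSize G q)) +
      (1 + 2 * inputSize G q + 2) * ((L + 2) * (11 * opTime (240 * inputSize G q))) + 2 ∧
    ∃ k out, Runs G q (.extract prof (paretoTimes (prof q.z)).val [] []) k (.halt out) ∧
      k ≤ (2 + 2 * inputSize G q) * ((inputSize G q * (2 + 2 * inputSize G q) + 1) *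
        roundTime (inputSize G q) L + 1) + 1 ∧ IsSolution G q out := by
  have hN := (bitsZ_pos q.tmin).trans_le (bits_tmin_le G q)
  have hcard := card_banValues_le_inputSize q
  obtain ⟨p1, p2⟩ := paretoTimes_time_le (D := 1 + 2 * inputSize G q)
    (show 2 ≤ 10 * inputSize G q by omega) (H.repr q.z) (H.bits q.z)
    fun l hl h => (card_drops_le q.z l hl h).trans hcard
  have hs := H.short q.z
  refine ⟨p2.trans ?_, ?_⟩
  · rw [show 24 * (10 * inputSize G q) = 240 * inputSize G q by ring]
    gcongr
  · have hmem := fun t => mem_paretoTimes (H.repr q.z) (t := t)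
    have htodo : ∀ t ∈ (paretoTimes (prof q.z)).val, t ≤ q.tmax ∧
        opt q q.z t < opt q q.z (t - 1) := by
      intro t ht
      obtain ⟨h1, h2⟩ := (hmem t).1 ht
      have h3 := (optUpTo_ne_top h1).1
      have h4 := h2 (t - 1) (by omega)
      rw [optUpTo_of_le h3, optUpTo_of_le (by omega)] at h4
      exact ⟨h3, h4⟩
    obtain ⟨k, out, r1, r2, r3, r4⟩ := runs_extract hd H (paretoTimes (prof q.z)).val [] htodo
      (by simp)
    rw [List.map_nil, List.append_nil] at r4
    refine ⟨k, out, r1, r2.trans ?_, isSolution_of_isOptimal hd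
      ((paretoTimes_pairwise (H.repr q.z)).imp fun h => h.ne) hmem r3 r4⟩
    have hn := n_le_inputSize G q
    have hc : (banValues q).card + 1 ≤ 2 + 2 * inputSize G q := by omega
    have hl : (paretoTimes (prof q.z)).val.length ≤ 2 + 2 * inputSize G q := by omega
    gcongr

end Output

/-! ### Polynomial bounds -/

/-- The function is given by a polynomial. -/
def IsPoly (f : ℕ → ℕ) : Prop := ∃ p : Polynomial ℕ, ∀ n, p.eval n = f n

theorem isPoly_const (k : ℕ) : IsPoly fun _ => k := ⟨Polynomial.C k, fun n => by simp⟩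

theorem isPoly_id : IsPoly fun n => n := ⟨Polynomial.X, fun n => by simp⟩

theorem IsPoly.add {f g : ℕ → ℕ} (hf : IsPoly f) (hg : IsPoly g) : IsPoly fun n => f n + g n := by
  obtain ⟨p, hp⟩ := hf
  obtain ⟨p', hp'⟩ := hg
  exact ⟨p + p', fun n => by rw [Polynomial.eval_add, hp, hp']⟩

theorem IsPoly.mul {f g : ℕ → ℕ} (hf : IsPoly f) (hg : IsPoly g) : IsPoly fun n => f n * g n := by
  obtain ⟨p, hp⟩ := hf
  obtain ⟨p', hp'⟩ := hg
  exact ⟨p * p', fun n => by rw [Polynomial.eval_mul, hp, hp']⟩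

theorem IsPoly.pow {f : ℕ → ℕ} (hf : IsPoly f) (k : ℕ) : IsPoly fun n => f n ^ k := by
  obtain ⟨p, hp⟩ := hf
  exact ⟨p ^ k, fun n => by rw [Polynomial.eval_pow, hp]⟩

theorem IsPoly.opTime {f : ℕ → ℕ} (hf : IsPoly f) : IsPoly fun n => opTime (f n) :=
  (isPoly_const 4).mul (hf.pow 2)

theorem IsPoly.lengthBound {f : ℕ → ℕ} (hf : IsPoly f) : IsPoly fun n => lengthBound n (f n) :=
  (((isPoly_const 2).mul hf).add ((isPoly_id.add (isPoly_const 1)).mul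
    ((isPoly_const 2).mul (hf.add (isPoly_const 1))))).add (isPoly_const 3)

theorem isPoly_iterations : IsPoly iterations :=
  have h : IsPoly fun n => 1 + 2 * n := (isPoly_const 1).add ((isPoly_const 2).mul isPoly_id)
  isPoly_id.mul (((isPoly_const 1).add h).add
    ((isPoly_id.add (isPoly_const 1)).mul (h.add (isPoly_const 1))))

theorem isPoly_valueBound : IsPoly valueBound :=
  (isPoly_const 1).add (((isPoly_const 2).mul isPoly_id).mul isPoly_iterations)

theorem IsPoly.relaxTime {f g : ℕ → ℕ} (hf : IsPoly f) (hg : IsPoly g) :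
    IsPoly fun n => relaxTime (f n) (g n) :=
  have h := (hg.add ((isPoly_const 4).mul hf)).add (isPoly_const 20)
  (isPoly_const 10000).mul ((h.mul h).mul ((isPoly_const (10 ^ 14)).mul hf).opTime)

theorem IsPoly.iterTime {f : ℕ → ℕ} (hf : IsPoly f) : IsPoly fun n => iterTime n (f n) :=
  have h1 := isPoly_id.add (isPoly_const 1)
  (((isPoly_const 2).mul h1).add (h1.mul ((isPoly_id.add (isPoly_const 2)).add isPoly_id.opTime))).add
    (h1.mul (h1.add (((isPoly_const 10).mul isPoly_id).relaxTime hf.lengthBound)))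

theorem IsPoly.edgeTime {f : ℕ → ℕ} (hf : IsPoly f) : IsPoly fun n => edgeTime n (f n) :=
  have h := (isPoly_id.add hf).add (isPoly_const 3)
  (h.mul h).mul ((isPoly_const 40).mul ((isPoly_const 1000).mul isPoly_id).opTime)

theorem IsPoly.roundTime {f : ℕ → ℕ} (hf : IsPoly f) : IsPoly fun n => roundTime n (f n) :=
  have h1 := isPoly_id.add (isPoly_const 1)
  ((((h1.mul hf.edgeTime).add ((hf.add (isPoly_const 5)).mul ((hf.add (isPoly_const 2)).mul
    ((isPoly_const 11).mul ((isPoly_const 960).mul isPoly_id).opTime)))).add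
    ((isPoly_const 10).mul h1)).add hf).add isPoly_id.opTime

/-- A bound on the time of the step from the main loop to the finalization phase. -/
def transitionTime (N L : ℕ) : ℕ :=
  2 * (N + 1) + (N + 1) * (N + 2 + opTime N) + ((L + (1 + 2 * N) + 2) * (6 * opTime (10 * N)) +
    (1 + 2 * N + 2) * ((L + 2) * (11 * opTime (240 * N))) + 2)

theorem IsPoly.transitionTime {f : ℕ → ℕ} (hf : IsPoly f) : IsPoly fun n => transitionTime n (f n) :=
  have h1 := isPoly_id.add (isPoly_const 1)
  have h2 := (isPoly_const 1).add ((isPoly_const 2).mul isPoly_id)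
  (((isPoly_const 2).mul h1).add (h1.mul ((isPoly_id.add (isPoly_const 2)).add isPoly_id.opTime))).add
    (((((hf.add h2).add (isPoly_const 2)).mul
      ((isPoly_const 6).mul ((isPoly_const 10).mul isPoly_id).opTime)).add
      ((h2.add (isPoly_const 2)).mul ((hf.add (isPoly_const 2)).mul
        ((isPoly_const 11).mul ((isPoly_const 240).mul isPoly_id).opTime)))).add (isPoly_const 2))

/-- A bound on the time of the construction of all routes. -/
def outputTime (N L : ℕ) : ℕ := (2 + 2 * N) * ((N * (2 + 2 * N) + 1) * roundTime N L + 1) + 1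

theorem IsPoly.outputTime {f : ℕ → ℕ} (hf : IsPoly f) : IsPoly fun n => outputTime n (f n) :=
  have h := (isPoly_const 2).add ((isPoly_const 2).mul isPoly_id)
  (h.mul ((((isPoly_id.mul h).add (isPoly_const 1)).mul hf.roundTime).add (isPoly_const 1))).add
    (isPoly_const 1)

/-- A bound on the total running time. -/
def totalTime (N : ℕ) : ℕ :=
  5 * (N + 1) + 4 * opTime (4 * N) + iterations N * iterTime N (valueBound N) +
    transitionTime N (lengthBound N (valueBound N)) + outputTime N (lengthBound N (valueBound N))

theorem isPoly_totalTime : IsPoly totalTime :=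
  have h := isPoly_valueBound
  (((((isPoly_const 5).mul (isPoly_id.add (isPoly_const 1))).add ((isPoly_const 4).mul
    ((isPoly_const 4).mul isPoly_id).opTime)).add (isPoly_iterations.mul h.iterTime)).add
    h.lengthBound.transitionTime).add h.lengthBound.outputTime

/-! ### The running time -/

section Main

variable {G : RoadGraph} {q : Query G}

theorem Exact.mono {L L' : ℕ} {prof : Fin G.n → Profile} (H : Exact q L prof) (h : L ≤ L') :
    Exact q L' prof := ⟨H.repr, H.bits, fun v => (H.short v).trans h⟩

theorem init_time_le (q : Query G) :
    (init G q).time ≤ 5 * (inputSize G q + 1) + 4 * opTime (4 * inputSize G q) := by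
  have h1 := bits_tmin_le G q
  have h2 := bits_tmax_le G q
  have h3 := bits_c_le G q (G.ρ q.s)
  have h4 := n_le_inputSize G q
  have h5 := r_le_inputSize G q
  have h6 := bitsZ_pos q.tmin
  have v1 := bitsZ_sub_le q.tmax q.tmin
  have v2 := bitsQ_intCast (q.tmax - q.tmin)
  have t1 := subZ_time_le (b := 4 * inputSize G q) (x := q.tmax) (y := q.tmin) (by omega) (by omega)
  have t2 := toQ_time_le (b := 4 * inputSize G q) (x := q.tmax - q.tmin) (by omega)
  have t3 := mulQ_time_le (b := 4 * inputSize G q) (u := G.c (G.ρ q.s))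
    (v := ((q.tmax - q.tmin : ℤ) : ℚ)) (by omega) (by omega)
  have t4 := ltZ_time_le (b := 4 * inputSize G q) (x := q.tmin) (y := q.tmax) (by omega) (by omega)
  simp only [init, Timed.time_bind, Timed.time_tick, Timed.time_load, Timed.val_load,
    Timed.time_ite, Timed.time_pure, ite_self, subZ_val, toQ_val, mulQ_val]
  omega

/-- The algorithm terminates with a solution in polynomial time. -/
theorem algorithm_correct (hd : G.d = G.c 0) : ∃ (k : ℕ) (out : List (Route G.n)),
    Runs G q (.loop (init G q).val) k (.halt out) ∧
    (init G q).time + k ≤ totalTime (inputSize G q) ∧ IsSolution G q out := by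
  obtain ⟨k, σ, Φ, popped, tvisit, r1, r2, H, r3, r4⟩ := loop_terminates hd
    (iterations (inputSize G q)) (init_stateInv q) (by simp) (by simp)
  have n1 := n_le_inputSize G q
  have n2 := r_le_inputSize G q
  have hL : lengthBound G.r Φ.card ≤ lengthBound (inputSize G q) (valueBound (inputSize G q)) :=
    (lengthBound_mono' _ (by omega)).trans (lengthBound_mono _ r3)
  obtain ⟨f1, k', out, f2, f3, f4⟩ := finalization hd ((H.exact r4).mono hL)
  obtain ⟨s1, s2⟩ := loop_of_queue_empty (q := q) r4
  have hrun := Runs.one (q := q) (.loop σ)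
  rw [s1] at hrun
  refine ⟨_, out, (r1.trans hrun).trans f2, ?_, f4⟩
  have hmin := findMin_time_le H.key_bits (List.finRange G.n)
  rw [List.length_finRange] at hmin
  have hmin' := hmin.trans (Nat.mul_le_mul (Nat.succ_le_succ n1)
    (Nat.add_le_add_right (Nat.add_le_add_right n1 2) _))
  have h0 := init_time_le q
  have ht : (step G q (.loop σ)).time ≤
      transitionTime (inputSize G q) (lengthBound (inputSize G q) (valueBound (inputSize G q))) := by
    rw [s2]
    unfold transitionTime
    refine le_trans (le_of_eq (by ring : _ = ((G.n + 1) + (G.n + 1) +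
      (findMin G σ (List.finRange G.n)).time) + (paretoTimes (σ.prof q.z)).time))
      (Nat.add_le_add (Nat.add_le_add (by omega) hmin') f1)
  exact (Nat.add_assoc _ _ _).symm.le.trans (Nat.add_le_add ((Nat.add_assoc _ _ _).symm.le.trans
    (Nat.add_le_add (Nat.add_le_add h0 r2) ht)) f3)

end Main

end TempBans

theorem mainTheorem1 :
    ∃ p : Polynomial ℕ, ∀ (G : TempBans.RoadGraph) (q : TempBans.Query G), G.d = G.c 0 →
      (∃ (k : ℕ) (out : List (TempBans.Route G.n)),
        TempBans.Runs G q (.loop (TempBans.init G q).val) k (.halt out) ∧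
        (TempBans.init G q).time + k ≤ p.eval (TempBans.inputSize G q) ∧
        TempBans.IsSolution G q out) ∧
      (∀ (k : ℕ) (σ : TempBans.State G),
        TempBans.Runs G q (.loop (TempBans.init G q).val) k (.loop σ) →
        Relation.ReflTransGen (TempBans.AbsIteration G q) (TempBans.absInit G q) σ.toAbs) := by
  obtain ⟨p, hp⟩ := TempBans.isPoly_totalTime
  refine ⟨p, fun G q hd => ⟨?_, fun k σ h => ?_⟩⟩
  · rw [hp]
    exact TempBans.algorithm_correct hd
  · rw [← TempBans.init_toAbs]
    exact TempBans.StateInv.loop_sound hd h (TempBans.init_stateInv q) rfl rfl
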